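/- Let $A$ be a reduced Noetherian ring, let $R=\bigoplus_{n\ge 0}[R]_n$ be a finitely generated $\mathbb{N}$-graded commutative $A$-algebra (with $A$ mapping into $[R]_0$), and let $\mathfrak{m}=[R]_+=\bigoplus_{n>0}[R]_n$. Let $M$ be a finitely generated $\mathbb{Z}$-graded $R$-module and put $\beta(M)=\max\{d\in\mathbb{Z} \mid [M/\mathfrak{m}M]_d\neq 0\}$ (with $\beta(M)=-\infty$ if $M=0$), the maximal degree of an element in a minimal set of homogeneous generators of $M$. For $\mathfrak{p}\in\operatorname{Spec}(A)$ let $k(\mathfrak{p})=A_\mathfrak{p}/\mathfrak{p}A_\mathfrak{p}$ be the residue field. Fix $j\in\mathbb{Z}$ and $b\in\mathbb{Z}$ with $b\ge\beta(M)$. Then there is a dense open subset $\mathcal{U}_j\subset\operatorname{Spec}(A)$ such that, for all $i\ge 0$ and $k\ge 0$, the function $$ \mathfrak{p}\;\longmapsto\;\dim_{k(\mathfrak{p})}\Big(\big[H^i_{\mathfrak{m}}\big(\operatorname{Sym}^k_{R\otimes_A k(\mathfrak{p})}(M\otimes_A k(\mathfrak{p}))\big)\big]_{j+kb}\Big) $$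 is locally constant on $\mathcal{U}_j$. Moreover, these dimensions are finite at every $\mathfrak{p}\in\operatorname{Spec}(A)$ whenever $[R]_0$ is a finitely generated $A$-module (in particular when $[R]_0$ is the image of $A$); without this condition they are to be read as cardinal numbers. Here $H^i_{\mathfrak{m}}$ carries its natural $\mathbb{Z}$-grading, $\operatorname{Sym}^k$ denotes the $k$-th symmetric power, and $[\,\cdot\,]_d$ denotes the homogeneous component of degree $d$. -/

import Mathlib

open TensorProduct

-- For `K ⊗[A] R` this makes the right factor `R` act through `r ↦ 1 ⊗ r`.
attribute [local instance] Algebra.TensorProduct.rightAlgebra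

namespace GradedLocalCohomology

noncomputable section

/-! ### Graded local cohomology through the Čech complex

`S` is a commutative algebra over a ring `K`, with graded pieces `𝒮 n`, `n : ℕ`;
`N` is an `S`-module with graded pieces `𝒩 n`, `n : ℤ`; and `x 0, …, x (r-1)` are elements of `S`. -/

/-- The localization `N_{x_I}` of `N` at the product of the elements `x i`, `i ∈ I`, realised by
inverting all products of powers of these elements. -/
abbrev CechLocalization {S : Type*} [CommRing S] {r : ℕ} (x : Fin r → S)
    (N : Type*) [AddCommGroup N] [Module S N] (I : Finset (Fin r)) : Type _ :=
  LocalizedModule (Submonoid.closure (x '' (I : Set (Fin r)))) N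

/-- The canonical map `N_{x_I} → N_{x_J}` for `I ⊆ J`. -/
def cechRestrict {S : Type*} [CommRing S] {r : ℕ} (x : Fin r → S)
    (N : Type*) [AddCommGroup N] [Module S N] {I J : Finset (Fin r)} (h : I ⊆ J) :
    CechLocalization x N I →ₗ[S] CechLocalization x N J :=
  IsLocalizedModule.liftOfLE (Submonoid.closure (x '' (I : Set (Fin r))))
    (Submonoid.closure (x '' (J : Set (Fin r))))
    (Submonoid.closure_mono (Set.image_mono (Finset.coe_subset.mpr h)))
    (LocalizedModule.mkLinearMap _ N) (LocalizedModule.mkLinearMap _ N)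

/-- The Čech cochains `C^p(x; N) = ⨁_{|I| = p} N_{x_I}`; in particular `C^0(x; N) = N`. -/
abbrev CechCochain {S : Type*} [CommRing S] {r : ℕ} (x : Fin r → S)
    (N : Type*) [AddCommGroup N] [Module S N] (p : ℕ) : Type _ :=
  (I : {I : Finset (Fin r) // I.card = p}) → CechLocalization x N I.1

/-- The Čech differential `C^p(x; N) → C^{p+1}(x; N)`: its component at `J` is the sum over
`j ∈ J` of `(-1)^{#{l ∈ J | l < j}}` times the canonical image of the component at `J \ {j}`. -/
def cechD {S : Type*} [CommRing S] {r : ℕ} (x : Fin r → S)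
    (N : Type*) [AddCommGroup N] [Module S N] (p : ℕ) :
    CechCochain x N p →ₗ[S] CechCochain x N (p + 1) :=
  LinearMap.pi fun J => ∑ j : {j : Fin r // j ∈ J.1},
    ((-1 : ℤ) ^ (J.1.filter (fun l => l < j.1)).card) •
      (cechRestrict x N (Finset.erase_subset j.1 J.1) ∘ₗ
        LinearMap.proj (⟨J.1.erase j.1, by
          rw [Finset.card_erase_of_mem j.2, J.2, Nat.add_sub_cancel]⟩ :
            {I : Finset (Fin r) // I.card = p}))

section Graded

variable {K : Type*} [CommRing K] {S : Type*} [CommRing S] [Algebra K S]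
  (𝒮 : ℕ → Submodule K S) {r : ℕ} (x : Fin r → S)
  {N : Type*} [AddCommGroup N] [Module S N] [Module K N] [IsScalarTower K S N]
  (𝒩 : ℤ → Submodule K N)

/-- The piece of degree `d` of a localization of `N`: it consists of the fractions `n / w` with
`w` homogeneous of some degree `e` and `n` homogeneous of degree `d + e`. -/
def localizedPiece (W : Submonoid S) (d : ℤ) : Submodule K (LocalizedModule W N) :=
  Submodule.span K {z | ∃ (e : ℕ) (n : N) (w : W),
    (w : S) ∈ 𝒮 e ∧ n ∈ 𝒩 (d + e) ∧ z = LocalizedModule.mk n w}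

/-- The piece `[C^p(x; N)]_d` of degree `d` of the Čech cochains. -/
def cechPiece (p : ℕ) (d : ℤ) : Submodule K (CechCochain x N p) :=
  Submodule.pi Set.univ fun I =>
    localizedPiece 𝒮 𝒩 (Submonoid.closure (x '' (I.1 : Set (Fin r)))) d

/-- The Čech cocycles of cohomological degree `i` and internal degree `d`. -/
def cechCocycles (i : ℕ) (d : ℤ) : Submodule K (CechCochain x N i) :=
  LinearMap.ker ((cechD x N i).restrictScalars K) ⊓ cechPiece 𝒮 x 𝒩 i d

/-- The Čech coboundaries of cohomological degree `i` and internal degree `d`. -/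
def cechCoboundaries : (i : ℕ) → (d : ℤ) → Submodule K (CechCochain x N i)
  | 0, _ => ⊥
  | i + 1, d => (cechPiece 𝒮 x 𝒩 i d).map ((cechD x N i).restrictScalars K)

/-- The piece `[H^i_𝔪(N)]_d` of degree `d` of the `i`-th local cohomology module of the graded
module `N` with support in the ideal `𝔪` generated by the homogeneous elements `x i`, computed by
the Čech complex of these elements. -/
abbrev LocalCohomologyPiece (i : ℕ) (d : ℤ) : Type _ :=
  cechCocycles 𝒮 x 𝒩 i d ⧸ (cechCoboundaries 𝒮 x 𝒩 i d).submoduleOf (cechCocycles 𝒮 x 𝒩 i d)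

end Graded

/-! ### Symmetric powers of a graded module -/

/-- The `k`-th symmetric power `Sym^k_S(N)`: the `S`-submodule of the symmetric algebra spanned by
the products of `k` elements of `N`. The base ring `K` of `S` is recorded so that `Sym^k_S(N)` can
be regarded as a `K`-module. -/
def SymPower (_K : Type*) (S : Type*) [CommRing S] (N : Type*) [AddCommGroup N] [Module S N]
    (k : ℕ) : Type _ :=
  ↥((LinearMap.range (SymmetricAlgebra.ι S N)) ^ k : Submodule S (SymmetricAlgebra S N))

section SymPower

variable (K : Type*) (S : Type*) [CommRing S] (N : Type*) [AddCommGroup N] [Module S N] (k : ℕ)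

instance : AddCommGroup (SymPower K S N k) :=
  inferInstanceAs (AddCommGroup
    ↥((LinearMap.range (SymmetricAlgebra.ι S N)) ^ k : Submodule S (SymmetricAlgebra S N)))

instance : Module S (SymPower K S N k) :=
  inferInstanceAs (Module S
    ↥((LinearMap.range (SymmetricAlgebra.ι S N)) ^ k : Submodule S (SymmetricAlgebra S N)))

instance [CommRing K] [Algebra K S] : Module K (SymPower K S N k) :=
  Module.compHom _ (algebraMap K S)

instance [CommRing K] [Algebra K S] : IsScalarTower K S (SymPower K S N k) :=
  IsScalarTower.of_algebraMap_smul fun _ _ => rfl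

/-- The inclusion of the `k`-th symmetric power into the symmetric algebra. -/
def SymPower.toSymmetricAlgebra : SymPower K S N k →ₗ[S] SymmetricAlgebra S N :=
  Submodule.subtype
    ((LinearMap.range (SymmetricAlgebra.ι S N)) ^ k : Submodule S (SymmetricAlgebra S N))

variable {K S N} [CommRing K] [Algebra K S] [Module K N]

/-- The piece of degree `d` of `Sym^k_S(N)` for a graded module `N` over a graded ring `S`: it is
spanned by the elements `a · n₁ ⋯ n_k` with `a ∈ S` and the `n_i ∈ N` homogeneous and
`deg a + deg n₁ + ⋯ + deg n_k = d`. -/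
def symPowerPiece (𝒮 : ℕ → Submodule K S) (𝒩 : ℤ → Submodule K N) (d : ℤ) :
    Submodule K (SymPower K S N k) :=
  Submodule.span K {z | ∃ (e : ℕ) (a : S) (c : Fin k → ℤ) (n : Fin k → N),
    a ∈ 𝒮 e ∧ (∀ i, n i ∈ 𝒩 (c i)) ∧ (e : ℤ) + ∑ i, c i = d ∧
    SymPower.toSymmetricAlgebra K S N k z = a • ∏ i, SymmetricAlgebra.ι S N (n i)}

end SymPower

/-! ### Fibres over the points of `Spec A` -/

section Fiber

variable {A : Type*} [CommRing A] {R : Type*} [CommRing R] [Algebra A R]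
  (𝒜 : ℕ → Submodule A R) {M : Type*} [AddCommGroup M] [Module R M] [Module A M]
  (ℳ : ℤ → Submodule A M) (K : Type*) [CommRing K] [Algebra A K]

/-- The grading of `K ⊗_A R` induced by that of `R`. -/
def fiberRingPiece (n : ℕ) : Submodule K (K ⊗[A] R) :=
  (𝒜 n).baseChange K

variable (M) in
/-- The `(K ⊗_A R)`-module `K ⊗_A M = (K ⊗_A R) ⊗_R M`. -/
abbrev FiberModule : Type _ := (K ⊗[A] R) ⊗[R] M

/-- The grading of `(K ⊗_A R) ⊗_R M = K ⊗_A M` induced by that of `M`: the piece of degree `d` is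
the `K`-span of the elements of `M` of degree `d`. -/
def fiberModulePiece (d : ℤ) : Submodule K (FiberModule (A := A) (R := R) M K) :=
  Submodule.span K ((fun m : M => (1 : K ⊗[A] R) ⊗ₜ[R] m) '' (ℳ d : Set M))

/-- The piece `[H^i_𝔪(Sym^k_{R ⊗ K}(M ⊗ K))]_d`, where `𝔪` is generated by the images in `R ⊗ K` of
the homogeneous elements `x i` of `R`. -/
abbrev FiberSymCohomologyPiece {r : ℕ} (x : Fin r → R) (i k : ℕ) (d : ℤ) : Type _ :=
  LocalCohomologyPiece (fiberRingPiece 𝒜 K) (fun l => (1 : K) ⊗ₜ[A] x l)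
    (symPowerPiece k (fiberRingPiece 𝒜 K) (fiberModulePiece (R := R) ℳ K)) i d

end Fiber

/-- The set of degrees `d` with `[M/𝔪M]_d ≠ 0`, where `𝔪 = R_+`. For finitely generated `M` it is
finite and its maximum is `β(M)`, the maximal degree of a minimal homogeneous generator. -/
def generatorDegrees {A : Type*} [CommRing A] {R : Type*} [CommRing R] [Algebra A R]
    (𝒜 : ℕ → Submodule A R) [GradedAlgebra 𝒜] {M : Type*} [AddCommGroup M] [Module R M]
    [Module A M] (ℳ : ℤ → Submodule A M) : Set ℤ :=
  {d | ∃ m ∈ ℳ d, m ∉ (HomogeneousIdeal.irrelevant 𝒜).toIdeal • (⊤ : Submodule R M)}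

end

end GradedLocalCohomology

namespace GradedLocalCohomology

/-! ### Finiteness of homology along short exact sequences of modules with a differential. -/

section Differential

variable {P : Type*} [CommRing P]

/-! Let T be the symmetric algebra of M over R, bigraded by symmetric degree k and internal degree
d, and regrade it by d - k b (`shiftedDegree`). The part of Sym^k of internal degree j + k b is then
the part of T of symmetric degree k and shifted degree j, so all the modules in question, for all k
at once, live in the single shifted degree j. Since b ≥ β(M), M has homogeneous generators of degree
at most b. Those of degree exactly b, and the algebra generators of R of degree zero, get shifted
degree zero; the other generators of M get negative degree; the generators x_l of 𝔪 keep their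
positive degree.

Let P be the polynomial ring over A on the generators of shifted degree zero. Modulo the x_l, the
ring T is generated over P by elements of negative degree, so a finite graded T-module killed by the
x_l has graded pieces that are finite over P and vanish in all large degrees
(`IsGradedModule.finite_range`). Dévissage on the set of x_l that act nontrivially, together with
the fact that a power of each x_l kills any given Čech class, extends this to the Čech cohomology of
every finite graded T-module (`IsGradedModule.hasFiniteCohomology`). For T itself, the cohomology in
shifted degree j is thus a finite P-module. It is still graded by k and by the cohomological degree,
and P is a finitely generated A-algebra graded by k. A graded form of generic freeness
(`exists_freeAt_range`) yields, for every minimal prime q of A, one g ∉ q such that inverting g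
makes all components free over A simultaneously; a further factor of g does the same for the
bigraded pieces of T.

Over A_g each graded strand of the Čech complex is a bounded complex of flat modules with flat
cohomology, so its cohomology commutes with base change to residue fields
(`IsCechBaseChange.nonempty_equiv`). Symmetric algebras commute with base change too
(`IsFiberMap.bijective_liftBaseChange`). On D(g) the dimensions are therefore the ranks of fixed
free A_g-modules. The union of these D(g) over the minimal primes is open, and dense because it
contains every minimal prime.

The open set is built from one system of generators of 𝔪;
`CechCohomology.nonempty_equiv_of_generators` transfers the conclusion to any other. Finiteness of
the dimensions is the same dévissage, run over the residue field K for the ring K ⊗ R, with no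
generators of negative degree and with the finite module K ⊗ [R]_0 in their place. -/

theorem fg_range_of_ker_le [IsNoetherianRing P] {X Y Z : Type*} [AddCommGroup X] [AddCommGroup Y]
    [AddCommGroup Z] [Module P X] [Module P Y] [Module P Z] [Module.Finite P Z]
    (α : X →ₗ[P] Y) (β : X →ₗ[P] Z) (h : LinearMap.ker β ≤ LinearMap.ker α) :
    Module.Finite P (LinearMap.range α) := by
  -- X / ker β embeds in the Noetherian module Z, and the range of α is a quotient of X / ker β.
  have e := β.quotKerEquivRange
  have : Module.Finite P (X ⧸ LinearMap.ker β) := Module.Finite.equiv e.symm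
  refine Module.Finite.of_surjective ((LinearMap.ker β).liftQ α.rangeRestrict ?_) ?_
  · intro x hx
    have := h hx
    rw [LinearMap.mem_ker] at this ⊢
    exact Subtype.ext this
  · intro y
    obtain ⟨x, rfl⟩ := α.surjective_rangeRestrict y
    exact ⟨Submodule.Quotient.mk x, rfl⟩

theorem finite_of_surjective_of_ker_le [IsNoetherianRing P] {X Y Z : Type*} [AddCommGroup X]
    [AddCommGroup Y] [AddCommGroup Z] [Module P X] [Module P Y] [Module P Z] [Module.Finite P Z]
    (α : X →ₗ[P] Y) (hα : Function.Surjective α) (β : X →ₗ[P] Z)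
    (h : LinearMap.ker β ≤ LinearMap.ker α) : Module.Finite P Y := by
  have := fg_range_of_ker_le α β h
  rw [LinearMap.range_eq_top.mpr hα] at this
  exact Module.Finite.equiv (Submodule.topEquiv (R := P) (M := Y))

variable {E' E E'' : Type*} [AddCommGroup E'] [Module P E'] [AddCommGroup E] [Module P E]
  [AddCommGroup E''] [Module P E'']

/-- The homology of a module with an endomorphism `D`, intended for `D² = 0`. -/
abbrev DiffHomology (D : E →ₗ[P] E) : Type _ :=
  LinearMap.ker D ⧸ (LinearMap.range D).submoduleOf (LinearMap.ker D)

/-- The homology class of a cycle. -/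
abbrev DiffHomology.mk (D : E →ₗ[P] E) : LinearMap.ker D →ₗ[P] DiffHomology D :=
  ((LinearMap.range D).submoduleOf (LinearMap.ker D)).mkQ

theorem DiffHomology.mk_eq_zero {D : E →ₗ[P] E} {c : LinearMap.ker D} :
    DiffHomology.mk D c = 0 ↔ ∃ b, D b = c := by
  rw [DiffHomology.mk, Submodule.mkQ_apply, Submodule.Quotient.mk_eq_zero]
  exact Iff.rfl

theorem DiffHomology.mk_surjective (D : E →ₗ[P] E) : Function.Surjective (DiffHomology.mk D) :=
  Submodule.mkQ_surjective _

/-- A chain map acts on cycles. -/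
def cyclesMap {D : E →ₗ[P] E} {D'' : E'' →ₗ[P] E''} (g : E →ₗ[P] E'')
    (hg : ∀ c, g (D c) = D'' (g c)) : LinearMap.ker D →ₗ[P] LinearMap.ker D'' :=
  g.restrict fun c hc => by
    rw [LinearMap.mem_ker] at hc ⊢
    rw [← hg, hc, map_zero]

@[simp]
theorem cyclesMap_coe {D : E →ₗ[P] E} {D'' : E'' →ₗ[P] E''} (g : E →ₗ[P] E'')
    (hg : ∀ c, g (D c) = D'' (g c)) (c : LinearMap.ker D) : (cyclesMap g hg c : E'') = g c := rfl

/-- Exactness of H(E') → H(E) → H(E'') in the middle. The image ψ of the cycles of E' is finite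
because ψ factors through H(E'). Modulo that image H(E) is controlled by H(E''): a cycle whose image
in E'' bounds differs from a boundary by an element of E', which is again a cycle. -/
theorem finite_diffHomology_middle [IsNoetherianRing P] {D' : E' →ₗ[P] E'} {D : E →ₗ[P] E}
    {D'' : E'' →ₗ[P] E''} (f : E' →ₗ[P] E) (g : E →ₗ[P] E'') (hf : ∀ c, f (D' c) = D (f c))
    (hg : ∀ c, g (D c) = D'' (g c)) (hD : ∀ c, D (D c) = 0) (hinj : Function.Injective f)
    (hex : ∀ c, g c = 0 → ∃ b, f b = c) (hsurj : Function.Surjective g)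
    [Module.Finite P (DiffHomology D')] [Module.Finite P (DiffHomology D'')] :
    Module.Finite P (DiffHomology D) := by
  let ψ : LinearMap.ker D' →ₗ[P] DiffHomology D := DiffHomology.mk D ∘ₗ cyclesMap f hf
  have h1 : Module.Finite P (LinearMap.range ψ) := by
    refine fg_range_of_ker_le ψ (DiffHomology.mk D') fun c hc => ?_
    obtain ⟨b, hb⟩ := DiffHomology.mk_eq_zero.mp hc
    exact DiffHomology.mk_eq_zero.mpr ⟨f b, by rw [← hf, hb]; rfl⟩
  have h2 : Module.Finite P (DiffHomology D ⧸ LinearMap.range ψ) := by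
    refine finite_of_surjective_of_ker_le ((LinearMap.range ψ).mkQ ∘ₗ DiffHomology.mk D)
      ((Submodule.mkQ_surjective _).comp (DiffHomology.mk_surjective D))
      (DiffHomology.mk D'' ∘ₗ cyclesMap g hg) fun c hc => ?_
    obtain ⟨b'', hb''⟩ := DiffHomology.mk_eq_zero.mp hc
    obtain ⟨b, rfl⟩ := hsurj b''
    obtain ⟨e, he⟩ := hex (c.1 - D b) (by rw [map_sub, hg, hb'']; simp)
    have he' : D' e = 0 := hinj (by rw [hf, he, map_sub, hD, c.2, map_zero, sub_zero])
    rw [LinearMap.mem_ker, LinearMap.comp_apply, Submodule.mkQ_apply, Submodule.Quotient.mk_eq_zero]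
    refine ⟨⟨e, he'⟩, ?_⟩
    rw [← sub_eq_zero, LinearMap.comp_apply, ← map_sub]
    exact DiffHomology.mk_eq_zero.mpr ⟨-b, by simp [he]⟩
  exact Module.Finite.of_submodule_quotient (LinearMap.range ψ)

/-- The part H(E'') → H(E') → H(E) of the exact triangle: H(E') modulo the kernel Q of the map to
H(E) is finite since H(E) is, and Q is the image of the connecting map from H(E''). -/
theorem finite_diffHomology_left [IsNoetherianRing P] {D' : E' →ₗ[P] E'} {D : E →ₗ[P] E}
    {D'' : E'' →ₗ[P] E''} (f : E' →ₗ[P] E) (g : E →ₗ[P] E'') (hf : ∀ c, f (D' c) = D (f c))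
    (hg : ∀ c, g (D c) = D'' (g c)) (hD : ∀ c, D (D c) = 0) (hinj : Function.Injective f)
    (hgf : ∀ c, g (f c) = 0)
    (hex : ∀ c, g c = 0 → ∃ b, f b = c) (hsurj : Function.Surjective g)
    [Module.Finite P (DiffHomology D)] [Module.Finite P (DiffHomology D'')] :
    Module.Finite P (DiffHomology D') := by
  let β : LinearMap.ker D' →ₗ[P] DiffHomology D := DiffHomology.mk D ∘ₗ cyclesMap f hf
  let Q : Submodule P (DiffHomology D') := (LinearMap.ker β).map (DiffHomology.mk D')
  have h2 : Module.Finite P (DiffHomology D' ⧸ Q) := by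
    refine finite_of_surjective_of_ker_le (Q.mkQ ∘ₗ DiffHomology.mk D')
      ((Submodule.mkQ_surjective _).comp (DiffHomology.mk_surjective D')) β fun c hc => ?_
    rw [LinearMap.mem_ker, LinearMap.comp_apply, Submodule.mkQ_apply, Submodule.Quotient.mk_eq_zero]
    exact ⟨c, hc, rfl⟩
  have h1 : Module.Finite P Q := by
    -- The pairs (b, c) with D b = f c replace the connecting map: c runs through the cycles whose
    -- class dies in H(E), while g b is a cycle of E''.
    let X : Submodule P (E × LinearMap.ker D') :=
      LinearMap.ker (D ∘ₗ LinearMap.fst P E (LinearMap.ker D') -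
        f ∘ₗ (LinearMap.ker D').subtype ∘ₗ LinearMap.snd P E (LinearMap.ker D'))
    have hX : ∀ v : X, D v.1.1 = f v.1.2 := fun v => sub_eq_zero.mp v.2
    let β' : X →ₗ[P] LinearMap.ker D'' :=
      (g ∘ₗ LinearMap.fst P E (LinearMap.ker D') ∘ₗ X.subtype).codRestrict _ fun v => by
        rw [LinearMap.mem_ker]
        change D'' (g v.1.1) = 0
        rw [← hg, hX, hgf]
    let α : X →ₗ[P] DiffHomology D' :=
      DiffHomology.mk D' ∘ₗ LinearMap.snd P E (LinearMap.ker D') ∘ₗ X.subtype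
    have hα : LinearMap.range α = Q := by
      apply le_antisymm
      · rintro _ ⟨v, rfl⟩
        exact ⟨v.1.2, DiffHomology.mk_eq_zero.mpr ⟨v.1.1, hX v⟩, rfl⟩
      · rintro _ ⟨c, hc, rfl⟩
        obtain ⟨b, hb⟩ := DiffHomology.mk_eq_zero.mp hc
        exact ⟨⟨(b, c), sub_eq_zero.mpr hb⟩, rfl⟩
    rw [← hα]
    refine fg_range_of_ker_le α (DiffHomology.mk D'' ∘ₗ β') fun v hv => ?_
    obtain ⟨b'', hb''⟩ := DiffHomology.mk_eq_zero.mp hv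
    obtain ⟨b, rfl⟩ := hsurj b''
    have hb3 : g (D b) = g v.1.1 := (hg b).trans hb''
    obtain ⟨e, he⟩ := hex (D b - v.1.1) (by rw [map_sub, hb3, sub_self])
    refine DiffHomology.mk_eq_zero.mpr ⟨-e, hinj ?_⟩
    rw [map_neg, map_neg, hf, he, map_sub, hD, zero_sub, neg_neg]
    exact hX v
  exact Module.Finite.of_submodule_quotient Q

end Differential

end GradedLocalCohomology

namespace GradedLocalCohomology

noncomputable section

/-! ### The total Čech complex, its differential and its graded pieces. -/

section Sign

/-- The sign `(-1)^{#{l ∈ J | l < j}}` of the Čech differential. -/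
def cechSign {r : ℕ} (j : Fin r) (J : Finset (Fin r)) : ℤ :=
  (-1) ^ (J.filter (fun l => l < j)).card

theorem cechSign_mul_self {r : ℕ} (j : Fin r) (J : Finset (Fin r)) :
    cechSign j J * cechSign j J = 1 := by
  rw [cechSign, ← mul_pow]; simp

theorem cechSign_erase_of_lt {r : ℕ} {i j : Fin r} {J : Finset (Fin r)} (hi : i ∈ J)
    (h : i < j) : cechSign j J = - cechSign j (J.erase i) := by
  have : (J.filter (fun l => l < j)) = insert i ((J.erase i).filter (fun l => l < j)) := by
    ext l
    by_cases hl : l = i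
    · subst hl; simp [hi, h]
    · simp [hl]
  rw [cechSign, this, Finset.card_insert_of_notMem (by simp), cechSign, pow_succ]
  ring

theorem cechSign_erase_of_not_lt {r : ℕ} {i j : Fin r} {J : Finset (Fin r)}
    (h : ¬ i < j) : cechSign j (J.erase i) = cechSign j J := by
  have : (J.erase i).filter (fun l => l < j) = J.filter (fun l => l < j) := by
    ext l
    by_cases hl : l = i
    · subst hl; simp [h]
    · simp [hl]
  rw [cechSign, this, cechSign]

/-- Removing the smaller index lowers the count for the larger one by one, while removing the larger
leaves the count for the smaller unchanged. Exactly one of the four signs flips, which is what makes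
the square of the differential vanish. -/
theorem cechSign_swap {r : ℕ} {i j : Fin r} {J : Finset (Fin r)} (hi : i ∈ J) (hj : j ∈ J)
    (hij : i ≠ j) :
    cechSign j J * cechSign i (J.erase j) = -(cechSign i J * cechSign j (J.erase i)) := by
  rcases lt_or_gt_of_ne hij with h | h
  · rw [cechSign_erase_of_lt hi h, cechSign_erase_of_not_lt h.not_gt]
    ring
  · rw [cechSign_erase_of_lt hj h, cechSign_erase_of_not_lt h.not_gt]
    ring

end Sign

section Total

variable {S : Type*} [CommRing S] {r : ℕ} (x : Fin r → S) (N : Type*) [AddCommGroup N] [Module S N]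

theorem prod_pow_mem_closure (I : Finset (Fin r)) (k : ℕ) :
    (∏ i ∈ I, x i) ^ k ∈ Submonoid.closure (x '' (I : Set (Fin r))) :=
  pow_mem (prod_mem fun _ hi => Submonoid.subset_closure (Set.mem_image_of_mem x hi)) k

/-- The fraction `n / (∏_{i ∈ I} x i)^k`. -/
def cechFrac (I : Finset (Fin r)) (k : ℕ) : N →ₗ[S] CechLocalization x N I :=
  LocalizedModule.divBy (S := Submonoid.closure (x '' (I : Set (Fin r))))
    ⟨(∏ i ∈ I, x i) ^ k, prod_pow_mem_closure x I k⟩ ∘ₗ LocalizedModule.mkLinearMap _ N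

variable {N}

theorem cechFrac_apply (I : Finset (Fin r)) (k : ℕ) (n : N) :
    cechFrac x N I k n = LocalizedModule.mk n
      ⟨(∏ i ∈ I, x i) ^ k, prod_pow_mem_closure x I k⟩ := by
  simp [cechFrac, LocalizedModule.mkLinearMap_apply, LocalizedModule.divBy,
    LocalizedModule.liftOn_mk]

/-- Every denominator divides a power of the product of the x i, so these powers suffice as
denominators. This reduces all computations in the localization to `cechFrac`. -/
theorem exists_mul_eq_prod_pow {I : Finset (Fin r)} {w : S}
    (hw : w ∈ Submonoid.closure (x '' (I : Set (Fin r)))) :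
    ∃ v ∈ Submonoid.closure (x '' (I : Set (Fin r))), ∃ k, w * v = (∏ i ∈ I, x i) ^ k := by
  induction hw using Submonoid.closure_induction with
  | mem w hw =>
    obtain ⟨i, hi, rfl⟩ := hw
    exact ⟨∏ l ∈ I.erase i, x l, prod_mem fun l hl => Submonoid.subset_closure
      ⟨l, Finset.mem_of_mem_erase hl, rfl⟩, 1, by rw [pow_one, Finset.mul_prod_erase _ _ hi]⟩
  | one => exact ⟨1, one_mem _, 0, by simp⟩
  | mul w w' _ _ h h' =>
    obtain ⟨v, hv, k, h⟩ := h
    obtain ⟨v', hv', k', h'⟩ := h'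
    exact ⟨v * v', mul_mem hv hv', k + k', by rw [pow_add, ← h, ← h']; ring⟩

theorem mk_eq_cechFrac {I : Finset (Fin r)} (n : N)
    (w : Submonoid.closure (x '' (I : Set (Fin r)))) {v : S} {k : ℕ}
    (h : (w : S) * v = (∏ i ∈ I, x i) ^ k) :
    LocalizedModule.mk n w = cechFrac x N I k (v • n) := by
  rw [cechFrac_apply, LocalizedModule.mk_eq]
  refine ⟨1, ?_⟩
  simp only [one_smul, Submonoid.smul_def, ← h, mul_smul]

theorem exists_eq_cechFrac {I : Finset (Fin r)} (z : CechLocalization x N I) :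
    ∃ k n, z = cechFrac x N I k n := by
  induction z using LocalizedModule.induction_on with
  | h n w =>
    obtain ⟨v, hv, k, h⟩ := exists_mul_eq_prod_pow x w.2
    exact ⟨k, v • n, mk_eq_cechFrac x n w h⟩

theorem cechFrac_eq_zero {I : Finset (Fin r)} {k : ℕ} {n : N} :
    cechFrac x N I k n = 0 ↔ ∃ m, (∏ i ∈ I, x i) ^ m • n = 0 := by
  rw [cechFrac_apply, ← LocalizedModule.zero_mk ⟨_, prod_pow_mem_closure x I k⟩,
    LocalizedModule.mk_eq]
  constructor
  · rintro ⟨u, hu⟩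
    obtain ⟨v, hv, m, h⟩ := exists_mul_eq_prod_pow x u.2
    simp only [Submonoid.smul_def, smul_zero] at hu
    refine ⟨m + k, ?_⟩
    rw [pow_add, ← h, mul_comm (u : S), mul_assoc, mul_smul, mul_smul, hu, smul_zero]
  · rintro ⟨m, hm⟩
    refine ⟨⟨_, prod_pow_mem_closure x I m⟩, ?_⟩
    simp only [Submonoid.smul_def, smul_zero]
    rw [smul_comm, hm, smul_zero]

theorem cechFrac_shift (I : Finset (Fin r)) (k m : ℕ) (n : N) :
    cechFrac x N I (k + m) ((∏ i ∈ I, x i) ^ m • n) = cechFrac x N I k n := by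
  rw [cechFrac_apply x I k, mk_eq_cechFrac x n _ (pow_add _ k m).symm]

variable (N) in
/-- The canonical map `N_{x_I} → N_{x_J}` if `I ⊆ J`, and `0` otherwise. -/
def cechRes (I J : Finset (Fin r)) : CechLocalization x N I →ₗ[S] CechLocalization x N J :=
  if h : I ⊆ J then cechRestrict x N h else 0

theorem cechRes_of_subset {I J : Finset (Fin r)} (h : I ⊆ J) :
    cechRes x N I J = cechRestrict x N h := dif_pos h

theorem cechRes_mk {I J : Finset (Fin r)} (h : I ⊆ J) (n : N)
    (w : Submonoid.closure (x '' (I : Set (Fin r)))) :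
    cechRes x N I J (LocalizedModule.mk n w) = LocalizedModule.mk n
      ⟨w.1, Submonoid.closure_mono (Set.image_mono (Finset.coe_subset.mpr h)) w.2⟩ := by
  rw [cechRes_of_subset x h, cechRestrict, IsLocalizedModule.mk_eq_mk', IsLocalizedModule.mk_eq_mk']
  exact IsLocalizedModule.liftOfLE_mk' ..

theorem cechRes_comp {I J L : Finset (Fin r)} (hIJ : I ⊆ J) (hJL : J ⊆ L)
    (z : CechLocalization x N I) : cechRes x N J L (cechRes x N I J z) = cechRes x N I L z := by
  induction z using LocalizedModule.induction_on with
  | h n w => rw [cechRes_mk x hIJ, cechRes_mk x hJL, cechRes_mk x (hIJ.trans hJL)]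

theorem cechRes_cechFrac {I J : Finset (Fin r)} (h : I ⊆ J) (k : ℕ) (n : N) :
    cechRes x N I J (cechFrac x N I k n) = cechFrac x N J k ((∏ i ∈ J \ I, x i) ^ k • n) := by
  rw [cechFrac_apply, cechRes_mk x h]
  exact mk_eq_cechFrac x n _ (by
    rw [← mul_pow, mul_comm, Finset.prod_sdiff h])

variable (N) in
/-- The total Čech cochains: one component for every set `I` of indices. -/
abbrev CechTotal : Type _ := (I : Finset (Fin r)) → CechLocalization x N I

variable (N) in
/-- The differential of the total Čech cochains. -/
def cechDTotal : CechTotal x N →ₗ[S] CechTotal x N :=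
  LinearMap.pi fun J => ∑ j ∈ J, ((cechSign j J : ℤ) : S) • (cechRes x N (J.erase j) J ∘ₗ
    LinearMap.proj (J.erase j))

theorem cechDTotal_apply (c : CechTotal x N) (J : Finset (Fin r)) :
    cechDTotal x N c J = ∑ j ∈ J, ((cechSign j J : ℤ) : S) • cechRes x N (J.erase j) J (c (J.erase j)) := by
  simp [cechDTotal]

theorem cechDTotal_cechDTotal (c : CechTotal x N) : cechDTotal x N (cechDTotal x N c) = 0 := by
  funext J
  rw [cechDTotal_apply, Pi.zero_apply]
  have h : ∀ j ∈ J, ((cechSign j J : ℤ) : S) • cechRes x N (J.erase j) J (cechDTotal x N c (J.erase j)) =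
      ∑ i ∈ J.erase j, ((cechSign j J * cechSign i (J.erase j) : ℤ) : S) •
        cechRes x N ((J.erase j).erase i) J (c ((J.erase j).erase i)) := by
    intro j hj
    rw [cechDTotal_apply, map_sum, Finset.smul_sum]
    refine Finset.sum_congr rfl fun i hi => ?_
    rw [map_smul, cechRes_comp x (Finset.erase_subset _ _) (Finset.erase_subset _ _), Int.cast_mul,
      mul_smul]
  rw [Finset.sum_congr rfl h, Finset.sum_sigma']
  -- Removing j then i, or i then j, reaches the same set with opposite signs.
  refine Finset.sum_involution (fun p _ => ⟨p.2, p.1⟩) ?_ ?_ ?_ ?_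
  · rintro ⟨j, i⟩ hp
    simp only [Finset.mem_sigma, Finset.mem_erase] at hp
    rw [cechSign_swap hp.2.2 hp.1 hp.2.1, Finset.erase_right_comm, Int.cast_neg, neg_smul, neg_add_cancel]
  · rintro ⟨j, i⟩ hp _ heq
    simp only [Finset.mem_sigma, Finset.mem_erase] at hp
    exact hp.2.1 (congrArg Sigma.fst heq)
  · rintro ⟨j, i⟩ hp
    simp only [Finset.mem_sigma, Finset.mem_erase] at hp ⊢
    exact ⟨hp.2.2, fun h => hp.2.1 h.symm, hp.1⟩
  · rintro ⟨j, i⟩ hp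
    rfl

variable (K : Type*) [CommRing K] [Algebra K S] [Module K N] [IsScalarTower K S N]

/-- Multiplication by `x l` raises degrees by `e l`. -/
def RaisesDegree (e : Fin r → ℕ) {K : Type*} [CommRing K] [Module K N]
    (𝒩 : ℤ → Submodule K N) : Prop :=
  ∀ l d n, n ∈ 𝒩 d → x l • n ∈ 𝒩 (d + e l)

variable {K x}

omit [Algebra K S] [IsScalarTower K S N] in
theorem RaisesDegree.prod_pow_smul_mem {e : Fin r → ℕ} {𝒩 : ℤ → Submodule K N}
    (hx : RaisesDegree x e 𝒩) (I : Finset (Fin r)) (k : ℕ) {d : ℤ} {n : N} (hn : n ∈ 𝒩 d) :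
    (∏ i ∈ I, x i) ^ k • n ∈ 𝒩 (d + (k * ∑ i ∈ I, e i : ℕ)) := by
  have h1 : ∀ (d : ℤ) (n : N), n ∈ 𝒩 d → (∏ i ∈ I, x i) • n ∈ 𝒩 (d + (∑ i ∈ I, e i : ℕ)) := by
    induction I using Finset.induction_on with
    | empty => simp
    | insert i I hi ih =>
      intro d n hn
      rw [Finset.prod_insert hi, Finset.sum_insert hi, mul_smul]
      convert hx i _ _ (ih d n hn) using 2
      push_cast
      ring
  induction k with
  | zero => simpa using hn
  | succ k ih =>
    rw [pow_succ', mul_smul]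
    convert h1 _ _ ih using 2
    push_cast
    ring

variable (x) in
/-- The piece of degree `d` of `N_{x_I}`, where `x l` has degree `e l`: it consists of the fractions
`n / (∏_{i ∈ I} x i)^k` with `n` homogeneous. -/
def cechFracPiece (e : Fin r → ℕ) {𝒩 : ℤ → Submodule K N} (hx : RaisesDegree x e 𝒩)
    (d : ℤ) (I : Finset (Fin r)) : Submodule K (CechLocalization x N I) where
  carrier := {z | ∃ (k : ℕ) (n : N), n ∈ 𝒩 (d + (k * ∑ i ∈ I, e i : ℕ)) ∧ z = cechFrac x N I k n}
  add_mem' := by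
    rintro _ _ ⟨k, n, hn, rfl⟩ ⟨k', n', hn', rfl⟩
    refine ⟨k + k', (∏ i ∈ I, x i) ^ k' • n + (∏ i ∈ I, x i) ^ k • n', add_mem ?_ ?_, ?_⟩
    · convert hx.prod_pow_smul_mem I k' hn using 2
      push_cast; ring
    · convert hx.prod_pow_smul_mem I k hn' using 2
      push_cast; ring
    · rw [map_add, cechFrac_shift, add_comm k k', cechFrac_shift]
  zero_mem' := ⟨0, 0, zero_mem _, (map_zero _).symm⟩
  smul_mem' a z := by
    rintro ⟨k, n, hn, rfl⟩
    exact ⟨k, a • n, (𝒩 _).smul_mem a hn, by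
      rw [← algebraMap_smul S a, ← algebraMap_smul S a n, map_smul]⟩

theorem cechRes_mem_piece {e : Fin r → ℕ} {𝒩 : ℤ → Submodule K N} {hx : RaisesDegree x e 𝒩}
    {d : ℤ} {I J : Finset (Fin r)} {z : CechLocalization x N I}
    (hz : z ∈ cechFracPiece x e hx d I) : cechRes x N I J z ∈ cechFracPiece x e hx d J := by
  by_cases h : I ⊆ J
  · obtain ⟨k, n, hn, rfl⟩ := hz
    rw [cechRes_cechFrac x h]
    refine ⟨k, _, ?_, rfl⟩
    convert hx.prod_pow_smul_mem (J \ I) k hn using 2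
    rw [← Finset.sum_sdiff h]
    push_cast
    ring
  · rw [cechRes, dif_neg h]
    exact zero_mem _

variable (x) in
/-- The cochains of internal degree `d`. -/
def cechTotalPiece (e : Fin r → ℕ) {𝒩 : ℤ → Submodule K N} (hx : RaisesDegree x e 𝒩)
    (d : ℤ) : Submodule K (CechTotal x N) :=
  Submodule.pi Set.univ (cechFracPiece x e hx d)

theorem mem_cechTotalPiece {e : Fin r → ℕ} {𝒩 : ℤ → Submodule K N} {hx : RaisesDegree x e 𝒩}
    {d : ℤ} {c : CechTotal x N} : c ∈ cechTotalPiece x e hx d ↔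
      ∀ I, c I ∈ cechFracPiece x e hx d I := by
  simp [cechTotalPiece]

theorem cechDTotal_mem {e : Fin r → ℕ} {𝒩 : ℤ → Submodule K N} {hx : RaisesDegree x e 𝒩}
    {d : ℤ} {c : CechTotal x N} (hc : c ∈ cechTotalPiece x e hx d) :
    cechDTotal x N c ∈ cechTotalPiece x e hx d := by
  rw [mem_cechTotalPiece] at hc ⊢
  intro J
  rw [cechDTotal_apply]
  refine sum_mem fun j _ => ?_
  rw [Int.cast_smul_eq_zsmul]
  exact zsmul_mem (cechRes_mem_piece (hc _)) _

variable (x) in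
/-- The differential on the cochains of internal degree `d`. -/
def cechDPiece (e : Fin r → ℕ) {𝒩 : ℤ → Submodule K N} (hx : RaisesDegree x e 𝒩)
    (d : ℤ) : cechTotalPiece x e hx d →ₗ[K] cechTotalPiece x e hx d :=
  ((cechDTotal x N).restrictScalars K).restrict fun _ hc => cechDTotal_mem hc

@[simp]
theorem cechDPiece_coe {e : Fin r → ℕ} {𝒩 : ℤ → Submodule K N} {hx : RaisesDegree x e 𝒩}
    {d : ℤ} (c : cechTotalPiece x e hx d) :
    (cechDPiece x e hx d c : CechTotal x N) = cechDTotal x N c := rfl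

theorem cechDPiece_cechDPiece {e : Fin r → ℕ} {𝒩 : ℤ → Submodule K N} {hx : RaisesDegree x e 𝒩}
    {d : ℤ} (c : cechTotalPiece x e hx d) : cechDPiece x e hx d (cechDPiece x e hx d c) = 0 :=
  Subtype.ext (cechDTotal_cechDTotal x c.1)

end Total

end

end GradedLocalCohomology

namespace GradedLocalCohomology

noncomputable section

/-! ### Comparison of the Čech complex of the statement with the total complex. -/

section Frozen

variable {K : Type*} [CommRing K] {S : Type*} [CommRing S] [Algebra K S]
  (𝒮 : ℕ → Submodule K S) {r : ℕ} (x : Fin r → S)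
  {N : Type*} [AddCommGroup N] [Module S N] [Module K N] [IsScalarTower K S N]
  (𝒩 : ℤ → Submodule K N)

/-- `x` is homogeneous of degrees `e` for a graded ring structure `𝒮` on `S`, which acts on `𝒩`. -/
structure IsGradedAction (e : Fin r → ℕ) : Prop where
  one_mem : (1 : S) ∈ 𝒮 0
  mul_mem : ∀ {a b : ℕ} {s t : S}, s ∈ 𝒮 a → t ∈ 𝒮 b → s * t ∈ 𝒮 (a + b)
  eq_zero : ∀ {a b : ℕ} {s : S}, s ∈ 𝒮 a → s ∈ 𝒮 b → a ≠ b → s = 0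
  mem : ∀ l, x l ∈ 𝒮 (e l)
  smul_mem : ∀ {a : ℕ} {d : ℤ} {s : S} {n : N}, s ∈ 𝒮 a → n ∈ 𝒩 d → s • n ∈ 𝒩 (d + a)

variable {𝒮 x 𝒩} {e : Fin r → ℕ}

omit [IsScalarTower K S N] in
theorem IsGradedAction.raisesDegree (h : IsGradedAction 𝒮 x 𝒩 e) : RaisesDegree x e 𝒩 :=
  fun l _ _ hn => h.smul_mem (h.mem l) hn

omit [IsScalarTower K S N] in
theorem IsGradedAction.prod_mem (h : IsGradedAction 𝒮 x 𝒩 e) (I : Finset (Fin r)) :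
    ∏ i ∈ I, x i ∈ 𝒮 (∑ i ∈ I, e i) := by
  induction I using Finset.induction_on with
  | empty => simpa using h.one_mem
  | insert i I hi ih =>
    rw [Finset.prod_insert hi, Finset.sum_insert hi]
    exact h.mul_mem (h.mem i) ih

omit [IsScalarTower K S N] in
theorem IsGradedAction.pow_mem (h : IsGradedAction 𝒮 x 𝒩 e) {s : S} {a : ℕ} (hs : s ∈ 𝒮 a)
    (k : ℕ) : s ^ k ∈ 𝒮 (k * a) := by
  induction k with
  | zero => simpa using h.one_mem
  | succ k ih =>
    rw [pow_succ, Nat.succ_mul]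
    exact h.mul_mem ih hs

omit [IsScalarTower K S N] in
theorem IsGradedAction.exists_mul_eq_prod_pow (h : IsGradedAction 𝒮 x 𝒩 e) {I : Finset (Fin r)}
    {w : S} (hw : w ∈ Submonoid.closure (x '' (I : Set (Fin r)))) :
    ∃ (v : S) (a b k : ℕ), w ∈ 𝒮 a ∧ v ∈ 𝒮 b ∧ a + b = k * ∑ i ∈ I, e i ∧
      w * v = (∏ i ∈ I, x i) ^ k := by
  induction hw using Submonoid.closure_induction with
  | mem w hw =>
    obtain ⟨i, hi, rfl⟩ := hw
    exact ⟨∏ l ∈ I.erase i, x l, e i, ∑ l ∈ I.erase i, e l, 1, h.mem i, h.prod_mem _,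
      by rw [one_mul, Finset.add_sum_erase _ _ hi],
      by rw [pow_one, Finset.mul_prod_erase _ _ hi]⟩
  | one => exact ⟨1, 0, 0, 0, h.one_mem, h.one_mem, by simp, by simp⟩
  | mul w w' _ _ h1 h2 =>
    obtain ⟨v, a, b, k, hw, hv, hab, h1⟩ := h1
    obtain ⟨v', a', b', k', hw', hv', hab', h2⟩ := h2
    exact ⟨v * v', a + a', b + b', k + k', h.mul_mem hw hw', h.mul_mem hv hv',
      by rw [add_mul, ← hab, ← hab']; ring, by rw [pow_add, ← h1, ← h2]; ring⟩

/-- In `localizedPiece` the denominator w is assigned a degree a with w ∈ 𝒮 a, whereas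
`cechFracPiece` uses the degree dictated by the x i. The two can differ only if w = 0, and then the
localization is zero. -/
theorem IsGradedAction.localizedPiece_eq (h : IsGradedAction 𝒮 x 𝒩 e) (I : Finset (Fin r))
    (d : ℤ) : localizedPiece 𝒮 𝒩 (Submonoid.closure (x '' (I : Set (Fin r)))) d =
      cechFracPiece x e h.raisesDegree d I := by
  apply le_antisymm
  · refine Submodule.span_le.mpr ?_
    rintro _ ⟨a, n, w, hw, hn, rfl⟩
    obtain ⟨v, a', b, k, hw', hv, hab, hwv⟩ := h.exists_mul_eq_prod_pow w.2
    by_cases haa : a = a'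
    · subst haa
      refine ⟨k, v • n, ?_, mk_eq_cechFrac x n w hwv⟩
      rw [← hab]
      convert h.smul_mem hv hn using 2
      push_cast; ring
    · have h0 : (w : S) = 0 := h.eq_zero hw hw' haa
      have := LocalizedModule.subsingleton (M := N)
        (show (0 : S) ∈ Submonoid.closure (x '' (I : Set (Fin r))) from h0 ▸ w.2)
      rw [SetLike.mem_coe, Subsingleton.elim (LocalizedModule.mk n w) 0]
      exact zero_mem _
  · rintro _ ⟨k, n, hn, rfl⟩
    exact Submodule.subset_span ⟨k * ∑ i ∈ I, e i, n, ⟨_, prod_pow_mem_closure x I k⟩,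
      h.pow_mem (h.prod_mem I) k, hn, cechFrac_apply x I k n⟩

variable (x N) in
/-- The cochains of cohomological degree `p` among the total cochains. -/
def cechProj (p : ℕ) : CechTotal x N →ₗ[S] CechCochain x N p :=
  LinearMap.pi fun I => LinearMap.proj I.1

variable (x N) in
/-- The extension by zero of the cochains of cohomological degree `p`. -/
def cechIncl (p : ℕ) : CechCochain x N p →ₗ[S] CechTotal x N :=
  LinearMap.pi fun I => if h : I.card = p then
    LinearMap.proj (⟨I, h⟩ : {I : Finset (Fin r) // I.card = p}) else 0

@[simp]
theorem cechProj_apply {p : ℕ} (c : CechTotal x N) (I : {I : Finset (Fin r) // I.card = p}) :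
    cechProj x N p c I = c I.1 := rfl

theorem cechIncl_apply {p : ℕ} (c : CechCochain x N p) {I : Finset (Fin r)} (h : I.card = p) :
    cechIncl x N p c I = c ⟨I, h⟩ := by
  simp [cechIncl, h]

theorem cechIncl_apply_of_ne {p : ℕ} (c : CechCochain x N p) {I : Finset (Fin r)}
    (h : I.card ≠ p) : cechIncl x N p c I = 0 := by
  simp [cechIncl, h]

@[simp]
theorem cechProj_cechIncl {p : ℕ} (c : CechCochain x N p) :
    cechProj x N p (cechIncl x N p c) = c :=
  funext fun I => cechIncl_apply c I.2

theorem cechD_apply {p : ℕ} (c : CechCochain x N p) (J : {J : Finset (Fin r) // J.card = p + 1}) :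
    cechD x N p c J = ∑ j ∈ J.1.attach, ((cechSign j.1 J.1 : ℤ) : S) •
      cechRestrict x N (Finset.erase_subset j.1 J.1) (c ⟨J.1.erase j.1, by
        rw [Finset.card_erase_of_mem j.2, J.2, Nat.add_sub_cancel]⟩) := by
  simp only [cechD, LinearMap.pi_apply, LinearMap.sum_apply]
  refine Finset.sum_congr rfl fun j _ => ?_
  rw [Int.cast_smul_eq_zsmul]
  rfl

theorem cechD_cechProj {p : ℕ} (c : CechTotal x N) :
    cechD x N p (cechProj x N p c) = cechProj x N (p + 1) (cechDTotal x N c) := by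
  funext J
  rw [cechD_apply, cechProj_apply, cechDTotal_apply]
  symm
  rw [← Finset.sum_attach]
  exact Finset.sum_congr rfl fun j _ => by
    rw [cechRes_of_subset x (Finset.erase_subset j.1 J.1), cechProj_apply]

theorem cechProj_zero_cechDTotal (c : CechTotal x N) : cechProj x N 0 (cechDTotal x N c) = 0 := by
  funext J
  rw [cechProj_apply, cechDTotal_apply]
  refine Finset.sum_eq_zero fun j hj => absurd hj ?_
  rw [Finset.card_eq_zero.mp J.2]
  exact Finset.notMem_empty j

theorem cechDTotal_cechIncl {p : ℕ} (c : CechCochain x N p) :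
    cechDTotal x N (cechIncl x N p c) = cechIncl x N (p + 1) (cechD x N p c) := by
  funext J
  by_cases h : J.card = p + 1
  · rw [cechIncl_apply _ h]
    nth_rw 2 [← cechProj_cechIncl c]
    rw [cechD_cechProj]
    rfl
  · rw [cechIncl_apply_of_ne _ h, cechDTotal_apply]
    refine Finset.sum_eq_zero fun j hj => ?_
    rw [cechIncl_apply_of_ne, map_zero, smul_zero]
    rw [Finset.card_erase_of_mem hj]
    have := Finset.card_pos.mpr ⟨j, hj⟩
    lia

theorem cechD_cechD {p : ℕ} (c : CechCochain x N p) : cechD x N (p + 1) (cechD x N p c) = 0 := by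
  nth_rw 1 [← cechProj_cechIncl c]
  rw [cechD_cechProj, cechD_cechProj, cechDTotal_cechDTotal, map_zero]

variable (x) in
/-- The cochains of cohomological degree `p` and internal degree `d`. -/
def cechCochainPiece (hx : RaisesDegree x e 𝒩) (p : ℕ) (d : ℤ) : Submodule K (CechCochain x N p) :=
  Submodule.pi Set.univ fun I => cechFracPiece x e hx d I.1

theorem mem_cechCochainPiece {hx : RaisesDegree x e 𝒩} {p : ℕ} {d : ℤ} {c : CechCochain x N p} :
    c ∈ cechCochainPiece x hx p d ↔ ∀ I, c I ∈ cechFracPiece x e hx d I.1 := by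
  simp [cechCochainPiece]

theorem cechProj_mem {hx : RaisesDegree x e 𝒩} {p : ℕ} {d : ℤ} {c : CechTotal x N}
    (hc : c ∈ cechTotalPiece x e hx d) : cechProj x N p c ∈ cechCochainPiece x hx p d :=
  mem_cechCochainPiece.mpr fun I => mem_cechTotalPiece.mp hc I.1

theorem cechIncl_mem {hx : RaisesDegree x e 𝒩} {p : ℕ} {d : ℤ} {c : CechCochain x N p}
    (hc : c ∈ cechCochainPiece x hx p d) : cechIncl x N p c ∈ cechTotalPiece x e hx d := by
  refine mem_cechTotalPiece.mpr fun I => ?_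
  by_cases h : I.card = p
  · rw [cechIncl_apply c h]
    exact mem_cechCochainPiece.mp hc ⟨I, h⟩
  · rw [cechIncl_apply_of_ne c h]
    exact zero_mem _

theorem cechD_mem {hx : RaisesDegree x e 𝒩} {p : ℕ} {d : ℤ} {c : CechCochain x N p}
    (hc : c ∈ cechCochainPiece x hx p d) : cechD x N p c ∈ cechCochainPiece x hx (p + 1) d := by
  rw [← cechProj_cechIncl c, cechD_cechProj]
  exact cechProj_mem (cechDTotal_mem (cechIncl_mem hc))

theorem IsGradedAction.cechPiece_eq (h : IsGradedAction 𝒮 x 𝒩 e) (p : ℕ) (d : ℤ) :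
    cechPiece 𝒮 x 𝒩 p d = cechCochainPiece x h.raisesDegree p d := by
  unfold cechPiece cechCochainPiece
  simp_rw [h.localizedPiece_eq]

end Frozen

end

end GradedLocalCohomology

namespace GradedLocalCohomology

noncomputable section

/-! ### Functoriality of the Čech complex under semilinear maps and reindexing. -/

section LocMap

variable {K : Type*} [CommRing K] {S S' : Type*} [CommRing S] [CommRing S'] [Algebra K S]
  [Algebra K S'] {N N' : Type*} [AddCommGroup N] [AddCommGroup N'] [Module S N] [Module S' N']
  [Module K N] [Module K N'] [IsScalarTower K S N] [IsScalarTower K S' N']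

/-- The map of localizations induced by a semilinear map. -/
def localizedSemiMap (θ : S →+* S') (f : N →ₗ[K] N') (W : Submonoid S) (W' : Submonoid S')
    (hW : ∀ w ∈ W, θ w ∈ W' ∧ ∀ n, f (w • n) = θ w • f n) :
    LocalizedModule W N →ₗ[K] LocalizedModule W' N' where
  toFun z := z.liftOn (fun q => LocalizedModule.mk (f q.1) ⟨θ q.2, (hW _ q.2.2).1⟩) (by
    rintro ⟨n, w⟩ ⟨n', w'⟩ ⟨u, hu⟩
    refine LocalizedModule.mk_eq.mpr ⟨⟨θ u, (hW _ u.2).1⟩, ?_⟩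
    simp only [Submonoid.smul_def] at hu ⊢
    rw [← (hW _ w.2).2, ← (hW _ w'.2).2, ← (hW _ u.2).2, ← (hW _ u.2).2, hu])
  map_add' y z := by
    induction y, z using LocalizedModule.induction_on₂ with
    | h n n' w w' =>
      simp only [LocalizedModule.mk_add_mk, LocalizedModule.liftOn_mk, Submonoid.smul_def, map_add,
        (hW _ w.2).2, (hW _ w'.2).2]
      congr 1
      exact Subtype.ext (map_mul θ _ _)
  map_smul' a z := by
    induction z using LocalizedModule.induction_on with
    | h n w =>
      rw [LocalizedModule.smul'_mk, LocalizedModule.liftOn_mk, LocalizedModule.liftOn_mk,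
        RingHom.id_apply, LocalizedModule.smul'_mk, map_smul]

theorem localizedSemiMap_mk (θ : S →+* S') (f : N →ₗ[K] N') (W : Submonoid S) (W' : Submonoid S')
    (hW : ∀ w ∈ W, θ w ∈ W' ∧ ∀ n, f (w • n) = θ w • f n) (n : N) (w : W) :
    localizedSemiMap θ f W W' hW (LocalizedModule.mk n w) =
      LocalizedModule.mk (f n) ⟨θ w, (hW _ w.2).1⟩ :=
  rfl

end LocMap

section CechMap

variable {K : Type*} [CommRing K] {S S' : Type*} [CommRing S] [CommRing S'] [Algebra K S]
  [Algebra K S'] {N N' : Type*} [AddCommGroup N] [AddCommGroup N'] [Module S N] [Module S' N']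
  [Module K N] [Module K N'] [IsScalarTower K S N] [IsScalarTower K S' N']
  {r r' : ℕ}

/-- The compatibilities under which `f` induces a map from the Čech complex of `x` with coefficients
in `N` to that of `x'` with coefficients in `N'`, by `c ↦ (I ↦ f (c (τ I)))`. -/
structure IsCechMap (x : Fin r → S) (x' : Fin r' → S') (θ : S →+* S') (σ : Fin r' ↪o Fin r)
    (τ : Finset (Fin r') → Finset (Fin r)) (f : N →ₗ[K] N') : Prop where
  map_eq : ∀ I, τ I = I.map σ.toEmbedding
  map_x : ∀ i, θ (x (σ i)) = x' i
  map_smul : ∀ i n, f (x (σ i) • n) = x' i • f n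

variable {x : Fin r → S} {x' : Fin r' → S'} {θ : S →+* S'} {σ : Fin r' ↪o Fin r}
  {τ : Finset (Fin r') → Finset (Fin r)} {f : N →ₗ[K] N'}

omit [Algebra K S] [Algebra K S'] [IsScalarTower K S N] [IsScalarTower K S' N'] in
theorem IsCechMap.closure (h : IsCechMap x x' θ σ τ f) (I : Finset (Fin r')) (w : S)
    (hw : w ∈ Submonoid.closure (x '' (τ I : Set (Fin r)))) :
    θ w ∈ Submonoid.closure (x' '' (I : Set (Fin r'))) ∧ ∀ n, f (w • n) = θ w • f n := by
  induction hw using Submonoid.closure_induction with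
  | mem w hw =>
    obtain ⟨i, hi, rfl⟩ := hw
    rw [h.map_eq, Finset.coe_map] at hi
    obtain ⟨i, hi, rfl⟩ := hi
    have h1 : θ (x (σ.toEmbedding i)) = x' i := h.map_x i
    rw [h1]
    exact ⟨Submonoid.subset_closure (Set.mem_image_of_mem x' hi), h.map_smul i⟩
  | one => simp
  | mul w w' _ _ h1 h2 =>
    rw [map_mul]
    exact ⟨mul_mem h1.1 h2.1, fun n => by rw [mul_smul, h1.2, h2.2, mul_smul]⟩

/-- The component at `I` of the map of Čech complexes. -/
def cechMapAt (h : IsCechMap x x' θ σ τ f) (I : Finset (Fin r')) :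
    CechLocalization x N (τ I) →ₗ[K] CechLocalization x' N' I :=
  localizedSemiMap θ f _ _ (h.closure I)

omit [Algebra K S] [Algebra K S'] [IsScalarTower K S N] [IsScalarTower K S' N'] in
theorem IsCechMap.map_prod (h : IsCechMap x x' θ σ τ f) (I : Finset (Fin r')) :
    θ (∏ i ∈ τ I, x i) = ∏ i ∈ I, x' i := by
  rw [h.map_eq, Finset.prod_map, _root_.map_prod]
  exact Finset.prod_congr rfl fun i _ => h.map_x i

omit [Algebra K S] [Algebra K S'] [IsScalarTower K S N] [IsScalarTower K S' N'] in
theorem IsCechMap.map_prod_pow_smul (h : IsCechMap x x' θ σ τ f) (I : Finset (Fin r')) (k : ℕ)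
    (n : N) : f ((∏ i ∈ τ I, x i) ^ k • n) = (∏ i ∈ I, x' i) ^ k • f n := by
  rw [(h.closure I _ (prod_pow_mem_closure x (τ I) k)).2, map_pow, h.map_prod]

theorem cechMapAt_cechFrac (h : IsCechMap x x' θ σ τ f) (I : Finset (Fin r')) (k : ℕ) (n : N) :
    cechMapAt h I (cechFrac x N (τ I) k n) = cechFrac x' N' I k (f n) := by
  rw [cechFrac_apply, cechMapAt, localizedSemiMap_mk, cechFrac_apply]
  congr 1
  exact Subtype.ext ((map_pow θ _ _).trans (by rw [h.map_prod]))

omit [Algebra K S] [Algebra K S'] [IsScalarTower K S N] [IsScalarTower K S' N'] in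
theorem IsCechMap.map_mono (h : IsCechMap x x' θ σ τ f) {I J : Finset (Fin r')} (hIJ : I ⊆ J) :
    τ I ⊆ τ J := by
  rw [h.map_eq, h.map_eq]
  exact Finset.map_subset_map.mpr hIJ

theorem cechMapAt_cechRes (h : IsCechMap x x' θ σ τ f) {I J : Finset (Fin r')} (hIJ : I ⊆ J)
    (z : CechLocalization x N (τ I)) :
    cechMapAt h J (cechRes x N (τ I) (τ J) z) = cechRes x' N' I J (cechMapAt h I z) := by
  induction z using LocalizedModule.induction_on with
  | h n w =>
    rw [cechRes_mk x (h.map_mono hIJ), cechMapAt, cechMapAt, localizedSemiMap_mk,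
      localizedSemiMap_mk, cechRes_mk x' hIJ]

/-- The map of total Čech cochains. -/
def cechMap (h : IsCechMap x x' θ σ τ f) : CechTotal x N →ₗ[K] CechTotal x' N' :=
  LinearMap.pi fun I => cechMapAt h I ∘ₗ LinearMap.proj (τ I)

@[simp]
theorem cechMap_apply (h : IsCechMap x x' θ σ τ f) (c : CechTotal x N) (I : Finset (Fin r')) :
    cechMap h c I = cechMapAt h I (c (τ I)) := rfl

/-- The sign counts smaller elements, so it survives reindexing because σ preserves the order; this
is why `IsCechMap` asks for an order embedding. -/
theorem cechSign_map (j : Fin r') (J : Finset (Fin r')) :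
    cechSign (σ j) (J.map σ.toEmbedding) = cechSign j J := by
  rw [cechSign, cechSign, Finset.filter_map, Finset.card_map]
  congr 3
  ext l
  simp

theorem cechMap_cechDTotal (h : IsCechMap x x' θ σ τ f) (c : CechTotal x N) :
    cechMap h (cechDTotal x N c) = cechDTotal x' N' (cechMap h c) := by
  funext J
  rw [cechMap_apply, cechDTotal_apply, cechDTotal_apply, map_sum]
  have h1 : ∀ F : Fin r → CechLocalization x' N' J, ∑ j ∈ τ J, F j = ∑ j ∈ J, F (σ j) := by
    intro F
    rw [h.map_eq, Finset.sum_map]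
    rfl
  rw [h1]
  refine Finset.sum_congr rfl fun j hj => ?_
  have h2 : (τ J).erase (σ j) = τ (J.erase j) := by
    rw [h.map_eq, h.map_eq, Finset.map_erase]
    rfl
  rw [h2, cechMap_apply, ← cechMapAt_cechRes h (Finset.erase_subset j J), Int.cast_smul_eq_zsmul,
    Int.cast_smul_eq_zsmul, map_zsmul,
    show cechSign (σ j) (τ J) = cechSign j J by rw [h.map_eq, cechSign_map]]

variable {e : Fin r → ℕ} {e' : Fin r' → ℕ} {𝒩 : ℤ → Submodule K N}

omit [Algebra K S] [Algebra K S'] [IsScalarTower K S N] [IsScalarTower K S' N'] in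
theorem IsCechMap.sum_eq (h : IsCechMap x x' θ σ τ f) (he : ∀ i, e (σ i) = e' i)
    (I : Finset (Fin r')) : ∑ i ∈ τ I, e i = ∑ i ∈ I, e' i := by
  rw [h.map_eq, Finset.sum_map]
  exact Finset.sum_congr rfl fun i _ => he i

variable {K' : Type*} [CommRing K'] [Algebra K' S'] [Module K' N'] [IsScalarTower K' S' N']
  {𝒩' : ℤ → Submodule K' N'}

theorem cechMapAt_mem (h : IsCechMap x x' θ σ τ f) (he : ∀ i, e (σ i) = e' i)
    {hx : RaisesDegree x e 𝒩} {hx' : RaisesDegree x' e' 𝒩'} {d : ℤ}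
    (hf : ∀ d, ∀ n ∈ 𝒩 d, f n ∈ 𝒩' d) {I : Finset (Fin r')}
    {z : CechLocalization x N (τ I)} (hz : z ∈ cechFracPiece x e hx d (τ I)) :
    cechMapAt h I z ∈ cechFracPiece x' e' hx' d I := by
  obtain ⟨k, n, hn, rfl⟩ := hz
  rw [h.sum_eq he] at hn
  exact ⟨k, f n, hf _ n hn, cechMapAt_cechFrac h I k n⟩

theorem cechMap_mem (h : IsCechMap x x' θ σ τ f) (he : ∀ i, e (σ i) = e' i)
    {hx : RaisesDegree x e 𝒩} {hx' : RaisesDegree x' e' 𝒩'} {d : ℤ}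
    (hf : ∀ d, ∀ n ∈ 𝒩 d, f n ∈ 𝒩' d) {c : CechTotal x N} (hc : c ∈ cechTotalPiece x e hx d) :
    cechMap h c ∈ cechTotalPiece x' e' hx' d :=
  mem_cechTotalPiece.mpr fun _ => cechMapAt_mem h he hf (mem_cechTotalPiece.mp hc _)

end CechMap

end

end GradedLocalCohomology

namespace GradedLocalCohomology

noncomputable section

/-! ### Every Čech class is killed by a power of each x m. -/

section Torsion

variable {K : Type*} [CommRing K] {S : Type*} [CommRing S] [Algebra K S] {r : ℕ} {x : Fin r → S}
  {N : Type*} [AddCommGroup N] [Module S N] [Module K N] [IsScalarTower K S N]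
  {𝒩 : ℤ → Submodule K N} {e : Fin r → ℕ}

theorem mem_cechFracPiece_congr {hx : RaisesDegree x e 𝒩} {d d' : ℤ} (h : d = d')
    {I : Finset (Fin r)} {z : CechLocalization x N I} (hz : z ∈ cechFracPiece x e hx d I) :
    z ∈ cechFracPiece x e hx d' I := h ▸ hz

/-- `s` maps elements of degree `d` to elements of degree `d + q`. -/
def ShiftsDegree (𝒩 : ℤ → Submodule K N) (q : ℤ) (s : S) : Prop :=
  ∀ d n, n ∈ 𝒩 d → s • n ∈ 𝒩 (d + q)

omit [Algebra K S] [IsScalarTower K S N] in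
theorem ShiftsDegree.mul {q q' : ℤ} {s s' : S} (h : ShiftsDegree 𝒩 q s)
    (h' : ShiftsDegree 𝒩 q' s') : ShiftsDegree 𝒩 (q + q') (s * s') := fun d n hn => by
  rw [mul_smul]
  convert h _ _ (h' d n hn) using 2
  ring

omit [Algebra K S] [IsScalarTower K S N] in
theorem ShiftsDegree.pow {q : ℤ} {s : S} (h : ShiftsDegree 𝒩 q s) (k : ℕ) :
    ShiftsDegree 𝒩 (k * q) (s ^ k) := by
  induction k with
  | zero => intro d n hn; simpa using hn
  | succ k ih =>
    rw [pow_succ]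
    convert ih.mul h using 1
    push_cast
    ring

omit [Algebra K S] [IsScalarTower K S N] in
theorem ShiftsDegree.add {q : ℤ} {s s' : S} (h : ShiftsDegree 𝒩 q s)
    (h' : ShiftsDegree 𝒩 q s') : ShiftsDegree 𝒩 q (s + s') := fun d n hn => by
  rw [add_smul]
  exact add_mem (h d n hn) (h' d n hn)

theorem ShiftsDegree.smul_mem_piece {q : ℤ} {s : S} (h : ShiftsDegree 𝒩 q s)
    {hx : RaisesDegree x e 𝒩} {d : ℤ} {I : Finset (Fin r)} {z : CechLocalization x N I}
    (hz : z ∈ cechFracPiece x e hx d I) : s • z ∈ cechFracPiece x e hx (d + q) I := by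
  obtain ⟨k, n, hn, rfl⟩ := hz
  refine ⟨k, s • n, ?_, (map_smul _ _ _).symm⟩
  convert h _ _ hn using 2
  ring

theorem ShiftsDegree.smul_mem_total {q : ℤ} {s : S} (h : ShiftsDegree 𝒩 q s)
    {hx : RaisesDegree x e 𝒩} {d : ℤ} {c : CechTotal x N}
    (hc : c ∈ cechTotalPiece x e hx d) : s • c ∈ cechTotalPiece x e hx (d + q) :=
  mem_cechTotalPiece.mpr fun I => h.smul_mem_piece (mem_cechTotalPiece.mp hc I)

/-- Inverting x m in addition only introduces powers of x m into denominators, and a large power of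
x m clears them. All k ≥ k₀ are allowed so that one exponent can serve every index set. -/
theorem exists_cechRes_eq_pow_smul {hx : RaisesDegree x e 𝒩} {m : Fin r} {I : Finset (Fin r)}
    (hm : m ∉ I) {d : ℤ} {z : CechLocalization x N (insert m I)}
    (hz : z ∈ cechFracPiece x e hx d (insert m I)) :
    ∃ k₀ : ℕ, ∀ k ≥ k₀, ∃ b ∈ cechFracPiece x e hx (d + k * e m) I,
      cechRes x N I (insert m I) b = x m ^ k • z := by
  obtain ⟨k₀, n, hn, rfl⟩ := hz
  refine ⟨k₀, fun k hk => ⟨x m ^ (k - k₀) • cechFrac x N I k₀ n, ?_, ?_⟩⟩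
  · have h1 : cechFrac x N I k₀ n ∈ cechFracPiece x e hx (d + k₀ * e m) I := by
      refine ⟨k₀, n, ?_, rfl⟩
      convert hn using 2
      rw [Finset.sum_insert hm]
      push_cast
      ring
    refine mem_cechFracPiece_congr ?_ (ShiftsDegree.smul_mem_piece (ShiftsDegree.pow (hx m) _) h1)
    push_cast [hk]
    ring
  · rw [map_smul, cechRes_cechFrac x (Finset.subset_insert m I), Finset.insert_sdiff_cancel hm,
      Finset.prod_singleton, map_smul, smul_smul, ← pow_add, Nat.sub_add_cancel hk]

theorem exists_pow_smul_eq_zero_of_cechRes {m : Fin r} {I : Finset (Fin r)}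
    (hm : m ∉ I) {z : CechLocalization x N I} (hz : cechRes x N I (insert m I) z = 0) :
    ∃ k : ℕ, x m ^ k • z = 0 := by
  obtain ⟨k, n, rfl⟩ := exists_eq_cechFrac x z
  rw [cechRes_cechFrac x (Finset.subset_insert m I), Finset.insert_sdiff_cancel hm,
      Finset.prod_singleton, cechFrac_eq_zero] at hz
  obtain ⟨q, hq⟩ := hz
  refine ⟨q + k, ?_⟩
  rw [← map_smul, cechFrac_eq_zero]
  refine ⟨q, ?_⟩
  rw [Finset.prod_insert hm, mul_pow] at hq
  rw [smul_smul, pow_add, ← hq, smul_smul]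
  congr 1
  ring

/-- On the sets containing m the complex is contracted by c ↦ (I ↦ ± c (insert m I)), which makes
sense in N_{x_I} once a power of x m has cleared denominators. What remains lives on the sets
avoiding m and is killed by a further power. The last clause keeps a cochain supported on the sets
containing l within such cochains; the acyclicity argument needs it. -/
theorem exists_pow_smul_eq_cechDTotal {hx : RaisesDegree x e 𝒩} (m : Fin r) {d : ℤ}
    {c : CechTotal x N} (hc : c ∈ cechTotalPiece x e hx d) (hDc : cechDTotal x N c = 0) :
    ∃ (k : ℕ) (b : CechTotal x N), b ∈ cechTotalPiece x e hx (d + k * e m) ∧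
      cechDTotal x N b = x m ^ k • c ∧
      ∀ l, l ≠ m → (∀ I, l ∉ I → c I = 0) → ∀ I, l ∉ I → b I = 0 := by
  rw [mem_cechTotalPiece] at hc
  have h0 : ∀ I : Finset (Fin r), ∃ k₀ : ℕ, m ∉ I → ∀ k ≥ k₀,
      ∃ b ∈ cechFracPiece x e hx (d + k * e m) I,
      cechRes x N I (insert m I) b = x m ^ k • c (insert m I) := fun I => by
    by_cases hm : m ∈ I
    · exact ⟨0, fun h => absurd hm h⟩
    · obtain ⟨k₀, hk₀⟩ := exists_cechRes_eq_pow_smul hm (hc (insert m I))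
      exact ⟨k₀, fun _ => hk₀⟩
  choose k₀ hk₀ using h0
  set k := Finset.univ.sup k₀
  -- Choosing b = 0 wherever c (insert m I) = 0 is what yields the support clause.
  have h1 : ∀ I : Finset (Fin r), ∃ b ∈ cechFracPiece x e hx (d + k * e m) I,
      (m ∈ I → b = 0) ∧ (c (insert m I) = 0 → b = 0) ∧ (m ∉ I →
      cechRes x N I (insert m I) b =
        ((cechSign m (insert m I) : ℤ) : S) • x m ^ k • c (insert m I)) := fun I => by
    by_cases hm : m ∈ I
    · exact ⟨0, zero_mem _, fun _ => rfl, fun _ => rfl, fun h => absurd hm h⟩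
    by_cases hcI : c (insert m I) = 0
    · exact ⟨0, zero_mem _, fun _ => rfl, fun _ => rfl, fun h => by rw [hcI]; simp⟩
    · obtain ⟨b, hb, hb'⟩ := hk₀ I hm k (Finset.le_sup (Finset.mem_univ I))
      refine ⟨((cechSign m (insert m I) : ℤ) : S) • b, ?_, fun h => absurd h hm,
        fun h => absurd h hcI, fun _ => by rw [map_smul, hb']⟩
      rw [Int.cast_smul_eq_zsmul]
      exact zsmul_mem hb _
  choose b hb hbm hbc hbr using h1
  have herr : ∀ J, m ∈ J → cechDTotal x N b J = x m ^ k • c J := by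
    intro J hJ
    rw [cechDTotal_apply, Finset.sum_eq_single_of_mem m hJ]
    · have := hbr (J.erase m) (Finset.notMem_erase m J)
      rw [Finset.insert_erase hJ] at this
      rw [this, smul_smul, ← Int.cast_mul, cechSign_mul_self, Int.cast_one, one_smul]
    · intro j hj hjm
      rw [hbm _ (Finset.mem_erase.mpr ⟨hjm.symm, hJ⟩), map_zero, smul_zero]
  -- The error is a cocycle vanishing on the sets containing m. Its differential at insert m J
  -- therefore reduces to the restriction of its component at J, so that component dies after
  -- inverting x m.
  set err := cechDTotal x N b - x m ^ k • c
  have herr0 : ∀ J, m ∈ J → err J = 0 := fun J hJ => sub_eq_zero.mpr (herr J hJ)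
  have hDerr : cechDTotal x N err = 0 := by
    rw [map_sub, cechDTotal_cechDTotal, map_smul, hDc, smul_zero, sub_zero]
  have h2 : ∀ J : Finset (Fin r), ∃ q : ℕ, x m ^ q • err J = 0 := by
    intro J
    by_cases hJ : m ∈ J
    · exact ⟨0, by rw [herr0 J hJ, smul_zero]⟩
    · refine exists_pow_smul_eq_zero_of_cechRes hJ ?_
      have h3 := congrFun hDerr (insert m J)
      rw [cechDTotal_apply, Finset.sum_eq_single_of_mem m (Finset.mem_insert_self m J),
        Finset.erase_insert hJ] at h3
      · have h4 := congrArg (((cechSign m (insert m J) : ℤ) : S) • ·) h3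
        simp only [smul_smul, ← Int.cast_mul, cechSign_mul_self] at h4
        simpa using h4
      · intro j hj hjm
        have hmj : m ∈ (insert m J).erase j :=
          Finset.mem_erase.mpr ⟨hjm.symm, Finset.mem_insert_self m J⟩
        rw [herr0 _ hmj, map_zero, smul_zero]
  choose q hq using h2
  set Q := Finset.univ.sup q
  refine ⟨Q + k, x m ^ Q • b, ?_, ?_, ?_⟩
  · rw [mem_cechTotalPiece]
    intro I
    refine mem_cechFracPiece_congr ?_ (ShiftsDegree.smul_mem_piece (ShiftsDegree.pow (hx m) Q) (hb I))
    push_cast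
    ring
  · rw [map_smul, pow_add, mul_smul, ← sub_eq_zero, ← smul_sub]
    funext J
    have hle : q J ≤ Q := Finset.le_sup (Finset.mem_univ J)
    change x m ^ Q • err J = 0
    rw [← Nat.sub_add_cancel hle, pow_add, mul_smul, hq, smul_zero]
  · intro l hl hcl I hI
    rw [Pi.smul_apply, hbc I (hcl _ (by simp [hl, hI])), smul_zero]

end Torsion

end

end GradedLocalCohomology

namespace GradedLocalCohomology

noncomputable section

/-! ### Acyclicity of the part of the complex supported on a redundant generator. -/

section Acyclic

variable {K : Type*} [CommRing K] {S : Type*} [CommRing S] [Algebra K S] {r : ℕ} {x : Fin r → S}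
  {N : Type*} [AddCommGroup N] [Module S N] [Module K N] [IsScalarTower K S N]
  {𝒩 : ℤ → Submodule K N} {e : Fin r → ℕ}

/-- The cochain `c` is the boundary of a cochain of degree `d` whose components at the `I ∌ l`
vanish. -/
def IsBoundaryOver (hx : RaisesDegree x e 𝒩) (l : Fin r) (d : ℤ) (c : CechTotal x N) : Prop :=
  ∃ b ∈ cechTotalPiece x e hx d, (∀ I, l ∉ I → b I = 0) ∧ cechDTotal x N b = c

theorem IsBoundaryOver.add {hx : RaisesDegree x e 𝒩} {l : Fin r} {d : ℤ} {c c' : CechTotal x N}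
    (h : IsBoundaryOver hx l d c) (h' : IsBoundaryOver hx l d c') :
    IsBoundaryOver hx l d (c + c') := by
  obtain ⟨b, hb, hl, rfl⟩ := h
  obtain ⟨b', hb', hl', rfl⟩ := h'
  exact ⟨b + b', add_mem hb hb', fun I hI => by rw [Pi.add_apply, hl I hI, hl' I hI, add_zero],
    map_add _ _ _⟩

theorem IsBoundaryOver.zero {hx : RaisesDegree x e 𝒩} {l : Fin r} {d : ℤ} :
    IsBoundaryOver hx l d 0 :=
  ⟨0, zero_mem _, fun _ _ => rfl, map_zero _⟩

theorem IsBoundaryOver.sum {hx : RaisesDegree x e 𝒩} {l : Fin r} {d : ℤ} {ι : Type*}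
    (s : Finset ι) {c : ι → CechTotal x N} (h : ∀ i ∈ s, IsBoundaryOver hx l d (c i)) :
    IsBoundaryOver hx l d (∑ i ∈ s, c i) :=
  Finset.sum_induction c _ (fun _ _ => IsBoundaryOver.add) IsBoundaryOver.zero h

theorem IsBoundaryOver.smul {hx : RaisesDegree x e 𝒩} {l : Fin r} {d q : ℤ} {c : CechTotal x N}
    (h : IsBoundaryOver hx l d c) {s : S} (hs : ShiftsDegree 𝒩 q s) :
    IsBoundaryOver hx l (d + q) (s • c) := by
  obtain ⟨b, hb, hl, rfl⟩ := h
  exact ⟨s • b, hs.smul_mem_total hb, fun I hI => by rw [Pi.smul_apply, hl I hI, smul_zero],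
    map_smul _ _ _⟩

theorem IsBoundaryOver.congr {hx : RaisesDegree x e 𝒩} {l : Fin r} {d d' : ℤ}
    {c c' : CechTotal x N} (h : IsBoundaryOver hx l d c) (hd : d = d') (hc : c = c') :
    IsBoundaryOver hx l d' c' := hd ▸ hc ▸ h

/-- Binomial theorem: every term of (s + t)^(k + k') contains s^k or t^k', as in the proof that a
radical is closed under addition. -/
theorem IsBoundaryOver.exists_add_pow {hx : RaisesDegree x e 𝒩} {l : Fin r} {d q : ℤ}
    {c : CechTotal x N} {s t : S} (hs : ShiftsDegree 𝒩 q s) (ht : ShiftsDegree 𝒩 q t)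
    (h1 : ∃ k : ℕ, IsBoundaryOver hx l (d + k * q) (s ^ k • c))
    (h2 : ∃ k : ℕ, IsBoundaryOver hx l (d + k * q) (t ^ k • c)) :
    ∃ k : ℕ, IsBoundaryOver hx l (d + k * q) ((s + t) ^ k • c) := by
  obtain ⟨k, h1⟩ := h1
  obtain ⟨k', h2⟩ := h2
  refine ⟨k + k', ?_⟩
  rw [add_pow, Finset.sum_smul]
  refine IsBoundaryOver.sum _ fun i hi => ?_
  have hi' : i ≤ k + k' := Nat.lt_succ_iff.mp (Finset.mem_range.mp hi)
  have h3 : IsBoundaryOver hx l (d + ((k + k' : ℕ) : ℤ) * q)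
      ((s ^ i * t ^ (k + k' - i)) • c) := by
    rcases le_total k i with hki | hki
    · refine (h1.smul ((hs.pow (i - k)).mul (ht.pow (k + k' - i)))).congr ?_ ?_
      · push_cast [hki, hi']; ring
      · rw [smul_smul]
        congr 1
        calc s ^ (i - k) * t ^ (k + k' - i) * s ^ k = s ^ (i - k + k) * t ^ (k + k' - i) := by ring
          _ = _ := by rw [Nat.sub_add_cancel hki]
    · have hk2 : k' ≤ k + k' - i := by lia
      refine (h2.smul ((hs.pow i).mul (ht.pow (k + k' - i - k')))).congr ?_ ?_
      · push_cast [hk2, hi']; ring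
      · rw [smul_smul]
        congr 1
        calc s ^ i * t ^ (k + k' - i - k') * t ^ k' = s ^ i * t ^ (k + k' - i - k' + k') := by ring
          _ = _ := by rw [Nat.sub_add_cancel hk2]
  have h4 : ShiftsDegree 𝒩 0 (((k + k').choose i : ℕ) : S) := fun d n hn => by
    rw [Nat.cast_smul_eq_nsmul, add_zero]
    exact nsmul_mem hn _
  exact (h3.smul h4).congr (by ring) (by rw [smul_smul, mul_comm])

/-- Division by a power of `x l` on the components at the `I ∋ l`. -/
theorem exists_pow_smul_eq {hx : RaisesDegree x e 𝒩} {l : Fin r} {I : Finset (Fin r)} (hl : l ∈ I)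
    {d : ℤ} (k : ℕ) {z : CechLocalization x N I}
    (hz : z ∈ cechFracPiece x e hx (d + k * e l) I) :
    ∃ y ∈ cechFracPiece x e hx d I, x l ^ k • y = z := by
  obtain ⟨q, n, hn, rfl⟩ := hz
  refine ⟨cechFrac x N I (q + k) ((∏ i ∈ I.erase l, x i) ^ k • n), ⟨_, _, ?_, rfl⟩, ?_⟩
  · convert hx.prod_pow_smul_mem (I.erase l) k hn using 2
    rw [← Finset.add_sum_erase _ _ hl]
    push_cast
    ring
  · rw [← map_smul, smul_smul, ← mul_pow, Finset.mul_prod_erase _ _ hl, cechFrac_shift]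

theorem eq_zero_of_pow_smul_eq_zero {l : Fin r} {I : Finset (Fin r)} (hl : l ∈ I)
    {k : ℕ} {z : CechLocalization x N I} (hz : x l ^ k • z = 0) : z = 0 := by
  obtain ⟨q, n, rfl⟩ := exists_eq_cechFrac x z
  rw [← map_smul, cechFrac_eq_zero] at hz
  obtain ⟨m, hm⟩ := hz
  refine (cechFrac_eq_zero x).mpr ⟨m + k, ?_⟩
  rw [pow_add, ← Finset.mul_prod_erase _ _ hl, mul_pow (x l) _ k, mul_comm (x l ^ k), ← mul_assoc,
    mul_comm _ ((∏ i ∈ I.erase l, x i) ^ k), mul_assoc, mul_smul, mul_smul,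
    Finset.mul_prod_erase _ _ hl, hm, smul_zero]

/-- Cocycles supported on the `I ∋ l` are boundaries if `x l` is a combination of the
other `x m`. -/
theorem isBoundaryOver_of_eq_sum {hx : RaisesDegree x e 𝒩} {l : Fin r} (a : Fin r → S)
    (ha : ∀ m, ShiftsDegree 𝒩 (e l - e m) (a m))
    (hsum : x l = ∑ m ∈ Finset.univ.erase l, a m * x m)
    {d : ℤ} {c : CechTotal x N} (hc : c ∈ cechTotalPiece x e hx d) (hDc : cechDTotal x N c = 0)
    (hl : ∀ I, l ∉ I → c I = 0) : IsBoundaryOver hx l d c := by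
  have hax : ∀ m, ShiftsDegree 𝒩 (e l) (a m * x m) := fun m => by
    convert (ha m).mul (show ShiftsDegree 𝒩 (e m) (x m) from hx m) using 1
    ring
  -- A power of each x m with m ≠ l turns c into a boundary supported on the sets containing l.
  -- Adding up the terms a m * x m shows the same for a power of x l.
  have h1 : ∀ s : Finset (Fin r), l ∉ s → ShiftsDegree 𝒩 (e l) (∑ m ∈ s, a m * x m) ∧
      ∃ k : ℕ, IsBoundaryOver hx l (d + k * (e l : ℤ)) ((∑ m ∈ s, a m * x m) ^ k • c) := by
    intro s
    induction s using Finset.induction_on with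
    | empty =>
      intro _
      refine ⟨fun d n _ => by simp, 1, ?_⟩
      simpa using IsBoundaryOver.zero
    | insert m s hm ih =>
      intro hls
      rw [Finset.mem_insert, not_or] at hls
      obtain ⟨ih1, ih2⟩ := ih hls.2
      rw [Finset.sum_insert hm]
      refine ⟨(hax m).add ih1, IsBoundaryOver.exists_add_pow (hax m) ih1 ?_ ih2⟩
      obtain ⟨k, b, hb, hDb, hbl⟩ := exists_pow_smul_eq_cechDTotal m hc hDc
      have h2 : IsBoundaryOver hx l (d + k * e m) (x m ^ k • c) := ⟨b, hb, hbl l hls.1 hl, hDb⟩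
      refine ⟨k, (h2.smul ((ha m).pow k)).congr (by ring) ?_⟩
      rw [mul_pow, mul_smul]
  obtain ⟨-, k, b, hb, hbl, hDb⟩ := h1 (Finset.univ.erase l) (Finset.notMem_erase l _)
  rw [← hsum] at hDb
  -- On the components that contain l the element x l is invertible, so its power can be divided out
  -- of the primitive b.
  have h2 : ∀ I, ∃ y ∈ cechFracPiece x e hx d I, x l ^ k • y = b I ∧ (l ∉ I → y = 0) := fun I => by
    by_cases hI : l ∈ I
    · obtain ⟨y, hy, hy'⟩ := exists_pow_smul_eq hI k (mem_cechTotalPiece.mp hb I)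
      exact ⟨y, hy, hy', fun h => absurd hI h⟩
    · exact ⟨0, zero_mem _, by rw [hbl I hI, smul_zero], fun _ => rfl⟩
  choose y hy hyb hyl using h2
  refine ⟨y, mem_cechTotalPiece.mpr hy, hyl, ?_⟩
  have h3 : x l ^ k • cechDTotal x N y = x l ^ k • c := by
    rw [← map_smul, ← hDb]
    exact congrArg _ (funext hyb)
  funext I
  by_cases hI : l ∈ I
  · rw [← sub_eq_zero]
    refine eq_zero_of_pow_smul_eq_zero hI (k := k) ?_
    rw [smul_sub, sub_eq_zero]
    exact congrFun h3 I
  · rw [hl I hI, cechDTotal_apply]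
    exact Finset.sum_eq_zero fun j _ => by
      rw [hyl _ (fun h => hI (Finset.mem_of_mem_erase h)), map_zero, smul_zero]

end Acyclic

end

end GradedLocalCohomology

namespace GradedLocalCohomology

noncomputable section

/-! ### Čech cohomology in one cohomological degree and its independence of the generators. -/

section SubCohomology

variable {K : Type*} [CommRing K] {C C' : ℕ → Type*} [∀ p, AddCommGroup (C p)]
  [∀ p, Module K (C p)] [∀ p, AddCommGroup (C' p)] [∀ p, Module K (C' p)]

/-- The cocycles lying in the submodules `Q p`. -/
def subCocycles (D : ∀ p, C p →ₗ[K] C (p + 1)) (Q : ∀ p, Submodule K (C p)) (p : ℕ) :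
    Submodule K (C p) :=
  LinearMap.ker (D p) ⊓ Q p

/-- The coboundaries of elements of the submodules `Q p`. -/
def subCoboundaries (D : ∀ p, C p →ₗ[K] C (p + 1)) (Q : ∀ p, Submodule K (C p)) :
    ∀ p, Submodule K (C p)
  | 0 => ⊥
  | p + 1 => (Q p).map (D p)

/-- The cohomology of the subcomplex `Q` of the complex `C`. -/
abbrev SubCohomology (D : ∀ p, C p →ₗ[K] C (p + 1)) (Q : ∀ p, Submodule K (C p)) (p : ℕ) : Type _ :=
  subCocycles D Q p ⧸ (subCoboundaries D Q p).submoduleOf (subCocycles D Q p)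

/-- A linear map that is bijective on the cohomology in degree `p` in terms of elements induces an
isomorphism. -/
theorem SubCohomology.nonempty_equiv {D : ∀ p, C p →ₗ[K] C (p + 1)} {Q : ∀ p, Submodule K (C p)}
    {D' : ∀ p, C' p →ₗ[K] C' (p + 1)} {Q' : ∀ p, Submodule K (C' p)} {p : ℕ}
    (φ : C p →ₗ[K] C' p) (hZ : ∀ c ∈ subCocycles D Q p, φ c ∈ subCocycles D' Q' p)
    (hB : ∀ c ∈ subCoboundaries D Q p, φ c ∈ subCoboundaries D' Q' p)
    (hinj : ∀ c ∈ subCocycles D Q p, φ c ∈ subCoboundaries D' Q' p → c ∈ subCoboundaries D Q p)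
    (hsurj : ∀ c' ∈ subCocycles D' Q' p, ∃ c ∈ subCocycles D Q p,
      φ c - c' ∈ subCoboundaries D' Q' p) :
    Nonempty (SubCohomology D Q p ≃ₗ[K] SubCohomology D' Q' p) := by
  let Φ : SubCohomology D Q p →ₗ[K] SubCohomology D' Q' p :=
    Submodule.mapQ _ _ (φ.restrict hZ) fun c hc => hB c.1 hc
  refine ⟨LinearEquiv.ofBijective Φ ⟨?_, ?_⟩⟩
  · rw [← LinearMap.ker_eq_bot, LinearMap.ker_eq_bot']
    intro z hz
    obtain ⟨c, rfl⟩ := Submodule.mkQ_surjective _ z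
    have hz' : Submodule.Quotient.mk (p := (subCoboundaries D' Q' p).submoduleOf
        (subCocycles D' Q' p)) (φ.restrict hZ c) = 0 := hz
    have hz'' := (Submodule.Quotient.mk_eq_zero _).mp hz'
    exact (Submodule.Quotient.mk_eq_zero _).mpr (hinj c.1 c.2 hz'')
  · intro z
    obtain ⟨c', rfl⟩ := Submodule.mkQ_surjective _ z
    obtain ⟨c, hc, hcc⟩ := hsurj c'.1 c'.2
    exact ⟨Submodule.Quotient.mk ⟨c, hc⟩, (Submodule.Quotient.eq _).mpr hcc⟩

end SubCohomology

section Total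

variable {K : Type*} [CommRing K] {S : Type*} [CommRing S] [Algebra K S] {r : ℕ} {x : Fin r → S}
  {N : Type*} [AddCommGroup N] [Module S N] [Module K N] [IsScalarTower K S N]
  {𝒩 : ℤ → Submodule K N} {e : Fin r → ℕ}

/-- The Čech cohomology in cohomological degree `p` and internal degree `d`. -/
abbrev CechCohomology (hx : RaisesDegree x e 𝒩) (p : ℕ) (d : ℤ) : Type _ :=
  SubCohomology (fun p => (cechD x N p).restrictScalars K)
    (fun p => cechCochainPiece x hx p d) p

theorem IsGradedAction.nonempty_equiv {𝒮 : ℕ → Submodule K S} (h : IsGradedAction 𝒮 x 𝒩 e)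
    (p : ℕ) (d : ℤ) :
    Nonempty (LocalCohomologyPiece 𝒮 x 𝒩 p d ≃ₗ[K] CechCohomology h.raisesDegree p d) := by
  have h1 : Nonempty (LocalCohomologyPiece 𝒮 x 𝒩 p d ≃ₗ[K]
      SubCohomology (fun p => (cechD x N p).restrictScalars K)
        (fun p => cechPiece 𝒮 x 𝒩 p d) p) := by
    cases p with
    | zero => exact ⟨LinearEquiv.refl K _⟩
    | succ p => exact ⟨LinearEquiv.refl K _⟩
  have h2 : (fun p => cechPiece 𝒮 x 𝒩 p d) = fun p => cechCochainPiece x h.raisesDegree p d :=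
    funext fun p => h.cechPiece_eq p d
  rwa [h2] at h1

theorem mem_subCocycles {hx : RaisesDegree x e 𝒩} {p : ℕ} {d : ℤ} {c : CechCochain x N p} :
    c ∈ subCocycles (fun p => (cechD x N p).restrictScalars K)
      (fun p => cechCochainPiece x hx p d) p ↔
    cechDTotal x N (cechIncl x N p c) = 0 ∧ cechIncl x N p c ∈ cechTotalPiece x e hx d := by
  rw [cechDTotal_cechIncl, subCocycles, Submodule.mem_inf]
  refine and_congr ⟨fun h => ?_, fun h => ?_⟩ ⟨cechIncl_mem, fun h => ?_⟩
  · rw [show cechD x N p c = 0 from h, map_zero]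
  · have := congrArg (cechProj x N (p + 1)) h
    rwa [cechProj_cechIncl, map_zero] at this
  · rw [← cechProj_cechIncl c]
    exact cechProj_mem h

theorem mem_subCoboundaries {hx : RaisesDegree x e 𝒩} {p : ℕ} {d : ℤ} {c : CechCochain x N p} :
    c ∈ subCoboundaries (fun p => (cechD x N p).restrictScalars K)
      (fun p => cechCochainPiece x hx p d) p ↔
    ∃ b ∈ cechTotalPiece x e hx d, cechProj x N p (cechDTotal x N b) = c := by
  cases p with
  | zero =>
    constructor
    · intro h
      exact ⟨0, zero_mem _, by rw [map_zero, map_zero]; exact h.symm⟩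
    · rintro ⟨b, -, rfl⟩
      exact cechProj_zero_cechDTotal b
  | succ p =>
    constructor
    · rintro ⟨b, hb, rfl⟩
      exact ⟨cechIncl x N p b, cechIncl_mem hb, by
        rw [cechDTotal_cechIncl, cechProj_cechIncl]; rfl⟩
    · rintro ⟨b, hb, rfl⟩
      exact ⟨cechProj x N p b, cechProj_mem hb, cechD_cechProj b⟩

variable {S' : Type*} [CommRing S'] [Algebra K S'] {r' : ℕ} {x' : Fin r' → S'}
  {N' : Type*} [AddCommGroup N'] [Module S' N'] [Module K N'] [IsScalarTower K S' N']
  {𝒩' : ℤ → Submodule K N'} {e' : Fin r' → ℕ} {θ : S →+* S'} {σ : Fin r' ↪o Fin r}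
  {τ : Finset (Fin r') → Finset (Fin r)} {f : N →ₗ[K] N'}

theorem cechMap_cechIncl (h : IsCechMap x x' θ σ τ f) {p : ℕ} (c : CechCochain x N p) :
    cechMap h (cechIncl x N p c) =
      cechIncl x' N' p (cechProj x' N' p (cechMap h (cechIncl x N p c))) := by
  funext I
  by_cases hI : I.card = p
  · rw [cechIncl_apply _ hI, cechProj_apply]
  · rw [cechIncl_apply_of_ne _ hI, cechMap_apply, cechIncl_apply_of_ne, map_zero]
    rwa [h.map_eq, Finset.card_map]

theorem cechMap_cechProj (h : IsCechMap x x' θ σ τ f) {p : ℕ} (c : CechTotal x N) :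
    cechMap h (cechIncl x N p (cechProj x N p c)) =
      cechIncl x' N' p (cechProj x' N' p (cechMap h c)) := by
  funext I
  have h0 : (τ I).card = I.card := by rw [h.map_eq, Finset.card_map]
  by_cases hI : I.card = p
  · rw [cechIncl_apply _ hI, cechProj_apply, cechMap_apply, cechIncl_apply _ (h0.trans hI)]
    rfl
  · rw [cechIncl_apply_of_ne _ hI, cechMap_apply, cechIncl_apply_of_ne _ (h0 ▸ hI), map_zero]

/-- The differential is homogeneous, so the degree p part of a boundary is the boundary of the
degree p - 1 part; for p = 0 that part is zero. The map q is this truncation. -/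
theorem cechProj_cechDTotal_cechIncl (b : CechTotal x N) (p : ℕ) :
    ∃ q : CechTotal x N →ₗ[S] CechTotal x N,
      (∀ (hx : RaisesDegree x e 𝒩) (d : ℤ), ∀ b ∈ cechTotalPiece x e hx d,
        q b ∈ cechTotalPiece x e hx d) ∧
      cechIncl x N p (cechProj x N p (cechDTotal x N b)) = cechDTotal x N (q b) := by
  cases p with
  | zero =>
    refine ⟨0, fun hx d b _ => zero_mem _, ?_⟩
    rw [cechProj_zero_cechDTotal]
    simp
  | succ p =>
    refine ⟨cechIncl x N p ∘ₗ cechProj x N p, fun hx d b hb => cechIncl_mem (cechProj_mem hb), ?_⟩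
    rw [LinearMap.comp_apply, cechDTotal_cechIncl, cechD_cechProj]

/-- A map of total Čech complexes that is bijective on cohomology in terms of elements induces
isomorphisms in every cohomological degree. -/
theorem CechCohomology.nonempty_equiv_of_total (h : IsCechMap x x' θ σ τ f)
    (he : ∀ i, e (σ i) = e' i) (hx : RaisesDegree x e 𝒩) (hx' : RaisesDegree x' e' 𝒩')
    (hf : ∀ d, ∀ n ∈ 𝒩 d, f n ∈ 𝒩' d) {d : ℤ}
    (hinj : ∀ c ∈ cechTotalPiece x e hx d, cechDTotal x N c = 0 →
      (∃ b' ∈ cechTotalPiece x' e' hx' d, cechDTotal x' N' b' = cechMap h c) →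
      ∃ b ∈ cechTotalPiece x e hx d, cechDTotal x N b = c)
    (hsurj : ∀ c' ∈ cechTotalPiece x' e' hx' d, cechDTotal x' N' c' = 0 →
      ∃ c ∈ cechTotalPiece x e hx d, cechDTotal x N c = 0 ∧
        ∃ b' ∈ cechTotalPiece x' e' hx' d, cechDTotal x' N' b' = cechMap h c - c') (p : ℕ) :
    Nonempty (CechCohomology hx p d ≃ₗ[K] CechCohomology hx' p d) := by
  refine SubCohomology.nonempty_equiv
    ((cechProj x' N' p).restrictScalars K ∘ₗ cechMap h ∘ₗ (cechIncl x N p).restrictScalars K)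
    ?_ ?_ ?_ ?_
  · intro c hc
    rw [mem_subCocycles] at hc ⊢
    change cechDTotal x' N' (cechIncl x' N' p (cechProj x' N' p (cechMap h (cechIncl x N p c)))) = 0
      ∧ cechIncl x' N' p (cechProj x' N' p (cechMap h (cechIncl x N p c))) ∈ _
    rw [← cechMap_cechIncl, ← cechMap_cechDTotal, hc.1, map_zero]
    exact ⟨rfl, cechMap_mem h he hf hc.2⟩
  · intro c hc
    rw [mem_subCoboundaries] at hc ⊢
    obtain ⟨b, hb, rfl⟩ := hc
    refine ⟨cechMap h b, cechMap_mem h he hf hb, ?_⟩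
    change _ = cechProj x' N' p (cechMap h (cechIncl x N p _))
    rw [cechMap_cechProj, cechProj_cechIncl, cechMap_cechDTotal]
  · intro c hc hcB
    rw [mem_subCocycles] at hc
    rw [mem_subCoboundaries] at hcB ⊢
    obtain ⟨b', hb', hbc⟩ := hcB
    change _ = cechProj x' N' p (cechMap h (cechIncl x N p c)) at hbc
    obtain ⟨q, hq, hq'⟩ := cechProj_cechDTotal_cechIncl (𝒩 := 𝒩') (e := e') b' p
    obtain ⟨b, hb, hDb⟩ := hinj _ hc.2 hc.1 ⟨q b', hq hx' d b' hb', by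
      rw [← hq', hbc, ← cechMap_cechIncl]⟩
    exact ⟨b, hb, by rw [hDb, cechProj_cechIncl]⟩
  · intro c' hc'
    rw [mem_subCocycles] at hc'
    obtain ⟨c, hc, hDc, b', hb', hbc⟩ := hsurj _ hc'.2 hc'.1
    refine ⟨cechProj x N p c, ?_, ?_⟩
    · rw [mem_subCocycles]
      refine ⟨?_, cechIncl_mem (cechProj_mem hc)⟩
      rw [cechDTotal_cechIncl, cechD_cechProj, hDc, map_zero, map_zero]
    · rw [mem_subCoboundaries]
      refine ⟨b', hb', ?_⟩
      change _ = cechProj x' N' p (cechMap h (cechIncl x N p (cechProj x N p c))) - c'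
      rw [hbc, map_sub, cechProj_cechIncl, cechMap_cechProj, cechProj_cechIncl]

end Total

section Independence

variable {K : Type*} [CommRing K] {S : Type*} [CommRing S] [Algebra K S]
  {N : Type*} [AddCommGroup N] [Module S N] [Module K N] [IsScalarTower K S N]
  {𝒩 : ℤ → Submodule K N}

/-- Leaving out an element that is a combination of the others does not change the cohomology. -/
theorem CechCohomology.nonempty_equiv_succAbove {r : ℕ} {x : Fin (r + 1) → S}
    {e : Fin (r + 1) → ℕ} (hx : RaisesDegree x e 𝒩) (l : Fin (r + 1)) (a : Fin (r + 1) → S)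
    (ha : ∀ m, ShiftsDegree 𝒩 (e l - e m) (a m))
    (hsum : x l = ∑ m ∈ Finset.univ.erase l, a m * x m)
    (hx' : RaisesDegree (x ∘ l.succAbove) (e ∘ l.succAbove) 𝒩) (p : ℕ) (d : ℤ) :
    Nonempty (CechCohomology hx p d ≃ₗ[K] CechCohomology hx' p d) := by
  -- Restriction to the sets avoiding l is onto the smaller complex. Its kernel consists of the
  -- cochains supported on the sets containing l and is acyclic by `isBoundaryOver_of_eq_sum`, so
  -- cohomology does not change.
  let σ : Fin r ↪o Fin (r + 1) := l.succAboveOrderEmb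
  have h : IsCechMap x (x ∘ l.succAbove) (RingHom.id S) σ (fun I => I.map σ.toEmbedding)
      (LinearMap.id : N →ₗ[K] N) := ⟨fun _ => rfl, fun _ => rfl, fun _ _ => rfl⟩
  have hinjAt : ∀ I z, cechMapAt h I z = 0 → z = 0 := by
    intro I z hz
    obtain ⟨k, n, rfl⟩ := exists_eq_cechFrac x z
    rw [cechMapAt_cechFrac h, cechFrac_eq_zero] at hz
    obtain ⟨m, hm⟩ := hz
    rw [cechFrac_eq_zero]
    refine ⟨m, ?_⟩
    have := h.map_prod_pow_smul I m n
    exact this.trans hm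
  have hmem : ∀ I : Finset (Fin (r + 1)), l ∉ I → ∃ I' : Finset (Fin r), I'.map σ.toEmbedding = I := by
    intro I hI
    refine ⟨Finset.univ.filter fun i => σ i ∈ I, ?_⟩
    ext j
    simp only [Finset.mem_map, Finset.mem_filter, Finset.mem_univ, true_and]
    constructor
    · rintro ⟨i, hi, rfl⟩; exact hi
    · intro hj
      obtain ⟨i, rfl⟩ := Fin.exists_succAbove_eq (x := j) (y := l) (fun h => hI (h ▸ hj))
      exact ⟨i, hj, rfl⟩
  have hker : ∀ c, cechMap h c = 0 → ∀ I, l ∉ I → c I = 0 := by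
    intro c hc I hI
    obtain ⟨I', rfl⟩ := hmem I hI
    exact hinjAt I' _ (congrFun hc I')
  have hlift : ∀ c' ∈ cechTotalPiece (x ∘ l.succAbove) (e ∘ l.succAbove) hx' d,
      ∃ c ∈ cechTotalPiece x e hx d, cechMap h c = c' := by
    intro c' hc'
    have h1 : ∀ I : Finset (Fin (r + 1)), ∃ z ∈ cechFracPiece x e hx d I,
        ∀ (I' : Finset (Fin r)) (hI' : I = I'.map σ.toEmbedding),
          cechMapAt h I' (hI' ▸ z) = c' I' := by
      intro I
      by_cases hI : l ∈ I
      · refine ⟨0, zero_mem _, fun I' hI' => ?_⟩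
        rw [hI'] at hI
        obtain ⟨i, -, hi⟩ := Finset.mem_map.mp hI
        exact absurd hi (Fin.succAbove_ne l i)
      · obtain ⟨I₁, rfl⟩ := hmem I hI
        obtain ⟨k, n, hn, hz⟩ := mem_cechTotalPiece.mp hc' I₁
        refine ⟨cechFrac x N _ k n, ⟨k, n, ?_, rfl⟩, fun I' hI' => ?_⟩
        · rwa [Finset.sum_map]
        · obtain rfl := Finset.map_injective _ hI'
          rw [hz]
          exact cechMapAt_cechFrac h I₁ k n
    choose c hc hcz using h1
    exact ⟨c, mem_cechTotalPiece.mpr hc, funext fun I' => hcz _ I' rfl⟩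
  have hbd : ∀ c ∈ cechTotalPiece x e hx d, cechDTotal x N c = 0 → cechMap h c = 0 →
      ∃ b ∈ cechTotalPiece x e hx d, cechMap h b = 0 ∧ cechDTotal x N b = c := by
    intro c hc hDc hc0
    obtain ⟨b, hb, hbl, hDb⟩ := isBoundaryOver_of_eq_sum a ha hsum hc hDc (hker c hc0)
    refine ⟨b, hb, ?_, hDb⟩
    funext I
    rw [cechMap_apply, hbl, map_zero]
    · rfl
    · intro hI
      obtain ⟨i, -, hi⟩ := Finset.mem_map.mp hI
      exact absurd hi (Fin.succAbove_ne l i)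
  refine CechCohomology.nonempty_equiv_of_total h (fun _ => rfl) hx hx' (fun _ _ hn => hn) ?_ ?_ p
  · rintro c hc hDc ⟨b', hb', hDb'⟩
    obtain ⟨b, hb, rfl⟩ := hlift b' hb'
    obtain ⟨b₁, hb₁, -, hDb₁⟩ := hbd (c - cechDTotal x N b) (sub_mem hc (cechDTotal_mem hb))
      (by rw [map_sub, hDc, cechDTotal_cechDTotal, sub_zero])
      (by rw [map_sub, cechMap_cechDTotal, hDb', sub_self])
    exact ⟨b₁ + b, add_mem hb₁ hb, by rw [map_add, hDb₁, sub_add_cancel]⟩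
  · intro c' hc' hDc'
    obtain ⟨c, hc, rfl⟩ := hlift c' hc'
    obtain ⟨b, hb, hb0, hDb⟩ := hbd (cechDTotal x N c) (cechDTotal_mem hc)
      (cechDTotal_cechDTotal x c) (by rw [cechMap_cechDTotal, hDc'])
    exact ⟨c - b, sub_mem hc hb, by rw [map_sub, hDb, sub_self], 0, zero_mem _, by
      rw [map_zero, map_sub, hb0, sub_zero, sub_self]⟩

/-- The elements `x l` are homogeneous combinations of the `x (σ i)`. -/
def IsHomogeneousCombination (𝒩 : ℤ → Submodule K N) {r r' : ℕ} (x : Fin r → S) (e : Fin r → ℕ)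
    (σ : Fin r' → Fin r) : Prop :=
  ∀ l, ∃ a : Fin r' → S, (∀ i, ShiftsDegree 𝒩 (e l - e (σ i)) (a i)) ∧
    x l = ∑ i, a i * x (σ i)

theorem CechCohomology.nonempty_equiv_of_eq {r : ℕ} {x x' : Fin r → S} {e e' : Fin r → ℕ}
    (hxx : x = x') (hee : e = e') (hx : RaisesDegree x e 𝒩) (hx' : RaisesDegree x' e' 𝒩)
    (p : ℕ) (d : ℤ) : Nonempty (CechCohomology hx p d ≃ₗ[K] CechCohomology hx' p d) := by
  subst hxx hee
  exact ⟨LinearEquiv.refl K _⟩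

/-- Induction on r: an index missed by σ is dropped with `nonempty_equiv_succAbove`, and a
surjective order embedding of `Fin r'` into `Fin r` is the identity. -/
theorem CechCohomology.nonempty_equiv_of_embedding {r' : ℕ} : ∀ {r : ℕ} {x : Fin r → S}
    {e : Fin r → ℕ} (hx : RaisesDegree x e 𝒩) (σ : Fin r' ↪o Fin r)
    (_ : IsHomogeneousCombination 𝒩 x e σ)
    (hx' : RaisesDegree (x ∘ σ) (e ∘ σ) 𝒩) (p : ℕ) (d : ℤ),
    Nonempty (CechCohomology hx p d ≃ₗ[K] CechCohomology hx' p d) := by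
  have hsurj : ∀ {r : ℕ} {x : Fin r → S} {e : Fin r → ℕ} (hx : RaisesDegree x e 𝒩)
      (σ : Fin r' ↪o Fin r) (_ : Function.Surjective σ) (hx' : RaisesDegree (x ∘ σ) (e ∘ σ) 𝒩)
      (p : ℕ) (d : ℤ), Nonempty (CechCohomology hx p d ≃ₗ[K] CechCohomology hx' p d) := by
    intro r x e hx σ hs hx' p d
    have h0 : r' = r := by
      simpa using Fintype.card_of_bijective ⟨σ.injective, hs⟩
    subst h0
    have hσ : (σ : Fin r' → Fin r') = id :=
      (StrictMono.range_inj σ.strictMono strictMono_id).mp (by simp [hs.range_eq])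
    exact CechCohomology.nonempty_equiv_of_eq (by rw [hσ]; rfl) (by rw [hσ]; rfl) hx hx' p d
  intro r
  induction r with
  | zero => exact fun hx σ _ hx' p d => hsurj hx σ (fun i => i.elim0) hx' p d
  | succ r ih =>
    intro x e hx σ hcomb hx' p d
    by_cases hs : Function.Surjective σ
    · exact hsurj hx σ hs hx' p d
    · obtain ⟨l, hl⟩ := not_forall.mp hs
      have hl' : ∀ i, σ i ≠ l := fun i hi => hl ⟨i, hi⟩
      choose σ' hσ' using fun i => Fin.exists_succAbove_eq (hl' i)
      have hmono : StrictMono σ' := fun i j hij => by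
        rw [← (Fin.strictMono_succAbove l).lt_iff_lt, hσ', hσ']
        exact σ.strictMono hij
      obtain ⟨a, ha, hsum⟩ := hcomb l
      have hx₁ : RaisesDegree (x ∘ l.succAbove) (e ∘ l.succAbove) 𝒩 := fun i => hx _
      have h1 := CechCohomology.nonempty_equiv_succAbove hx l (Function.extend σ a 0) (fun m => by
        by_cases hm : ∃ i, σ i = m
        · obtain ⟨i, rfl⟩ := hm
          rw [σ.injective.extend_apply]
          exact ha i
        · rw [Function.extend_apply' _ _ _ hm]
          intro d n _
          simp) (by
        rw [hsum, ← Finset.sum_subset (s₁ := Finset.univ.map σ.toEmbedding)]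
        · rw [Finset.sum_map]
          exact Finset.sum_congr rfl fun i _ => by
            rw [RelEmbedding.coe_toEmbedding, σ.injective.extend_apply]
        · intro m hm
          obtain ⟨i, -, rfl⟩ := Finset.mem_map.mp hm
          exact Finset.mem_erase.mpr ⟨hl' i, Finset.mem_univ _⟩
        · intro m _ hm
          rw [Function.extend_apply', Pi.zero_apply, zero_mul]
          rintro ⟨i, rfl⟩
          exact hm (Finset.mem_map.mpr ⟨i, Finset.mem_univ _, rfl⟩)) hx₁ p d
      have hcomb' : IsHomogeneousCombination 𝒩 (x ∘ l.succAbove) (e ∘ l.succAbove)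
          (OrderEmbedding.ofStrictMono σ' hmono) := fun m => by
        obtain ⟨a, ha, hsum⟩ := hcomb (l.succAbove m)
        refine ⟨a, fun i => ?_, ?_⟩
        · simpa [hσ'] using ha i
        · simpa [hσ'] using hsum
      have hx₂ : RaisesDegree ((x ∘ l.succAbove) ∘ OrderEmbedding.ofStrictMono σ' hmono)
          ((e ∘ l.succAbove) ∘ OrderEmbedding.ofStrictMono σ' hmono) 𝒩 := fun i => hx _
      obtain ⟨E1⟩ := h1
      obtain ⟨E2⟩ := ih hx₁ (OrderEmbedding.ofStrictMono σ' hmono) hcomb' hx₂ p d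
      obtain ⟨E3⟩ := CechCohomology.nonempty_equiv_of_eq (funext fun i => by simp [hσ'])
        (funext fun i => by simp [hσ']) hx₂ hx' p d
      exact ⟨E1.trans (E2.trans E3)⟩

/-- The Čech cohomology does not depend on the choice of homogeneous generators. -/
theorem CechCohomology.nonempty_equiv_of_generators {r r' : ℕ} {x : Fin r → S} {x' : Fin r' → S}
    {e : Fin r → ℕ} {e' : Fin r' → ℕ} (hx : RaisesDegree x e 𝒩) (hx' : RaisesDegree x' e' 𝒩)
    (h : ∀ l, ∃ a : Fin r' → S, (∀ i, ShiftsDegree 𝒩 (e l - e' i) (a i)) ∧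
      x l = ∑ i, a i * x' i)
    (h' : ∀ l, ∃ a : Fin r → S, (∀ i, ShiftsDegree 𝒩 (e' l - e i) (a i)) ∧
      x' l = ∑ i, a i * x i) (p : ℕ) (d : ℤ) :
    Nonempty (CechCohomology hx p d ≃ₗ[K] CechCohomology hx' p d) := by
  -- Both families are compared with their concatenation, from which each arises by leaving out
  -- redundant elements.
  have hz : RaisesDegree (Fin.append x x') (Fin.append e e') 𝒩 := fun l => by
    induction l using Fin.addCases with
    | left i => simpa using hx i
    | right i => simpa using hx' i
  have hself : ∀ {r : ℕ} (x : Fin r → S) (e : Fin r → ℕ) (l : Fin r),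
      ∃ a : Fin r → S, (∀ i, ShiftsDegree 𝒩 (e l - e i) (a i)) ∧ x l = ∑ i, a i * x i := by
    intro r x e l
    refine ⟨Pi.single l 1, fun i => ?_, ?_⟩
    · by_cases hi : i = l
      · subst hi
        intro d n hn
        simpa using hn
      · rw [Pi.single_eq_of_ne hi]
        intro d n _
        simp
    · rw [Finset.sum_eq_single l] <;> simp +contextual [Pi.single_eq_of_ne]
  have h1 : IsHomogeneousCombination 𝒩 (Fin.append x x') (Fin.append e e')
      (Fin.castAddOrderEmb r' : Fin r ↪o Fin (r + r')) := fun l => by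
    induction l using Fin.addCases with
    | left i => simpa using hself x e i
    | right i => simpa using h' i
  have h2 : IsHomogeneousCombination 𝒩 (Fin.append x x') (Fin.append e e')
      (Fin.natAddOrderEmb r : Fin r' ↪o Fin (r + r')) := fun l => by
    induction l using Fin.addCases with
    | left i => simpa using h i
    | right i => simpa using hself x' e' i
  have hx₁ : RaisesDegree (Fin.append x x' ∘ (Fin.castAddOrderEmb r' : Fin r ↪o Fin (r + r')))
      (Fin.append e e' ∘ (Fin.castAddOrderEmb r' : Fin r ↪o Fin (r + r'))) 𝒩 := fun _ => hz _
  have hx₂ : RaisesDegree (Fin.append x x' ∘ (Fin.natAddOrderEmb r : Fin r' ↪o Fin (r + r')))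
      (Fin.append e e' ∘ (Fin.natAddOrderEmb r : Fin r' ↪o Fin (r + r'))) 𝒩 := fun _ => hz _
  obtain ⟨E1⟩ := CechCohomology.nonempty_equiv_of_embedding hz _ h1 hx₁ p d
  obtain ⟨E2⟩ := CechCohomology.nonempty_equiv_of_embedding hz _ h2 hx₂ p d
  obtain ⟨E3⟩ := CechCohomology.nonempty_equiv_of_eq (funext fun i => by simp)
    (funext fun i => by simp) hx₁ hx p d
  obtain ⟨E4⟩ := CechCohomology.nonempty_equiv_of_eq (funext fun i => by simp)
    (funext fun i => by simp) hx₂ hx' p d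
  exact ⟨E3.symm.trans (E1.symm.trans (E2.trans E4))⟩

end Independence

end

end GradedLocalCohomology

namespace GradedLocalCohomology

noncomputable section

/-! ### Graded modules described by projections, and their finiteness modulo the x l. -/

section Grading

/-- A family of projections onto the homogeneous components of a grading. -/
structure IsGrading {P T Γ : Type*} [CommRing P] [AddCommGroup T] [Module P T]
    (π : Γ → T →ₗ[P] T) : Prop where
  apply_self : ∀ γ t, π γ (π γ t) = π γ t
  apply_ne : ∀ γ γ' t, γ ≠ γ' → π γ (π γ' t) = 0
  exists_sum : ∀ t, ∃ s : Finset Γ, ∑ γ ∈ s, π γ t = t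

variable {P T Γ : Type*} [CommRing P] [AddCommGroup T] [Module P T] {π : Γ → T →ₗ[P] T}

theorem IsGrading.exists_support (hπ : IsGrading π) (t : T) :
    ∃ s : Finset Γ, ∀ γ ∉ s, π γ t = 0 := by
  obtain ⟨s, hs⟩ := hπ.exists_sum t
  refine ⟨s, fun γ hγ => ?_⟩
  rw [← hs, map_sum]
  exact Finset.sum_eq_zero fun γ' h => hπ.apply_ne _ _ _ fun h' => hγ (h' ▸ h)

theorem IsGrading.mem_range (hπ : IsGrading π) {γ : Γ} {t : T} :
    t ∈ LinearMap.range (π γ) ↔ π γ t = t :=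
  ⟨fun ⟨s, hs⟩ => by rw [← hs, hπ.apply_self], fun h => ⟨t, h⟩⟩

theorem IsGrading.exists_bound {π : ℤ → T →ₗ[P] T} (hπ : IsGrading π) (W : Finset T) :
    ∃ D : ℤ, ∀ d ≥ D, ∀ t ∈ W, π d t = 0 := by
  choose s hs using hπ.exists_support
  obtain ⟨D, hD⟩ := (W.biUnion s).bddAbove
  refine ⟨D + 1, fun d hd t ht => hs t d fun h => ?_⟩
  have := hD (Finset.mem_coe.mpr (Finset.mem_biUnion.mpr ⟨t, ht, h⟩))
  lia

end Grading

section GradedModule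

universe v

variable {P : Type*} [CommRing P] {S : Type*} [CommRing S] [Algebra P S]

/-- A graded module over `S`, on which `x l` has degree `e l` and `u i` has degree `- γ i`. -/
structure IsGradedModule {r s : ℕ} (x : Fin r → S) (e : Fin r → ℕ) (u : Fin s → S) (γ : Fin s → ℕ)
    {T : Type*} [AddCommGroup T] [Module S T] [Module P T] (π : ℤ → T →ₗ[P] T) : Prop extends
    IsGrading π where
  x_smul : ∀ l d t, x l • π d t = π (d + e l) (x l • t)
  u_smul : ∀ i d t, u i • π d t = π (d - γ i) (u i • t)

variable {r s : ℕ} {x : Fin r → S} {e : Fin r → ℕ} {u : Fin s → S} {γ : Fin s → ℕ}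
  {T : Type v} [AddCommGroup T] [Module S T] [Module P T] [IsScalarTower P S T]
  {π : ℤ → T →ₗ[P] T}

omit [Algebra P S] [IsScalarTower P S T] in
theorem IsGradedModule.raisesDegree (h : IsGradedModule x e u γ π) :
    RaisesDegree x e (fun d => LinearMap.range (π d)) := by
  rintro l d _ ⟨t, rfl⟩
  exact ⟨x l • t, (h.x_smul l d t).symm⟩

/-- The projections of a homogeneous submodule. -/
def subGrading {Γ : Type*} (π : Γ → T →ₗ[P] T) (B : Submodule S T) (hB : ∀ d, ∀ t ∈ B, π d t ∈ B) (d : Γ) :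
    B →ₗ[P] B where
  toFun b := ⟨π d b, hB d b b.2⟩
  map_add' _ _ := Subtype.ext (map_add _ _ _)
  map_smul' a b := Subtype.ext (map_smul (π d) a b.1)

/-- The projections of the quotient by a homogeneous submodule. -/
def quotGrading {Γ : Type*} (π : Γ → T →ₗ[P] T) (B : Submodule S T) (hB : ∀ d, ∀ t ∈ B, π d t ∈ B) (d : Γ) :
    (T ⧸ B) →ₗ[P] (T ⧸ B) :=
  (Submodule.Quotient.restrictScalarsEquiv P B).toLinearMap ∘ₗ
    (B.restrictScalars P).mapQ (B.restrictScalars P) (π d) (hB d) ∘ₗ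
    (Submodule.Quotient.restrictScalarsEquiv P B).symm.toLinearMap

theorem quotGrading_mk {Γ : Type*} {π : Γ → T →ₗ[P] T} (B : Submodule S T) (hB : ∀ d, ∀ t ∈ B, π d t ∈ B) (d : Γ) (t : T) :
    quotGrading π B hB d (B.mkQ t) = B.mkQ (π d t) := rfl

theorem IsGrading.sub {Γ : Type*} {π : Γ → T →ₗ[P] T} (h : IsGrading π) (B : Submodule S T)
    (hB : ∀ d, ∀ t ∈ B, π d t ∈ B) : IsGrading (subGrading π B hB) where
  apply_self d t := Subtype.ext (h.apply_self d t)
  apply_ne d d' t hd := Subtype.ext (h.apply_ne d d' t hd)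
  exists_sum t := by
    obtain ⟨s, hs⟩ := h.exists_sum t
    exact ⟨s, Subtype.ext (by rw [AddSubmonoidClass.coe_finsetSum]; exact hs)⟩

theorem IsGrading.quot {Γ : Type*} {π : Γ → T →ₗ[P] T} (h : IsGrading π) (B : Submodule S T)
    (hB : ∀ d, ∀ t ∈ B, π d t ∈ B) : IsGrading (quotGrading π B hB) where
  apply_self d t := by
    obtain ⟨t, rfl⟩ := B.mkQ_surjective t
    rw [quotGrading_mk, quotGrading_mk, h.apply_self]
  apply_ne d d' t hd := by
    obtain ⟨t, rfl⟩ := B.mkQ_surjective t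
    rw [quotGrading_mk, quotGrading_mk, h.apply_ne d d' t hd, map_zero]
  exists_sum t := by
    obtain ⟨t, rfl⟩ := B.mkQ_surjective t
    obtain ⟨s, hs⟩ := h.exists_sum t
    refine ⟨s, ?_⟩
    nth_rw 2 [← hs]
    rw [map_sum]
    rfl

theorem IsGradedModule.sub (h : IsGradedModule x e u γ π) (B : Submodule S T)
    (hB : ∀ d, ∀ t ∈ B, π d t ∈ B) : IsGradedModule x e u γ (subGrading π B hB) where
  toIsGrading := h.toIsGrading.sub B hB
  x_smul l d t := Subtype.ext (h.x_smul l d t)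
  u_smul i d t := Subtype.ext (h.u_smul i d t)

theorem IsGradedModule.quot (h : IsGradedModule x e u γ π) (B : Submodule S T)
    (hB : ∀ d, ∀ t ∈ B, π d t ∈ B) : IsGradedModule x e u γ (quotGrading π B hB) where
  toIsGrading := h.toIsGrading.quot B hB
  x_smul l d t := by
    obtain ⟨t, rfl⟩ := B.mkQ_surjective t
    rw [quotGrading_mk, ← B.mkQ.map_smul, ← B.mkQ.map_smul, quotGrading_mk, h.x_smul]
  u_smul l d t := by
    obtain ⟨t, rfl⟩ := B.mkQ_surjective t
    rw [quotGrading_mk, ← B.mkQ.map_smul, ← B.mkQ.map_smul, quotGrading_mk, h.u_smul]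

/-- The Čech cohomology is finite in every degree, and vanishes in all large degrees. -/
def HasFiniteCohomology {T : Type*} [AddCommGroup T] [Module S T] [Module P T]
    [IsScalarTower P S T] {𝒯 : ℤ → Submodule P T} (hx : RaisesDegree x e 𝒯) : Prop :=
  (∀ d, Module.Finite P (DiffHomology (cechDPiece x e hx d))) ∧
    ∃ D : ℤ, ∀ d ≥ D, ∀ c, cechDPiece x e hx d c = 0 → ∃ b, cechDPiece x e hx d b = c

/-- `S` is generated by the finite set `V` as a module over the subalgebra generated by the `u i`,
up to the ideal generated by the `x l`. -/
def GeneratedModulo (P : Type*) [CommRing P] [Algebra P S] {r s : ℕ} (x : Fin r → S)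
    (u : Fin s → S) (V : Finset S) : Prop :=
  Submodule.span P {a | ∃ v ∈ V, ∃ w ∈ Submonoid.closure (Set.range u), a = w * v} ⊔
    (Ideal.span (Set.range x)).restrictScalars P = ⊤

/-- The x l act as zero, so S acts through its quotient by them, which is spanned over P by words in
the u i times elements of V. -/
theorem GeneratedModulo.span_eq_top {V : Finset S} (hV : GeneratedModulo P x u V)
    (hx : ∀ l (t : T), x l • t = 0) {G : Set T} (hG : Submodule.span S G = ⊤) :
    Submodule.span P {a | ∃ g ∈ G, ∃ v ∈ V, ∃ w ∈ Submonoid.closure (Set.range u),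
      a = w • v • g} = ⊤ := by
  set Q := Submodule.span P {a | ∃ g ∈ G, ∃ v ∈ V, ∃ w ∈ Submonoid.closure (Set.range u),
      a = w • v • g}
  have hkill : ∀ a ∈ Ideal.span (Set.range x), ∀ t : T, a • t = 0 := by
    intro a ha t
    induction ha using Submodule.span_induction with
    | mem a ha => obtain ⟨l, rfl⟩ := ha; exact hx l t
    | zero => exact zero_smul S t
    | add a b _ _ ha hb => rw [add_smul, ha, hb, add_zero]
    | smul c a _ ha => rw [smul_eq_mul, mul_smul, ha, smul_zero]
  have h1 : ∀ g ∈ G, ∀ a : S, a • g ∈ Q := by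
    intro g hg a
    have ha : a ∈ (⊤ : Submodule P S) := trivial
    rw [← hV] at ha
    obtain ⟨b, hb, c, hc, rfl⟩ := Submodule.mem_sup.mp ha
    rw [add_smul, hkill c hc, add_zero]
    clear ha
    induction hb using Submodule.span_induction with
    | mem b hb =>
      obtain ⟨v, hv, w, hw, rfl⟩ := hb
      exact Submodule.subset_span ⟨g, hg, v, hv, w, hw, mul_smul _ _ _⟩
    | zero => rw [zero_smul]; exact zero_mem _
    | add a b _ _ ha hb => rw [add_smul]; exact add_mem ha hb
    | smul c a _ ha => rw [smul_assoc]; exact Q.smul_mem c ha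
  rw [eq_top_iff]
  intro t _
  have ht : t ∈ Submodule.span S G := hG ▸ trivial
  have h2 : ∀ a : S, a • t ∈ Q := by
    induction ht using Submodule.span_induction with
    | mem g hg => exact h1 g hg
    | zero => intro a; rw [smul_zero]; exact zero_mem _
    | add t t' _ _ h h' => intro a; rw [smul_add]; exact add_mem (h trivial a) (h' trivial a)
    | smul c t _ h => intro a; rw [smul_smul]; exact h trivial _
  simpa using h2 1

/-- Words in the u i only lower the degree, so nothing lives above the degrees of the finitely many
elements v • g. The piece of degree d is contained in the span of the projections of these elements
and of u i times the pieces of degree d + γ i; descending induction on d gives finiteness. -/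
theorem IsGradedModule.finite_range [IsNoetherianRing P] (h : IsGradedModule x e u γ π)
    (hγ : ∀ i, 0 < γ i) {V : Finset S} (hV : GeneratedModulo P x u V)
    (hx : ∀ l (t : T), x l • t = 0) [Module.Finite S T] :
    (∀ d, Module.Finite P (LinearMap.range (π d))) ∧ ∃ D : ℤ, ∀ d ≥ D, ∀ t, π d t = 0 := by
  classical
  obtain ⟨G, hG⟩ := Module.Finite.fg_top (R := S) (M := T)
  have hspan := hV.span_eq_top hx hG
  let W : Finset T := Finset.image₂ (fun v g => v • g) V G
  obtain ⟨D, hD⟩ := h.exists_bound W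
  have hzero : ∀ d ≥ D, ∀ t, π d t = 0 := by
    intro d hd t
    have ht : t ∈ (⊤ : Submodule P T) := trivial
    rw [← hspan] at ht
    induction ht using Submodule.span_induction with
    | mem t ht =>
      obtain ⟨g, hg, v, hv, w, hw, rfl⟩ := ht
      induction hw using Submonoid.closure_induction_left generalizing d with
      | one => rw [one_smul]; exact hD d hd _ (Finset.mem_image₂_of_mem hv hg)
      | mul_left a ha w hw ih =>
        obtain ⟨i, rfl⟩ := ha
        have := h.u_smul i (d + γ i) (w • v • g)
        rw [ih (d + γ i) (by lia), smul_zero, add_sub_cancel_right] at this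
        rw [mul_smul, ← this]
    | zero => exact map_zero _
    | add a b _ _ ha hb => rw [map_add, ha, hb, add_zero]
    | smul c a _ ha => rw [map_smul, ha, smul_zero]
  refine ⟨fun d => ?_, D, hzero⟩
  have key : ∀ n : ℕ, ∀ d : ℤ, D - n ≤ d → (LinearMap.range (π d)).FG := by
    intro n
    induction n with
    | zero =>
      intro d hd
      rw [show LinearMap.range (π d) = ⊥ from LinearMap.range_eq_bot.mpr
        (LinearMap.ext (hzero d (by simpa using hd)))]
      exact Submodule.fg_bot
    | succ n ih =>
      intro d hd
      let uMap : Fin s → T →ₗ[P] T := fun i => (LinearMap.lsmul S T (u i)).restrictScalars P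
      have hle : LinearMap.range (π d) ≤ Submodule.span P ((W.image (π d) : Finset T) : Set T) ⊔
          ⨆ i, (LinearMap.range (π (d + γ i))).map (uMap i) := by
        rw [LinearMap.range_eq_map, ← hspan, Submodule.map_span, Submodule.span_le]
        rintro _ ⟨_, ⟨g, hg, v, hv, w, hw, rfl⟩, rfl⟩
        induction hw using Submonoid.closure_induction_left with
        | one =>
          refine Submodule.mem_sup_left (Submodule.subset_span ?_)
          rw [one_smul]
          exact Finset.mem_coe.mpr (Finset.mem_image_of_mem _ (Finset.mem_image₂_of_mem hv hg))
        | mul_left a ha w hw ih =>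
          obtain ⟨i, rfl⟩ := ha
          refine Submodule.mem_sup_right (Submodule.mem_iSup_of_mem i ⟨π (d + γ i) (w • v • g),
            ⟨_, rfl⟩, ?_⟩)
          have := h.u_smul i (d + γ i) (w • v • g)
          rw [add_sub_cancel_right] at this
          rw [mul_smul, ← this]
          rfl
      have hfg : (Submodule.span P ((W.image (π d) : Finset T) : Set T) ⊔
          ⨆ i, (LinearMap.range (π (d + γ i))).map (uMap i)).FG := by
        refine Submodule.FG.sup ⟨_, rfl⟩ (Submodule.fg_iSup _ fun i => Submodule.FG.map _ (ih _ ?_))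
        have := hγ i
        push_cast at hd
        lia
      have : IsNoetherian P (Submodule.span P ((W.image (π d) : Finset T) : Set T) ⊔
          ⨆ i, (LinearMap.range (π (d + γ i))).map (uMap i) : Submodule P T) :=
        isNoetherian_of_fg_of_noetherian _ hfg
      exact (isNoetherian_submodule.mp this) _ hle
  refine Module.Finite.iff_fg.mpr (key (D - d).toNat d ?_)
  have := Int.self_le_toNat (D - d)
  lia

end GradedModule

end

end GradedLocalCohomology

namespace GradedLocalCohomology

noncomputable section

/-! ### Exact sequences of Čech complexes and finiteness of Čech cohomology. -/

section Exact

variable {P : Type*} [CommRing P] {S : Type*} [CommRing S] [Algebra P S] {r : ℕ} {x : Fin r → S}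
  {e : Fin r → ℕ} {N' N N'' : Type*} [AddCommGroup N'] [AddCommGroup N] [AddCommGroup N'']
  [Module S N'] [Module S N] [Module S N''] [Module P N'] [Module P N] [Module P N'']
  [IsScalarTower P S N'] [IsScalarTower P S N] [IsScalarTower P S N'']

theorem isCechMap_linear (f : N' →ₗ[S] N) :
    IsCechMap x x (RingHom.id S) (RelEmbedding.refl _) id (f.restrictScalars P) where
  map_eq I := by ext; simp
  map_x _ := rfl
  map_smul i n := map_smul f (x i) n

variable (P) in
/-- The map of localizations induced by a linear map. -/
def cechLinearAt (f : N' →ₗ[S] N) (I : Finset (Fin r)) :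
    CechLocalization x N' I →ₗ[P] CechLocalization x N I :=
  cechMapAt (isCechMap_linear f) I

theorem cechLinearAt_cechFrac (f : N' →ₗ[S] N) (I : Finset (Fin r)) (k : ℕ) (n : N') :
    cechLinearAt P f I (cechFrac x N' I k n) = cechFrac x N I k (f n) :=
  cechMapAt_cechFrac (isCechMap_linear f) I k n

variable (P x) in
/-- The map of total Čech cochains induced by a linear map. -/
def cechLinear (f : N' →ₗ[S] N) : CechTotal x N' →ₗ[P] CechTotal x N :=
  cechMap (isCechMap_linear f)

theorem cechLinear_apply (f : N' →ₗ[S] N) (c : CechTotal x N') (I : Finset (Fin r)) :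
    cechLinear P x f c I = cechLinearAt P f I (c I) := rfl

theorem cechLinear_cechDTotal (f : N' →ₗ[S] N) (c : CechTotal x N') :
    cechLinear P x f (cechDTotal x N' c) = cechDTotal x N (cechLinear P x f c) :=
  cechMap_cechDTotal (isCechMap_linear f) c

/-- A short exact sequence of graded modules, whose first map shifts degrees by `q`. -/
structure IsGradedExact (𝒩' : ℤ → Submodule P N') (𝒩 : ℤ → Submodule P N)
    (𝒩'' : ℤ → Submodule P N'') (f : N' →ₗ[S] N) (g : N →ₗ[S] N'') (q : ℤ) : Prop where
  map_left : ∀ d, ∀ n ∈ 𝒩' d, f n ∈ 𝒩 (d + q)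
  map_right : ∀ d, ∀ n ∈ 𝒩 d, g n ∈ 𝒩'' d
  injective : Function.Injective f
  comp_eq : ∀ n, g (f n) = 0
  exact : ∀ d, ∀ n ∈ 𝒩 (d + q), g n = 0 → ∃ n' ∈ 𝒩' d, f n' = n
  surjective : ∀ d, ∀ n ∈ 𝒩'' d, ∃ n' ∈ 𝒩 d, g n' = n

variable {𝒩' : ℤ → Submodule P N'} {𝒩 : ℤ → Submodule P N} {𝒩'' : ℤ → Submodule P N''}
  {f : N' →ₗ[S] N} {g : N →ₗ[S] N''} {q : ℤ}

theorem cechLinear_injective (hf : Function.Injective f) :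
    Function.Injective (cechLinear P x f) := by
  rw [injective_iff_map_eq_zero]
  intro c hc
  funext I
  have hI := congrFun hc I
  obtain ⟨k, n, hn⟩ := exists_eq_cechFrac x (c I)
  rw [cechLinear_apply, hn, cechLinearAt_cechFrac, Pi.zero_apply, cechFrac_eq_zero] at hI
  obtain ⟨m, hm⟩ := hI
  rw [hn, Pi.zero_apply, cechFrac_eq_zero]
  exact ⟨m, hf (by rw [map_smul, map_zero, hm])⟩

theorem cechLinear_comp_eq_zero (hgf : ∀ n, g (f n) = 0) (c : CechTotal x N') :
    cechLinear P x g (cechLinear P x f c) = 0 := by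
  funext I
  obtain ⟨k, n, hn⟩ := exists_eq_cechFrac x (c I)
  rw [cechLinear_apply, cechLinear_apply, hn, cechLinearAt_cechFrac, cechLinearAt_cechFrac, hgf,
    map_zero, Pi.zero_apply]

namespace IsGradedExact

variable (h : IsGradedExact 𝒩' 𝒩 𝒩'' f g q) {hx' : RaisesDegree x e 𝒩'}
  {hx : RaisesDegree x e 𝒩} {hx'' : RaisesDegree x e 𝒩''}
include h

omit [IsScalarTower P S N''] in
theorem cechLinear_left_mem {d : ℤ} {c : CechTotal x N'} (hc : c ∈ cechTotalPiece x e hx' d) :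
    cechLinear P x f c ∈ cechTotalPiece x e hx (d + q) := by
  rw [mem_cechTotalPiece] at hc ⊢
  intro I
  obtain ⟨k, n, hn, hz⟩ := hc I
  refine ⟨k, f n, ?_, ?_⟩
  · convert h.map_left _ n hn using 2
    ring
  · rw [cechLinear_apply, hz, cechLinearAt_cechFrac]

omit [IsScalarTower P S N'] in
theorem cechLinear_right_mem {d : ℤ} {c : CechTotal x N} (hc : c ∈ cechTotalPiece x e hx d) :
    cechLinear P x g c ∈ cechTotalPiece x e hx'' d := by
  rw [mem_cechTotalPiece] at hc ⊢
  intro I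
  obtain ⟨k, n, hn, hz⟩ := hc I
  exact ⟨k, g n, h.map_right _ n hn, by rw [cechLinear_apply, hz, cechLinearAt_cechFrac]⟩

theorem cechLinear_exact {d : ℤ} {c : CechTotal x N} (hc : c ∈ cechTotalPiece x e hx (d + q))
    (hgc : cechLinear P x g c = 0) :
    ∃ b ∈ cechTotalPiece x e hx' d, cechLinear P x f b = c := by
  rw [mem_cechTotalPiece] at hc
  have key : ∀ I, ∃ z ∈ cechFracPiece x e hx' d I, cechLinearAt P f I z = c I := by
    intro I
    obtain ⟨k, n, hn, hz⟩ := hc I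
    have hI := congrFun hgc I
    rw [cechLinear_apply, hz, cechLinearAt_cechFrac, Pi.zero_apply, cechFrac_eq_zero] at hI
    obtain ⟨m, hm⟩ := hI
    have h1 := hx.prod_pow_smul_mem I m hn
    obtain ⟨n', hn', hn''⟩ := h.exact (d + ((k + m) * ∑ i ∈ I, e i : ℕ)) ((∏ i ∈ I, x i) ^ m • n)
      (by convert h1 using 2; push_cast; ring) (by rw [map_smul]; exact hm)
    refine ⟨cechFrac x N' I (k + m) n', ⟨_, _, hn', rfl⟩, ?_⟩
    rw [cechLinearAt_cechFrac, hn'', cechFrac_shift, hz]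
  choose b hb hb' using key
  exact ⟨b, mem_cechTotalPiece.mpr hb, funext hb'⟩

omit [IsScalarTower P S N'] in
theorem cechLinear_surjective {d : ℤ} {c : CechTotal x N''} (hc : c ∈ cechTotalPiece x e hx'' d) :
    ∃ b ∈ cechTotalPiece x e hx d, cechLinear P x g b = c := by
  rw [mem_cechTotalPiece] at hc
  have key : ∀ I, ∃ z ∈ cechFracPiece x e hx d I, cechLinearAt P g I z = c I := by
    intro I
    obtain ⟨k, n, hn, hz⟩ := hc I
    obtain ⟨n', hn', rfl⟩ := h.surjective _ n hn
    exact ⟨cechFrac x N I k n', ⟨_, _, hn', rfl⟩, by rw [cechLinearAt_cechFrac, hz]⟩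
  choose b hb hb' using key
  exact ⟨b, mem_cechTotalPiece.mpr hb, funext hb'⟩

/-- The first map on cochains of a fixed degree. -/
def cechLeft (hx' : RaisesDegree x e 𝒩') (hx : RaisesDegree x e 𝒩) {d d' : ℤ} (hd : d + q = d') :
    cechTotalPiece x e hx' d →ₗ[P] cechTotalPiece x e hx d' :=
  (cechLinear P x f).restrict fun _ hc => hd ▸ h.cechLinear_left_mem hc

/-- The second map on cochains of a fixed degree. -/
def cechRight (hx : RaisesDegree x e 𝒩) (hx'' : RaisesDegree x e 𝒩'') (d : ℤ) :
    cechTotalPiece x e hx d →ₗ[P] cechTotalPiece x e hx'' d :=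
  (cechLinear P x g).restrict fun _ hc => h.cechLinear_right_mem hc

omit [IsScalarTower P S N''] in
theorem cechLeft_injective {d d' : ℤ} (hd : d + q = d') :
    Function.Injective (h.cechLeft hx' hx hd) := fun _ _ hab =>
  Subtype.ext (cechLinear_injective (P := P) h.injective (congrArg Subtype.val hab))

omit [IsScalarTower P S N''] in
theorem cechLeft_comm {d d' : ℤ} (hd : d + q = d') (c : cechTotalPiece x e hx' d) :
    h.cechLeft hx' hx hd (cechDPiece x e hx' d c) =
      cechDPiece x e hx d' (h.cechLeft hx' hx hd c) :=
  Subtype.ext (cechLinear_cechDTotal _ c.1)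

omit [IsScalarTower P S N'] in
theorem cechRight_comm {d : ℤ} (c : cechTotalPiece x e hx d) :
    h.cechRight hx hx'' d (cechDPiece x e hx d c) =
      cechDPiece x e hx'' d (h.cechRight hx hx'' d c) :=
  Subtype.ext (cechLinear_cechDTotal _ c.1)

theorem cechRight_cechLeft {d d' : ℤ} (hd : d + q = d') (c : cechTotalPiece x e hx' d) :
    h.cechRight hx hx'' d' (h.cechLeft hx' hx hd c) = 0 :=
  Subtype.ext (cechLinear_comp_eq_zero h.comp_eq c.1)

theorem cech_exact {d d' : ℤ} (hd : d + q = d') (c : cechTotalPiece x e hx d')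
    (hc : h.cechRight hx hx'' d' c = 0) : ∃ b, h.cechLeft hx' hx hd b = c := by
  subst hd
  obtain ⟨b, hb, hbc⟩ := h.cechLinear_exact (hx' := hx') c.2 (congrArg Subtype.val hc)
  exact ⟨⟨b, hb⟩, Subtype.ext hbc⟩

omit [IsScalarTower P S N'] in
theorem cechRight_surjective (d : ℤ) : Function.Surjective (h.cechRight hx hx'' d) := by
  intro c
  obtain ⟨b, hb, hbc⟩ := h.cechLinear_surjective (hx := hx) c.2
  exact ⟨⟨b, hb⟩, Subtype.ext hbc⟩

/-- Finiteness and vanishing both come from the exact triangle in degree d, in which N' enters in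
degree d - q because f raises degrees by q. -/
theorem hasFiniteCohomology_middle [IsNoetherianRing P] (h' : HasFiniteCohomology hx')
    (h'' : HasFiniteCohomology hx'') : HasFiniteCohomology hx := by
  refine ⟨fun d => ?_, ?_⟩
  · have hd : d - q + q = d := by ring
    have := h'.1 (d - q)
    have := h''.1 d
    exact finite_diffHomology_middle (h.cechLeft hx' hx hd) (h.cechRight hx hx'' d)
      (h.cechLeft_comm hd) h.cechRight_comm cechDPiece_cechDPiece (h.cechLeft_injective hd)
      (h.cech_exact hd) (h.cechRight_surjective d)
  · obtain ⟨D', hD'⟩ := h'.2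
    obtain ⟨D'', hD''⟩ := h''.2
    refine ⟨max (D' + q) D'', fun d hd c hc => ?_⟩
    have hd' : d - q + q = d := by ring
    obtain ⟨b'', hb''⟩ := hD'' d (le_of_max_le_right hd) (h.cechRight hx hx'' d c)
      (by rw [← h.cechRight_comm, hc, map_zero])
    obtain ⟨b, rfl⟩ := h.cechRight_surjective (hx := hx) d b''
    obtain ⟨a, ha⟩ := h.cech_exact (hx' := hx') (hx'' := hx'') hd' (c - cechDPiece x e hx d b)
      (by rw [map_sub, h.cechRight_comm (hx'' := hx''), hb'', sub_self])
    obtain ⟨a', ha'⟩ := hD' (d - q) (by have := le_of_max_le_left hd; lia) a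
      (h.cechLeft_injective (hx := hx) hd' (by
        rw [h.cechLeft_comm, ha, map_sub, hc, cechDPiece_cechDPiece, sub_zero, map_zero]))
    refine ⟨b + h.cechLeft hx' hx hd' a', ?_⟩
    rw [map_add, ← h.cechLeft_comm, ha', ha]
    abel

end IsGradedExact

theorem cechLinear_lsmul (s : S) (c : CechTotal x N) :
    cechLinear P x (LinearMap.lsmul S N s) c = s • c := by
  funext I
  obtain ⟨k, n, hn⟩ := exists_eq_cechFrac x (c I)
  rw [cechLinear_apply, hn, cechLinearAt_cechFrac, Pi.smul_apply, hn, LinearMap.lsmul_apply,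
    map_smul]

/-- The sequence 0 → N → N → N'' → 0 given by x l yields H_{d+e}(N'') → H_d(N) → H_{d+e}(N) with e =
e l. Where H(N'') vanishes, x l is injective on H(N); as a power of x l kills each class, H(N)
vanishes there too. Since e > 0, finiteness in the remaining degrees follows by descending
induction. -/
theorem IsGradedExact.hasFiniteCohomology_of_regular [IsNoetherianRing P] {l : Fin r}
    (hl : 0 < e l) {g : N →ₗ[S] N''}
    (h : IsGradedExact 𝒩 𝒩 𝒩'' (LinearMap.lsmul S N (x l)) g (e l)) {hx : RaisesDegree x e 𝒩}
    {hx'' : RaisesDegree x e 𝒩''} (h'' : HasFiniteCohomology hx'') : HasFiniteCohomology hx := by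
  obtain ⟨D, hD⟩ := h''.2
  have hinj : ∀ c : CechTotal x N, x l • c = 0 → c = 0 := fun c hc =>
    cechLinear_injective (P := P) h.injective
      ((cechLinear_lsmul _ _).trans (hc.trans (map_zero _).symm))
  have hvan : ∀ d ≥ D, ∀ c, cechDPiece x e hx d c = 0 → ∃ b, cechDPiece x e hx d b = c := by
    intro d hd c hc
    -- Here x l ^ k • c is the boundary of b. For k > 0 the image of b is a cocycle over N'', hence
    -- a boundary, so b can be corrected to a multiple of x l and the exponent drops by one.
    obtain ⟨k, b, hb, hbc, -⟩ := exists_pow_smul_eq_cechDTotal l c.2 (congrArg Subtype.val hc)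
    induction k generalizing b with
    | zero =>
      rw [Nat.cast_zero, zero_mul, add_zero] at hb
      exact ⟨⟨b, hb⟩, Subtype.ext (hbc.trans (by rw [pow_zero, one_smul]))⟩
    | succ k ih =>
      have hd' : d + k * e l + e l = d + (k + 1 : ℕ) * e l := by push_cast; ring
      have hpos : (0 : ℤ) ≤ (k + 1 : ℕ) * e l := by positivity
      have hcyc : cechDPiece x e hx'' _ (h.cechRight hx hx'' _ ⟨b, hb⟩) = 0 := by
        rw [← h.cechRight_comm]
        refine Subtype.ext ?_
        change cechLinear P x g (cechDTotal x N b) = 0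
        rw [hbc, pow_succ', mul_smul, ← cechLinear_lsmul (P := P)]
        exact cechLinear_comp_eq_zero h.comp_eq _
      obtain ⟨b'', hb''⟩ := hD _ (by lia) _ hcyc
      obtain ⟨b1, rfl⟩ := h.cechRight_surjective (hx := hx) _ b''
      obtain ⟨b2, hb2⟩ := h.cech_exact (hx' := hx) (hx'' := hx'') hd' (⟨b, hb⟩ - cechDPiece x e hx _ b1)
        (by rw [map_sub, h.cechRight_comm (hx'' := hx''), hb'', sub_self])
      refine ih b2.1 b2.2 ?_
      have h3 : x l • b2.1 = b - cechDTotal x N b1.1 :=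
        (cechLinear_lsmul (P := P) _ _).symm.trans (congrArg Subtype.val hb2)
      rw [← sub_eq_zero]
      refine hinj _ ?_
      rw [smul_sub, ← map_smul, h3, map_sub, cechDTotal_cechDTotal, hbc, sub_zero, pow_succ',
        mul_smul, sub_self]
  refine ⟨fun d => ?_, D, hvan⟩
  have key : ∀ n : ℕ, ∀ d : ℤ, D - n ≤ d → Module.Finite P (DiffHomology (cechDPiece x e hx d)) := by
    intro n
    induction n with
    | zero =>
      intro d hd
      have : Subsingleton (DiffHomology (cechDPiece x e hx d)) := by
        refine subsingleton_of_forall_eq 0 fun z => ?_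
        obtain ⟨c, rfl⟩ := DiffHomology.mk_surjective _ z
        exact DiffHomology.mk_eq_zero.mpr (hvan d (by simpa using hd) c.1 c.2)
      infer_instance
    | succ n ih =>
      intro d hd
      have := ih (d + e l) (by push_cast at hd; lia)
      have := h''.1 (d + e l)
      exact finite_diffHomology_left (h.cechLeft hx hx rfl) (h.cechRight hx hx'' _)
        (h.cechLeft_comm rfl) h.cechRight_comm cechDPiece_cechDPiece (h.cechLeft_injective rfl)
        (h.cechRight_cechLeft rfl) (h.cech_exact rfl) (h.cechRight_surjective _)
  refine key (D - d).toNat d ?_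
  have := Int.self_le_toNat (D - d)
  lia

end Exact

section Finiteness

universe v

variable {P : Type*} [CommRing P] {S : Type*} [CommRing S] [Algebra P S]
  {r s : ℕ} {x : Fin r → S} {e : Fin r → ℕ} {u : Fin s → S} {γ : Fin s → ℕ}

theorem IsGradedModule.isGradedExact_quot {T : Type*} [AddCommGroup T] [Module S T] [Module P T]
    [IsScalarTower P S T] {π : ℤ → T →ₗ[P] T} (h : IsGradedModule x e u γ π) (B : Submodule S T)
    (hB : ∀ d, ∀ t ∈ B, π d t ∈ B) :
    IsGradedExact (fun d => LinearMap.range (subGrading π B hB d)) (fun d => LinearMap.range (π d))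
      (fun d => LinearMap.range (quotGrading π B hB d)) B.subtype B.mkQ 0 where
  map_left := by
    rintro d _ ⟨t, rfl⟩
    rw [add_zero]
    exact ⟨t, rfl⟩
  map_right := by
    rintro d _ ⟨t, rfl⟩
    exact ⟨B.mkQ t, rfl⟩
  injective := B.subtype_injective
  comp_eq n := by simp
  exact d n hn hgn := by
    rw [add_zero, h.mem_range] at hn
    have hnB : n ∈ B := by simpa using hgn
    exact ⟨⟨n, hnB⟩, ⟨⟨n, hnB⟩, Subtype.ext hn⟩, rfl⟩
  surjective := by
    rintro d _ ⟨t, rfl⟩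
    obtain ⟨t, rfl⟩ := B.mkQ_surjective t
    exact ⟨π d t, ⟨t, rfl⟩, rfl⟩

/-- Inverting an element that acts as zero kills the module, so only the component at I = ∅ survives
and the complex is T itself, with zero differential. -/
theorem IsGradedModule.hasFiniteCohomology_of_smul_eq_zero [IsNoetherianRing P] {T : Type*}
    [AddCommGroup T] [Module S T] [Module P T]
    [IsScalarTower P S T] {π : ℤ → T →ₗ[P] T} (h : IsGradedModule x e u γ π)
    (hγ : ∀ i, 0 < γ i) {V : Finset S} (hV : GeneratedModulo P x u V)
    (hx : ∀ l (t : T), x l • t = 0) [Module.Finite S T] :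
    HasFiniteCohomology h.raisesDegree := by
  obtain ⟨hfin, D, hD⟩ := h.finite_range hγ hV hx
  let F (d : ℤ) : LinearMap.range (π d) →ₗ[P] cechTotalPiece x e h.raisesDegree d :=
    LinearMap.codRestrict _ (LinearMap.pi fun I =>
      (cechFrac x T I 0).restrictScalars P ∘ₗ (LinearMap.range (π d)).subtype) fun n =>
      mem_cechTotalPiece.mpr fun I => ⟨0, n, by simp, rfl⟩
  have hF : ∀ d, Function.Surjective (F d) := by
    intro d c
    have hc := mem_cechTotalPiece.mp c.2
    obtain ⟨k, n, hn, hz⟩ := hc ∅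
    rw [Finset.sum_empty, mul_zero, Nat.cast_zero, add_zero] at hn
    refine ⟨⟨n, hn⟩, Subtype.ext (funext fun I => ?_)⟩
    change cechFrac x T I 0 n = c.1 I
    rcases I.eq_empty_or_nonempty with rfl | ⟨i, hi⟩
    · rw [hz, ← cechFrac_shift x ∅ 0 k n]
      simp
    · have h0 : ∀ z : CechLocalization x T I, z = 0 := by
        intro z
        obtain ⟨k, n, rfl⟩ := exists_eq_cechFrac x z
        refine (cechFrac_eq_zero x).mpr ⟨1, ?_⟩
        rw [pow_one, ← Finset.mul_prod_erase _ _ hi, mul_smul, hx]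
      rw [h0 (c.1 I), h0 (cechFrac x T I 0 n)]
  refine ⟨fun d => ?_, D, fun d hd c hc => ⟨0, ?_⟩⟩
  · have := hfin d
    have : Module.Finite P (cechTotalPiece x e h.raisesDegree d) :=
      Module.Finite.of_surjective (F d) (hF d)
    infer_instance
  · obtain ⟨⟨_, t, rfl⟩, rfl⟩ := hF d c
    rw [map_zero, eq_comm]
    exact (congrArg (F d) (Subtype.ext (hD d hd t))).trans (map_zero _)

/-- The Čech cohomology of a finite graded module is finite in every degree over a ring over
which the elements of negative degree and the ideal generated by the `x l` generate `S`. -/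
theorem IsGradedModule.hasFiniteCohomology [IsNoetherianRing P] [IsNoetherianRing S]
    (he : ∀ l, 0 < e l) (hγ : ∀ i, 0 < γ i) {V : Finset S} (hV : GeneratedModulo P x u V)
    {T : Type v} [AddCommGroup T] [Module S T] [Module P T]
    [IsScalarTower P S T] {π : ℤ → T →ₗ[P] T} (h : IsGradedModule x e u γ π)
    [Module.Finite S T] : HasFiniteCohomology h.raisesDegree := by
  -- Induction on a set Λ of indices outside of which the x l act as zero. To add l, T is split into
  -- its x l-power torsion B and T / B. On B induction on the nilpotency exponent applies through
  -- the submodule x l B; on T / B the element x l is regular and its cokernel falls under the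
  -- induction hypothesis.
  suffices key : ∀ Λ : Finset (Fin r), ∀ (T : Type v) [AddCommGroup T] [Module S T] [Module P T]
      [IsScalarTower P S T] (π : ℤ → T →ₗ[P] T) (h : IsGradedModule x e u γ π) [Module.Finite S T],
      (∀ l ∉ Λ, ∀ t : T, x l • t = 0) → HasFiniteCohomology h.raisesDegree from
    key Finset.univ T π h fun l hl => absurd (Finset.mem_univ l) hl
  intro Λ
  induction Λ using Finset.induction_on with
  | empty =>
    intro T _ _ _ _ π h _ hx
    exact h.hasFiniteCohomology_of_smul_eq_zero hγ hV fun l t => hx l (Finset.notMem_empty l) t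
  | insert l Λ hl ih =>
    have hker : ∀ (T : Type v) [AddCommGroup T] [Module S T] [Module P T]
        [IsScalarTower P S T] (π : ℤ → T →ₗ[P] T) (_ : IsGradedModule x e u γ π) (k : ℕ),
        ∀ d, ∀ t ∈ LinearMap.ker (LinearMap.lsmul S T (x l ^ k)),
          π d t ∈ LinearMap.ker (LinearMap.lsmul S T (x l ^ k)) := by
      intro T _ _ _ _ π h k d t ht
      rw [LinearMap.mem_ker, LinearMap.lsmul_apply] at ht ⊢
      have : ∀ (k : ℕ) (d : ℤ) (t : T), x l ^ k • π d t = π (d + k * e l) (x l ^ k • t) := by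
        intro k
        induction k with
        | zero => simp
        | succ k ih =>
          intro d t
          rw [pow_succ, mul_smul, mul_smul, h.x_smul, ih]
          congr 2
          push_cast
          ring
      rw [this, ht, map_zero]
    have hran : ∀ (T : Type v) [AddCommGroup T] [Module S T] [Module P T]
        [IsScalarTower P S T] (π : ℤ → T →ₗ[P] T) (_ : IsGradedModule x e u γ π),
        ∀ d, ∀ t ∈ LinearMap.range (LinearMap.lsmul S T (x l)),
          π d t ∈ LinearMap.range (LinearMap.lsmul S T (x l)) := by
      rintro T _ _ _ _ π h d _ ⟨t, rfl⟩
      refine ⟨π (d - e l) t, ?_⟩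
      rw [LinearMap.lsmul_apply, LinearMap.lsmul_apply, h.x_smul, sub_add_cancel]
    have hnil : ∀ (k : ℕ) (T : Type v) [AddCommGroup T] [Module S T] [Module P T]
        [IsScalarTower P S T] (π : ℤ → T →ₗ[P] T) (h : IsGradedModule x e u γ π)
        [Module.Finite S T], (∀ l' ∉ insert l Λ, ∀ t : T, x l' • t = 0) →
        (∀ t : T, x l ^ k • t = 0) → HasFiniteCohomology h.raisesDegree := by
      intro k
      induction k with
      | zero =>
        intro T _ _ _ _ π h _ hx hk
        refine ih T π h fun l' _ t => ?_
        have h0 := hk t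
        rw [pow_zero, one_smul] at h0
        rw [h0, smul_zero]
      | succ k ihk =>
        intro T _ _ _ _ π h _ hx hk
        have : IsNoetherian S T := isNoetherian_of_isNoetherianRing_of_finite S T
        set B := LinearMap.range (LinearMap.lsmul S T (x l))
        have hB := hran T π h
        refine (h.isGradedExact_quot B hB).hasFiniteCohomology_middle
          (ihk B (subGrading π B hB) (h.sub B hB) (fun l' hl' t => Subtype.ext (hx l' hl' t)) ?_)
          (ih (T ⧸ B) (quotGrading π B hB) (h.quot B hB) ?_)
        · rintro ⟨_, t, rfl⟩
          refine Subtype.ext ?_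
          change x l ^ k • x l • t = 0
          rw [smul_smul, ← pow_succ, hk]
        · intro l' hl' t
          obtain ⟨t, rfl⟩ := B.mkQ_surjective t
          rw [← map_smul]
          by_cases hll : l' = l
          · subst hll
            rw [Submodule.mkQ_apply, Submodule.Quotient.mk_eq_zero]
            exact ⟨t, rfl⟩
          · rw [hx l' (by simp [hll, hl']), map_zero]
    intro T _ _ _ _ π h _ hx
    have : IsNoetherian S T := isNoetherian_of_isNoetherianRing_of_finite S T
    -- The kernels of the powers of x l stabilize at some n; dividing by the stable kernel makes x l
    -- injective.
    obtain ⟨n, hn⟩ := monotone_stabilizes_iff_noetherian.mpr this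
      ⟨fun k => LinearMap.ker (LinearMap.lsmul S T (x l ^ k)), monotone_nat_of_le_succ fun k t ht => by
        rw [LinearMap.mem_ker, LinearMap.lsmul_apply] at ht ⊢
        rw [pow_succ', mul_smul, ht, smul_zero]⟩
    set B := LinearMap.ker (LinearMap.lsmul S T (x l ^ n))
    have hB := hker T π h n
    have hreg : ∀ t : T, x l • t ∈ B → t ∈ B := by
      intro t ht
      have h1 : t ∈ LinearMap.ker (LinearMap.lsmul S T (x l ^ (n + 1))) := by
        rw [LinearMap.mem_ker, LinearMap.lsmul_apply] at ht ⊢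
        rw [pow_succ, mul_smul, ht]
      exact (hn (n + 1) (Nat.le_succ n)).ge h1
    have h1 := h.quot B hB
    refine (h.isGradedExact_quot B hB).hasFiniteCohomology_middle (hx'' := h1.raisesDegree)
      (hnil n B (subGrading π B hB) (h.sub B hB) (fun l' hl' t => Subtype.ext (hx l' hl' t))
        fun t => Subtype.ext t.2) ?_
    have hB' := hran (T ⧸ B) _ h1
    set B' := LinearMap.range (LinearMap.lsmul S (T ⧸ B) (x l))
    have hinj : Function.Injective (LinearMap.lsmul S (T ⧸ B) (x l)) := by
      rw [injective_iff_map_eq_zero]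
      intro t ht
      obtain ⟨t, rfl⟩ := B.mkQ_surjective t
      rw [LinearMap.lsmul_apply, ← map_smul, Submodule.mkQ_apply,
        Submodule.Quotient.mk_eq_zero] at ht
      rw [Submodule.mkQ_apply, Submodule.Quotient.mk_eq_zero]
      exact hreg t ht
    have h2 := h1.isGradedExact_quot B' hB'
    refine IsGradedExact.hasFiniteCohomology_of_regular (he l) (g := B'.mkQ)
      ⟨fun d n hn => h1.raisesDegree l d n hn, h2.map_right, hinj, fun n => ?_, ?_, h2.surjective⟩
      (ih _ _ (h1.quot B' hB') ?_)
    · rw [Submodule.mkQ_apply, Submodule.Quotient.mk_eq_zero]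
      exact ⟨n, rfl⟩
    · intro d n hn hgn
      rw [Submodule.mkQ_apply, Submodule.Quotient.mk_eq_zero] at hgn
      obtain ⟨t, rfl⟩ := hgn
      rw [h1.mem_range, LinearMap.lsmul_apply, ← h1.x_smul] at hn
      exact ⟨_, ⟨t, rfl⟩, hn⟩
    · intro l' hl' t
      obtain ⟨t, rfl⟩ := B'.mkQ_surjective t
      rw [← map_smul]
      by_cases hll : l' = l
      · subst hll
        rw [Submodule.mkQ_apply, Submodule.Quotient.mk_eq_zero]
        exact ⟨t, rfl⟩
      · obtain ⟨t, rfl⟩ := B.mkQ_surjective t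
        rw [← map_smul, hx l' (by simp [hll, hl']), map_zero, map_zero]

end Finiteness

end

end GradedLocalCohomology

namespace GradedLocalCohomology

noncomputable section

/-! ### Free modules from filtrations, and freeness after inverting one element. -/

section Filtration

/-- Two quotients of a module by the same kernel are isomorphic. -/
def equivOfKerEq {Q X Y Z : Type*} [CommRing Q] [AddCommGroup X] [AddCommGroup Y] [AddCommGroup Z]
    [Module Q X] [Module Q Y] [Module Q Z] (α : X →ₗ[Q] Y) (β : X →ₗ[Q] Z)
    (hα : Function.Surjective α) (hβ : Function.Surjective β)
    (h : LinearMap.ker α = LinearMap.ker β) : Y ≃ₗ[Q] Z :=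
  (α.quotKerEquivOfSurjective hα).symm ≪≫ₗ Submodule.quotEquivOfEq _ _ h ≪≫ₗ
    β.quotKerEquivOfSurjective hβ

/-- Free quotients are projective, so every step of the filtration splits, and the chosen sections
identify Y with the direct sum of the G i. -/
theorem free_of_filtration {Q Y : Type*} [CommRing Q] [AddCommGroup Y] [Module Q Y]
    (F : ℕ → Submodule Q Y) (hF : Monotone F) (h0 : F 0 = ⊥) (htop : ∀ y, ∃ i, y ∈ F i)
    {G : ℕ → Type*} [∀ i, AddCommGroup (G i)] [∀ i, Module Q (G i)] [∀ i, Module.Free Q (G i)]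
    (p : ∀ i, F (i + 1) →ₗ[Q] G i) (hsurj : ∀ i, Function.Surjective (p i))
    (hp : ∀ i y, p i y = 0 ↔ (y : Y) ∈ F i) :
    Module.Free Q Y := by
  classical
  have hsec : ∀ i, ∃ s : G i →ₗ[Q] F (i + 1), p i ∘ₗ s = LinearMap.id := fun i =>
    Module.projective_lifting_property (p i) LinearMap.id (hsurj i)
  choose s hs using hsec
  have hs' : ∀ i z, p i (s i z) = z := fun i z => LinearMap.congr_fun (hs i) z
  let Φ : (DirectSum ℕ G) →ₗ[Q] Y := DirectSum.toModule Q ℕ Y fun i => (F (i + 1)).subtype ∘ₗ s i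
  have hΦ : ∀ i z, Φ (DirectSum.lof Q ℕ G i z) = s i z := fun i z => DirectSum.toModule_lof ..
  have hΦsurj : Function.Surjective Φ := by
    have key : ∀ i, ∀ y ∈ F i, ∃ z, Φ z = y := by
      intro i
      induction i with
      | zero => intro y hy; rw [h0, Submodule.mem_bot] at hy; exact ⟨0, by rw [map_zero, hy]⟩
      | succ i ih =>
        intro y hy
        obtain ⟨z, hz⟩ := ih (y - s i (p i ⟨y, hy⟩))
          ((hp i (⟨y, hy⟩ - s i (p i ⟨y, hy⟩))).mp (by rw [map_sub, hs', sub_self]))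
        exact ⟨z + DirectSum.lof Q ℕ G i (p i ⟨y, hy⟩), by rw [map_add, hΦ, hz]; simp⟩
    intro y
    obtain ⟨i, hi⟩ := htop y
    exact key i y hi
  have hinj : Function.Injective Φ := by
    rw [injective_iff_map_eq_zero]
    have hmem : ∀ (n : ℕ) (z : DirectSum ℕ G), (∀ i ≥ n, z i = 0) → Φ z ∈ F n := by
      intro n z hz
      rw [← DirectSum.sum_support_of z, map_sum]
      refine sum_mem fun i hi => ?_
      have hin : i < n := by
        by_contra h
        exact (DFinsupp.mem_support_iff.mp hi) (hz i (not_lt.mp h))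
      have : Φ (DirectSum.of G i (z i)) = s i (z i) := hΦ i (z i)
      rw [this]
      exact hF hin (s i (z i)).2
    have key : ∀ (n : ℕ) (z : DirectSum ℕ G), (∀ i ≥ n, z i = 0) → Φ z = 0 → z = 0 := by
      intro n
      induction n with
      | zero => intro z hz _; exact DFinsupp.ext fun i => hz i (Nat.zero_le i)
      | succ n ih =>
        intro z hz hΦz
        refine ih z (fun i hi => ?_) hΦz
        rcases hi.lt_or_eq with hi | rfl
        · exact hz i hi
        · have h1 : Φ (z - DirectSum.lof Q ℕ G n (z n)) ∈ F n := by
            refine hmem n _ fun i hi => ?_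
            rw [DirectSum.sub_apply]
            rcases hi.lt_or_eq with hi' | rfl
            · rw [hz i hi', DirectSum.lof_eq_of, DirectSum.of_eq_of_ne _ _ _ hi'.ne', sub_zero]
            · rw [DirectSum.lof_apply, sub_self]
          rw [map_sub, hΦz, hΦ, zero_sub, neg_mem_iff] at h1
          rw [← hs' n (z n)]
          exact (hp n _).mpr h1
    intro z hz
    refine key ((DFinsupp.support z).sup id + 1) z (fun i hi => ?_) hz
    by_contra h
    have := Finset.le_sup (f := id) (DFinsupp.mem_support_iff.mpr h)
    simp only [id] at this
    lia
  exact Module.Free.of_equiv (LinearEquiv.ofBijective Φ ⟨hinj, hΦsurj⟩)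

/-- Flatness of Q over A turns the filtration of Y into a filtration of Q ⊗ Y whose factors are the
base changes of the original factors. -/
theorem free_baseChange_of_filtration {A Q Y : Type*} [CommRing A] [CommRing Q] [Algebra A Q]
    [Module.Flat A Q] [AddCommGroup Y] [Module A Y] (F : ℕ → Submodule A Y) (hF : Monotone F)
    (h0 : F 0 = ⊥) (htop : ∀ y, ∃ i, y ∈ F i)
    (hfree : ∀ i, Module.Free Q (Q ⊗[A] (F (i + 1) ⧸ (F i).submoduleOf (F (i + 1))))) :
    Module.Free Q (Q ⊗[A] Y) := by
  have hinj : ∀ i, Function.Injective ((F i).subtype.baseChange Q) := fun i =>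
    Module.Flat.lTensor_preserves_injective_linearMap _ (F i).subtype_injective
  have hFb : Monotone fun i => LinearMap.range ((F i).subtype.baseChange Q) := by
    rintro i i' h _ ⟨z, rfl⟩
    refine ⟨(Submodule.inclusion (hF h)).baseChange Q z, ?_⟩
    rw [← LinearMap.comp_apply, ← LinearMap.baseChange_comp]
    rfl
  let B (i : ℕ) := (F i).submoduleOf (F (i + 1))
  let α (i : ℕ) : Q ⊗[A] F (i + 1) →ₗ[Q] Q ⊗[A] (F (i + 1) ⧸ B i) := (B i).mkQ.baseChange Q
  have hα : ∀ i, Function.Surjective (α i) := fun i =>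
    LinearMap.lTensor_surjective Q (B i).mkQ_surjective
  refine free_of_filtration (fun i => LinearMap.range ((F i).subtype.baseChange Q)) hFb ?_ ?_
    (fun i => α i ∘ₗ (LinearEquiv.ofInjective _ (hinj (i + 1))).symm.toLinearMap)
    (fun i => (hα i).comp (LinearEquiv.surjective _)) ?_
  · rw [LinearMap.range_eq_bot, show (F 0).subtype = 0 from LinearMap.ext fun y => by
      have := y.2
      simp only [h0] at this
      exact (Submodule.mem_bot A).mp this, LinearMap.baseChange_zero]
  · intro y
    induction y using TensorProduct.induction_on with
    | zero => exact ⟨0, zero_mem _⟩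
    | tmul a y =>
      obtain ⟨i, hi⟩ := htop y
      exact ⟨i, a ⊗ₜ ⟨y, hi⟩, rfl⟩
    | add y y' h h' =>
      obtain ⟨i, hi⟩ := h
      obtain ⟨i', hi'⟩ := h'
      exact ⟨max i i', add_mem (hFb (le_max_left i i') hi) (hFb (le_max_right i i') hi')⟩
  · intro i y
    obtain ⟨z, rfl⟩ := (LinearEquiv.ofInjective _ (hinj (i + 1))).surjective y
    have hex : α i z = 0 ↔ ∃ w, (B i).subtype.baseChange Q w = z :=
      lTensor_exact Q (LinearMap.exact_subtype_mkQ (B i)) (B i).mkQ_surjective z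
    rw [LinearMap.comp_apply, LinearEquiv.coe_coe, LinearEquiv.symm_apply_apply, hex,
      LinearEquiv.ofInjective_apply]
    constructor
    · rintro ⟨w, rfl⟩
      refine ⟨((F (i + 1)).subtype.restrict (p := B i) (q := F i) fun _ h => h).baseChange Q w, ?_⟩
      rw [← LinearMap.comp_apply, ← LinearMap.comp_apply, ← LinearMap.baseChange_comp,
        ← LinearMap.baseChange_comp]
      rfl
    · rintro ⟨w, hw⟩
      refine ⟨((Submodule.inclusion (hF i.le_succ)).codRestrict (B i) fun y => y.2).baseChange Q w,
        hinj (i + 1) ?_⟩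
      rw [← hw, ← LinearMap.comp_apply, ← LinearMap.comp_apply, ← LinearMap.baseChange_comp,
        ← LinearMap.baseChange_comp]
      rfl

end Filtration

section FreeAt

variable {A : Type*} [CommRing A]

/-- The localization of `X` away from `g` is free. -/
def FreeAt (g : A) (X : Type*) [AddCommGroup X] [Module A X] : Prop :=
  Module.Free (Localization.Away g) (Localization.Away g ⊗[A] X)

theorem free_baseChange_of_free (Q Q' : Type*) [CommRing Q] [CommRing Q'] [Algebra A Q]
    [Algebra A Q'] [Algebra Q Q'] [IsScalarTower A Q Q'] {X : Type*} [AddCommGroup X] [Module A X]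
    [Module.Free Q (Q ⊗[A] X)] : Module.Free Q' (Q' ⊗[A] X) :=
  Module.Free.of_equiv (AlgebraTensorModule.cancelBaseChange A Q Q' Q' X)

theorem FreeAt.of_dvd {g g' : A} (h : g ∣ g') {X : Type*} [AddCommGroup X] [Module A X]
    (hX : FreeAt g X) : FreeAt g' X := by
  let φ : Localization.Away g →ₐ[A] Localization.Away g' :=
    IsLocalization.liftAlgHom (M := Submonoid.powers g) (f := Algebra.ofId A _) (by
      rintro ⟨_, n, rfl⟩
      obtain ⟨c, rfl⟩ := h
      have : IsUnit (algebraMap A (Localization.Away (g * c)) (g * c)) :=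
        IsLocalization.Away.algebraMap_isUnit _
      rw [map_mul] at this
      change IsUnit (algebraMap A (Localization.Away (g * c)) (g ^ n))
      rw [map_pow]
      exact (isUnit_of_mul_isUnit_left this).pow n)
  let := φ.toAlgebra
  have : Module.Free (Localization.Away g) (Localization.Away g ⊗[A] X) := hX
  exact free_baseChange_of_free (Localization.Away g) (Localization.Away g')

theorem FreeAt.of_equiv {g : A} {X Y : Type*} [AddCommGroup X] [Module A X] [AddCommGroup Y]
    [Module A Y] (e : X ≃ₗ[A] Y) (hX : FreeAt g X) : FreeAt g Y := by
  have : Module.Free (Localization.Away g) (Localization.Away g ⊗[A] X) := hX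
  exact Module.Free.of_equiv (e.baseChange A (Localization.Away g) X Y)

theorem exists_notMem_forall_of_finite {q : Ideal A} [q.IsPrime] {ι : Type*} (s : Finset ι)
    {C : ι → A → Prop} (hC : ∀ i g g', g ∣ g' → C i g → C i g')
    (h : ∀ i ∈ s, ∃ g ∉ q, C i g) : ∃ g ∉ q, ∀ i ∈ s, C i g := by
  classical
  induction s using Finset.induction_on with
  | empty => exact ⟨1, fun h => Ideal.IsPrime.ne_top ‹_› ((Ideal.eq_top_iff_one q).mpr h), by simp⟩
  | insert i s _ ih =>
    obtain ⟨g, hg, hgs⟩ := ih fun i hi => h i (Finset.mem_insert_of_mem hi)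
    obtain ⟨g', hg', hgi⟩ := h i (Finset.mem_insert_self i s)
    refine ⟨g * g', fun h => (Ideal.IsPrime.mem_or_mem ‹_› h).elim hg hg', fun i' hi' => ?_⟩
    rcases Finset.mem_insert.mp hi' with rfl | hi'
    · exact hC _ _ _ (Dvd.intro_left g rfl) hgi
    · exact hC _ _ _ (Dvd.intro g' rfl) (hgs i' hi')

/-- A reduced ring localized at a minimal prime is a field, so X is free there, and freeness of a
finitely presented module spreads to a basic open set. This is where reducedness of A enters. -/
theorem exists_freeAt_of_finite [IsNoetherianRing A] [IsReduced A] {q : Ideal A}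
    (hq : q ∈ minimalPrimes A) (X : Type*) [AddCommGroup X] [Module A X] [Module.Finite A X] :
    ∃ g ∉ q, FreeAt g X := by
  have hp : q.IsPrime := hq.1.1
  have : Ring.KrullDimLE 0 (Localization.AtPrime q) :=
    Ring.KrullDimLE.of_isLocalization q hq _
  let : Field (Localization.AtPrime q) := (Ring.KrullDimLE.isField_of_isReduced).toField
  have : Module.FinitePresentation A X := Module.finitePresentation_of_finite A X
  have hfree : Module.Free (Localization.AtPrime q) (LocalizedModule q.primeCompl X) := by
    infer_instance
  obtain ⟨g, hg, hg', -⟩ := Module.FinitePresentation.exists_free_localizedModule_powers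
    q.primeCompl (LocalizedModule.mkLinearMap q.primeCompl X) (Localization.AtPrime q)
  exact ⟨g, hg, Module.Free.of_equiv (LocalizedModule.equivTensorProduct (.powers g) X)⟩

end FreeAt

end

end GradedLocalCohomology

namespace GradedLocalCohomology

noncomputable section

/-! ### Generic freeness of all graded pieces at once. -/

section GenericFreeness

universe v w

variable {A : Type*} [CommRing A] {Γ : Type*} [AddCommGroup Γ]

theorem smul_mem_of_adjoin_eq_top {S : Type*} [CommRing S] [Algebra A S] {L : Type*}
    [AddCommGroup L] [Module S L] [Module A L] [IsScalarTower A S L] {ι : Type*} {t : ι → S}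
    (ht : Algebra.adjoin A (Set.range t) = ⊤) (Q : Submodule A L)
    (hQ : ∀ i, ∀ l ∈ Q, t i • l ∈ Q) (a : S) {l : L} (hl : l ∈ Q) : a • l ∈ Q := by
  have ha : a ∈ Algebra.adjoin A (Set.range t) := ht ▸ trivial
  induction ha using Algebra.adjoin_induction generalizing l with
  | mem a ha => obtain ⟨i, rfl⟩ := ha; exact hQ i l hl
  | algebraMap c => rw [algebraMap_smul]; exact Q.smul_mem c hl
  | add a b _ _ ha hb => rw [add_smul]; exact add_mem (ha hl) (hb hl)
  | mul a b _ _ ha hb => rw [mul_smul]; exact ha (hb hl)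

/-- The span of a set that is stable under the projections is stable under the projections. -/
theorem apply_mem_span_of_adjoin_eq_top {S : Type*} [CommRing S] [Algebra A S] {L : Type*}
    [AddCommGroup L] [Module S L] [Module A L] [IsScalarTower A S L] {ι : Type*} {t : ι → S}
    {c : ι → Γ} (ht : Algebra.adjoin A (Set.range t) = ⊤) {π : Γ → L →ₗ[A] L}
    (hc : ∀ i γ l, t i • π γ l = π (γ + c i) (t i • l)) {G : Set L}
    (hG : ∀ γ, ∀ l ∈ G, π γ l ∈ Submodule.span S G) (γ : Γ) {l : L}
    (hl : l ∈ Submodule.span S G) : π γ l ∈ Submodule.span S G := by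
  let Q : Submodule A L :=
    { carrier := {l | ∀ γ, π γ l ∈ Submodule.span S G}
      add_mem' := fun h h' γ => by rw [map_add]; exact add_mem (h γ) (h' γ)
      zero_mem' := fun γ => by rw [map_zero]; exact zero_mem _
      smul_mem' := fun a l h γ => by
        rw [map_smul]
        exact Submodule.smul_of_tower_mem _ a (h γ) }
  have hQ : ∀ i, ∀ l ∈ Q, t i • l ∈ Q := fun i l h γ => by
    have := hc i (γ - c i) l
    rw [sub_add_cancel] at this
    rw [← this]
    exact Submodule.smul_mem _ _ (h _)
  have key : l ∈ Q := by
    induction hl using Submodule.span_induction with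
    | mem l hl => exact fun γ => hG γ l hl
    | zero => exact zero_mem _
    | add a b _ _ ha hb => exact add_mem ha hb
    | smul a l _ h => exact smul_mem_of_adjoin_eq_top ht Q hQ a h
  exact key γ

/-- The submodules `∑_{j < i} s^j L₀`. -/
def powerFiltration {S' S : Type*} [CommRing S'] [CommRing S] [Algebra S' S] {L : Type*}
    [AddCommGroup L] [Module S L] [Module S' L] [IsScalarTower S' S L] (s : S)
    (L₀ : Submodule S' L) : ℕ → Submodule S' L
  | 0 => ⊥
  | i + 1 => powerFiltration s L₀ i ⊔
      L₀.map ((LinearMap.lsmul S L (s ^ i)).restrictScalars S')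

section PowerFiltration

variable {S' S : Type*} [CommRing S'] [CommRing S] [Algebra S' S] {L : Type*}
    [AddCommGroup L] [Module S L] [Module S' L] [IsScalarTower S' S L] {s : S}
    {L₀ : Submodule S' L}

theorem powerFiltration_mono : Monotone (powerFiltration s L₀) :=
  monotone_nat_of_le_succ fun _ => le_sup_left

theorem mem_powerFiltration_succ {i : ℕ} {l : L} : l ∈ powerFiltration s L₀ (i + 1) ↔
    ∃ y ∈ powerFiltration s L₀ i, ∃ v ∈ L₀, y + s ^ i • v = l := by
  rw [powerFiltration, Submodule.mem_sup]
  constructor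
  · rintro ⟨y, hy, _, ⟨v, hv, rfl⟩, h⟩
    exact ⟨y, hy, v, hv, h⟩
  · rintro ⟨y, hy, v, hv, h⟩
    exact ⟨y, hy, _, ⟨v, hv, rfl⟩, h⟩

theorem smul_mem_powerFiltration {i : ℕ} {l : L} (h : l ∈ powerFiltration s L₀ i) :
    s • l ∈ powerFiltration s L₀ (i + 1) := by
  induction i generalizing l with
  | zero =>
    rw [powerFiltration, Submodule.mem_bot] at h
    rw [h, smul_zero]
    exact zero_mem _
  | succ i ih =>
    obtain ⟨y, hy, v, hv, rfl⟩ := mem_powerFiltration_succ.mp h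
    rw [smul_add, smul_smul, ← pow_succ']
    exact mem_powerFiltration_succ.mpr ⟨_, ih hy, v, hv, rfl⟩

end PowerFiltration

omit [AddCommGroup Γ] in
-- A finite module has only finitely many nonzero components, so the elements that make each of them
-- free can be multiplied.
theorem exists_freeAt_range_of_finite [IsNoetherianRing A] [IsReduced A] {q : Ideal A}
    (hq : q ∈ minimalPrimes A) {L : Type*} [AddCommGroup L] [Module A L] [Module.Finite A L]
    {π : Γ → L →ₗ[A] L} (hπ : IsGrading π) : ∃ g ∉ q, ∀ γ, FreeAt g (LinearMap.range (π γ)) := by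
  classical
  have hp : q.IsPrime := hq.1.1
  obtain ⟨G, hG⟩ := Module.Finite.fg_top (R := A) (M := L)
  choose s hs using hπ.exists_support
  obtain ⟨g, hg, hfree⟩ := exists_notMem_forall_of_finite (q := q) (G.biUnion s)
    (C := fun γ g => FreeAt g (LinearMap.range (π γ))) (fun γ g g' h hX => FreeAt.of_dvd h hX)
    fun γ _ => exists_freeAt_of_finite hq _
  refine ⟨g, hg, fun γ => ?_⟩
  by_cases hγ : γ ∈ G.biUnion s
  · exact hfree γ hγ
  · have h0 : π γ = 0 := LinearMap.ext_on hG fun l hl => hs l γ fun h =>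
      hγ (Finset.mem_biUnion.mpr ⟨l, hl, h⟩)
    have : Subsingleton (LinearMap.range (π γ)) := by
      rw [h0, LinearMap.range_zero]
      infer_instance
    have : Subsingleton (Localization.Away g ⊗[A] LinearMap.range (π γ)) := inferInstance
    exact Module.Free.of_subsingleton _ _

theorem adjoin_eq_top_restrict {S : Type*} [CommRing S] [Algebra A S] {n : ℕ} (t : Fin n → S) :
    Algebra.adjoin A (Set.range fun i : Fin n =>
      (⟨t i, Algebra.subset_adjoin ⟨i, rfl⟩⟩ : Algebra.adjoin A (Set.range t))) = ⊤ := by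
  refine Subalgebra.map_injective (f := (Algebra.adjoin A (Set.range t)).val)
    Subtype.val_injective ?_
  rw [AlgHom.map_adjoin, ← Set.range_comp, Algebra.map_top, Subalgebra.range_val]
  rfl

/-- Multiplication by s^i identifies L₀ / K i with the i-th factor of the filtration of L by the
sums of the s^j L₀. It shifts degrees by i • c, so the component of degree γ of that factor is the
component of degree γ - i • c of L₀ / K i. -/
theorem exists_freeAt_powerFiltration {S' S : Type*} [CommRing S'] [CommRing S] [Algebra S' S]
    {L : Type*} [AddCommGroup L] [Module S L] [Module S' L] [IsScalarTower S' S L]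
    [Algebra A S'] [Algebra A S] [Module A L] [IsScalarTower A S' L] [IsScalarTower A S L]
    {s : S} {L₀ : Submodule S' L} {π : Γ → L →ₗ[A] L} {c : Γ} (hπ : IsGrading π)
    (hs : ∀ γ l, s • π γ l = π (γ + c) (s • l)) (hL₀ : ∀ γ, ∀ l ∈ L₀, π γ l ∈ L₀)
    (hF : ∀ i γ, ∀ l ∈ powerFiltration s L₀ i, π γ l ∈ powerFiltration s L₀ i)
    (htop : ∀ l, ∃ i, l ∈ powerFiltration s L₀ i)
    (K : ℕ → Submodule S' L₀) (hK : ∀ i v, v ∈ K i ↔ s ^ i • (v : L) ∈ powerFiltration s L₀ i)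
    (hKπ : ∀ i γ, ∀ v ∈ K i, subGrading π L₀ hL₀ γ v ∈ K i) {g : A}
    (hfree : ∀ i γ, FreeAt g
      (LinearMap.range (quotGrading (subGrading π L₀ hL₀) (K i) (hKπ i) γ))) (γ : Γ) :
    FreeAt g (LinearMap.range (π γ)) := by
  have hpow : ∀ (i : ℕ) γ l, s ^ i • π γ l = π (γ + i • c) (s ^ i • l) := by
    intro i
    induction i with
    | zero => simp
    | succ i ih =>
      intro γ l
      rw [pow_succ', mul_smul, mul_smul, ih, hs, succ_nsmul, add_assoc]
  let F (i : ℕ) : Submodule A (LinearMap.range (π γ)) :=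
    ((powerFiltration s L₀ i).restrictScalars A).submoduleOf (LinearMap.range (π γ))
  have hmemF : ∀ i y, y ∈ F i ↔ (y : L) ∈ powerFiltration s L₀ i := fun _ _ => Iff.rfl
  refine free_baseChange_of_filtration F (fun i i' h y hy => powerFiltration_mono h hy) ?_
    (fun y => htop y) fun i => ?_
  · ext y
    rw [hmemF, powerFiltration, Submodule.mem_bot, Submodule.mem_bot, ZeroMemClass.coe_eq_zero]
  · have hmap : ∀ v : LinearMap.range (subGrading π L₀ hL₀ (γ - i • c)),
        s ^ i • (v.1 : L) ∈ LinearMap.range (π γ) := by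
      rintro ⟨_, v, rfl⟩
      change s ^ i • π (γ - i • c) v ∈ _
      rw [hpow, sub_add_cancel]
      exact ⟨_, rfl⟩
    let m : LinearMap.range (subGrading π L₀ hL₀ (γ - i • c)) →ₗ[A] F (i + 1) :=
      { toFun := fun v => ⟨⟨s ^ i • (v.1 : L), hmap v⟩,
          mem_powerFiltration_succ.mpr ⟨0, zero_mem _, v.1, v.1.2, zero_add _⟩⟩
        map_add' := fun v w => Subtype.ext (Subtype.ext (smul_add _ _ _))
        map_smul' := fun a v => Subtype.ext (Subtype.ext (smul_comm _ _ _)) }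
    let α := ((F i).submoduleOf (F (i + 1))).mkQ ∘ₗ m
    let β : LinearMap.range (subGrading π L₀ hL₀ (γ - i • c)) →ₗ[A]
        LinearMap.range (quotGrading (subGrading π L₀ hL₀) (K i) (hKπ i) (γ - i • c)) :=
      ((K i).mkQ.restrictScalars A).restrict fun v hv => by
        obtain ⟨v, rfl⟩ := hv
        exact ⟨(K i).mkQ v, rfl⟩
    have hβ : Function.Surjective β := by
      rintro ⟨_, v, rfl⟩
      obtain ⟨v, rfl⟩ := (K i).mkQ_surjective v
      exact ⟨⟨_, v, rfl⟩, rfl⟩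
    have hα : Function.Surjective α := by
      intro y
      obtain ⟨y, rfl⟩ := Submodule.mkQ_surjective _ y
      obtain ⟨f, hf, v, hv, hy⟩ := mem_powerFiltration_succ.mp ((hmemF _ _).mp y.2)
      refine ⟨⟨subGrading π L₀ hL₀ (γ - i • c) ⟨v, hv⟩, _, rfl⟩, ?_⟩
      rw [← sub_eq_zero, LinearMap.comp_apply, ← map_sub, Submodule.mkQ_apply,
        Submodule.Quotient.mk_eq_zero]
      change s ^ i • π (γ - i • c) v - (y.1 : L) ∈ powerFiltration s L₀ i
      rw [hpow, sub_add_cancel, ← hπ.mem_range.mp y.1.2, ← map_sub, ← hy]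
      refine hF _ _ _ ?_
      rw [sub_add_cancel_right]
      exact neg_mem hf
    refine FreeAt.of_equiv (equivOfKerEq β α hβ hα ?_) (hfree i (γ - i • c))
    ext v
    rw [LinearMap.mem_ker, LinearMap.mem_ker, LinearMap.comp_apply, Submodule.mkQ_apply,
      Submodule.Quotient.mk_eq_zero]
    change _ ↔ s ^ i • (v.1 : L) ∈ powerFiltration s L₀ i
    rw [← hK, ← Submodule.Quotient.mk_eq_zero]
    exact Subtype.ext_iff

/-- Generic freeness for graded modules: one localization makes all graded pieces free. -/
theorem exists_freeAt_range [IsNoetherianRing A] [IsReduced A] {q : Ideal A}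
    (hq : q ∈ minimalPrimes A) {n : ℕ} {S : Type w} [CommRing S] [Algebra A S] {t : Fin n → S}
    (ht : Algebra.adjoin A (Set.range t) = ⊤) {L : Type v} [AddCommGroup L] [Module S L]
    [Module A L] [IsScalarTower A S L] [Module.Finite S L] {π : Γ → L →ₗ[A] L} (hπ : IsGrading π)
    {c : Fin n → Γ} (hc : ∀ i γ l, t i • π γ l = π (γ + c i) (t i • l)) :
    ∃ g ∉ q, ∀ γ, FreeAt g (LinearMap.range (π γ)) := by
  classical
  have hp : q.IsPrime := hq.1.1
  induction n generalizing S L with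
  | zero =>
    have : Module.Finite A S := by
      refine Module.Finite.of_surjective (Algebra.linearMap A S) fun a => ?_
      have ha : a ∈ Algebra.adjoin A (Set.range t) := ht ▸ trivial
      rwa [Set.range_eq_empty, Algebra.adjoin_empty] at ha
    have : Module.Finite A L := Module.Finite.trans S L
    exact exists_freeAt_range_of_finite hq hπ
  | succ n ih =>
    -- The generator t 0 is peeled off: L is filtered by the powers of t 0 applied to a finite
    -- module L₀ over the subalgebra S' of the remaining generators, and the induction hypothesis
    -- treats the factors.
    let t' : Fin n → S := fun i => t i.succ
    let S' := Algebra.adjoin A (Set.range t')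
    have ht' := adjoin_eq_top_restrict (A := A) t'
    have : Algebra.FiniteType A S' := ⟨by
      rw [← ht']
      exact ⟨(Set.finite_range _).toFinset, by rw [Set.Finite.coe_toFinset]⟩⟩
    have : IsNoetherianRing S' := Algebra.FiniteType.isNoetherianRing A S'
    obtain ⟨G₀, hG₀⟩ := Module.Finite.fg_top (R := S) (M := L)
    choose sup hsup using hπ.exists_support
    -- The generators are replaced by their homogeneous components so that L₀ is stable under the
    -- projections.
    let G : Finset L := G₀.biUnion fun l => (sup l).image fun γ => π γ l
    have hG : ∀ γ, ∀ l ∈ (G : Set L), π γ l ∈ Submodule.span S' (G : Set L) := by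
      intro γ l hl
      obtain ⟨l₀, hl₀, hl⟩ := Finset.mem_biUnion.mp hl
      obtain ⟨γ', hγ', rfl⟩ := Finset.mem_image.mp hl
      by_cases h : γ = γ'
      · subst h
        rw [hπ.apply_self]
        exact Submodule.subset_span (Finset.mem_coe.mpr
          (Finset.mem_biUnion.mpr ⟨l₀, hl₀, Finset.mem_image_of_mem _ hγ'⟩))
      · rw [hπ.apply_ne _ _ _ h]
        exact zero_mem _
    set L₀ := Submodule.span S' (G : Set L)
    have hL₀ : ∀ γ, ∀ l ∈ L₀, π γ l ∈ L₀ := fun γ l hl =>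
      apply_mem_span_of_adjoin_eq_top ht' (c := fun i => c i.succ)
        (fun i γ l => hc i.succ γ l) hG γ hl
    have hfin : Module.Finite S' L₀ := Module.Finite.of_fg ⟨G, rfl⟩
    have hF : ∀ i γ, ∀ l ∈ powerFiltration (t 0) L₀ i, π γ l ∈ powerFiltration (t 0) L₀ i := by
      intro i
      induction i with
      | zero =>
        intro γ l hl
        rw [powerFiltration, Submodule.mem_bot] at hl
        rw [hl, map_zero]
        exact zero_mem _
      | succ i ihi =>
        intro γ l hl
        obtain ⟨y, hy, v, hv, rfl⟩ := mem_powerFiltration_succ.mp hl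
        rw [map_add]
        refine mem_powerFiltration_succ.mpr ⟨_, ihi γ y hy, π (γ - i • c 0) v, hL₀ _ v hv, ?_⟩
        congr 1
        have hpow : ∀ (i : ℕ) γ l, t 0 ^ i • π γ l = π (γ + i • c 0) (t 0 ^ i • l) := by
          intro i
          induction i with
          | zero => simp
          | succ i ih =>
            intro γ l
            rw [pow_succ', mul_smul, mul_smul, ih, hc, succ_nsmul, add_assoc]
        rw [hpow, sub_add_cancel]
    have htop : ∀ l, ∃ i, l ∈ powerFiltration (t 0) L₀ i := by
      let Q : Submodule A L := (⨆ i, powerFiltration (t 0) L₀ i).restrictScalars A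
      have hmem : ∀ l, l ∈ Q ↔ ∃ i, l ∈ powerFiltration (t 0) L₀ i := fun l =>
        Submodule.mem_iSup_of_directed _ powerFiltration_mono.directed_le
      have hQ : ∀ i, ∀ l ∈ Q, t i • l ∈ Q := by
        intro i l hl
        obtain ⟨j, hj⟩ := (hmem l).mp hl
        refine Fin.cases ?_ (fun i => ?_) i
        · exact (hmem _).mpr ⟨_, smul_mem_powerFiltration hj⟩
        · exact (hmem _).mpr ⟨j, Submodule.smul_mem _
            (⟨t i.succ, Algebra.subset_adjoin ⟨i, rfl⟩⟩ : S') hj⟩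
      intro l
      rw [← hmem]
      have hl : l ∈ Submodule.span S (G₀ : Set L) := hG₀ ▸ trivial
      induction hl using Submodule.span_induction with
      | mem l hl =>
        obtain ⟨s, hs⟩ := hπ.exists_sum l
        rw [← hs]
        refine sum_mem fun γ _ => ?_
        by_cases hγ : γ ∈ sup l
        · refine (hmem _).mpr ⟨1, mem_powerFiltration_succ.mpr ⟨0, zero_mem _, π γ l, ?_, ?_⟩⟩
          · exact Submodule.subset_span (Finset.mem_coe.mpr
              (Finset.mem_biUnion.mpr ⟨l, hl, Finset.mem_image_of_mem _ hγ⟩))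
          · rw [pow_zero, one_smul, zero_add]
        · rw [hsup l γ hγ]
          exact zero_mem _
      | zero => exact zero_mem _
      | add a b _ _ ha hb => exact add_mem ha hb
      | smul a l _ h => exact smul_mem_of_adjoin_eq_top ht Q hQ a h
    let K (i : ℕ) : Submodule S' L₀ := (powerFiltration (t 0) L₀ i).comap
      ((LinearMap.lsmul S L (t 0 ^ i)).restrictScalars S' ∘ₗ L₀.subtype)
    have hK : ∀ i v, v ∈ K i ↔ t 0 ^ i • (v : L) ∈ powerFiltration (t 0) L₀ i := fun _ _ => Iff.rfl
    have hKmono : Monotone K := monotone_nat_of_le_succ fun i v hv => by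
      rw [hK] at hv ⊢
      rw [pow_succ', mul_smul]
      exact smul_mem_powerFiltration hv
    have hKπ : ∀ i γ, ∀ v ∈ K i, subGrading π L₀ hL₀ γ v ∈ K i := by
      intro i γ v hv
      rw [hK] at hv ⊢
      have hpow : ∀ (i : ℕ) γ l, t 0 ^ i • π γ l = π (γ + i • c 0) (t 0 ^ i • l) := by
        intro i
        induction i with
        | zero => simp
        | succ i ih =>
          intro γ l
          rw [pow_succ', mul_smul, mul_smul, ih, hc, succ_nsmul, add_assoc]
      change t 0 ^ i • π γ v ∈ _
      rw [hpow]
      exact hF _ _ _ hv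
    -- The K i increase inside a Noetherian module, so only finitely many different factors L₀ / K i
    -- occur and a single g suffices for all of them.
    obtain ⟨i₀, hi₀⟩ := monotone_stabilizes_iff_noetherian.mpr
      (isNoetherian_of_isNoetherianRing_of_finite S' L₀) ⟨K, hKmono⟩
    obtain ⟨g, hg, hfree⟩ := exists_notMem_forall_of_finite (q := q) (Finset.range (i₀ + 1))
      (C := fun i g => ∀ γ, FreeAt g
        (LinearMap.range (quotGrading (subGrading π L₀ hL₀) (K i) (hKπ i) γ)))
      (fun i g g' h hX γ => (hX γ).of_dvd h) fun i _ => by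
        refine ih ht' ((hπ.sub L₀ hL₀).quot (K i) (hKπ i)) (c := fun i => c i.succ) ?_
        intro j γ v
        obtain ⟨v, rfl⟩ := (K i).mkQ_surjective v
        rw [quotGrading_mk, ← (K i).mkQ.map_smul, ← (K i).mkQ.map_smul, quotGrading_mk]
        congr 1
        exact Subtype.ext (hc j.succ γ v)
    refine ⟨g, hg, exists_freeAt_powerFiltration hπ (hc 0) hL₀ hF htop K hK hKπ fun i γ => ?_⟩
    by_cases hi : i ≤ i₀
    · exact hfree i (Finset.mem_range.mpr (Nat.lt_succ_of_le hi)) γ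
    · have hKi : K i₀ = K i := hi₀ i (not_le.mp hi).le
      have hf := hfree i₀ (Finset.self_mem_range_succ i₀) γ
      have h2 : ∀ (K' : Submodule S' L₀) (hK' : ∀ γ, ∀ v ∈ K', subGrading π L₀ hL₀ γ v ∈ K'),
          K i₀ = K' → FreeAt g (LinearMap.range
            (quotGrading (subGrading π L₀ hL₀) K' hK' γ)) := by
        rintro _ _ rfl
        exact hf
      exact h2 _ _ hKi

end GenericFreeness

end

end GradedLocalCohomology

namespace GradedLocalCohomology

noncomputable section

/-! ### Flatness in exact sequences and colimits, and base change of homology. -/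

section FlatExact

variable {Q X Y Z : Type*} [CommRing Q] [AddCommGroup X] [AddCommGroup Y] [AddCommGroup Z]
  [Module Q X] [Module Q Y] [Module Q Z] {f : X →ₗ[Q] Y} {g : Y →ₗ[Q] Z}

theorem rTensor_lTensor_comm (I : Ideal Q) (f : X →ₗ[Q] Y) (z : I ⊗[Q] X) :
    I.subtype.rTensor Y (f.lTensor I z) = f.lTensor Q (I.subtype.rTensor X z) := by
  rw [← LinearMap.comp_apply, ← LinearMap.comp_apply, LinearMap.rTensor_comp_lTensor,
    LinearMap.lTensor_comp_rTensor]

/-- Flatness of Z keeps I ⊗ X → I ⊗ Y injective, and flatness of Y keeps I ⊗ Y → Y injective; their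
composite factors through I ⊗ X → X. -/
theorem flat_of_exact_left (hf : Function.Injective f) (hg : Function.Surjective g)
    (hfg : Function.Exact f g) [Module.Flat Q Y] [Module.Flat Q Z] : Module.Flat Q X := by
  rw [Module.Flat.iff_rTensor_injective']
  intro I
  have h1 : Function.Injective (f.lTensor I) :=
    LinearMap.lTensor_injective_of_exact_of_flat g hg f hf hfg I
  have h2 : Function.Injective (I.subtype.rTensor Y) :=
    Module.Flat.iff_rTensor_injective'.mp ‹_› I
  refine Function.Injective.of_comp (f := f.lTensor Q) fun a b hab => h1 (h2 ?_)
  rw [rTensor_lTensor_comm, rTensor_lTensor_comm]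
  exact hab

theorem flat_of_exact_middle (hf : Function.Injective f) (hg : Function.Surjective g)
    (hfg : Function.Exact f g) [Module.Flat Q X] [Module.Flat Q Z] : Module.Flat Q Y := by
  rw [Module.Flat.iff_rTensor_injective']
  intro I
  rw [injective_iff_map_eq_zero]
  intro z hz
  have h1 : Function.Injective (I.subtype.rTensor X) := Module.Flat.iff_rTensor_injective'.mp ‹_› I
  have h2 : Function.Injective (I.subtype.rTensor Z) := Module.Flat.iff_rTensor_injective'.mp ‹_› I
  have h3 : Function.Injective (f.lTensor Q) :=
    LinearMap.lTensor_injective_of_exact_of_flat g hg f hf hfg Q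
  obtain ⟨w, rfl⟩ := (lTensor_exact I hfg hg z).mp (h2 (by
    rw [rTensor_lTensor_comm, hz, map_zero, map_zero]))
  rw [rTensor_lTensor_comm] at hz
  rw [h1 (h3 (hz.trans (by rw [map_zero, map_zero]))), map_zero]

end FlatExact

section FlatOver

variable {A : Type*} [CommRing A] (Q : Type*) [CommRing Q] [Algebra A Q] [Module.Flat A Q]
  {X Y Z : Type*} [AddCommGroup X] [AddCommGroup Y] [AddCommGroup Z] [Module A X] [Module A Y]
  [Module A Z] {f : X →ₗ[A] Y} {g : Y →ₗ[A] Z}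

/-- The base change of `X` to `Q` is flat. -/
def FlatOver (A : Type*) [CommRing A] (Q : Type*) [CommRing Q] [Algebra A Q] (X : Type*)
    [AddCommGroup X] [Module A X] : Prop :=
  Module.Flat Q (Q ⊗[A] X)

omit [Module.Flat A Q] in
variable {Q} in
theorem FlatOver.of_equiv (h : FlatOver A Q X) (e : X ≃ₗ[A] Y) : FlatOver A Q Y := by
  have : Module.Flat Q (Q ⊗[A] X) := h
  exact Module.Flat.of_linearEquiv (e.baseChange A Q X Y).symm

theorem flatOver_left (hf : Function.Injective f) (hg : Function.Surjective g)
    (hfg : Function.Exact f g) (hY : FlatOver A Q Y) (hZ : FlatOver A Q Z) : FlatOver A Q X := by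
  have : Module.Flat Q (Q ⊗[A] Y) := hY
  have : Module.Flat Q (Q ⊗[A] Z) := hZ
  exact flat_of_exact_left (f := f.baseChange Q) (g := g.baseChange Q)
    (Module.Flat.lTensor_preserves_injective_linearMap _ hf) (LinearMap.lTensor_surjective Q hg)
    (lTensor_exact Q hfg hg)

theorem flatOver_middle (hf : Function.Injective f) (hg : Function.Surjective g)
    (hfg : Function.Exact f g) (hX : FlatOver A Q X) (hZ : FlatOver A Q Z) : FlatOver A Q Y := by
  have : Module.Flat Q (Q ⊗[A] X) := hX
  have : Module.Flat Q (Q ⊗[A] Z) := hZ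
  exact flat_of_exact_middle (f := f.baseChange Q) (g := g.baseChange Q)
    (Module.Flat.lTensor_preserves_injective_linearMap _ hf) (LinearMap.lTensor_surjective Q hg)
    (lTensor_exact Q hfg hg)

/-- As K is a Q-algebra, base change to K goes through Q. The first step is exact because Q is flat
over A, the second preserves the injection because the cokernel Q ⊗ Z is flat over Q. -/
theorem baseChange_injective_of_flatOver (K : Type*) [CommRing K] [Algebra A K] [Algebra Q K]
    [IsScalarTower A Q K] (hf : Function.Injective f) (hg : Function.Surjective g)
    (hfg : Function.Exact f g) (hZ : FlatOver A Q Z) : Function.Injective (f.baseChange K) := by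
  have : Module.Flat Q (Q ⊗[A] Z) := hZ
  have h1 : Function.Injective ((f.baseChange Q).lTensor K) :=
    LinearMap.lTensor_injective_of_exact_of_flat (g.baseChange Q)
      (LinearMap.lTensor_surjective Q hg) (f.baseChange Q)
      (Module.Flat.lTensor_preserves_injective_linearMap _ hf) (lTensor_exact Q hfg hg) K
  have h2 : ∀ z, f.baseChange K (AlgebraTensorModule.cancelBaseChange A Q K K X z) =
      AlgebraTensorModule.cancelBaseChange A Q K K Y ((f.baseChange Q).lTensor K z) := by
    intro z
    induction z using TensorProduct.induction_on with
    | zero => simp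
    | add a b ha hb => simp only [map_add, ha, hb]
    | tmul k z =>
      induction z using TensorProduct.induction_on with
      | zero => simp
      | add a b ha hb => simp only [tmul_add, map_add, ha, hb]
      | tmul q x => simp
  intro a b hab
  obtain ⟨a, rfl⟩ := (AlgebraTensorModule.cancelBaseChange A Q K K X).surjective a
  obtain ⟨b, rfl⟩ := (AlgebraTensorModule.cancelBaseChange A Q K K X).surjective b
  rw [h2, h2] at hab
  rw [h1 ((AlgebraTensorModule.cancelBaseChange A Q K K Y).injective hab)]

/-- Y / B is an extension of the range of β by the homology ker β / B, and the range is flat as the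
kernel of W → W / range β. This is the step of a descending induction along a complex. -/
theorem flatOver_quotient {Y W : Type*} [AddCommGroup Y] [AddCommGroup W] [Module A Y] [Module A W]
    {β : Y →ₗ[A] W} {B : Submodule A Y} (hB : B ≤ LinearMap.ker β)
    (hH : FlatOver A Q (LinearMap.ker β ⧸ B.submoduleOf (LinearMap.ker β)))
    (hW : FlatOver A Q W) (hWβ : FlatOver A Q (W ⧸ LinearMap.range β)) : FlatOver A Q (Y ⧸ B) := by
  have hI : FlatOver A Q (LinearMap.range β) :=
    flatOver_left Q (LinearMap.range β).subtype_injective (LinearMap.range β).mkQ_surjective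
      (LinearMap.exact_subtype_mkQ _) hW hWβ
  let i : (LinearMap.ker β ⧸ B.submoduleOf (LinearMap.ker β)) →ₗ[A] Y ⧸ B :=
    (B.submoduleOf (LinearMap.ker β)).mapQ B (LinearMap.ker β).subtype le_rfl
  let b : (Y ⧸ B) →ₗ[A] LinearMap.range β := B.liftQ β.rangeRestrict (by
    rwa [LinearMap.ker_rangeRestrict])
  refine flatOver_middle Q (f := i) (g := b) ?_ ?_ ?_ hH hI
  · rw [injective_iff_map_eq_zero]
    intro z hz
    obtain ⟨z, rfl⟩ := Submodule.mkQ_surjective _ z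
    exact (Submodule.Quotient.mk_eq_zero _).mpr
      ((Submodule.Quotient.mk_eq_zero B (x := (z : Y))).mp hz)
  · rintro ⟨_, y, rfl⟩
    exact ⟨B.mkQ y, rfl⟩
  · intro y
    obtain ⟨y, rfl⟩ := B.mkQ_surjective y
    constructor
    · intro hy
      have hy' : β y = 0 := congrArg Subtype.val hy
      exact ⟨Submodule.Quotient.mk ⟨y, hy'⟩, rfl⟩
    · rintro ⟨z, hz⟩
      obtain ⟨z, rfl⟩ := Submodule.mkQ_surjective _ z
      rw [← hz]
      exact Subtype.ext z.2

/-- Homology commutes with base change under flatness assumptions on the target of the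
differential and its cokernel. -/
theorem nonempty_equiv_homology_baseChange (K : Type*) [CommRing K] [Algebra A K] [Algebra Q K]
    [IsScalarTower A Q K] {Y W Y' W' : Type*} [AddCommGroup Y] [AddCommGroup W] [Module A Y]
    [Module A W] [AddCommGroup Y'] [AddCommGroup W'] [Module A Y'] [Module K Y']
    [IsScalarTower A K Y'] [Module A W'] [Module K W'] [IsScalarTower A K W']
    {β : Y →ₗ[A] W} {β' : Y' →ₗ[K] W'} {f : Y →ₗ[A] Y'} {h : W →ₗ[A] W'}
    (hf : IsBaseChange K f) (hh : IsBaseChange K h) (hcomm : ∀ y, β' (f y) = h (β y))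
    {B : Submodule A Y} (hB : B ≤ LinearMap.ker β) {B' : Submodule K Y'}
    (hB' : B' = Submodule.span K (f '' B))
    (hW : FlatOver A Q W) (hWβ : FlatOver A Q (W ⧸ LinearMap.range β)) :
    Nonempty ((K ⊗[A] (LinearMap.ker β ⧸ B.submoduleOf (LinearMap.ker β))) ≃ₗ[K]
      (LinearMap.ker β' ⧸ B'.submoduleOf (LinearMap.ker β'))) := by
  have hI : FlatOver A Q (LinearMap.range β) :=
    flatOver_left Q (LinearMap.range β).subtype_injective (LinearMap.range β).mkQ_surjective
      (LinearMap.exact_subtype_mkQ _) hW hWβ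
  -- Flatness of W / range β keeps the range inside W after base change to K, and flatness of the
  -- range keeps the cycles inside Y. Hence forming cycles commutes with the base change, and only
  -- the boundaries remain to be compared.
  have hIinj : Function.Injective ((LinearMap.range β).subtype.baseChange K) :=
    baseChange_injective_of_flatOver Q K (LinearMap.range β).subtype_injective
      (LinearMap.range β).mkQ_surjective (LinearMap.exact_subtype_mkQ _) hWβ
  have hexZ : Function.Exact (LinearMap.ker β).subtype β.rangeRestrict := by
    rw [LinearMap.exact_iff, LinearMap.ker_rangeRestrict, Submodule.range_subtype]
  have hZinj : Function.Injective ((LinearMap.ker β).subtype.baseChange K) :=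
    baseChange_injective_of_flatOver Q K (LinearMap.ker β).subtype_injective
      β.surjective_rangeRestrict hexZ hI
  have hβ : ∀ w, β' (hf.equiv w) = hh.equiv (β.baseChange K w) := by
    intro w
    induction w using TensorProduct.induction_on with
    | zero => simp
    | add a b ha hb => simp only [map_add, ha, hb]
    | tmul k y =>
      rw [hf.equiv_tmul, LinearMap.baseChange_tmul, hh.equiv_tmul, map_smul, hcomm]
  have hιmem : ∀ z, hf.equiv ((LinearMap.ker β).subtype.baseChange K z) ∈ LinearMap.ker β' := by
    intro z
    rw [LinearMap.mem_ker, hβ, ← LinearMap.comp_apply (f := β.baseChange K),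
      ← LinearMap.baseChange_comp, LinearMap.comp_ker_subtype, LinearMap.baseChange_zero,
      LinearMap.zero_apply, map_zero]
  let ι : K ⊗[A] LinearMap.ker β →ₗ[K] LinearMap.ker β' :=
    (hf.equiv.toLinearMap ∘ₗ (LinearMap.ker β).subtype.baseChange K).codRestrict _ hιmem
  have hιcoe : ∀ z, (ι z : Y') = hf.equiv ((LinearMap.ker β).subtype.baseChange K z) :=
    fun _ => rfl
  have hιinj : Function.Injective ι := fun a b hab => by
    have hab' := congrArg Subtype.val hab
    rw [hιcoe, hιcoe] at hab'
    exact hZinj (hf.equiv.injective hab')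
  have hιsurj : Function.Surjective ι := by
    rintro ⟨y', hy'⟩
    obtain ⟨w, rfl⟩ := hf.equiv.surjective y'
    rw [LinearMap.mem_ker, hβ] at hy'
    have h1 : β.rangeRestrict.baseChange K w = 0 := by
      refine hIinj (hh.equiv.injective ?_)
      rw [map_zero, map_zero, ← hy', ← LinearMap.comp_apply (f := Submodule.subtype _ |>.baseChange K),
        ← LinearMap.baseChange_comp]
      rfl
    obtain ⟨z, rfl⟩ := (lTensor_exact K hexZ β.surjective_rangeRestrict w).mp h1
    exact ⟨z, rfl⟩
  set BZ := B.submoduleOf (LinearMap.ker β)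
  have hBspan : ∀ y' ∈ B', ∃ u, hf.equiv ((LinearMap.ker β).subtype.baseChange K
      (BZ.subtype.baseChange K u)) = y' := by
    intro y' hy'
    rw [hB'] at hy'
    induction hy' using Submodule.span_induction with
    | mem y' hy' =>
      obtain ⟨y, hy, rfl⟩ := hy'
      refine ⟨1 ⊗ₜ ⟨⟨y, hB hy⟩, hy⟩, ?_⟩
      rw [LinearMap.baseChange_tmul, LinearMap.baseChange_tmul, hf.equiv_tmul, one_smul]
      rfl
    | zero => exact ⟨0, by simp⟩
    | add a b _ _ ha hb =>
      obtain ⟨u, rfl⟩ := ha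
      obtain ⟨v, rfl⟩ := hb
      exact ⟨u + v, by simp only [map_add]⟩
    | smul k a _ ha =>
      obtain ⟨u, rfl⟩ := ha
      exact ⟨k • u, by simp only [map_smul]⟩
  refine ⟨equivOfKerEq (BZ.mkQ.baseChange K) (Submodule.mkQ _ ∘ₗ ι)
    (LinearMap.lTensor_surjective K BZ.mkQ_surjective)
    ((Submodule.mkQ_surjective _).comp hιsurj) ?_⟩
  ext z
  have hex : BZ.mkQ.baseChange K z = 0 ↔ ∃ u, BZ.subtype.baseChange K u = z :=
    lTensor_exact K (LinearMap.exact_subtype_mkQ BZ) BZ.mkQ_surjective z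
  rw [LinearMap.mem_ker, hex, LinearMap.mem_ker, LinearMap.comp_apply, Submodule.mkQ_apply,
    Submodule.Quotient.mk_eq_zero]
  change _ ↔ hf.equiv ((LinearMap.ker β).subtype.baseChange K z) ∈ B'
  constructor
  · rintro ⟨u, rfl⟩
    clear hex
    induction u using TensorProduct.induction_on with
    | zero => simp
    | add a b ha hb => simp only [map_add]; exact add_mem ha hb
    | tmul k b =>
      rw [LinearMap.baseChange_tmul, LinearMap.baseChange_tmul, hf.equiv_tmul, hB']
      exact Submodule.smul_mem _ _ (Submodule.subset_span ⟨_, b.2, rfl⟩)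
  · intro hz
    obtain ⟨u, hu⟩ := hBspan _ hz
    exact ⟨u, hZinj (hf.equiv.injective hu)⟩

end FlatOver

section Colimit

variable {A : Type*} [CommRing A] {N : ℕ → Type*} [∀ k, AddCommGroup (N k)] [∀ k, Module A (N k)]
  {G : Type*} [AddCommGroup G] [Module A G]

/-- `G` is the colimit of the sequence of the modules `N k`. -/
structure IsSequentialColimit (φ : ∀ k, N k →ₗ[A] G) (ν : ∀ k k', N k →ₗ[A] N k') : Prop where
  comp_eq : ∀ k k' n, k ≤ k' → φ k' (ν k k' n) = φ k n
  exists_eq : ∀ z, ∃ k n, φ k n = z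
  eq_zero : ∀ k n, φ k n = 0 → ∃ k₀, ∀ k' ≥ k₀, ν k k' n = 0

variable {φ : ∀ k, N k →ₗ[A] G} {ν : ∀ k k', N k →ₗ[A] N k'} (h : IsSequentialColimit φ ν)
  (Q : Type*) [CommRing Q] [Algebra A Q]
include h

namespace IsSequentialColimit

theorem baseChange_comp {k k' : ℕ} (hk : k ≤ k') (u : Q ⊗[A] N k) :
    (φ k').baseChange Q ((ν k k').baseChange Q u) = (φ k).baseChange Q u := by
  rw [← LinearMap.comp_apply, ← LinearMap.baseChange_comp,
    show φ k' ∘ₗ ν k k' = φ k from LinearMap.ext fun n => h.comp_eq k k' n hk]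

theorem exists_baseChange_eq (w : Q ⊗[A] G) : ∃ k₀, ∀ k ≥ k₀, ∃ u, (φ k).baseChange Q u = w := by
  induction w using TensorProduct.induction_on with
  | zero => exact ⟨0, fun k _ => ⟨0, map_zero _⟩⟩
  | add a b ha hb =>
    obtain ⟨k, hk⟩ := ha
    obtain ⟨k', hk'⟩ := hb
    refine ⟨max k k', fun l hl => ?_⟩
    obtain ⟨u, rfl⟩ := hk l (le_of_max_le_left hl)
    obtain ⟨v, rfl⟩ := hk' l (le_of_max_le_right hl)
    exact ⟨u + v, map_add _ _ _⟩
  | tmul q z =>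
    obtain ⟨k, n, rfl⟩ := h.exists_eq z
    exact ⟨k, fun l hl => ⟨q ⊗ₜ ν k l n, by rw [LinearMap.baseChange_tmul, h.comp_eq k l n hl]⟩⟩

theorem baseChange_eq_zero [Module.Flat A Q] {k : ℕ} {u : Q ⊗[A] N k}
    (hu : (φ k).baseChange Q u = 0) : ∃ k₀, ∀ k' ≥ k₀, (ν k k').baseChange Q u = 0 := by
  obtain ⟨v, rfl⟩ := (Module.Flat.lTensor_exact Q
    (LinearMap.exact_subtype_ker_map (φ k)) u).mp hu
  clear hu
  induction v using TensorProduct.induction_on with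
  | zero => exact ⟨0, by simp⟩
  | add a b ha hb =>
    obtain ⟨k, hk⟩ := ha
    obtain ⟨k', hk'⟩ := hb
    refine ⟨max k k', fun l hl => ?_⟩
    rw [map_add, map_add, hk l (le_of_max_le_left hl), hk' l (le_of_max_le_right hl), add_zero]
  | tmul q n =>
    obtain ⟨k₀, hk₀⟩ := h.eq_zero k n n.2
    refine ⟨k₀, fun k' hk' => ?_⟩
    rw [LinearMap.lTensor_tmul, LinearMap.baseChange_tmul]
    have := hk₀ k' hk'
    rw [Submodule.subtype_apply, this, tmul_zero]

/-- Equational criterion: a relation in the colimit already holds at a finite stage, where flatness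
trivializes it. Flatness of Q over A ensures that an element of Q ⊗ N k that dies in the colimit
dies at a finite stage. -/
theorem flatOver [Module.Flat A Q] (hN : ∀ k, FlatOver A Q (N k)) : FlatOver A Q G := by
  refine Module.Flat.of_forall_isTrivialRelation fun {l f w} hfw => ?_
  choose k₀ hk₀ using fun i => h.exists_baseChange_eq Q (w i)
  set k := Finset.univ.sup k₀
  have h1 : ∀ i, ∃ u, (φ k).baseChange Q u = w i := fun i =>
    hk₀ i k (Finset.le_sup (Finset.mem_univ i))
  choose u hu using h1
  have h2 : (φ k).baseChange Q (∑ i, f i • u i) = 0 := by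
    rw [map_sum, ← hfw]
    exact Finset.sum_congr rfl fun i _ => by rw [map_smul, hu]
  obtain ⟨k₁, hk₁⟩ := h.baseChange_eq_zero Q h2
  have h3 := hk₁ (max k k₁) (le_max_right _ _)
  rw [map_sum] at h3
  simp only [map_smul] at h3
  have : Module.Flat Q (Q ⊗[A] N (max k k₁)) := hN _
  obtain ⟨m, a, y, hy, ha⟩ := Module.Flat.isTrivialRelation_of_sum_smul_eq_zero h3
  refine ⟨m, a, fun j => (φ (max k k₁)).baseChange Q (y j), fun i => ?_, ha⟩
  rw [← hu i, ← h.baseChange_comp Q (le_max_left k k₁)]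
  refine (congrArg _ (hy i)).trans ?_
  rw [map_sum]
  exact Finset.sum_congr rfl fun j _ => map_smul _ _ _

end IsSequentialColimit

end Colimit

end

end GradedLocalCohomology

namespace GradedLocalCohomology

noncomputable section

/-! ### Base change for bounded flat complexes, and flatness of the Čech pieces. -/

section SubCohomologyBaseChange

variable {A : Type*} [CommRing A] {C : ℕ → Type*} [∀ p, AddCommGroup (C p)] [∀ p, Module A (C p)]
  {D : ∀ p, C p →ₗ[A] C (p + 1)} {V : ∀ p, Submodule A (C p)}

/-- The differential of a subcomplex. -/
def subDifferential (hV : ∀ p, ∀ c ∈ V p, D p c ∈ V (p + 1)) (p : ℕ) : V p →ₗ[A] V (p + 1) :=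
  (D p).restrict (hV p)

/-- The coboundaries as a submodule of the subcomplex. -/
def subBoundary (D : ∀ p, C p →ₗ[A] C (p + 1)) (V : ∀ p, Submodule A (C p)) (p : ℕ) :
    Submodule A (V p) :=
  (subCoboundaries D V p).submoduleOf (V p)

theorem subBoundary_succ (hV : ∀ p, ∀ c ∈ V p, D p c ∈ V (p + 1)) (p : ℕ) :
    subBoundary D V (p + 1) = LinearMap.range (subDifferential hV p) := by
  ext y
  constructor
  · rintro ⟨c, hc, hy⟩
    exact ⟨⟨c, hc⟩, Subtype.ext hy⟩
  · rintro ⟨c, rfl⟩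
    exact ⟨c, c.2, rfl⟩

theorem subBoundary_le (hV : ∀ p, ∀ c ∈ V p, D p c ∈ V (p + 1))
    (hDD : ∀ p, ∀ c ∈ V p, D (p + 1) (D p c) = 0) (p : ℕ) :
    subBoundary D V p ≤ LinearMap.ker (subDifferential hV p) := by
  cases p with
  | zero =>
    rintro y hy
    have hy' : (y : C 0) = 0 := hy
    rw [LinearMap.mem_ker, show y = 0 from Subtype.ext hy', map_zero]
  | succ p =>
    rw [subBoundary_succ hV]
    rintro _ ⟨c, rfl⟩
    exact Subtype.ext (hDD p c c.2)

/-- The cohomology of a subcomplex computed in the subcomplex. -/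
def SubCohomology.equivRestrict (hV : ∀ p, ∀ c ∈ V p, D p c ∈ V (p + 1)) (p : ℕ) :
    (LinearMap.ker (subDifferential hV p) ⧸
      (subBoundary D V p).submoduleOf (LinearMap.ker (subDifferential hV p))) ≃ₗ[A]
      SubCohomology D V p :=
  let e : LinearMap.ker (subDifferential hV p) →ₗ[A] subCocycles D V p :=
    LinearMap.codRestrict _ ((V p).subtype ∘ₗ Submodule.subtype _) fun c =>
      ⟨congrArg Subtype.val c.2, c.1.2⟩
  equivOfKerEq (Submodule.mkQ _) (Submodule.mkQ _ ∘ₗ e) (Submodule.mkQ_surjective _)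
    ((Submodule.mkQ_surjective _).comp fun c =>
      ⟨⟨⟨c, c.2.2⟩, Subtype.ext c.2.1⟩, rfl⟩) (by
    ext c
    rw [LinearMap.mem_ker, LinearMap.mem_ker, LinearMap.comp_apply, Submodule.mkQ_apply,
      Submodule.mkQ_apply, Submodule.Quotient.mk_eq_zero, Submodule.Quotient.mk_eq_zero]
    rfl)

variable (Q : Type*) [CommRing Q] [Algebra A Q] [Module.Flat A Q]

/-- Descending induction from beyond r, where the complex is zero: flat terms and flat cohomology
make V p modulo its boundaries flat as soon as this holds in degree p + 1. -/
theorem flatOver_quotient_subBoundary (hV : ∀ p, ∀ c ∈ V p, D p c ∈ V (p + 1))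
    (hDD : ∀ p, ∀ c ∈ V p, D (p + 1) (D p c) = 0) {r : ℕ} (hr : ∀ p > r, V p = ⊥)
    (hVflat : ∀ p, FlatOver A Q (V p)) (hH : ∀ p, FlatOver A Q (SubCohomology D V p)) (p : ℕ) :
    FlatOver A Q (V p ⧸ subBoundary D V p) := by
  have key : ∀ n p, r < p + n → FlatOver A Q (V p ⧸ subBoundary D V p) := by
    intro n
    induction n with
    | zero =>
      intro p hp
      have : Subsingleton (V p) := by
        rw [hr p hp]
        infer_instance
      have : Subsingleton (Q ⊗[A] (V p ⧸ subBoundary D V p)) := inferInstance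
      have : Module.Free Q (Q ⊗[A] (V p ⧸ subBoundary D V p)) := Module.Free.of_subsingleton _ _
      exact Module.Flat.of_free
    | succ n ih =>
      intro p hp
      have h1 := ih (p + 1) (by lia)
      rw [subBoundary_succ hV] at h1
      exact flatOver_quotient Q (subBoundary_le hV hDD p)
        ((hH p).of_equiv (SubCohomology.equivRestrict hV p).symm) (hVflat (p + 1)) h1
  exact key (r + 1) p (by lia)

/-- Base change of the cohomology of a bounded complex of flat modules with flat cohomology. -/
theorem SubCohomology.nonempty_baseChange_equiv (hV : ∀ p, ∀ c ∈ V p, D p c ∈ V (p + 1))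
    (hDD : ∀ p, ∀ c ∈ V p, D (p + 1) (D p c) = 0) {r : ℕ} (hr : ∀ p > r, V p = ⊥)
    (hVflat : ∀ p, FlatOver A Q (V p)) (hH : ∀ p, FlatOver A Q (SubCohomology D V p))
    (K : Type*) [CommRing K] [Algebra A K] [Algebra Q K] [IsScalarTower A Q K]
    {C' : ℕ → Type*} [∀ p, AddCommGroup (C' p)] [∀ p, Module K (C' p)] [∀ p, Module A (C' p)]
    [∀ p, IsScalarTower A K (C' p)]
    {D' : ∀ p, C' p →ₗ[K] C' (p + 1)} {V' : ∀ p, Submodule K (C' p)}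
    (hV' : ∀ p, ∀ c ∈ V' p, D' p c ∈ V' (p + 1)) {F : ∀ p, V p →ₗ[A] V' p}
    (hF : ∀ p, IsBaseChange K (F p))
    (hcomm : ∀ p c, subDifferential hV' p (F p c) = F (p + 1) (subDifferential hV p c)) (p : ℕ) :
    Nonempty ((K ⊗[A] SubCohomology D V p) ≃ₗ[K] SubCohomology D' V' p) := by
  have h1 := flatOver_quotient_subBoundary Q hV hDD hr hVflat hH (p + 1)
  rw [subBoundary_succ hV] at h1
  have hspan : subBoundary D' V' p = Submodule.span K (F p '' subBoundary D V p) := by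
    cases p with
    | zero =>
      have h0 : (subBoundary D V 0 : Set (V 0)) = {0} := by
        ext y
        exact ⟨fun h => Subtype.ext h, fun h => congrArg Subtype.val h⟩
      rw [h0, Set.image_singleton, map_zero, Submodule.span_zero_singleton, eq_bot_iff]
      exact fun y hy => Subtype.ext hy
    | succ p =>
      rw [subBoundary_succ hV, subBoundary_succ hV']
      apply le_antisymm
      · rintro _ ⟨c, rfl⟩
        obtain ⟨u, rfl⟩ := (hF p).equiv.surjective c
        induction u using TensorProduct.induction_on with
        | zero => rw [map_zero, map_zero]; exact zero_mem _
        | add a b ha hb => rw [map_add, map_add]; exact add_mem ha hb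
        | tmul k c =>
          rw [(hF p).equiv_tmul, map_smul, hcomm]
          exact Submodule.smul_mem _ _ (Submodule.subset_span ⟨_, ⟨c, rfl⟩, rfl⟩)
      · rw [Submodule.span_le]
        rintro _ ⟨_, ⟨c, rfl⟩, rfl⟩
        exact ⟨F p c, hcomm p c⟩
  obtain ⟨e⟩ := nonempty_equiv_homology_baseChange Q K (hF p) (hF (p + 1)) (hcomm p)
    (subBoundary_le hV hDD p) hspan (hVflat (p + 1)) h1
  exact ⟨(SubCohomology.equivRestrict hV p).symm.baseChange A K _ _ ≪≫ₗ e ≪≫ₗ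
    SubCohomology.equivRestrict hV' p⟩

end SubCohomologyBaseChange

section CechPieces

variable {A : Type*} [CommRing A] {S : Type*} [CommRing S] [Algebra A S] {r : ℕ} {x : Fin r → S}
  {N : Type*} [AddCommGroup N] [Module S N] [Module A N] [IsScalarTower A S N]
  {𝒩 : ℤ → Submodule A N} {e : Fin r → ℕ}

/-- The fractions with denominator `(∏_{i ∈ I} x i)^k`. -/
def cechFracMap (hx : RaisesDegree x e 𝒩) (d : ℤ) (I : Finset (Fin r)) (k : ℕ) :
    𝒩 (d + (k * ∑ i ∈ I, e i : ℕ)) →ₗ[A] cechFracPiece x e hx d I :=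
  ((cechFrac x N I k).restrictScalars A).restrict fun n hn => ⟨k, n, hn, rfl⟩

theorem cechFracMap_coe (hx : RaisesDegree x e 𝒩) (d : ℤ) (I : Finset (Fin r)) (k : ℕ)
    (n : 𝒩 (d + (k * ∑ i ∈ I, e i : ℕ))) :
    (cechFracMap hx d I k n : CechLocalization x N I) = cechFrac x N I k n := rfl

omit [Algebra A S] [IsScalarTower A S N] in
theorem RaisesDegree.pow_smul_mem (hx : RaisesDegree x e 𝒩) (d : ℤ) (I : Finset (Fin r))
    {k k' : ℕ} (hk : k ≤ k') {n : N} (hn : n ∈ 𝒩 (d + (k * ∑ i ∈ I, e i : ℕ))) :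
    (∏ i ∈ I, x i) ^ (k' - k) • n ∈ 𝒩 (d + (k' * ∑ i ∈ I, e i : ℕ)) := by
  obtain ⟨m, rfl⟩ := Nat.exists_eq_add_of_le hk
  rw [Nat.add_sub_cancel_left]
  convert hx.prod_pow_smul_mem I m hn using 2
  push_cast
  ring

/-- The multiplication by a power of `∏_{i ∈ I} x i`. -/
def cechShift (hx : RaisesDegree x e 𝒩) (d : ℤ) (I : Finset (Fin r)) (k k' : ℕ) :
    𝒩 (d + (k * ∑ i ∈ I, e i : ℕ)) →ₗ[A] 𝒩 (d + (k' * ∑ i ∈ I, e i : ℕ)) :=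
  if hk : k ≤ k' then ((LinearMap.lsmul S N ((∏ i ∈ I, x i) ^ (k' - k))).restrictScalars A).restrict
    fun _ hn => hx.pow_smul_mem d I hk hn else 0

theorem cechShift_coe (hx : RaisesDegree x e 𝒩) (d : ℤ) (I : Finset (Fin r)) {k k' : ℕ}
    (hk : k ≤ k') (n : 𝒩 (d + (k * ∑ i ∈ I, e i : ℕ))) :
    (cechShift hx d I k k' n : N) = (∏ i ∈ I, x i) ^ (k' - k) • (n : N) := by
  rw [cechShift, dif_pos hk]
  rfl

/-- A graded piece of a localization is the colimit of graded pieces of N along multiplication by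
the product of the x i. Through this description flatness and base change pass from the pieces of N
to those of N_{x_I}. -/
theorem isSequentialColimit_cechFracPiece (hx : RaisesDegree x e 𝒩) (d : ℤ) (I : Finset (Fin r)) :
    IsSequentialColimit (cechFracMap hx d I) (cechShift hx d I) where
  comp_eq k k' n hk := by
    refine Subtype.ext ?_
    rw [cechFracMap_coe, cechFracMap_coe, cechShift_coe hx d I hk]
    obtain ⟨m, rfl⟩ := Nat.exists_eq_add_of_le hk
    rw [Nat.add_sub_cancel_left, cechFrac_shift]
  exists_eq := by
    rintro ⟨_, k, n, hn, rfl⟩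
    exact ⟨k, ⟨n, hn⟩, rfl⟩
  eq_zero k n hn := by
    obtain ⟨m, hm⟩ := (cechFrac_eq_zero x).mp (congrArg Subtype.val hn)
    rw [Submodule.subtype_apply] at hm
    refine ⟨k + m, fun k' hk' => Subtype.ext ?_⟩
    rw [cechShift_coe hx d I (by lia), show k' - k = (k' - k - m) + m by lia, pow_add, mul_smul, hm,
      smul_zero]
    rfl

theorem flatOver_cechFracPiece (Q : Type*) [CommRing Q] [Algebra A Q] [Module.Flat A Q]
    (hx : RaisesDegree x e 𝒩) (h𝒩 : ∀ d, FlatOver A Q (𝒩 d)) (d : ℤ) (I : Finset (Fin r)) :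
    FlatOver A Q (cechFracPiece x e hx d I) :=
  (isSequentialColimit_cechFracPiece hx d I).flatOver Q fun _ => h𝒩 _

theorem flatOver_pi (Q : Type*) [CommRing Q] [Algebra A Q] {ι : Type*} [Finite ι] {G : ι → Type*}
    [∀ i, AddCommGroup (G i)] [∀ i, Module A (G i)] (hG : ∀ i, FlatOver A Q (G i)) :
    FlatOver A Q (∀ i, G i) := by
  classical
  have := Fintype.ofFinite ι
  have : ∀ i, Module.Flat Q (Q ⊗[A] G i) := hG
  have : Module.Flat Q (∀ i, Q ⊗[A] G i) :=
    Module.Flat.of_linearEquiv (DirectSum.linearEquivFunOnFintype Q ι fun i => Q ⊗[A] G i).symm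
  exact Module.Flat.of_linearEquiv (TensorProduct.piRight A Q Q G)

/-- The product of a family of submodules. -/
def submodulePiEquiv {ι : Type*} {G : ι → Type*} [∀ i, AddCommGroup (G i)] [∀ i, Module A (G i)]
    (V : ∀ i, Submodule A (G i)) : Submodule.pi Set.univ V ≃ₗ[A] (∀ i, V i) where
  toFun c i := ⟨c.1 i, c.2 i trivial⟩
  invFun c := ⟨fun i => (c i).1, fun i _ => (c i).2⟩
  map_add' _ _ := rfl
  map_smul' _ _ := rfl

theorem flatOver_cechCochainPiece (Q : Type*) [CommRing Q] [Algebra A Q] [Module.Flat A Q]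
    (hx : RaisesDegree x e 𝒩) (h𝒩 : ∀ d, FlatOver A Q (𝒩 d)) (p : ℕ) (d : ℤ) :
    FlatOver A Q (cechCochainPiece x hx p d) := by
  have h1 := flatOver_pi Q fun I : {I : Finset (Fin r) // I.card = p} =>
    flatOver_cechFracPiece Q hx h𝒩 d I.1
  have e1 := submodulePiEquiv fun I : {I : Finset (Fin r) // I.card = p} =>
    cechFracPiece x e hx d I.1
  have h2 := h1.of_equiv e1.symm
  exact h2

end CechPieces

end

end GradedLocalCohomology

namespace GradedLocalCohomology

noncomputable section

/-! ### Base change maps of Čech complexes. -/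

section PieceBaseChange

variable {A : Type*} [CommRing A] {K : Type*} [CommRing K] [Algebra A K]
  {S S' : Type*} [CommRing S] [CommRing S'] [Algebra A S] [Algebra A S'] [Algebra K S']
  {N N' : Type*} [AddCommGroup N] [AddCommGroup N'] [Module S N] [Module S' N']
  [Module A N] [Module A N'] [Module K N'] [IsScalarTower A S N] [IsScalarTower A S' N']
  [IsScalarTower K S' N'] [IsScalarTower A K N'] {r : ℕ} {x : Fin r → S} {x' : Fin r → S'}
  {e : Fin r → ℕ} {𝒩 : ℤ → Submodule A N} {𝒩' : ℤ → Submodule K N'} {f : N →ₗ[A] N'}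
  {θ : S →+* S'}

/-- The restriction of a linear map to submodules over two rings. -/
def pieceMap {X X' : Type*} [AddCommGroup X] [AddCommGroup X'] [Module A X] [Module A X']
    [Module K X'] [IsScalarTower A K X'] (f : X →ₗ[A] X') (G : Submodule A X) (G' : Submodule K X')
    (h : ∀ z ∈ G, f z ∈ G') : G →ₗ[A] G' where
  toFun z := ⟨f z, h z z.2⟩
  map_add' _ _ := Subtype.ext (map_add f _ _)
  map_smul' a z := Subtype.ext (map_smul f a z.1)

theorem IsBaseChange.of_bijective {X X' : Type*} [AddCommGroup X] [AddCommGroup X'] [Module A X]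
    [Module A X'] [Module K X'] [IsScalarTower A K X'] {f : X →ₗ[A] X'}
    (h : Function.Bijective (f.liftBaseChange K)) : IsBaseChange K f :=
  IsBaseChange.of_equiv (LinearEquiv.ofBijective _ h) fun x => by simp

instance isScalarTower_cechLocalization (I : Finset (Fin r)) :
    IsScalarTower A K (CechLocalization x' N' I) :=
  ⟨fun a k z => by
    induction z using LocalizedModule.induction_on with
    | h n w =>
      rw [LocalizedModule.smul'_mk, LocalizedModule.smul'_mk, LocalizedModule.smul'_mk, smul_assoc]⟩

/-- The compatibilities under which `f` induces base change maps of Čech complexes. -/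
structure IsCechBaseChange (K : Type*) [CommRing K] [Algebra A K] [Module K N']
    [IsScalarTower A K N'] (x : Fin r → S) (x' : Fin r → S') (θ : S →+* S')
    (𝒩 : ℤ → Submodule A N) (𝒩' : ℤ → Submodule K N') (f : N →ₗ[A] N') : Prop where
  map_x : ∀ i, θ (x i) = x' i
  map_smul : ∀ i n, f (x i • n) = x' i • f n
  map_mem : ∀ d, ∀ n ∈ 𝒩 d, f n ∈ 𝒩' d
  isBaseChange : ∀ d, IsBaseChange K (pieceMap f (𝒩 d) (𝒩' d) (map_mem d))

namespace IsCechBaseChange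

variable (h : IsCechBaseChange K x x' θ 𝒩 𝒩' f) {hx : RaisesDegree x e 𝒩}
  {hx' : RaisesDegree x' e 𝒩'}
include h

omit [Algebra A S] [Algebra A S'] [IsScalarTower A S N] [IsScalarTower A S' N'] [Algebra K S']
  [IsScalarTower K S' N'] in
theorem isCechMap : IsCechMap x x' θ (RelEmbedding.refl _) (fun I => I) f where
  map_eq I := by ext; simp
  map_x := h.map_x
  map_smul := h.map_smul

/-- The map of localizations. -/
def mapAt (I : Finset (Fin r)) : CechLocalization x N I →ₗ[A] CechLocalization x' N' I :=
  cechMapAt h.isCechMap I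

omit [Algebra K S'] [IsScalarTower K S' N'] in
theorem mapAt_cechFrac (I : Finset (Fin r)) (k : ℕ) (n : N) :
    h.mapAt I (cechFrac x N I k n) = cechFrac x' N' I k (f n) :=
  cechMapAt_cechFrac h.isCechMap I k n

omit [Algebra K S'] [IsScalarTower K S' N'] in
theorem mapAt_cechRes {I J : Finset (Fin r)} (hIJ : I ⊆ J) (z : CechLocalization x N I) :
    h.mapAt J (cechRes x N I J z) = cechRes x' N' I J (h.mapAt I z) :=
  cechMapAt_cechRes h.isCechMap hIJ z

theorem mapAt_mem {I : Finset (Fin r)} {d : ℤ} {z : CechLocalization x N I}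
    (hz : z ∈ cechFracPiece x e hx d I) : h.mapAt I z ∈ cechFracPiece x' e hx' d I := by
  obtain ⟨k, n, hn, rfl⟩ := hz
  exact ⟨k, f n, h.map_mem _ n hn, h.mapAt_cechFrac I k n⟩

/-- Tensor products commute with sequential colimits: at every stage the map is a base change by
hypothesis, and these identifications respect the transition maps. No flatness is involved. -/
theorem isBaseChange_mapAt (hx : RaisesDegree x e 𝒩) (hx' : RaisesDegree x' e 𝒩') (d : ℤ)
    (I : Finset (Fin r)) :
    IsBaseChange K (pieceMap (h.mapAt I) (cechFracPiece x e hx d I) (cechFracPiece x' e hx' d I)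
      fun _ hz => h.mapAt_mem hz) := by
  have hcol := isSequentialColimit_cechFracPiece hx d I
  set g := pieceMap (h.mapAt I) (cechFracPiece x e hx d I) (cechFracPiece x' e hx' d I)
      fun _ hz => h.mapAt_mem hz
  have h1 : ∀ k u, g.liftBaseChange K ((cechFracMap hx d I k).baseChange K u) =
      cechFracMap hx' d I k ((h.isBaseChange _).equiv u) := by
    intro k u
    induction u using TensorProduct.induction_on with
    | zero => simp only [map_zero]
    | add a b ha hb => simp only [map_add, ha, hb]
    | tmul q n =>
      rw [LinearMap.baseChange_tmul, LinearMap.liftBaseChange_tmul, (h.isBaseChange _).equiv_tmul,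
        _root_.map_smul]
      congr 1
      exact Subtype.ext (h.mapAt_cechFrac I k n)
  have h2 : ∀ k k' u, k ≤ k' → (h.isBaseChange _).equiv ((cechShift hx d I k k').baseChange K u) =
      cechShift hx' d I k k' ((h.isBaseChange _).equiv u) := by
    intro k k' u hk
    induction u using TensorProduct.induction_on with
    | zero => simp only [map_zero]
    | add a b ha hb => simp only [map_add, ha, hb]
    | tmul q n =>
      rw [LinearMap.baseChange_tmul, (h.isBaseChange _).equiv_tmul, (h.isBaseChange _).equiv_tmul,
        _root_.map_smul]
      congr 1
      refine Subtype.ext ?_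
      rw [cechShift_coe hx' d I hk]
      change f (cechShift hx d I k k' n) = _
      rw [cechShift_coe hx d I hk, h.isCechMap.map_prod_pow_smul]
      rfl
  refine IsBaseChange.of_bijective ⟨?_, ?_⟩
  · rw [injective_iff_map_eq_zero]
    intro w hw
    obtain ⟨k, hk⟩ := hcol.exists_baseChange_eq K w
    obtain ⟨u, rfl⟩ := hk k le_rfl
    rw [h1] at hw
    obtain ⟨k₀, hk₀⟩ := (isSequentialColimit_cechFracPiece hx' d I).eq_zero _ _ hw
    have h3 := hk₀ (max k k₀) (le_max_right _ _)
    rw [← h2 _ _ _ (le_max_left _ _), LinearEquiv.map_eq_zero_iff] at h3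
    rw [← hcol.baseChange_comp K (le_max_left k k₀), h3, map_zero]
  · rintro ⟨_, k, n, hn, rfl⟩
    obtain ⟨u, hu⟩ := (h.isBaseChange _).equiv.surjective ⟨n, hn⟩
    refine ⟨(cechFracMap hx d I k).baseChange K u, ?_⟩
    rw [h1, hu]
    rfl

/-- The map of cochains of cohomological degree `p` and internal degree `d`. -/
def cochainMap (hx : RaisesDegree x e 𝒩) (hx' : RaisesDegree x' e 𝒩') (p : ℕ) (d : ℤ) :
    cechCochainPiece x hx p d →ₗ[A] cechCochainPiece x' hx' p d where
  toFun c := ⟨fun I => h.mapAt I.1 (c.1 I), mem_cechCochainPiece.mpr fun I =>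
    h.mapAt_mem (mem_cechCochainPiece.mp c.2 I)⟩
  map_add' c c' := Subtype.ext (funext fun I => map_add (h.mapAt I.1) (c.1 I) (c'.1 I))
  map_smul' a c := Subtype.ext (funext fun I => _root_.map_smul (h.mapAt I.1) a (c.1 I))

theorem cochainMap_coe (p : ℕ) (d : ℤ) (c : cechCochainPiece x hx p d)
    (I : {I : Finset (Fin r) // I.card = p}) :
    (h.cochainMap hx hx' p d c).1 I = h.mapAt I.1 (c.1 I) := rfl

theorem isBaseChange_cochainMap (hx : RaisesDegree x e 𝒩) (hx' : RaisesDegree x' e 𝒩') (p : ℕ)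
    (d : ℤ) : IsBaseChange K (h.cochainMap hx hx' p d) := by
  have h1 := IsBaseChange.pi _ fun I : {I : Finset (Fin r) // I.card = p} =>
    h.isBaseChange_mapAt hx hx' d I.1
  let e₁ : (∀ I : {I : Finset (Fin r) // I.card = p}, cechFracPiece x e hx d I.1) ≃ₗ[A]
      cechCochainPiece x hx p d :=
    (submodulePiEquiv fun I : {I : Finset (Fin r) // I.card = p} =>
      cechFracPiece x e hx d I.1).symm
  let e₂ : (∀ I : {I : Finset (Fin r) // I.card = p}, cechFracPiece x' e hx' d I.1) ≃ₗ[K]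
      cechCochainPiece x' hx' p d :=
    (submodulePiEquiv fun I : {I : Finset (Fin r) // I.card = p} =>
      cechFracPiece x' e hx' d I.1).symm
  have h2 : h.cochainMap hx hx' p d ∘ₗ e₁.toLinearMap =
      (e₂.restrictScalars A).toLinearMap ∘ₗ LinearMap.pi fun I : {I : Finset (Fin r) // I.card = p} =>
        pieceMap (h.mapAt I.1) (cechFracPiece x e hx d I.1) (cechFracPiece x' e hx' d I.1)
          (fun _ hz => h.mapAt_mem hz) ∘ₗ LinearMap.proj I :=
    LinearMap.ext fun c => rfl
  exact (IsBaseChange.iff_of_equiv_comm e₁ e₂ h2).mp h1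

theorem cochainMap_cechD (p : ℕ) (d : ℤ) (c : cechCochainPiece x hx p d) :
    cechD x' N' p (h.cochainMap hx hx' p d c).1 =
      (h.cochainMap hx hx' (p + 1) d ⟨cechD x N p c.1, cechD_mem c.2⟩).1 := by
  funext J
  rw [cochainMap_coe, cechD_apply]
  dsimp only
  rw [cechD_apply, map_sum]
  refine Finset.sum_congr rfl fun j _ => ?_
  rw [Int.cast_smul_eq_zsmul, Int.cast_smul_eq_zsmul, map_zsmul, cochainMap_coe,
    ← cechRes_of_subset, ← cechRes_of_subset, h.mapAt_cechRes (Finset.erase_subset j.1 J.1)]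

omit h in
theorem cechCochainPiece_eq_bot (hx : RaisesDegree x e 𝒩) {p : ℕ} (hp : r < p) (d : ℤ) :
    cechCochainPiece x hx p d = ⊥ := by
  rw [eq_bot_iff]
  intro c _
  refine funext fun I => absurd (Finset.card_le_univ I.1) ?_
  rw [I.2, Fintype.card_fin]
  exact not_le.mpr hp

/-- Base change for Čech cohomology with flat pieces and flat cohomology. -/
theorem nonempty_equiv (Q : Type*) [CommRing Q] [Algebra A Q] [Module.Flat A Q] [Algebra Q K]
    [IsScalarTower A Q K] (hx : RaisesDegree x e 𝒩) (hx' : RaisesDegree x' e 𝒩')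
    (h𝒩 : ∀ d, FlatOver A Q (𝒩 d)) (d : ℤ) (hH : ∀ p, FlatOver A Q (CechCohomology hx p d)) (p : ℕ) :
    Nonempty ((K ⊗[A] CechCohomology hx p d) ≃ₗ[K] CechCohomology hx' p d) := by
  have h1 : ∀ p, ∀ c ∈ cechCochainPiece x hx p d,
      (cechD x N p).restrictScalars A c ∈ cechCochainPiece x hx (p + 1) d :=
    fun p c hc => cechD_mem hc
  have h2 : ∀ p, ∀ c ∈ cechCochainPiece x hx p d, (cechD x N (p + 1)).restrictScalars A
      ((cechD x N p).restrictScalars A c) = 0 := fun p c _ => cechD_cechD c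
  have h3 : ∀ p > r, cechCochainPiece x hx p d = ⊥ := fun p hp => cechCochainPiece_eq_bot hx hp d
  have h4 : ∀ p, FlatOver A Q (cechCochainPiece x hx p d) := fun p =>
    flatOver_cechCochainPiece Q hx h𝒩 p d
  have h5 : ∀ p, ∀ c ∈ cechCochainPiece x' hx' p d,
      (cechD x' N' p).restrictScalars K c ∈ cechCochainPiece x' hx' (p + 1) d :=
    fun p c hc => cechD_mem hc
  have h6 : ∀ p, IsBaseChange K (h.cochainMap hx hx' p d) := fun p =>
    h.isBaseChange_cochainMap hx hx' p d
  have h7 : ∀ p c, subDifferential h5 p (h.cochainMap hx hx' p d c) =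
      h.cochainMap hx hx' (p + 1) d (subDifferential h1 p c) :=
    fun p c => Subtype.ext (h.cochainMap_cechD p d c)
  exact SubCohomology.nonempty_baseChange_equiv Q h1 h2 h3 h4 hH K h5 h6 h7 p

end IsCechBaseChange

end PieceBaseChange

end

end GradedLocalCohomology

namespace GradedLocalCohomology

noncomputable section

/-! ### Constancy of ranks, density, and transfer along injections. -/

section Rank

universe u w

variable {A : Type u} [CommRing A]

theorem FreeAt.flatOver {g : A} {X : Type*} [AddCommGroup X] [Module A X] (h : FreeAt g X) :
    FlatOver A (Localization.Away g) X := by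
  have : Module.Free (Localization.Away g) (Localization.Away g ⊗[A] X) := h
  exact inferInstanceAs (Module.Flat (Localization.Away g) (Localization.Away g ⊗[A] X))

/-- K ⊗ X is the base change from A_g to K of a free module, whose rank it inherits. If A_g = 0
there is no field over it, and any value of c will do. -/
theorem FreeAt.exists_rank_eq {g : A} {X : Type w} [AddCommGroup X] [Module A X]
    (h : FreeAt g X) : ∃ c : Cardinal.{max u w}, ∀ (K : Type u) [Field K] [Algebra A K]
      [Algebra (Localization.Away g) K] [IsScalarTower A (Localization.Away g) K],
      Module.rank K (K ⊗[A] X) = c := by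
  have : Module.Free (Localization.Away g) (Localization.Away g ⊗[A] X) := h
  by_cases hg : Nontrivial (Localization.Away g)
  · refine ⟨Module.rank (Localization.Away g) (Localization.Away g ⊗[A] X), ?_⟩
    intro K _ _ _ _
    rw [← (AlgebraTensorModule.cancelBaseChange A (Localization.Away g) K K X).rank_eq,
      Module.rank_baseChange, Cardinal.lift_id'.{u}]
  · refine ⟨0, ?_⟩
    intro K _ _ _ _
    rw [not_nontrivial_iff_subsingleton] at hg
    have := (algebraMap (Localization.Away g) K).codomain_trivial
    exact absurd this (not_subsingleton K)

/-- The residue fields at the points where `g` does not vanish are algebras over `A_g`. -/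
theorem FreeAt.exists_rank_residueField {g : A} {X : Type w} [AddCommGroup X] [Module A X]
    (h : FreeAt g X) : ∃ c : Cardinal.{max u w}, ∀ p : PrimeSpectrum A, g ∉ p.asIdeal →
      Module.rank p.asIdeal.ResidueField (p.asIdeal.ResidueField ⊗[A] X) = c := by
  obtain ⟨c, hc⟩ := h.exists_rank_eq
  refine ⟨c, fun p hp => ?_⟩
  have hu : IsUnit (algebraMap A p.asIdeal.ResidueField g) := by
    rw [isUnit_iff_ne_zero, Ne, Ideal.algebraMap_residueField_eq_zero]
    exact hp
  let := (IsLocalization.Away.lift (S := Localization.Away g) g hu).toAlgebra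
  have : IsScalarTower A (Localization.Away g) p.asIdeal.ResidueField :=
    IsScalarTower.of_algebraMap_eq fun a => (IsLocalization.Away.lift_eq g hu a).symm
  exact hc p.asIdeal.ResidueField

end Rank

section Generic

variable {A : Type*} [CommRing A]

/-- Every prime contains a minimal prime and so lies in the closure of that point. -/
theorem dense_of_minimalPrimes_subset {U : Set (PrimeSpectrum A)}
    (h : ∀ p : PrimeSpectrum A, p.asIdeal ∈ minimalPrimes A → p ∈ U) : Dense U := by
  intro p
  obtain ⟨q, hq, hqp⟩ := Ideal.exists_minimalPrimes_le (bot_le : ⊥ ≤ p.asIdeal)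
  have hmem : (⟨q, hq.1.1⟩ : PrimeSpectrum A) ∈ U := h _ hq
  have : p ∈ closure {(⟨q, hq.1.1⟩ : PrimeSpectrum A)} := by
    rw [← specializes_iff_mem_closure, ← PrimeSpectrum.le_iff_specializes]
    exact hqp
  exact closure_mono (Set.singleton_subset_iff.mpr hmem) this

end Generic

section Transfer

variable {K : Type*} [CommRing K] {S S' : Type*} [CommRing S] [CommRing S'] [Algebra K S]
  [Algebra K S'] {N N' : Type*} [AddCommGroup N] [AddCommGroup N'] [Module S N] [Module S' N']
  [Module K N] [Module K N'] [IsScalarTower K S N] [IsScalarTower K S' N'] {r : ℕ} {x : Fin r → S}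
  {x' : Fin r → S'} {e : Fin r → ℕ} {𝒩 : ℤ → Submodule K N} {𝒩' : ℤ → Submodule K N'}

/-- Čech cohomology depends only on the homogeneous components of the module. -/
theorem CechCohomology.nonempty_equiv_of_injective (θ : S →+* S') (f : N →ₗ[K] N')
    (hf : Function.Injective f) (hθ : ∀ i, θ (x i) = x' i) (hfx : ∀ i n, f (x i • n) = x' i • f n)
    (hmap : ∀ d, (𝒩 d).map f = 𝒩' d) (hx : RaisesDegree x e 𝒩) (hx' : RaisesDegree x' e 𝒩')
    (p : ℕ) (d : ℤ) : Nonempty (CechCohomology hx p d ≃ₗ[K] CechCohomology hx' p d) := by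
  have hmem : ∀ d, ∀ n ∈ 𝒩 d, f n ∈ 𝒩' d := fun d n hn => hmap d ▸ Submodule.mem_map_of_mem hn
  -- The map on index sets is the identity function, not the image under the identity embedding, so
  -- that no transport between localizations is needed.
  have h : IsCechMap x x' θ (RelEmbedding.refl _) (fun I => I) f :=
    ⟨fun I => by ext; simp, hθ, hfx⟩
  have hinjAt : ∀ I z, cechMapAt h I z = 0 → z = 0 := by
    intro I z hz
    obtain ⟨k, n, rfl⟩ := exists_eq_cechFrac x z
    rw [cechMapAt_cechFrac h, cechFrac_eq_zero] at hz
    obtain ⟨m, hm⟩ := hz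
    rw [cechFrac_eq_zero]
    refine ⟨m, hf ?_⟩
    have := h.map_prod_pow_smul I m n
    rw [this, map_zero]
    exact hm
  have hinj : ∀ c, cechMap h c = 0 → c = 0 := fun c hc => funext fun I =>
    hinjAt I (c I) (by have := congrFun hc I; rwa [cechMap_apply] at this)
  have hlift : ∀ c' ∈ cechTotalPiece x' e hx' d, ∃ c ∈ cechTotalPiece x e hx d,
      cechMap h c = c' := by
    intro c' hc'
    have : ∀ I, ∃ z ∈ cechFracPiece x e hx d I, cechMapAt h I z = c' I := by
      intro I
      obtain ⟨k, n', hn', hz⟩ := mem_cechTotalPiece.mp hc' I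
      rw [← hmap] at hn'
      obtain ⟨n, hn, rfl⟩ := hn'
      exact ⟨cechFrac x N I k n, ⟨k, n, hn, rfl⟩, by rw [cechMapAt_cechFrac h, ← hz]⟩
    choose c hc hcc using this
    exact ⟨c, mem_cechTotalPiece.mpr hc, funext fun I => by rw [cechMap_apply, hcc]⟩
  refine CechCohomology.nonempty_equiv_of_total h (fun _ => rfl) hx hx' hmem ?_ ?_ p
  · rintro c hc hDc ⟨b', hb', hDb'⟩
    obtain ⟨b, hb, rfl⟩ := hlift b' hb'
    refine ⟨b, hb, ?_⟩
    rw [← sub_eq_zero]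
    apply hinj
    rw [map_sub, cechMap_cechDTotal, hDb', sub_self]
  · intro c' hc' hDc'
    obtain ⟨c, hc, rfl⟩ := hlift c' hc'
    refine ⟨c, hc, hinj _ ?_, 0, zero_mem _, by rw [map_zero, sub_self]⟩
    rw [cechMap_cechDTotal, hDc']

end Transfer

end

end GradedLocalCohomology

namespace GradedLocalCohomology

noncomputable section

set_option linter.unusedSectionVars false

/-! ### The bigrading of the symmetric algebra, obtained from coactions. -/

section SymmetricAlgebra

/-- The coactions below move the elements of R to various degrees, so they are not R-linear for the
usual structure on T[Γ]. The universal property is therefore stated for maps that are semilinear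
along a ring map τ. -/
theorem IsSymmetricAlgebra.exists_ringHom {R M T : Type*} [CommRing R] [AddCommGroup M]
    [Module R M] [CommRing T] [Algebra R T] {ι : M →ₗ[R] T} (hι : IsSymmetricAlgebra ι)
    {B : Type*} [CommRing B] (τ : R →+* B) (μ : M →+ B) (h : ∀ a m, μ (a • m) = τ a * μ m) :
    ∃ F : T →+* B, (∀ a, F (algebraMap R T a) = τ a) ∧ ∀ m, F (ι m) = μ m := by
  let := τ.toAlgebra
  let μ' : M →ₗ[R] B := { μ with map_smul' := fun a m => (h a m).trans (Algebra.smul_def _ _).symm }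
  exact ⟨(hι.lift μ' : T →+* B), fun a => (hι.lift μ').commutes a, fun m => hι.lift_eq μ' m⟩

variable {A R M T : Type*} [CommRing A] [CommRing R] [Algebra A R] [AddCommGroup M] [Module R M]
  [Module A M] [CommRing T] [Algebra A T] [Algebra R T]

/-- `T` is the symmetric algebra of the graded module `M` over the graded ring `R`. -/
structure IsGradedSymmetricAlgebra (𝒜 : ℕ → Submodule A R) (ℳ : ℤ → Submodule A M)
    (ι : M →ₗ[R] T) : Prop where
  isInternal : DirectSum.IsInternal ℳ
  smul_mem : ∀ (n : ℕ) (d : ℤ) (a : R) (m : M), a ∈ 𝒜 n → m ∈ ℳ d → a • m ∈ ℳ (n + d)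
  isSymmetricAlgebra : IsSymmetricAlgebra ι

/-- The component of degree `d` of the `k`-th symmetric power. -/
def symPiece (𝒜 : ℕ → Submodule A R) (ℳ : ℤ → Submodule A M) (ι : M →ₗ[R] T) (k : ℕ) (d : ℤ) :
    Submodule A T :=
  Submodule.span A {t | ∃ (e : ℕ) (a : R) (c : Fin k → ℤ) (n : Fin k → M),
    a ∈ 𝒜 e ∧ (∀ i, n i ∈ ℳ (c i)) ∧ (e : ℤ) + ∑ i, c i = d ∧ t = a • ∏ i, ι (n i)}

variable {𝒜 : ℕ → Submodule A R} {ℳ : ℤ → Submodule A M} {ι : M →ₗ[R] T}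

theorem symPiece_mul_mem [SetLike.GradedMonoid 𝒜] [IsScalarTower A R T] {k k' : ℕ} {d d' : ℤ} {s t : T}
    (hs : s ∈ symPiece 𝒜 ℳ ι k d) (ht : t ∈ symPiece 𝒜 ℳ ι k' d') :
    s * t ∈ symPiece 𝒜 ℳ ι (k + k') (d + d') := by
  have h := Submodule.mul_mem_mul hs ht
  rw [symPiece, symPiece, Submodule.span_mul_span] at h
  refine Submodule.span_mono ?_ h
  rintro _ ⟨_, ⟨e, a, c, n, ha, hn, hd, rfl⟩, _, ⟨e', a', c', n', ha', hn', hd', rfl⟩, rfl⟩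
  refine ⟨e + e', a * a', Fin.append c c', Fin.append n n', SetLike.GradedMul.mul_mem ha ha', ?_,
    ?_, ?_⟩
  · intro i
    induction i using Fin.addCases with
    | left i => rw [Fin.append_left, Fin.append_left]; exact hn i
    | right i => rw [Fin.append_right, Fin.append_right]; exact hn' i
  · rw [Fin.sum_univ_add, ← hd, ← hd']
    simp only [Fin.append_left, Fin.append_right]
    push_cast
    ring
  · rw [Fin.prod_univ_add]
    simp only [Fin.append_left, Fin.append_right]
    exact smul_mul_smul_comm a _ a' _

/-- A grading amounts to a ring map into a group algebra that marks each homogeneous element with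
its degree. In this form it can be fed into the universal property of the symmetric algebra. -/
theorem exists_gradedHom [GradedAlgebra 𝒜] {Γ : Type*} [AddCommGroup Γ] (χ : ℕ →+ Γ) :
    ∃ τ : R →+* AddMonoidAlgebra T Γ, ∀ e, ∀ a ∈ 𝒜 e,
      τ a = AddMonoidAlgebra.single (χ e) (algebraMap R T a) := by
  let f : ∀ e, 𝒜 e →+ AddMonoidAlgebra T Γ := fun e =>
    { toFun := fun a => AddMonoidAlgebra.single (χ e) (algebraMap R T a)
      map_zero' := by simp
      map_add' := fun a b => by simp [AddMonoidAlgebra.single_add] }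
  let F := DirectSum.toSemiring f
    (by
      change AddMonoidAlgebra.single (χ 0) (algebraMap R T 1) = 1
      rw [map_zero, map_one]
      rfl)
    (fun {e e'} a b => by
      change AddMonoidAlgebra.single (χ (e + e')) (algebraMap R T (a * b)) =
        AddMonoidAlgebra.single (χ e) (algebraMap R T a) *
          AddMonoidAlgebra.single (χ e') (algebraMap R T b)
      rw [AddMonoidAlgebra.single_mul_single, map_add, map_mul])
  refine ⟨F.comp (DirectSum.decomposeRingEquiv 𝒜 : R →+* _), fun e a ha => ?_⟩
  have : DirectSum.decomposeRingEquiv 𝒜 a = DirectSum.of (fun i => 𝒜 i) e ⟨a, ha⟩ :=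
    DirectSum.decompose_of_mem 𝒜 ha
  change F (DirectSum.decomposeRingEquiv 𝒜 a) = _
  rw [this]
  exact DirectSum.toSemiring_of f _ _ e ⟨a, ha⟩

theorem induction_isInternal {Γ : Type*} [DecidableEq Γ] {ℳ : Γ → Submodule A M}
    (hℳ : DirectSum.IsInternal ℳ) {motive : M → Prop} (zero : motive 0)
    (mem : ∀ d, ∀ m ∈ ℳ d, motive m) (add : ∀ m n, motive m → motive n → motive (m + n)) (m : M) :
    motive m := by
  obtain ⟨w, rfl⟩ := hℳ.surjective m
  induction w using DirectSum.induction_on with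
  | zero => rwa [map_zero]
  | of d m => rw [DirectSum.coeAddMonoidHom_of]; exact mem d m m.2
  | add a b ha hb => rw [map_add]; exact add _ _ ha hb

theorem induction_graded (𝒜 : ℕ → Submodule A R) [GradedAlgebra 𝒜] {motive : R → Prop}
    (zero : motive 0) (mem : ∀ e, ∀ a ∈ 𝒜 e, motive a)
    (add : ∀ a b, motive a → motive b → motive (a + b)) (a : R) : motive a :=
  induction_isInternal (DirectSum.Decomposition.isInternal 𝒜) zero mem add a

theorem exists_gradedMap {Γ : Type*} {ℳ : ℤ → Submodule A M} (hℳ : DirectSum.IsInternal ℳ)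
    (ι : M →ₗ[R] T) (χ : ℤ → Γ) : ∃ μ : M →+ AddMonoidAlgebra T Γ, ∀ c, ∀ m ∈ ℳ c,
      μ m = AddMonoidAlgebra.single (χ c) (ι m) := by
  let f : ∀ c, ℳ c →+ AddMonoidAlgebra T Γ := fun c =>
    { toFun := fun m => AddMonoidAlgebra.single (χ c) (ι m)
      map_zero' := by simp
      map_add' := fun a b => by simp [AddMonoidAlgebra.single_add] }
  let E := AddEquiv.ofBijective _ hℳ
  refine ⟨(DirectSum.toAddMonoid f).comp E.symm.toAddMonoidHom, fun c m hm => ?_⟩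
  have : E.symm m = DirectSum.of (fun i => ℳ i) c ⟨m, hm⟩ := by
    rw [AddEquiv.symm_apply_eq]
    exact (DirectSum.coeAddMonoidHom_of ℳ c ⟨m, hm⟩).symm
  change DirectSum.toAddMonoid f (E.symm m) = _
  rw [this, DirectSum.toAddMonoid_of]
  rfl

namespace IsGradedSymmetricAlgebra

variable [GradedAlgebra 𝒜] (h : IsGradedSymmetricAlgebra 𝒜 ℳ ι) {Γ : Type*} [AddCommGroup Γ]
include h

/-- Elements of R of degree e are marked (0, e) and elements of M of degree c are marked (1, c), the
marks being pushed to Γ by χ; the universal property extends this to T. Homogeneous components can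
then be read off as coefficients, which makes their independence automatic. -/
theorem exists_coaction (χ : ℤ × ℤ →+ Γ) : ∃ F : T →+* AddMonoidAlgebra T Γ,
    (∀ e : ℕ, ∀ a ∈ 𝒜 e, F (algebraMap R T a) =
      AddMonoidAlgebra.single (χ (0, e)) (algebraMap R T a)) ∧
    ∀ c, ∀ m ∈ ℳ c, F (ι m) = AddMonoidAlgebra.single (χ (1, c)) (ι m) := by
  obtain ⟨τ, hτ⟩ := exists_gradedHom (𝒜 := 𝒜) (T := T) ((χ.comp (AddMonoidHom.inr ℤ ℤ)).comp
    (Nat.castAddMonoidHom ℤ))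
  obtain ⟨μ, hμ⟩ := exists_gradedMap h.isInternal ι fun c => χ (1, c)
  have hmul : ∀ a m, μ (a • m) = τ a * μ m := by
    intro a m
    induction a using induction_graded 𝒜 with
    | zero => rw [zero_smul, map_zero, map_zero, zero_mul]
    | add a b ha hb => rw [add_smul, map_add, map_add, add_mul, ha, hb]
    | mem e a ha =>
      induction m using induction_isInternal h.isInternal with
      | zero => rw [smul_zero, map_zero, mul_zero]
      | add m n hm hn => rw [smul_add, map_add, map_add, mul_add, hm, hn]
      | mem c m hm =>
        rw [hμ _ _ (h.smul_mem e c a m ha hm), hτ e a ha, hμ c m hm,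
          AddMonoidAlgebra.single_mul_single, LinearMap.map_smul, Algebra.smul_def]
        congr 1
        change _ = χ (0, (e : ℤ)) + χ (1, c)
        rw [← map_add, Prod.mk_add_mk, zero_add]
  obtain ⟨F, hF, hF'⟩ := IsSymmetricAlgebra.exists_ringHom h.isSymmetricAlgebra τ μ hmul
  exact ⟨F, fun e a ha => (hF a).trans (hτ e a ha), fun c m hm => (hF' m).trans (hμ c m hm)⟩

/-- The coaction on the symmetric algebra attached to a coarsening `χ` of its bigrading. -/
def coaction (χ : ℤ × ℤ →+ Γ) : T →+* AddMonoidAlgebra T Γ := (h.exists_coaction χ).choose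

theorem coaction_algebraMap (χ : ℤ × ℤ →+ Γ) {e : ℕ} {a : R} (ha : a ∈ 𝒜 e) :
    h.coaction χ (algebraMap R T a) = AddMonoidAlgebra.single (χ (0, e)) (algebraMap R T a) :=
  (h.exists_coaction χ).choose_spec.1 e a ha

theorem coaction_ι (χ : ℤ × ℤ →+ Γ) {c : ℤ} {m : M} (hm : m ∈ ℳ c) :
    h.coaction χ (ι m) = AddMonoidAlgebra.single (χ (1, c)) (ι m) :=
  (h.exists_coaction χ).choose_spec.2 c m hm

theorem coaction_algebraMap_base [IsScalarTower A R T] (χ : ℤ × ℤ →+ Γ) (a : A) :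
    h.coaction χ (algebraMap A T a) = AddMonoidAlgebra.single 0 (algebraMap A T a) := by
  rw [IsScalarTower.algebraMap_apply A R T, h.coaction_algebraMap χ
    (SetLike.algebraMap_mem_graded 𝒜 a)]
  rw [Nat.cast_zero, ← Prod.zero_eq_mk, map_zero]

/-- The symmetric algebra is spanned by homogeneous elements. -/
theorem induction_homogeneous [IsScalarTower A R T] {motive : T → Prop} (zero : motive 0)
    (mem : ∀ k d, ∀ t ∈ symPiece 𝒜 ℳ ι k d, motive t)
    (add : ∀ s t, motive s → motive t → motive (s + t)) (t : T) : motive t := by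
  have key : t ∈ ⨆ kd : ℕ × ℤ, symPiece 𝒜 ℳ ι kd.1 kd.2 := by
    set G := ⨆ kd : ℕ × ℤ, symPiece 𝒜 ℳ ι kd.1 kd.2
    have hG : ∀ {k d s}, s ∈ symPiece 𝒜 ℳ ι k d → s ∈ G := fun {k d s} hs =>
      Submodule.mem_iSup_of_mem (p := fun kd : ℕ × ℤ => symPiece 𝒜 ℳ ι kd.1 kd.2) (k, d) hs
    induction t using h.isSymmetricAlgebra.induction with
    | algebraMap a =>
      induction a using induction_graded 𝒜 with
      | zero => rw [map_zero]; exact zero_mem _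
      | add a b ha hb => rw [map_add]; exact add_mem ha hb
      | mem e a ha =>
        exact hG (Submodule.subset_span ⟨e, a, Fin.elim0, Fin.elim0, ha, fun i => i.elim0, rfl,
          by simp [Algebra.algebraMap_eq_smul_one]⟩)
    | ι m =>
      induction m using induction_isInternal h.isInternal with
      | zero => rw [map_zero]; exact zero_mem _
      | add m n hm hn => rw [map_add]; exact add_mem hm hn
      | mem c m hm =>
        exact hG (Submodule.subset_span ⟨0, 1, fun _ : Fin 1 => c, fun _ => m,
          SetLike.GradedOne.one_mem, fun _ => hm, rfl, by simp⟩)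
    | add s t hs ht => exact add_mem hs ht
    | mul s t hs ht =>
      induction hs using Submodule.iSup_induction' with
      | zero => rw [zero_mul]; exact zero_mem _
      | add s s' _ _ hs hs' => rw [add_mul]; exact add_mem hs hs'
      | mem kd s hs =>
        induction ht using Submodule.iSup_induction' with
        | zero => rw [mul_zero]; exact zero_mem _
        | add t t' _ _ ht ht' => rw [mul_add]; exact add_mem ht ht'
        | mem kd' t ht => exact hG (symPiece_mul_mem hs ht)
  induction key using Submodule.iSup_induction' with
  | zero => exact zero
  | add s t _ _ hs ht => exact add _ _ hs ht
  | mem kd t ht => exact mem _ _ t ht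

theorem coaction_of_mem [IsScalarTower A R T] (χ : ℤ × ℤ →+ Γ) {k : ℕ} {d : ℤ} {t : T}
    (ht : t ∈ symPiece 𝒜 ℳ ι k d) :
    h.coaction χ t = AddMonoidAlgebra.single (χ (k, d)) t := by
  induction ht using Submodule.span_induction with
  | zero => simp
  | add s t _ _ hs ht => rw [map_add, hs, ht, AddMonoidAlgebra.single_add]
  | smul a t _ ht =>
    rw [Algebra.smul_def, map_mul, ht, h.coaction_algebraMap_base,
      AddMonoidAlgebra.single_mul_single, zero_add]
  | mem t ht =>
    obtain ⟨e, a, c, n, ha, hn, hd, rfl⟩ := ht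
    have h1 : ∏ i, h.coaction χ (ι (n i)) =
        AddMonoidAlgebra.single (∑ i, χ (1, c i)) (∏ i, ι (n i)) := by
      rw [Finset.prod_congr rfl fun i _ => h.coaction_ι χ (hn i), AddMonoidAlgebra.prod_single]
    rw [Algebra.smul_def, map_mul, map_prod, h1, h.coaction_algebraMap χ ha,
      AddMonoidAlgebra.single_mul_single]
    congr 1
    rw [← map_sum, ← map_add, ← hd]
    congr 1
    ext <;> simp [Prod.fst_sum, Prod.snd_sum]

variable [IsScalarTower A R T]

/-- The projections onto the components of a coarsening of the bigrading. -/
def proj (χ : ℤ × ℤ →+ Γ) (γ : Γ) : T →ₗ[A] T where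
  toFun t := (h.coaction χ t).coeff γ
  map_add' s t := by rw [map_add, AddMonoidAlgebra.coeff_add, Finsupp.add_apply]
  map_smul' a t := by
    rw [Algebra.smul_def, map_mul, h.coaction_algebraMap_base,
      AddMonoidAlgebra.coeff_single_zero_mul, RingHom.id_apply, Algebra.smul_def]

theorem proj_apply (χ : ℤ × ℤ →+ Γ) (γ : Γ) (t : T) :
    h.proj χ γ t = (h.coaction χ t).coeff γ := rfl

theorem proj_self (χ : ℤ × ℤ →+ Γ) {γ : Γ} {k : ℕ} {d : ℤ} {t : T}
    (ht : t ∈ symPiece 𝒜 ℳ ι k d) (hγ : χ (k, d) = γ) : h.proj χ γ t = t := by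
  rw [proj_apply, h.coaction_of_mem χ ht, AddMonoidAlgebra.coeff_single, hγ,
    Finsupp.single_eq_same]

theorem proj_ne (χ : ℤ × ℤ →+ Γ) {γ : Γ} {k : ℕ} {d : ℤ} {t : T}
    (ht : t ∈ symPiece 𝒜 ℳ ι k d) (hγ : χ (k, d) ≠ γ) : h.proj χ γ t = 0 := by
  rw [proj_apply, h.coaction_of_mem χ ht, AddMonoidAlgebra.coeff_single,
    Finsupp.single_eq_of_ne hγ.symm]

theorem isGrading_proj (χ : ℤ × ℤ →+ Γ) : IsGrading (h.proj χ) where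
  apply_self γ t := by
    induction t using h.induction_homogeneous with
    | zero => simp only [map_zero]
    | add s t hs ht => simp only [map_add, hs, ht]
    | mem k d t ht =>
      by_cases hγ : χ (k, d) = γ
      · rw [h.proj_self χ ht hγ, h.proj_self χ ht hγ]
      · rw [h.proj_ne χ ht hγ, map_zero]
  apply_ne γ γ' t hne := by
    induction t using h.induction_homogeneous with
    | zero => simp only [map_zero]
    | add s t hs ht => simp only [map_add, hs, ht, add_zero]
    | mem k d t ht =>
      by_cases hγ : χ (k, d) = γ'
      · rw [h.proj_self χ ht hγ, h.proj_ne χ ht (hγ.trans_ne hne.symm)]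
      · rw [h.proj_ne χ ht hγ, map_zero]
  exists_sum t := by
    classical
    refine ⟨(h.coaction χ t).coeff.support, ?_⟩
    change (h.coaction χ t).coeff.sum (fun _ a => a) = t
    induction t using h.induction_homogeneous with
    | zero => simp
    | add s t hs ht =>
      rw [map_add, AddMonoidAlgebra.coeff_add, Finsupp.sum_add_index' (fun _ => rfl)
        (fun _ _ _ => rfl), hs, ht]
    | mem k d t ht =>
      rw [h.coaction_of_mem χ ht, AddMonoidAlgebra.coeff_single, Finsupp.sum_single_index rfl]

/-- The coaction is multiplicative, so a factor marked by a single degree merely translates the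
coefficients. -/
theorem proj_mul (χ : ℤ × ℤ →+ Γ) {γ : Γ} {s : T}
    (hs : h.coaction χ s = AddMonoidAlgebra.single γ s) (γ' : Γ) (t : T) :
    h.proj χ (γ' + γ) (s * t) = s * h.proj χ γ' t := by
  rw [proj_apply, map_mul, hs, add_comm γ' γ]
  exact AddMonoidAlgebra.coeff_single_mul_eq_mul_coeff _ fun _ _ => add_right_inj _

theorem proj_comm {Γ' : Type*} [AddCommGroup Γ'] (χ : ℤ × ℤ →+ Γ) (χ' : ℤ × ℤ →+ Γ') (γ : Γ)
    (γ' : Γ') (t : T) : h.proj χ γ (h.proj χ' γ' t) = h.proj χ' γ' (h.proj χ γ t) := by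
  induction t using h.induction_homogeneous with
  | zero => simp only [map_zero]
  | add s t hs ht => simp only [map_add, hs, ht]
  | mem k d t ht =>
    by_cases h1 : χ (k, d) = γ <;> by_cases h2 : χ' (k, d) = γ' <;>
      simp only [h.proj_self _ ht, h.proj_ne _ ht, h1, h2, map_zero, ne_eq, not_false_eq_true]

theorem range_proj_eq (χ : ℤ × ℤ →+ Γ) {γ : Γ} {k : ℕ} {d : ℤ}
    (hχ : ∀ (k' : ℕ) d', χ (k', d') = γ ↔ k' = k ∧ d' = d) :
    LinearMap.range (h.proj χ γ) = symPiece 𝒜 ℳ ι k d := by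
  apply le_antisymm
  · rintro _ ⟨t, rfl⟩
    induction t using h.induction_homogeneous with
    | zero => rw [map_zero]; exact zero_mem _
    | add s t hs ht => rw [map_add]; exact add_mem hs ht
    | mem k' d' t ht =>
      by_cases h1 : χ (k', d') = γ
      · rw [h.proj_self χ ht h1]
        obtain ⟨rfl, rfl⟩ := (hχ k' d').mp h1
        exact ht
      · rw [h.proj_ne χ ht h1]
        exact zero_mem _
  · exact fun t ht => ⟨t, h.proj_self χ ht ((hχ k d).mpr ⟨rfl, rfl⟩)⟩

theorem coaction_algebraMap_of_forall (χ : ℤ × ℤ →+ Γ) (hχ : ∀ e : ℕ, χ (0, e) = 0) (a : R) :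
    h.coaction χ (algebraMap R T a) = AddMonoidAlgebra.single 0 (algebraMap R T a) := by
  induction a using induction_graded 𝒜 with
  | zero => simp
  | add a b ha hb => simp only [map_add, ha, hb, AddMonoidAlgebra.single_add]
  | mem e a ha => rw [h.coaction_algebraMap χ ha, hχ]

end IsGradedSymmetricAlgebra

end SymmetricAlgebra

end

end GradedLocalCohomology

namespace GradedLocalCohomology

noncomputable section

/-! ### Gradings induced on the homology of the total Čech complex. -/

section HomologyGrading

variable {A P C Γ : Type*} [CommRing A] [CommRing P] [Algebra A P] [AddCommGroup C] [Module P C]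
  [Module A C] [IsScalarTower A P C] [AddCommGroup Γ] {D : C →ₗ[P] C} {E : Γ → C →ₗ[A] C} {δ : Γ}

/-- The projections induced on the homology of `D` by projections that commute with `D` up to a
shift. -/
def homologyGrading (hDE : ∀ γ c, D (E γ c) = E (γ + δ) (D c)) :
    Γ → DiffHomology D →ₗ[A] DiffHomology D :=
  quotGrading (subGrading E (LinearMap.ker D) fun γ c hc => by
      rw [LinearMap.mem_ker] at hc ⊢
      rw [hDE, hc, map_zero]) ((LinearMap.range D).submoduleOf (LinearMap.ker D)) fun γ c hc => by
    obtain ⟨b, hb⟩ := hc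
    refine ⟨E (γ - δ) b, ?_⟩
    rw [hDE, sub_add_cancel, hb]
    rfl

theorem homologyGrading_mk (hDE : ∀ γ c, D (E γ c) = E (γ + δ) (D c)) (γ : Γ) (c : LinearMap.ker D)
    (c' : LinearMap.ker D) (h : E γ c = c') :
    homologyGrading hDE γ (DiffHomology.mk D c) = DiffHomology.mk D c' := by
  rw [homologyGrading, DiffHomology.mk, quotGrading_mk]
  congr 1
  exact Subtype.ext h

theorem isGrading_homologyGrading (hE : IsGrading E) (hDE : ∀ γ c, D (E γ c) = E (γ + δ) (D c)) :
    IsGrading (homologyGrading hDE) :=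
  (hE.sub _ _).quot _ _

theorem smul_homologyGrading (hDE : ∀ γ c, D (E γ c) = E (γ + δ) (D c)) {t : P} {ε : Γ}
    (ht : ∀ γ c, t • E γ c = E (γ + ε) (t • c)) (γ : Γ) (z : DiffHomology D) :
    t • homologyGrading hDE γ z = homologyGrading hDE (γ + ε) (t • z) := by
  obtain ⟨c, rfl⟩ := DiffHomology.mk_surjective D z
  have h : E γ c ∈ LinearMap.ker D := by
    rw [LinearMap.mem_ker, hDE, c.2, map_zero]
  rw [homologyGrading_mk hDE γ c ⟨_, h⟩ rfl, ← map_smul, ← map_smul]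
  exact (homologyGrading_mk hDE _ _ _ (ht γ c).symm).symm

end HomologyGrading

theorem IsGrading.exists_sum_superset {P T Γ : Type*} [CommRing P] [AddCommGroup T] [Module P T]
    {π : Γ → T →ₗ[P] T} (hπ : IsGrading π) (t : T) :
    ∃ s : Finset Γ, ∀ s' ⊇ s, ∑ γ ∈ s', π γ t = t := by
  obtain ⟨s, hs⟩ := hπ.exists_sum t
  refine ⟨s, fun s' h => ?_⟩
  rw [← Finset.sum_subset h, hs]
  intro γ _ hγ
  rw [← hs, map_sum]
  exact Finset.sum_eq_zero fun γ' h => hπ.apply_ne _ _ _ fun h' => hγ (h' ▸ h)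

set_option linter.unusedSectionVars false

section BigradedCech

variable {A P S N : Type*} [CommRing A] [CommRing P] [CommRing S] [Algebra A P] [Algebra A S]
  [Algebra P S] [IsScalarTower A P S] [AddCommGroup N] [Module S N] [Module P N] [Module A N]
  [IsScalarTower A P N] [IsScalarTower P S N] [IsScalarTower A S N] {r : ℕ} {x : Fin r → S}
  {e : Fin r → ℕ} {𝒩 : ℤ → Submodule P N} {κ : ℤ → N →ₗ[A] N}

/-- The projections `κ` form a grading that is preserved by `x` and by the components of `𝒩`. -/
structure IsCechGrading (x : Fin r → S) (𝒩 : ℤ → Submodule P N) (κ : ℤ → N →ₗ[A] N) : Prop extends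
    IsGrading κ where
  map_x : ∀ k i n, κ k (x i • n) = x i • κ k n
  map_mem : ∀ k d, ∀ n ∈ 𝒩 d, κ k n ∈ 𝒩 d

namespace IsCechGrading

variable (h : IsCechGrading x 𝒩 κ) {hx : RaisesDegree x e 𝒩}
include h

theorem isCechMap (k : ℤ) :
    IsCechMap x x (RingHom.id S) (RelEmbedding.refl _) (fun I => I) (κ k) :=
  ⟨fun I => by ext; simp, fun _ => rfl, h.map_x k⟩

/-- The projection induced on a localization. -/
def projAt (k : ℤ) (I : Finset (Fin r)) : CechLocalization x N I →ₗ[A] CechLocalization x N I :=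
  cechMapAt (h.isCechMap k) I

theorem projAt_cechFrac (k : ℤ) (I : Finset (Fin r)) (m : ℕ) (n : N) :
    h.projAt k I (cechFrac x N I m n) = cechFrac x N I m (κ k n) :=
  cechMapAt_cechFrac (h.isCechMap k) I m n

theorem isGrading_projAt (I : Finset (Fin r)) : IsGrading (h.projAt · I) where
  apply_self k z := by
    obtain ⟨m, n, rfl⟩ := exists_eq_cechFrac x z
    rw [projAt_cechFrac, projAt_cechFrac, h.apply_self]
  apply_ne k k' z hk := by
    obtain ⟨m, n, rfl⟩ := exists_eq_cechFrac x z
    rw [projAt_cechFrac, projAt_cechFrac, h.apply_ne _ _ _ hk, map_zero]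
  exists_sum z := by
    obtain ⟨m, n, rfl⟩ := exists_eq_cechFrac x z
    obtain ⟨s, hs⟩ := h.exists_sum n
    refine ⟨s, ?_⟩
    simp only [projAt_cechFrac]
    rw [← map_sum, hs]

theorem projAt_mem {k : ℤ} {I : Finset (Fin r)} {d : ℤ} {z : CechLocalization x N I}
    (hz : z ∈ cechFracPiece x e hx d I) : h.projAt k I z ∈ cechFracPiece x e hx d I := by
  obtain ⟨m, n, hn, rfl⟩ := hz
  exact ⟨m, κ k n, h.map_mem k _ n hn, h.projAt_cechFrac k I m n⟩

/-- The projections onto the components of the bigrading by cohomological degree and `κ`. -/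
def totalProj (hx : RaisesDegree x e 𝒩) (d : ℤ) (γ : ℤ × ℤ) :
    cechTotalPiece x e hx d →ₗ[A] cechTotalPiece x e hx d where
  toFun c := ⟨fun I => if (I.card : ℤ) = γ.1 then h.projAt γ.2 I (c.1 I) else 0,
    mem_cechTotalPiece.mpr fun I => by
      split_ifs
      · exact h.projAt_mem (mem_cechTotalPiece.mp c.2 I)
      · exact zero_mem _⟩
  map_add' c c' := by
    refine Subtype.ext (funext fun I => ?_)
    by_cases hI : (I.card : ℤ) = γ.1
    · simp [hI]
    · simp [hI]
  map_smul' a c := by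
    refine Subtype.ext (funext fun I => ?_)
    by_cases hI : (I.card : ℤ) = γ.1
    · simp [hI]
    · simp [hI]

theorem totalProj_apply (d : ℤ) (γ : ℤ × ℤ) (c : cechTotalPiece x e hx d) (I : Finset (Fin r)) :
    (h.totalProj hx d γ c).1 I = if (I.card : ℤ) = γ.1 then h.projAt γ.2 I (c.1 I) else 0 := rfl

theorem isGrading_totalProj (hx : RaisesDegree x e 𝒩) (d : ℤ) : IsGrading (h.totalProj hx d) where
  apply_self γ c := by
    refine Subtype.ext (funext fun I => ?_)
    simp only [totalProj_apply]
    split_ifs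
    · exact (h.isGrading_projAt I).apply_self _ _
    · rfl
  apply_ne γ γ' c hne := by
    refine Subtype.ext (funext fun I => ?_)
    simp only [totalProj_apply]
    split_ifs with h1 h2
    · exact (h.isGrading_projAt I).apply_ne _ _ _ fun h3 => hne (Prod.ext (h1.symm.trans h2) h3)
    · exact map_zero _
    · rfl
  exists_sum c := by
    classical
    choose s hs using fun I => (h.isGrading_projAt I).exists_sum_superset (c.1 I)
    let s₁ : Finset ℤ := Finset.univ.image fun I : Finset (Fin r) => (I.card : ℤ)
    refine ⟨s₁ ×ˢ Finset.univ.biUnion s, Subtype.ext (funext fun I => ?_)⟩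
    rw [AddSubmonoidClass.coe_finsetSum, Finset.sum_apply, Finset.sum_product]
    simp only [totalProj_apply]
    rw [Finset.sum_eq_single (I.card : ℤ)]
    · simp only [if_true]
      exact hs I _ (Finset.subset_biUnion_of_mem s (Finset.mem_univ I))
    · intro p _ hp
      exact Finset.sum_eq_zero fun _ _ => if_neg hp.symm
    · exact fun hI => absurd (Finset.mem_image_of_mem _ (Finset.mem_univ I)) hI

theorem projAt_cechRes (k : ℤ) {I J : Finset (Fin r)} (hIJ : I ⊆ J) (z : CechLocalization x N I) :
    h.projAt k J (cechRes x N I J z) = cechRes x N I J (h.projAt k I z) :=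
  cechMapAt_cechRes (h.isCechMap k) hIJ z

/-- The differential has bidegree (1, 0): it adds one index to a set and commutes with κ. Hence the
bigrading descends to the homology of the total complex. -/
theorem cechDPiece_totalProj (d : ℤ) (γ : ℤ × ℤ) (c : cechTotalPiece x e hx d) :
    cechDPiece x e hx d (h.totalProj hx d γ c) =
      h.totalProj hx d (γ + (1, 0)) (cechDPiece x e hx d c) := by
  refine Subtype.ext (funext fun J => ?_)
  rw [totalProj_apply, cechDPiece_coe, cechDPiece_coe, cechDTotal_apply, cechDTotal_apply]
  have hcard : ∀ j ∈ J, ((J.erase j).card : ℤ) = γ.1 ↔ (J.card : ℤ) = (γ + (1, 0)).1 := by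
    intro j hj
    have := Finset.card_erase_add_one hj
    rw [Prod.fst_add]
    lia
  split_ifs with hJ
  · rw [map_sum]
    refine Finset.sum_congr rfl fun j hj => ?_
    rw [totalProj_apply, if_pos ((hcard j hj).mpr hJ), Int.cast_smul_eq_zsmul,
      Int.cast_smul_eq_zsmul, map_zsmul, projAt_cechRes _ _ (Finset.erase_subset j J),
      Prod.snd_add, add_zero]
  · refine Finset.sum_eq_zero fun j hj => ?_
    rw [totalProj_apply, if_neg fun h1 => hJ ((hcard j hj).mp h1), map_zero, smul_zero]

theorem smul_totalProj {t : P} {c₀ : ℤ} (ht : ∀ k n, t • κ k n = κ (k + c₀) (t • n)) (d : ℤ)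
    (γ : ℤ × ℤ) (c : cechTotalPiece x e hx d) :
    t • h.totalProj hx d γ c = h.totalProj hx d (γ + (0, c₀)) (t • c) := by
  refine Subtype.ext (funext fun I => ?_)
  have h1 : (t • h.totalProj hx d γ c).1 I = t • (h.totalProj hx d γ c).1 I := rfl
  have h2 : (t • c).1 I = t • c.1 I := rfl
  rw [h1, totalProj_apply, totalProj_apply, h2, Prod.fst_add, Prod.snd_add, add_zero]
  split_ifs
  · obtain ⟨m, n, hz⟩ := exists_eq_cechFrac x (c.1 I)
    have h3 : ∀ n, t • cechFrac x N I m n = cechFrac x N I m (t • n) := fun n =>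
      ((cechFrac x N I m).map_smul_of_tower t n).symm
    rw [hz, projAt_cechFrac, h3, h3, projAt_cechFrac, ht]
  · exact smul_zero _

end IsCechGrading

end BigradedCech

end

end GradedLocalCohomology

namespace GradedLocalCohomology

noncomputable section

set_option linter.unusedSectionVars false

/-! ### Čech cohomology modules as components of the total homology. -/

section BigradedCohomology

variable {A P S N : Type*} [CommRing A] [CommRing P] [CommRing S] [Algebra A P] [Algebra A S]
  [Algebra P S] [IsScalarTower A P S] [AddCommGroup N] [Module S N] [Module P N] [Module A N]
  [IsScalarTower A P N] [IsScalarTower P S N] [IsScalarTower A S N] {r : ℕ} {x : Fin r → S}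
  {e : Fin r → ℕ} {𝒩 : ℤ → Submodule P N} {κ : ℤ → N →ₗ[A] N}

namespace IsCechGrading

variable (h : IsCechGrading x 𝒩 κ) {hx : RaisesDegree x e 𝒩} {ℛ : ℤ → Submodule A N}
  {k s : ℤ} (hℛ : ∀ d n, n ∈ ℛ (d + s) ↔ n ∈ 𝒩 d ∧ κ k n = n)
include h hℛ

/-- The hypothesis hℛ identifies the part of ℛ of degree d + s with the k-th component of 𝒩 d. In
the application 𝒩 is the shifted grading of the symmetric algebra, ℛ the internal grading of its
k-th power, and s = k b. -/
theorem mem_cechFracPiece_iff (hx' : RaisesDegree x e ℛ) {d : ℤ} {I : Finset (Fin r)}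
    {z : CechLocalization x N I} : z ∈ cechFracPiece x e hx' (d + s) I ↔
      z ∈ cechFracPiece x e hx d I ∧ h.projAt k I z = z := by
  constructor
  · rintro ⟨m, n, hn, rfl⟩
    rw [add_right_comm, hℛ] at hn
    exact ⟨⟨m, n, hn.1, rfl⟩, by rw [projAt_cechFrac, hn.2]⟩
  · rintro ⟨⟨m, n, hn, rfl⟩, hz⟩
    rw [projAt_cechFrac] at hz
    refine ⟨m, κ k n, ?_, hz.symm⟩
    rw [add_right_comm, hℛ]
    exact ⟨h.map_mem k _ n hn, h.apply_self k n⟩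

theorem mem_cechTotalPiece_of_mem (hx' : RaisesDegree x e ℛ) {d : ℤ} {c : CechTotal x N}
    (hc : c ∈ cechTotalPiece x e hx' (d + s)) : c ∈ cechTotalPiece x e hx d :=
  mem_cechTotalPiece.mpr fun I =>
    ((h.mem_cechFracPiece_iff hℛ hx').mp (mem_cechTotalPiece.mp hc I)).1

theorem totalProj_eq_cechIncl (d : ℤ) (p : ℕ) (c : cechTotalPiece x e hx d) :
    (h.totalProj hx d (p, k) c).1 = cechIncl x N p (cechProj x N p (h.totalProj hx d (p, k) c).1) := by
  funext I
  by_cases hI : I.card = p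
  · rw [cechIncl_apply _ hI]
    rfl
  · rw [cechIncl_apply_of_ne _ hI, totalProj_apply, if_neg]
    exact fun h1 => hI (Int.ofNat_inj.mp h1)

theorem totalProj_mem (hx' : RaisesDegree x e ℛ) (d : ℤ) (p : ℤ) (c : cechTotalPiece x e hx d) :
    (h.totalProj hx d (p, k) c).1 ∈ cechTotalPiece x e hx' (d + s) := by
  refine mem_cechTotalPiece.mpr fun I => ?_
  rw [h.mem_cechFracPiece_iff hℛ hx' (hx := hx)]
  refine ⟨mem_cechTotalPiece.mp (h.totalProj hx d (p, k) c).2 I, ?_⟩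
  rw [totalProj_apply]
  split_ifs
  · exact (h.isGrading_projAt I).apply_self _ _
  · exact map_zero _

theorem totalProj_eq_self (hx' : RaisesDegree x e ℛ) (d : ℤ) (p : ℕ) (c : cechTotalPiece x e hx d)
    (c' : CechCochain x N p) (hc' : cechIncl x N p c' ∈ cechTotalPiece x e hx' (d + s))
    (hcc : c.1 = cechIncl x N p c') : h.totalProj hx d (p, k) c = c := by
  refine Subtype.ext (funext fun I => ?_)
  rw [totalProj_apply, hcc]
  split_ifs with hI
  · exact ((h.mem_cechFracPiece_iff hℛ hx' (hx := hx)).mp (mem_cechTotalPiece.mp hc' I)).2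
  · rw [cechIncl_apply_of_ne]
    exact fun h1 => hI (Int.ofNat_inj.mpr h1)

/-- The components of the homology of the total Čech complex are Čech cohomology modules. -/
theorem nonempty_range_equiv (hx : RaisesDegree x e 𝒩) (hx' : RaisesDegree x e ℛ) (d : ℤ)
    (p : ℕ) :
    Nonempty (LinearMap.range (homologyGrading (h.cechDPiece_totalProj d (hx := hx)) (p, k)) ≃ₗ[A]
      CechCohomology hx' p (d + s)) := by
  set Z := subCocycles (fun p => (cechD x N p).restrictScalars A)
    (fun p => cechCochainPiece x hx' p (d + s)) p with hZ
  set D := cechDPiece x e hx d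
  have hDP : ∀ γ c, D (h.totalProj hx d γ c) = h.totalProj hx d (γ + (1, 0)) (D c) :=
    h.cechDPiece_totalProj d
  have hmem : ∀ c : Z, cechIncl x N p c.1 ∈ cechTotalPiece x e hx' (d + s) := fun c =>
    (mem_subCocycles.mp c.2).2
  let ψ₀ : Z →ₗ[A] LinearMap.ker D :=
    { toFun := fun c => ⟨⟨cechIncl x N p c.1, h.mem_cechTotalPiece_of_mem hℛ hx' (hmem c)⟩,
        Subtype.ext (mem_subCocycles.mp c.2).1⟩
      map_add' := fun c c' => Subtype.ext (Subtype.ext (map_add (cechIncl x N p) c.1 c'.1))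
      map_smul' := fun a c => Subtype.ext (Subtype.ext
        ((cechIncl x N p).map_smul_of_tower a c.1)) }
  let ψ : Z →ₗ[A] DiffHomology D := (DiffHomology.mk D).restrictScalars A ∘ₗ ψ₀
  have hker : LinearMap.ker ψ = (subCoboundaries (fun p => (cechD x N p).restrictScalars A)
      (fun p => cechCochainPiece x hx' p (d + s)) p).submoduleOf Z := by
    ext c
    rw [LinearMap.mem_ker]
    have h1 : ψ c = 0 ↔ ∃ b, D b = (ψ₀ c).1 := DiffHomology.mk_eq_zero
    have h2 : c ∈ (subCoboundaries (fun p => (cechD x N p).restrictScalars A)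
      (fun p => cechCochainPiece x hx' p (d + s)) p).submoduleOf Z ↔
      ∃ b ∈ cechTotalPiece x e hx' (d + s), cechProj x N p (cechDTotal x N b) = c.1 :=
      mem_subCoboundaries
    rw [h1, h2]
    have hc : h.totalProj hx d (p, k) (ψ₀ c).1 = (ψ₀ c).1 :=
      h.totalProj_eq_self hℛ hx' d p _ c.1 (hmem c) rfl
    constructor
    · rintro ⟨b, hb⟩
      -- A primitive may be replaced by its component of bidegree (p - 1, k). The subtraction is in
      -- ℤ, so for p = 0 that component vanishes, as it should.
      refine ⟨(h.totalProj hx d (p - 1, k) b).1, h.totalProj_mem hℛ hx' d _ b, ?_⟩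
      have h3 : D (h.totalProj hx d (p - 1, k) b) = (ψ₀ c).1 := by
        rw [hDP, hb]
        convert hc using 3
        ext <;> simp
      have h4 : cechDTotal x N (h.totalProj hx d (p - 1, k) b).1 = (ψ₀ c).1.1 :=
        congrArg Subtype.val h3
      rw [h4]
      exact cechProj_cechIncl c.1
    · rintro ⟨b, hb, hbc⟩
      set b' : cechTotalPiece x e hx d := ⟨b, h.mem_cechTotalPiece_of_mem hℛ hx' hb⟩
      refine ⟨h.totalProj hx d (p - 1, k) b', ?_⟩
      rw [hDP]
      have h5 : ((p : ℤ) - 1, k) + (1, 0) = ((p : ℤ), k) := by ext <;> simp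
      rw [h5]
      refine Subtype.ext (funext fun I => ?_)
      rw [totalProj_apply]
      have h6 : (ψ₀ c).1.1 I = cechIncl x N p c.1 I := rfl
      rw [h6, ← hbc]
      split_ifs with hI
      · rw [cechIncl_apply _ (Int.ofNat_inj.mp hI)]
        have h7 : cechDTotal x N b ∈ cechTotalPiece x e hx' (d + s) := cechDTotal_mem hb
        exact ((h.mem_cechFracPiece_iff hℛ hx' (hx := hx)).mp (mem_cechTotalPiece.mp h7 I)).2
      · rw [cechIncl_apply_of_ne]
        exact fun h1 => hI (Int.ofNat_inj.mpr h1)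
  have hrange : LinearMap.range ψ =
      LinearMap.range (homologyGrading (h.cechDPiece_totalProj d (hx := hx)) (p, k)) := by
    apply le_antisymm
    · rintro _ ⟨c, rfl⟩
      exact ⟨ψ c, homologyGrading_mk _ _ _ _ (h.totalProj_eq_self hℛ hx' d p _ c.1 (hmem c) rfl)⟩
    · rintro _ ⟨z, rfl⟩
      obtain ⟨c, rfl⟩ := DiffHomology.mk_surjective D z
      have h1 := h.totalProj_eq_cechIncl hℛ d p c.1
      have h2 := h.totalProj_mem hℛ hx' d p c.1
      have h3 : D (h.totalProj hx d (p, k) c.1) = 0 := by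
        rw [hDP, c.2, map_zero]
      refine ⟨⟨cechProj x N p (h.totalProj hx d (p, k) c.1).1, mem_subCocycles.mpr ?_⟩, ?_⟩
      · rw [← h1]
        exact ⟨congrArg Subtype.val h3, h2⟩
      · exact (homologyGrading_mk _ _ c _ (Subtype.ext h1)).symm
  rw [← hrange]
  exact ⟨ψ.quotKerEquivRange.symm ≪≫ₗ Submodule.quotEquivOfEq _ _ hker⟩

end IsCechGrading

end BigradedCohomology

section GenericFreeness

universe v w

/-- Graded generic freeness is applied to the homology of the total complex in degree d, bigraded by
cohomological degree and by κ. Its components are the cohomology modules for all p and k, so one g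
serves them all. -/
theorem IsCechGrading.exists_freeAt {A : Type*} {P : Type w} {S : Type*} {N : Type v} [CommRing A]
    [IsNoetherianRing A] [IsReduced A] [CommRing P] [CommRing S] [Algebra A P] [Algebra A S]
    [Algebra P S] [IsScalarTower A P S] [AddCommGroup N] [Module S N] [Module P N] [Module A N]
    [IsScalarTower A P N] [IsScalarTower P S N] [IsScalarTower A S N] {r : ℕ} {x : Fin r → S}
    {e : Fin r → ℕ} {𝒩 : ℤ → Submodule P N} {κ : ℤ → N →ₗ[A] N} {q : Ideal A}
    (hq : q ∈ minimalPrimes A) (h : IsCechGrading x 𝒩 κ) (hx : RaisesDegree x e 𝒩) (d : ℤ)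
    [Module.Finite P (DiffHomology (cechDPiece x e hx d))] {n : ℕ} {t : Fin n → P}
    (ht : Algebra.adjoin A (Set.range t) = ⊤) {c : Fin n → ℤ}
    (hc : ∀ i k n, t i • κ k n = κ (k + c i) (t i • n)) :
    ∃ g ∉ q, ∀ (k s : ℤ) (ℛ : ℤ → Submodule A N) (hx' : RaisesDegree x e ℛ),
      (∀ d n, n ∈ ℛ (d + s) ↔ n ∈ 𝒩 d ∧ κ k n = n) → ∀ p,
        FreeAt g (CechCohomology hx' p (d + s)) := by
  obtain ⟨g, hg, hfree⟩ := exists_freeAt_range hq ht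
    (isGrading_homologyGrading (h.isGrading_totalProj hx d) (h.cechDPiece_totalProj d))
    (c := fun i => (0, c i)) fun i γ z => smul_homologyGrading (h.cechDPiece_totalProj d)
      (fun γ c => h.smul_totalProj (hc i) d γ c) γ z
  refine ⟨g, hg, fun k s ℛ hx' hℛ p => ?_⟩
  obtain ⟨E⟩ := h.nonempty_range_equiv hℛ hx hx' d p
  exact (hfree (p, k)).of_equiv E

end GenericFreeness

end

end GradedLocalCohomology

namespace GradedLocalCohomology

noncomputable section

set_option linter.unusedSectionVars false

/-! ### The shifted grading and generic freeness of the cohomology of symmetric powers. -/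

section Weight

/-- The linear coarsening of the bigrading under which elements of degree `b` of the module have
degree zero. -/
def shiftedDegree (b : ℤ) : ℤ × ℤ →+ ℤ :=
  AddMonoidHom.snd ℤ ℤ - (AddMonoidHom.mulRight b).comp (AddMonoidHom.fst ℤ ℤ)

@[simp]
theorem shiftedDegree_apply (b k d : ℤ) : shiftedDegree b (k, d) = d - k * b := rfl

end Weight

/-- Modulo the ideal of the x l, an A-polynomial in the t i, the u i and the x l becomes a
P-combination of monomials in the u i alone; hence V = {1} suffices. -/
theorem generatedModulo_of_adjoin {A P S : Type*} [CommRing A] [CommRing P] [CommRing S] [Algebra A P]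
    [Algebra A S] [Algebra P S] [IsScalarTower A P S] {n r s : ℕ} {t : Fin n → P} {x : Fin r → S}
    {u : Fin s → S} (hgen : Algebra.adjoin A (Set.range (fun i => algebraMap P S (t i)) ∪
      Set.range u ∪ Set.range x) = ⊤) : GeneratedModulo P x u {1} := by
  have hset : {a : S | ∃ v ∈ ({1} : Finset S), ∃ w ∈ Submonoid.closure (Set.range u), a = w * v} =
      Submonoid.closure (Set.range u) := by
    ext a
    simp
  rw [GeneratedModulo, hset, ← Algebra.adjoin_eq_span, eq_top_iff]
  intro a _
  have ha : a ∈ Algebra.adjoin A (Set.range (fun i => algebraMap P S (t i)) ∪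
      Set.range u ∪ Set.range x) := hgen ▸ Algebra.mem_top
  induction ha using Algebra.adjoin_induction with
  | mem a ha =>
    rcases ha with (⟨i, rfl⟩ | ha) | ha
    · exact Submodule.mem_sup_left (algebraMap_mem (Algebra.adjoin P (Set.range u)) (t i))
    · exact Submodule.mem_sup_left (Algebra.subset_adjoin (R := P) ha)
    · exact Submodule.mem_sup_right (Ideal.subset_span ha)
  | algebraMap a =>
    rw [IsScalarTower.algebraMap_apply A P S]
    exact Submodule.mem_sup_left (algebraMap_mem (Algebra.adjoin P (Set.range u)) _)
  | add a b _ _ ha hb => exact add_mem (ha trivial) (hb trivial)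
  | mul a b _ _ ha hb =>
    obtain ⟨a₁, ha₁, a₂, ha₂, rfl⟩ := Submodule.mem_sup.mp (ha trivial)
    obtain ⟨b₁, hb₁, b₂, hb₂, rfl⟩ := Submodule.mem_sup.mp (hb trivial)
    rw [add_mul, mul_add, add_assoc]
    refine add_mem (Submodule.mem_sup_left (mul_mem ha₁ hb₁ : a₁ * b₁ ∈ Algebra.adjoin P _))
      (Submodule.mem_sup_right ?_)
    exact add_mem (Ideal.mul_mem_left _ a₁ hb₂) (Ideal.mul_mem_right _ _ ha₂)

namespace IsGradedSymmetricAlgebra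

universe w w'

variable {A : Type w} {R M : Type*} {T : Type w'} [CommRing A] [CommRing R] [Algebra A R]
  [AddCommGroup M] [Module R M] [Module A M] [CommRing T] [Algebra A T] [Algebra R T]
  [IsScalarTower A R T] {𝒜 : ℕ → Submodule A R} {ℳ : ℤ → Submodule A M} {ι : M →ₗ[R] T}
  [GradedAlgebra 𝒜] (h : IsGradedSymmetricAlgebra 𝒜 ℳ ι)
include h

theorem proj_fst_proj_shiftedDegree (b k d : ℤ) (t : T) :
    h.proj (AddMonoidHom.fst ℤ ℤ) k (h.proj (shiftedDegree b) d t) =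
      h.proj (AddMonoidHom.id (ℤ × ℤ)) (k, d + k * b) t := by
  induction t using h.induction_homogeneous with
  | zero => simp only [map_zero]
  | add s t hs ht => simp only [map_add, hs, ht]
  | mem k' d' t ht =>
    by_cases h1 : shiftedDegree b (k', d') = d
    · rw [h.proj_self _ ht h1]
      rw [shiftedDegree_apply] at h1
      by_cases h2 : (k' : ℤ) = k
      · subst h2
        rw [h.proj_self (AddMonoidHom.fst ℤ ℤ) (γ := (k' : ℤ)) ht rfl, h.proj_self _ ht]
        change ((k' : ℤ), d') = _
        rw [← h1, sub_add_cancel]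
      · rw [h.proj_ne _ ht h2, h.proj_ne _ ht]
        exact fun h3 => h2 (congrArg Prod.fst h3)
    · rw [h.proj_ne _ ht h1, map_zero, h.proj_ne _ ht]
      intro h3
      have h4 : (k' : ℤ) = k := congrArg Prod.fst h3
      have h5 : d' = d + k * b := congrArg Prod.snd h3
      rw [shiftedDegree_apply, h5, h4, add_sub_cancel_right] at h1
      exact h1 rfl

/-- The bidegree can be recovered from the symmetric degree and the shifted degree, so the fixed
shifted degree d contains the pieces of internal degree d + k b of all symmetric powers. -/
theorem mem_symPiece_iff (b : ℤ) (k : ℕ) (d : ℤ) (t : T) :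
    t ∈ symPiece 𝒜 ℳ ι k (d + k * b) ↔
      t ∈ LinearMap.range (h.proj (shiftedDegree b) d) ∧
        h.proj (AddMonoidHom.fst ℤ ℤ) k t = t := by
  constructor
  · intro ht
    exact ⟨⟨t, h.proj_self _ ht (by simp)⟩, h.proj_self _ ht rfl⟩
  · rintro ⟨⟨s, rfl⟩, ht⟩
    rw [← ht, proj_fst_proj_shiftedDegree,
      ← h.range_proj_eq (AddMonoidHom.id (ℤ × ℤ)) (γ := (k, d + k * b))]
    · exact ⟨s, rfl⟩
    · intro k' d'
      change ((k' : ℤ), d') = ((k : ℤ), d + k * b) ↔ _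
      rw [Prod.mk.injEq, Nat.cast_inj]

/-- Generic freeness of the symmetric powers. -/
theorem exists_freeAt_symPiece [IsNoetherianRing A] [IsReduced A] {q : Ideal A}
    (hq : q ∈ minimalPrimes A) {G : Set T} (hG : G.Finite) (hgen : Algebra.adjoin A G = ⊤)
    (hhom : ∀ t ∈ G, ∃ (k : ℕ) (d : ℤ), t ∈ symPiece 𝒜 ℳ ι k d) :
    ∃ g ∉ q, ∀ k d, FreeAt g (symPiece 𝒜 ℳ ι k d) := by
  obtain ⟨n, t, -, rfl⟩ := hG.fin_param
  choose k d ht using fun i => hhom (t i) (Set.mem_range_self i)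
  obtain ⟨g, hg, hfree⟩ := exists_freeAt_range hq hgen (L := T)
    (h.isGrading_proj (AddMonoidHom.id (ℤ × ℤ))) (c := fun i => (k i, d i)) fun i γ l =>
      (h.proj_mul _ (h.coaction_of_mem (AddMonoidHom.id (ℤ × ℤ)) (ht i)) γ l).symm
  refine ⟨g, hg, fun k d => ?_⟩
  rw [← h.range_proj_eq (AddMonoidHom.id (ℤ × ℤ)) (γ := (k, d))]
  · exact hfree _
  · intro k' d'
    change ((k' : ℤ), d') = ((k : ℤ), d) ↔ _
    rw [Prod.mk.injEq, Nat.cast_inj]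

section Polynomial

variable {n : ℕ} {v : Fin n → T} {w : Fin n → ℕ} {b : ℤ}
  (hv : ∀ i, v i ∈ symPiece 𝒜 ℳ ι (w i) (w i * b))
include hv

theorem coaction_aeval (p : MvPolynomial (Fin n) A) :
    h.coaction (shiftedDegree b) (MvPolynomial.aeval v p) =
      AddMonoidAlgebra.single 0 (MvPolynomial.aeval v p) := by
  induction p using MvPolynomial.induction_on with
  | C a => rw [MvPolynomial.aeval_C, h.coaction_algebraMap_base]
  | add p p' hp hp' => rw [map_add, map_add, hp, hp', AddMonoidAlgebra.single_add]
  | mul_X p i hp =>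
    rw [map_mul, map_mul, hp, MvPolynomial.aeval_X, h.coaction_of_mem _ (hv i),
      AddMonoidAlgebra.single_mul_single, shiftedDegree_apply, sub_self, add_zero]

/-- The projections of the shifted grading are linear over the polynomials in elements of shifted
degree zero. -/
def polyProj [Algebra (MvPolynomial (Fin n) A) T]
    (halg : ∀ p, algebraMap (MvPolynomial (Fin n) A) T p = MvPolynomial.aeval v p) (d : ℤ) :
    T →ₗ[MvPolynomial (Fin n) A] T where
  toFun := h.proj (shiftedDegree b) d
  map_add' := map_add _
  map_smul' p t := by
    rw [RingHom.id_apply, Algebra.smul_def, Algebra.smul_def, halg]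
    have := h.proj_mul (shiftedDegree b) (h.coaction_aeval hv p) d t
    rwa [add_zero] at this

/-- Generic freeness of the Čech cohomology of the symmetric powers. -/
theorem exists_freeAt_cechCohomology [IsNoetherianRing A] [IsReduced A] {q : Ideal A}
    (hq : q ∈ minimalPrimes A) (j : ℤ) {r : ℕ} {x : Fin r → R} {e : Fin r → ℕ}
    (he : ∀ l, 0 < e l) (hx : ∀ l, x l ∈ 𝒜 (e l)) {s : ℕ} {u : Fin s → T} {γ : Fin s → ℕ}
    (hγ : ∀ i, 0 < γ i) (hu : ∀ i, u i ∈ symPiece 𝒜 ℳ ι 1 (b - γ i))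
    (hgen : Algebra.adjoin A (Set.range v ∪ Set.range u ∪
      Set.range fun l => algebraMap R T (x l)) = ⊤) :
    ∃ g ∉ q, ∀ (k : ℕ) (hx' : RaisesDegree (fun l => algebraMap R T (x l)) e
      (symPiece 𝒜 ℳ ι k)) (p : ℕ), FreeAt g (CechCohomology hx' p (j + k * b)) := by
  -- The v i have shifted degree zero, so T becomes an algebra over the polynomial ring P on them,
  -- and P acts on every shifted degree separately. It still raises the symmetric degree by the w i.
  let := (MvPolynomial.aeval v : MvPolynomial (Fin n) A →ₐ[A] T).toRingHom.toAlgebra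
  have halg : ∀ p, algebraMap (MvPolynomial (Fin n) A) T p = MvPolynomial.aeval v p := fun _ => rfl
  have : IsScalarTower A (MvPolynomial (Fin n) A) T :=
    IsScalarTower.of_algebraMap_eq fun a => by
      rw [halg]
      exact ((MvPolynomial.aeval v).commutes a).symm
  have hnoeth : IsNoetherianRing T := by
    have : Algebra.FiniteType A T := ⟨⟨((Set.finite_range v).union (Set.finite_range u)).union
      (Set.finite_range _) |>.toFinset, by rwa [Set.Finite.coe_toFinset]⟩⟩
    exact Algebra.FiniteType.isNoetherianRing A T
  have hgr : IsGradedModule (fun l => algebraMap R T (x l)) e u γ (h.polyProj hv halg) := by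
    refine ⟨⟨?_, ?_, ?_⟩, fun l d t => ?_, fun i d t => ?_⟩
    · exact (h.isGrading_proj (shiftedDegree b)).apply_self
    · exact (h.isGrading_proj (shiftedDegree b)).apply_ne
    · exact (h.isGrading_proj (shiftedDegree b)).exists_sum
    · have := h.proj_mul (shiftedDegree b) (h.coaction_algebraMap (shiftedDegree b) (hx l)) d t
      rw [shiftedDegree_apply, zero_mul, sub_zero] at this
      exact this.symm
    · have := h.proj_mul (shiftedDegree b) (h.coaction_of_mem (shiftedDegree b) (hu i)) d t
      rw [shiftedDegree_apply, Nat.cast_one, one_mul, sub_sub_cancel_left] at this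
      rw [sub_eq_add_neg]
      exact this.symm
  have hV : GeneratedModulo (MvPolynomial (Fin n) A) (fun l => algebraMap R T (x l)) u {1} := by
    refine generatedModulo_of_adjoin (t := MvPolynomial.X) (A := A) ?_
    convert hgen using 5
    funext i
    rw [halg, MvPolynomial.aeval_X]
  have hfin := hgr.hasFiniteCohomology he hγ hV
  have hcech : IsCechGrading (fun l => algebraMap R T (x l))
      (fun d => LinearMap.range (h.polyProj hv halg d)) (h.proj (AddMonoidHom.fst ℤ ℤ)) := by
    refine ⟨h.isGrading_proj _, fun k l t => ?_, ?_⟩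
    · have := h.proj_mul _ (h.coaction_algebraMap_of_forall (AddMonoidHom.fst ℤ ℤ)
        (fun e => rfl) (x l)) k t
      rwa [add_zero] at this
    · rintro k d _ ⟨t, rfl⟩
      exact ⟨h.proj (AddMonoidHom.fst ℤ ℤ) k t, h.proj_comm _ _ _ _ _⟩
  -- The cohomology in shifted degree j, for all symmetric powers together, is a finite P-module.
  -- Generic freeness is applied to it with the variables of P as generators.
  have := hfin.1 j
  obtain ⟨g, hg, hfree⟩ := hcech.exists_freeAt hq hgr.raisesDegree j
    (MvPolynomial.adjoin_range_X (R := A) (σ := Fin n)) (c := fun i => (w i : ℤ)) (fun i k t => by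
      rw [Algebra.smul_def, Algebra.smul_def, halg, MvPolynomial.aeval_X]
      exact (h.proj_mul (AddMonoidHom.fst ℤ ℤ) (h.coaction_of_mem _ (hv i)) k t).symm)
  refine ⟨g, hg, fun k hx' p => hfree k (k * b) (symPiece 𝒜 ℳ ι k) hx' (fun d t => ?_) p⟩
  exact h.mem_symPiece_iff b k d t

end Polynomial

end IsGradedSymmetricAlgebra

end

end GradedLocalCohomology

namespace GradedLocalCohomology

noncomputable section

set_option linter.unusedSectionVars false

/-! ### Homogeneous generators of the ring, the module and the symmetric algebra. -/

section RingGenerators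

variable {A R : Type*} [CommRing A] [CommRing R] [Algebra A R] (𝒜 : ℕ → Submodule A R)
  [GradedAlgebra 𝒜]

theorem exists_homogeneous_adjoin_eq_top [Algebra.FiniteType A R] :
    ∃ G : Set R, G.Finite ∧ (∀ a ∈ G, ∃ e, a ∈ 𝒜 e) ∧ Algebra.adjoin A G = ⊤ := by
  classical
  obtain ⟨F, hF⟩ := Algebra.FiniteType.out (R := A) (A := R)
  refine ⟨⋃ a ∈ F, ⋃ e ∈ (DirectSum.decompose 𝒜 a).support,
    {(DirectSum.decompose 𝒜 a e : R)}, ?_, ?_, ?_⟩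
  · exact F.finite_toSet.biUnion fun a _ => (Finset.finite_toSet _).biUnion fun e _ =>
      Set.finite_singleton _
  · intro a ha
    simp only [Set.mem_iUnion, Set.mem_singleton_iff] at ha
    obtain ⟨b, -, e, -, rfl⟩ := ha
    exact ⟨e, (DirectSum.decompose 𝒜 b e).2⟩
  · rw [← top_le_iff, ← hF, Algebra.adjoin_le_iff]
    intro a ha
    rw [← DirectSum.sum_support_decompose 𝒜 a]
    refine sum_mem fun e he => Algebra.subset_adjoin ?_
    simp only [Set.mem_iUnion, Set.mem_singleton_iff]
    exact ⟨a, ha, e, he, rfl⟩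

theorem eq_zero_of_mem_irrelevant {a : R} (ha : a ∈ (HomogeneousIdeal.irrelevant 𝒜).toIdeal)
    (ha0 : a ∈ 𝒜 0) : a = 0 := by
  have h := (HomogeneousIdeal.mem_irrelevant_iff 𝒜 a).mp ha
  rwa [GradedRing.proj_apply, DirectSum.decompose_of_mem_same 𝒜 ha0] at h

/-- Modulo the ideal of X every element is congruent to one of degree zero, and the irrelevant ideal
contains no nonzero element of degree zero. -/
theorem span_eq_irrelevant {Z X : Set R} (hZ : ∀ z ∈ Z, z ∈ 𝒜 0)
    (hX : ∀ x ∈ X, ∃ e, 0 < e ∧ x ∈ 𝒜 e) (hgen : Algebra.adjoin A (Z ∪ X) = ⊤) :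
    Ideal.span X = (HomogeneousIdeal.irrelevant 𝒜).toIdeal := by
  have hle : Ideal.span X ≤ (HomogeneousIdeal.irrelevant 𝒜).toIdeal := by
    rw [Ideal.span_le]
    intro x hx
    obtain ⟨e, he, hxe⟩ := hX x hx
    exact HomogeneousIdeal.mem_irrelevant_of_mem 𝒜 he hxe
  have key : ∀ a : R, ∃ a₀ ∈ 𝒜 0, a - a₀ ∈ Ideal.span X := by
    intro a
    have ha : a ∈ Algebra.adjoin A (Z ∪ X) := hgen ▸ Algebra.mem_top
    induction ha using Algebra.adjoin_induction with
    | mem a ha =>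
      rcases ha with ha | ha
      · exact ⟨a, hZ a ha, by rw [sub_self]; exact zero_mem _⟩
      · exact ⟨0, zero_mem _, by rw [sub_zero]; exact Ideal.subset_span ha⟩
    | algebraMap a =>
      exact ⟨_, SetLike.algebraMap_mem_graded 𝒜 a, by rw [sub_self]; exact zero_mem _⟩
    | add a b _ _ ha hb =>
      obtain ⟨a₀, ha₀, ha⟩ := ha
      obtain ⟨b₀, hb₀, hb⟩ := hb
      exact ⟨a₀ + b₀, add_mem ha₀ hb₀, by rw [add_sub_add_comm]; exact add_mem ha hb⟩
    | mul a b _ _ ha hb =>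
      obtain ⟨a₀, ha₀, ha⟩ := ha
      obtain ⟨b₀, hb₀, hb⟩ := hb
      refine ⟨a₀ * b₀, ?_, ?_⟩
      · have := SetLike.GradedMul.mul_mem (A := 𝒜) ha₀ hb₀
        rwa [add_zero] at this
      · rw [show a * b - a₀ * b₀ = a * (b - b₀) + b₀ * (a - a₀) by ring]
        exact add_mem (Ideal.mul_mem_left _ _ hb) (Ideal.mul_mem_left _ _ ha)
  refine le_antisymm hle fun a ha => ?_
  obtain ⟨a₀, ha₀, h⟩ := key a
  have h0 : a₀ = 0 := eq_zero_of_mem_irrelevant 𝒜 (by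
    have := sub_mem ha (hle h)
    rwa [sub_sub_cancel] at this) ha₀
  rwa [h0, sub_zero] at h

/-- A finite set of homogeneous algebra generators, separated into those of degree zero and those
of positive degree. -/
theorem exists_generators [Algebra.FiniteType A R] : ∃ (Z : Set R) (r : ℕ) (x : Fin r → R)
    (e : Fin r → ℕ), Z.Finite ∧ (∀ z ∈ Z, z ∈ 𝒜 0) ∧ (∀ l, 0 < e l) ∧ (∀ l, x l ∈ 𝒜 (e l)) ∧
      Algebra.adjoin A (Z ∪ Set.range x) = ⊤ ∧
      Ideal.span (Set.range x) = (HomogeneousIdeal.irrelevant 𝒜).toIdeal := by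
  obtain ⟨G, hG, hhom, hgen⟩ := exists_homogeneous_adjoin_eq_top 𝒜
  obtain ⟨r, x, -, hx⟩ := (hG.subset (Set.sep_subset G fun a => ∃ e, 0 < e ∧ a ∈ 𝒜 e)).fin_param
  have hx' : ∀ a ∈ Set.range x, ∃ e, 0 < e ∧ a ∈ 𝒜 e := fun a ha => by
    rw [hx] at ha
    exact ha.2
  choose e he hxe using fun l => hx' (x l) (Set.mem_range_self l)
  have hgen' : Algebra.adjoin A ({a ∈ G | a ∈ 𝒜 0} ∪ Set.range x) = ⊤ := by
    rw [eq_top_iff, ← hgen]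
    refine Algebra.adjoin_mono fun a ha => ?_
    obtain ⟨e, hae⟩ := hhom a ha
    rcases Nat.eq_zero_or_pos e with rfl | he
    · exact Or.inl ⟨ha, hae⟩
    · exact Or.inr (hx ▸ ⟨ha, e, he, hae⟩)
  exact ⟨{a ∈ G | a ∈ 𝒜 0}, r, x, e, hG.subset (Set.sep_subset _ _), fun z hz => hz.2, he, hxe,
    hgen', span_eq_irrelevant 𝒜 (fun z hz => hz.2) hx' hgen'⟩

end RingGenerators

section ModuleGenerators

variable {A R M : Type*} [CommRing A] [CommRing R] [Algebra A R] {𝒜 : ℕ → Submodule A R}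
  [GradedAlgebra 𝒜] [AddCommGroup M] [Module R M] [Module A M] {ℳ : ℤ → Submodule A M}

theorem exists_homogeneousProj (hℳ : DirectSum.IsInternal ℳ) : ∃ π : ℤ → M →+ M,
    (∀ d, ∀ m ∈ ℳ d, π d m = m) ∧ ∀ c d, ∀ m ∈ ℳ c, c ≠ d → π d m = 0 := by
  let E := AddEquiv.ofBijective _ hℳ
  have hE : ∀ c (m : M) (hm : m ∈ ℳ c), E.symm m = DirectSum.of (fun i => ℳ i) c ⟨m, hm⟩ := by
    intro c m hm
    rw [AddEquiv.symm_apply_eq]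
    exact (DirectSum.coeAddMonoidHom_of ℳ c ⟨m, hm⟩).symm
  refine ⟨fun d => ((ℳ d).subtype.toAddMonoidHom.comp
    (DFinsupp.evalAddMonoidHom d)).comp E.symm.toAddMonoidHom, ?_, ?_⟩
  · intro d m hm
    change ((E.symm m d : ℳ d) : M) = m
    rw [hE d m hm, DirectSum.of_eq_same]
  · intro c d m hm hcd
    change ((E.symm m d : ℳ d) : M) = 0
    rw [hE c m hm, DirectSum.of_eq_of_ne _ _ _ hcd.symm]
    rfl

/-- A factor from the irrelevant ideal raises degrees strictly, so a component of degree d of a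
product can only come from module elements of degree less than d. -/
theorem mem_span_of_mem_irrelevant_smul (hℳ : DirectSum.IsInternal ℳ)
    (hsmul : ∀ (n : ℕ) (d : ℤ) (a : R) (m : M), a ∈ 𝒜 n → m ∈ ℳ d → a • m ∈ ℳ (n + d))
    {d : ℤ} {m : M} (hm : m ∈ ℳ d)
    (h : m ∈ (HomogeneousIdeal.irrelevant 𝒜).toIdeal • (⊤ : Submodule R M)) :
    m ∈ Submodule.span R {m : M | ∃ c < d, m ∈ ℳ c} := by
  classical
  obtain ⟨π, hπ, hπ'⟩ := exists_homogeneousProj hℳ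
  suffices key : ∀ w ∈ (HomogeneousIdeal.irrelevant 𝒜).toIdeal • (⊤ : Submodule R M),
      π d w ∈ Submodule.span R {m : M | ∃ c < d, m ∈ ℳ c} by
    have := key m h
    rwa [hπ d m hm] at this
  intro w hw
  induction hw using Submodule.smul_induction_on' with
  | add w w' _ _ hw hw' => rw [map_add]; exact add_mem hw hw'
  | smul a ha n _ =>
    have ha0 : ((DirectSum.decompose 𝒜 a) 0 : R) = 0 :=
      (HomogeneousIdeal.mem_irrelevant_iff 𝒜 a).mp ha
    induction n using induction_isInternal hℳ with
    | zero => rw [smul_zero, map_zero]; exact zero_mem _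
    | add n n' hn hn' => rw [smul_add, map_add]; exact add_mem (hn trivial) (hn' trivial)
    | mem c n hn =>
      rw [← DirectSum.sum_support_decompose 𝒜 a, Finset.sum_smul, map_sum]
      refine sum_mem fun e _ => ?_
      have hmem := hsmul e c _ n (DirectSum.decompose 𝒜 a e).2 hn
      by_cases hd : (e : ℤ) + c = d
      · rw [← hd, hπ _ _ hmem]
        rcases Nat.eq_zero_or_pos e with rfl | he
        · rw [ha0, zero_smul]
          exact zero_mem _
        · exact Submodule.smul_mem _ _ (Submodule.subset_span ⟨c, by lia, hn⟩)
      · rw [hπ' _ _ _ hmem hd]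
        exact zero_mem _

/-- The module is generated by finitely many homogeneous elements of degree at most `b`. -/
theorem exists_homogeneous_span_eq_top [Module.Finite R M] (hℳ : DirectSum.IsInternal ℳ)
    (hsmul : ∀ (n : ℕ) (d : ℤ) (a : R) (m : M), a ∈ 𝒜 n → m ∈ ℳ d → a • m ∈ ℳ (n + d))
    {b : ℤ} (hb : b ∈ upperBounds (generatorDegrees (R := R) 𝒜 ℳ)) :
    ∃ Y : Set M, Y.Finite ∧ (∀ y ∈ Y, ∃ c ≤ b, y ∈ ℳ c) ∧ Submodule.span R Y = ⊤ := by
  set G : Set M := {m : M | ∃ c ≤ b, m ∈ ℳ c}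
  -- Graded Nakayama by induction on the excess of d over b: beyond b there are no generator
  -- degrees, so such elements lie in 𝔪M and are combinations of elements of lower degree.
  have hmem : ∀ (k : ℕ) (d : ℤ), d ≤ b + k → ∀ m ∈ ℳ d, m ∈ Submodule.span R G := by
    intro k
    induction k with
    | zero => exact fun d hd m hm => Submodule.subset_span ⟨d, by simpa using hd, hm⟩
    | succ k ih =>
      intro d hd m hm
      by_cases hdb : d ≤ b
      · exact Submodule.subset_span ⟨d, hdb, hm⟩
      · have h1 : m ∈ (HomogeneousIdeal.irrelevant 𝒜).toIdeal • (⊤ : Submodule R M) := by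
          by_contra h2
          exact hdb (hb ⟨m, hm, h2⟩)
        refine Submodule.span_le.mpr ?_ (mem_span_of_mem_irrelevant_smul hℳ hsmul hm h1)
        rintro n ⟨c, hc, hn⟩
        exact ih c (by push_cast at hd; lia) n hn
  have htop : Submodule.span R G = ⊤ := by
    rw [eq_top_iff]
    intro m _
    induction m using induction_isInternal hℳ with
    | zero => exact zero_mem _
    | add m n hm hn => exact add_mem (hm trivial) (hn trivial)
    | mem d m hm => exact hmem (d - b).toNat d (by lia) m hm
  have hfg : (Submodule.span R G).FG := htop ▸ Module.Finite.fg_top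
  obtain ⟨Y, hYG, hY⟩ := Submodule.fg_span_iff_fg_span_finset_subset G |>.mp hfg
  exact ⟨Y, Y.finite_toSet, fun y hy => hYG hy, hY ▸ htop⟩

end ModuleGenerators

section SymmetricGenerators

variable {A R M T : Type*} [CommRing A] [CommRing R] [Algebra A R] [AddCommGroup M] [Module R M]
  [CommRing T] [Algebra A T] [Algebra R T] [IsScalarTower A R T]

theorem adjoin_eq_top_of_isSymmetricAlgebra {ι : M →ₗ[R] T} (hι : IsSymmetricAlgebra ι)
    {G : Set R} (hG : Algebra.adjoin A G = ⊤) {Y : Set M} (hY : Submodule.span R Y = ⊤) :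
    Algebra.adjoin A (algebraMap R T '' G ∪ ι '' Y) = ⊤ := by
  set B := Algebra.adjoin A (algebraMap R T '' G ∪ ι '' Y)
  have hR : ∀ a, algebraMap R T a ∈ B := by
    intro a
    have ha : a ∈ Algebra.adjoin A G := hG ▸ Algebra.mem_top
    induction ha using Algebra.adjoin_induction with
    | mem a ha => exact Algebra.subset_adjoin (Or.inl ⟨a, ha, rfl⟩)
    | algebraMap a =>
      rw [← IsScalarTower.algebraMap_apply A R T]
      exact algebraMap_mem B a
    | add a b _ _ ha hb => rw [map_add]; exact add_mem ha hb
    | mul a b _ _ ha hb => rw [map_mul]; exact mul_mem ha hb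
  have hM : ∀ m, ι m ∈ B := by
    intro m
    have hm : m ∈ Submodule.span R Y := hY ▸ Submodule.mem_top
    induction hm using Submodule.span_induction with
    | mem m hm => exact Algebra.subset_adjoin (Or.inr ⟨m, hm, rfl⟩)
    | zero => rw [map_zero]; exact zero_mem _
    | add m n _ _ hm hn => rw [map_add]; exact add_mem hm hn
    | smul a m _ hm =>
      rw [LinearMap.map_smul, Algebra.smul_def]
      exact mul_mem (hR a) hm
  rw [eq_top_iff]
  intro t _
  induction t using hι.induction with
  | algebraMap a => exact hR a
  | ι m => exact hM m
  | mul s t hs ht => exact mul_mem (hs trivial) (ht trivial)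
  | add s t hs ht => exact add_mem (hs trivial) (ht trivial)

end SymmetricGenerators

section Freeness

universe w w'

variable {A : Type w} {R M : Type*} {T : Type w'} [CommRing A] [CommRing R] [Algebra A R]
  [AddCommGroup M] [Module R M] [Module A M] [CommRing T] [Algebra A T] [Algebra R T]
  [IsScalarTower A R T] {𝒜 : ℕ → Submodule A R} {ℳ : ℤ → Submodule A M} {ι : M →ₗ[R] T}
  [GradedAlgebra 𝒜]

theorem algebraMap_mem_symPiece {e : ℕ} {a : R} (ha : a ∈ 𝒜 e) :
    algebraMap R T a ∈ symPiece 𝒜 ℳ ι 0 e :=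
  Submodule.subset_span ⟨e, a, Fin.elim0, Fin.elim0, ha, fun i => i.elim0, by simp,
    by simp [Algebra.algebraMap_eq_smul_one]⟩

theorem ι_mem_symPiece {c : ℤ} {m : M} (hm : m ∈ ℳ c) : ι m ∈ symPiece 𝒜 ℳ ι 1 c :=
  Submodule.subset_span ⟨0, 1, fun _ => c, fun _ => m, SetLike.GradedOne.one_mem, fun _ => hm,
    by simp, by simp⟩

/-- There are generators of the irrelevant ideal for which the graded pieces of all symmetric
powers, and all their Čech cohomology modules along a line, become free after one localization. -/
theorem IsGradedSymmetricAlgebra.exists_generators_freeAt [IsNoetherianRing A] [IsReduced A]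
    [Algebra.FiniteType A R] [Module.Finite R M] (h : IsGradedSymmetricAlgebra 𝒜 ℳ ι) (j b : ℤ)
    (hb : b ∈ upperBounds (generatorDegrees (R := R) 𝒜 ℳ)) :
    ∃ (r : ℕ) (x : Fin r → R) (e : Fin r → ℕ), (∀ l, x l ∈ 𝒜 (e l)) ∧
      Ideal.span (Set.range x) = (HomogeneousIdeal.irrelevant 𝒜).toIdeal ∧
      ∀ q ∈ minimalPrimes A, ∃ g ∉ q, (∀ k d, FreeAt g (symPiece 𝒜 ℳ ι k d)) ∧
        ∀ (k : ℕ) (hx' : RaisesDegree (fun l => algebraMap R T (x l)) e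
          (symPiece 𝒜 ℳ ι k)) (p : ℕ), FreeAt g (CechCohomology hx' p (j + k * b)) := by
  obtain ⟨Z, r, x, e, hZ, hZ0, he, hx, hgen, hspan⟩ := exists_generators 𝒜
  obtain ⟨Y, hY, hYb, hYspan⟩ := exists_homogeneous_span_eq_top h.isInternal h.smul_mem hb
  have hT := adjoin_eq_top_of_isSymmetricAlgebra (A := A) h.isSymmetricAlgebra hgen hYspan
  refine ⟨r, x, e, hx, hspan, fun q hq => ?_⟩
  have hprime : q.IsPrime := hq.1.1
  obtain ⟨g₁, hg₁, h₁⟩ := h.exists_freeAt_symPiece hq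
    (((hZ.union (Set.finite_range x)).image _).union (hY.image _)) hT (by
      rintro t (⟨a, ha | ⟨l, rfl⟩, rfl⟩ | ⟨y, hy, rfl⟩)
      · exact ⟨0, 0, algebraMap_mem_symPiece (hZ0 a ha)⟩
      · exact ⟨0, e l, algebraMap_mem_symPiece (hx l)⟩
      · obtain ⟨c, -, hc⟩ := hYb y hy
        exact ⟨1, c, ι_mem_symPiece hc⟩)
  -- The generators are sorted by shifted degree: v collects those of degree zero, from R in degree
  -- 0 and from M in degree exactly b, while u collects those of M in degree below b. The x l have
  -- positive degree.
  obtain ⟨n, v, -, hv⟩ := ((hZ.image (algebraMap R T)).union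
    ((hY.subset (Set.sep_subset Y (· ∈ ℳ b))).image ι)).fin_param
  obtain ⟨s, u, -, hu⟩ := ((hY.subset (Set.sep_subset Y
    fun y => ∃ γ : ℕ, 0 < γ ∧ y ∈ ℳ (b - γ))).image ι).fin_param
  have hv' : ∀ i, ∃ w : ℕ, v i ∈ symPiece 𝒜 ℳ ι w (w * b) := by
    intro i
    have : v i ∈ Set.range v := ⟨i, rfl⟩
    rw [hv] at this
    rcases this with ⟨z, hz, hzi⟩ | ⟨y, hy, hyi⟩
    · refine ⟨0, ?_⟩
      rw [← hzi, Nat.cast_zero, zero_mul]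
      exact algebraMap_mem_symPiece (hZ0 z hz)
    · refine ⟨1, ?_⟩
      rw [← hyi, Nat.cast_one, one_mul]
      exact ι_mem_symPiece hy.2
  have hu' : ∀ i, ∃ γ : ℕ, 0 < γ ∧ u i ∈ symPiece 𝒜 ℳ ι 1 (b - γ) := by
    intro i
    have : u i ∈ Set.range u := ⟨i, rfl⟩
    rw [hu] at this
    obtain ⟨y, ⟨-, γ, hγ, hy⟩, hyi⟩ := this
    exact ⟨γ, hγ, hyi ▸ ι_mem_symPiece hy⟩
  choose w hw using hv'
  choose γ hγ hγu using hu'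
  have hgen' : Algebra.adjoin A (Set.range v ∪ Set.range u ∪
      Set.range fun l => algebraMap R T (x l)) = ⊤ := by
    rw [eq_top_iff, ← hT]
    refine Algebra.adjoin_mono ?_
    rintro t (⟨a, ha | ⟨l, rfl⟩, rfl⟩ | ⟨y, hy, rfl⟩)
    · exact Or.inl (Or.inl (hv ▸ Or.inl ⟨a, ha, rfl⟩))
    · exact Or.inr ⟨l, rfl⟩
    · obtain ⟨c, hcb, hc⟩ := hYb y hy
      refine Or.inl ?_
      rcases hcb.eq_or_lt with rfl | hlt
      · exact Or.inl (hv ▸ Or.inr ⟨y, ⟨hy, hc⟩, rfl⟩)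
      · refine Or.inr (hu ▸ ⟨y, ⟨hy, (b - c).toNat, by lia, ?_⟩, rfl⟩)
        rwa [Int.toNat_of_nonneg (by lia), sub_sub_cancel]
  obtain ⟨g₂, hg₂, h₂⟩ := h.exists_freeAt_cechCohomology hw hq j he hx hγ hγu hgen'
  refine ⟨g₁ * g₂, fun hg => (hprime.mem_or_mem hg).elim hg₁ hg₂,
    fun k d => FreeAt.of_dvd (dvd_mul_right g₁ g₂) (h₁ k d),
    fun k hx' p => FreeAt.of_dvd (dvd_mul_left g₂ g₁) (h₂ k hx' p)⟩

end Freeness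

end

end GradedLocalCohomology

namespace GradedLocalCohomology

noncomputable section

set_option linter.unusedSectionVars false

/-! ### The gradings of the fibres and base change of the symmetric algebra. -/

section FiberGrading

variable {A R M : Type*} [CommRing A] [CommRing R] [Algebra A R] [AddCommGroup M] [Module R M]
  [Module A M] [IsScalarTower A R M] (𝒜 : ℕ → Submodule A R) (ℳ : ℤ → Submodule A M)
  (K : Type*) [CommRing K] [Algebra A K]

instance [GradedAlgebra 𝒜] : GradedAlgebra (fiberRingPiece 𝒜 K) :=
  inferInstanceAs (GradedAlgebra fun i => (𝒜 i).baseChange K)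

variable {𝒜 ℳ}

theorem tmul_mem_fiberRingPiece {e : ℕ} {a : R} (ha : a ∈ 𝒜 e) :
    (1 : K) ⊗ₜ[A] a ∈ fiberRingPiece 𝒜 K e :=
  Submodule.tmul_mem_baseChange_of_mem 1 ha

theorem tmul_mem_fiberModulePiece {d : ℤ} {m : M} (hm : m ∈ ℳ d) :
    (1 : K ⊗[A] R) ⊗ₜ[R] m ∈ fiberModulePiece (R := R) ℳ K d :=
  Submodule.subset_span ⟨m, hm, rfl⟩

theorem one_tmul_smul_tmul (a : R) (m : M) :
    ((1 : K) ⊗ₜ[A] a) • ((1 : K ⊗[A] R) ⊗ₜ[R] m) = (1 : K ⊗[A] R) ⊗ₜ[R] (a • m) := by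
  rw [TensorProduct.tmul_smul, TensorProduct.smul_tmul', TensorProduct.smul_tmul', smul_eq_mul,
    mul_one, Algebra.smul_def, mul_one]
  rfl

theorem smul_mem_fiberModulePiece
    (hsmul : ∀ (n : ℕ) (d : ℤ) (a : R) (m : M), a ∈ 𝒜 n → m ∈ ℳ d → a • m ∈ ℳ (n + d))
    (n : ℕ) (d : ℤ) (s : K ⊗[A] R) (m : FiberModule (A := A) (R := R) M K)
    (hs : s ∈ fiberRingPiece 𝒜 K n) (hm : m ∈ fiberModulePiece (R := R) ℳ K d) :
    s • m ∈ fiberModulePiece (R := R) ℳ K (n + d) := by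
  rw [fiberRingPiece, Submodule.baseChange_eq_span] at hs
  induction hs using Submodule.span_induction with
  | zero => rw [zero_smul]; exact zero_mem _
  | add s s' _ _ hs hs' => rw [add_smul]; exact add_mem hs hs'
  | smul a s _ hs => rw [smul_assoc]; exact Submodule.smul_mem _ _ hs
  | mem s hs =>
    obtain ⟨a, ha, rfl⟩ := hs
    induction hm using Submodule.span_induction with
    | zero => rw [smul_zero]; exact zero_mem _
    | add m m' _ _ hm hm' => rw [smul_add]; exact add_mem hm hm'
    | smul c m _ hm => rw [smul_comm]; exact Submodule.smul_mem _ _ hm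
    | mem m hm =>
      obtain ⟨m, hm, rfl⟩ := hm
      have := tmul_mem_fiberModulePiece (R := R) K (hsmul n d a m ha hm)
      rw [← one_tmul_smul_tmul] at this
      exact this

/-- The decomposition of K ⊗_A M obtained by base change is transported along (K ⊗_A R) ⊗_R M ≅ K
⊗_A M. -/
theorem isInternal_fiberModulePiece (hℳ : DirectSum.IsInternal ℳ) :
    DirectSum.IsInternal (fiberModulePiece (R := R) ℳ K) := by
  let E : FiberModule (A := A) (R := R) M K ≃ₗ[K] K ⊗[A] M :=
    Algebra.IsPushout.cancelBaseChange A K R (K ⊗[A] R) M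
  have hE : ∀ m : M, E ((1 : K ⊗[A] R) ⊗ₜ[R] m) = 1 ⊗ₜ m := fun m =>
    Algebra.IsPushout.cancelBaseChange_tmul A K R (K ⊗[A] R) M m
  have hmap : ∀ d, (fiberModulePiece (R := R) ℳ K d).map E.toLinearMap = (ℳ d).baseChange K := by
    intro d
    rw [fiberModulePiece, Submodule.map_span, Submodule.baseChange_eq_span]
    congr 1
    ext z
    simp [hE]
  have h1 := hℳ.baseChange (S := K)
  rw [DirectSum.isInternal_submodule_iff_iSupIndep_and_iSup_eq_top] at h1 ⊢
  have h2 : (fun d => (ℳ d).baseChange K) =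
      (Submodule.orderIsoMapComap E) ∘ fiberModulePiece (R := R) ℳ K :=
    funext fun d => (hmap d).symm
  rw [h2] at h1
  refine ⟨(iSupIndep_map_orderIso_iff (Submodule.orderIsoMapComap E)).mp h1.1, ?_⟩
  have h3 : ⨆ d, Submodule.orderIsoMapComap E (fiberModulePiece (R := R) ℳ K d) = ⊤ := h1.2
  rw [← OrderIso.map_iSup] at h3
  exact (map_eq_top_iff (Submodule.orderIsoMapComap E)).mp h3

end FiberGrading

section FiberSymmetricAlgebra

variable {A R M T : Type*} [CommRing A] [CommRing R] [Algebra A R] [AddCommGroup M] [Module R M]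
  [Module A M] [IsScalarTower A R M] [CommRing T] [Algebra A T] [Algebra R T] [IsScalarTower A R T]
  {𝒜 : ℕ → Submodule A R} {ℳ : ℤ → Submodule A M} {ι : M →ₗ[R] T}
  {K : Type*} [CommRing K] [Algebra A K] {T' : Type*} [CommRing T'] [Algebra (K ⊗[A] R) T']
  [Algebra K T'] [IsScalarTower K (K ⊗[A] R) T'] [Algebra A T'] [IsScalarTower A K T']
  {ι' : FiberModule (A := A) (R := R) M K →ₗ[K ⊗[A] R] T'}

theorem IsGradedSymmetricAlgebra.fiber (h : IsGradedSymmetricAlgebra 𝒜 ℳ ι)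
    (hι' : IsSymmetricAlgebra ι') :
    IsGradedSymmetricAlgebra (fiberRingPiece 𝒜 K) (fiberModulePiece (R := R) ℳ K) ι' where
  isInternal := isInternal_fiberModulePiece K h.isInternal
  smul_mem := smul_mem_fiberModulePiece K h.smul_mem
  isSymmetricAlgebra := hι'

/-- The base change map of symmetric algebras. -/
structure IsFiberMap (ι : M →ₗ[R] T) (ι' : FiberModule (A := A) (R := R) M K →ₗ[K ⊗[A] R] T')
    (f : T →ₐ[A] T') : Prop where
  map_algebraMap : ∀ a, f (algebraMap R T a) = algebraMap (K ⊗[A] R) T' (1 ⊗ₜ a)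
  map_ι : ∀ m, f (ι m) = ι' (1 ⊗ₜ m)

theorem IsSymmetricAlgebra.exists_fiberMap (hι : IsSymmetricAlgebra ι)
    (ι' : FiberModule (A := A) (R := R) M K →ₗ[K ⊗[A] R] T') :
    ∃ f : T →ₐ[A] T', IsFiberMap ι ι' f := by
  obtain ⟨F, hF, hF'⟩ := IsSymmetricAlgebra.exists_ringHom hι
    ((algebraMap (K ⊗[A] R) T').comp (algebraMap R (K ⊗[A] R)))
    (ι'.toAddMonoidHom.comp (TensorProduct.mk R (K ⊗[A] R) M 1).toAddMonoidHom) (fun a m => by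
      change ι' (1 ⊗ₜ (a • m)) = algebraMap (K ⊗[A] R) T' (1 ⊗ₜ a) * ι' (1 ⊗ₜ m)
      rw [← one_tmul_smul_tmul, LinearMap.map_smul, Algebra.smul_def])
  refine ⟨{ F with commutes' := fun a => ?_ }, ⟨hF, hF'⟩⟩
  change F (algebraMap A T a) = _
  rw [IsScalarTower.algebraMap_apply A R T, hF, RingHom.comp_apply,
    ← IsScalarTower.algebraMap_apply A R (K ⊗[A] R), IsScalarTower.algebraMap_apply A K (K ⊗[A] R),
    ← IsScalarTower.algebraMap_apply K (K ⊗[A] R) T', ← IsScalarTower.algebraMap_apply A K T']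

/-- The universal properties of the tensor product and of the symmetric algebra are combined: a ring
map out of T' is determined by a ring map on K ⊗ R and a compatible additive map on M. -/
theorem IsSymmetricAlgebra.exists_fiberRingHom (hι' : IsSymmetricAlgebra ι') {B : Type*}
    [CommRing B] (τ : K ⊗[A] R →+* B) (l : M →+ B)
    (hl : ∀ (a : R) (m : M), l (a • m) = τ (1 ⊗ₜ a) * l m) :
    ∃ G : T' →+* B, (∀ s, G (algebraMap (K ⊗[A] R) T' s) = τ s) ∧ ∀ m, G (ι' (1 ⊗ₜ m)) = l m := by
  let f : K ⊗[A] R →+ M →+ B := (AddMonoidHom.mul.comp (τ : K ⊗[A] R →+ B)).compl₂ l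
  have hf : ∀ s m, f s m = τ s * l m := fun _ _ => rfl
  let μ : (K ⊗[A] R) ⊗[R] M →+ B := TensorProduct.liftAddHom f fun a s m => by
    rw [hf, hf, hl, Algebra.smul_def, map_mul, mul_comm (τ _) (τ s), mul_assoc]
    rfl
  have hμ : ∀ s m, μ (s ⊗ₜ m) = τ s * l m := fun _ _ => rfl
  obtain ⟨G, hG, hG'⟩ := IsSymmetricAlgebra.exists_ringHom hι' τ μ (fun s m => by
    induction m using TensorProduct.induction_on with
    | zero => rw [smul_zero, map_zero, mul_zero]
    | add m n hm hn => rw [smul_add, map_add, map_add, mul_add, hm, hn]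
    | tmul s' m => rw [TensorProduct.smul_tmul', hμ, hμ, smul_eq_mul, map_mul, mul_assoc])
  refine ⟨G, hG, fun m => ?_⟩
  rw [hG', hμ, map_one, one_mul]

namespace IsFiberMap

variable {f : T →ₐ[A] T'} (hf : IsFiberMap ι ι' f)
include hf

/-- Symmetric algebras commute with base change. The universal property of T' supplies a retraction
G, checked on generators; surjectivity holds because the image is closed under sums and products and
contains the generators of T'. -/
theorem bijective_liftBaseChange (hι : IsSymmetricAlgebra ι) (hι' : IsSymmetricAlgebra ι') :
    Function.Bijective (f.toLinearMap.liftBaseChange K) := by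
  have hfl : ∀ (c : K) t, f.toLinearMap.liftBaseChange K (c ⊗ₜ t) = algebraMap K T' c * f t :=
    fun c t => by rw [LinearMap.liftBaseChange_tmul, Algebra.smul_def]; rfl
  constructor
  · let τ : K ⊗[A] R →ₐ[A] K ⊗[A] T :=
      Algebra.TensorProduct.map (AlgHom.id A K) (IsScalarTower.toAlgHom A R T)
    have hτ : ∀ c a, τ (c ⊗ₜ a) = c ⊗ₜ algebraMap R T a := fun _ _ => rfl
    obtain ⟨G, hG, hG'⟩ := IsSymmetricAlgebra.exists_fiberRingHom hι' (τ : K ⊗[A] R →+* K ⊗[A] T)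
      ((TensorProduct.mk A K T 1).toAddMonoidHom.comp ι.toAddMonoidHom) (fun a m => by
        change (1 : K) ⊗ₜ[A] ι (a • m) = τ (1 ⊗ₜ a) * ((1 : K) ⊗ₜ[A] ι m)
        rw [hτ, Algebra.TensorProduct.tmul_mul_tmul, mul_one, LinearMap.map_smul, Algebra.smul_def])
    have h1 : ∀ t, G (f t) = 1 ⊗ₜ t := by
      intro t
      induction t using hι.induction with
      | algebraMap a => rw [hf.map_algebraMap, hG]; rfl
      | ι m => rw [hf.map_ι, hG']; rfl
      | mul s t hs ht =>
        rw [map_mul, map_mul, hs, ht, Algebra.TensorProduct.tmul_mul_tmul, mul_one]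
      | add s t hs ht => rw [map_add, map_add, hs, ht, TensorProduct.tmul_add]
    have h2 : ∀ z, G (f.toLinearMap.liftBaseChange K z) = z := by
      intro z
      induction z using TensorProduct.induction_on with
      | zero => simp
      | add z z' hz hz' => rw [map_add, map_add, hz, hz']
      | tmul c t =>
        rw [hfl, map_mul, h1, IsScalarTower.algebraMap_apply K (K ⊗[A] R) T', hG]
        change τ (c ⊗ₜ 1) * _ = _
        rw [hτ, map_one, Algebra.TensorProduct.tmul_mul_tmul, mul_one, one_mul]
    exact Function.LeftInverse.injective h2
  · have hmul : ∀ z z', f.toLinearMap.liftBaseChange K (z * z') =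
        f.toLinearMap.liftBaseChange K z * f.toLinearMap.liftBaseChange K z' := by
      intro z z'
      induction z using TensorProduct.induction_on with
      | zero => simp
      | add z z'' hz hz' => rw [add_mul, map_add, map_add, add_mul, hz, hz']
      | tmul c t =>
        induction z' using TensorProduct.induction_on with
        | zero => simp
        | add z z'' hz hz' => rw [mul_add, map_add, map_add, mul_add, hz, hz']
        | tmul c' t' =>
          rw [Algebra.TensorProduct.tmul_mul_tmul, hfl, hfl, hfl, map_mul, map_mul]
          ring
    have hS : ∀ s, ∃ z, f.toLinearMap.liftBaseChange K z = algebraMap (K ⊗[A] R) T' s := by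
      intro s
      induction s using TensorProduct.induction_on with
      | zero => exact ⟨0, by rw [map_zero, map_zero]⟩
      | add s s' hs hs' =>
        obtain ⟨z, hz⟩ := hs
        obtain ⟨z', hz'⟩ := hs'
        exact ⟨z + z', by rw [map_add, map_add, hz, hz']⟩
      | tmul c a =>
        refine ⟨c ⊗ₜ algebraMap R T a, ?_⟩
        rw [hfl, hf.map_algebraMap, IsScalarTower.algebraMap_apply K (K ⊗[A] R) T', ← map_mul,
          Algebra.TensorProduct.algebraMap_apply, Algebra.TensorProduct.tmul_mul_tmul, one_mul]
        simp
    intro t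
    induction t using hι'.induction with
    | algebraMap s => exact hS s
    | mul s t hs ht =>
      obtain ⟨z, rfl⟩ := hs
      obtain ⟨z', rfl⟩ := ht
      exact ⟨z * z', hmul z z'⟩
    | add s t hs ht =>
      obtain ⟨z, rfl⟩ := hs
      obtain ⟨z', rfl⟩ := ht
      exact ⟨z + z', map_add _ z z'⟩
    | ι m =>
      induction m using TensorProduct.induction_on with
      | zero => exact ⟨0, by rw [map_zero, map_zero]⟩
      | add m n hm hn =>
        obtain ⟨z, hz⟩ := hm
        obtain ⟨z', hz'⟩ := hn
        exact ⟨z + z', by rw [map_add, map_add, hz, hz']⟩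
      | tmul s m =>
        obtain ⟨z, hz⟩ := hS s
        refine ⟨z * (1 ⊗ₜ ι m), ?_⟩
        rw [hmul, hz, hfl, map_one, one_mul, hf.map_ι, ← Algebra.smul_def, ← LinearMap.map_smul,
          TensorProduct.smul_tmul', smul_eq_mul, mul_one]

theorem map_mem_symPiece {k : ℕ} {d : ℤ} {t : T} (ht : t ∈ symPiece 𝒜 ℳ ι k d) :
    f t ∈ symPiece (fiberRingPiece 𝒜 K) (fiberModulePiece (R := R) ℳ K) ι' k d := by
  induction ht using Submodule.span_induction with
  | zero => rw [map_zero]; exact zero_mem _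
  | add s t _ _ hs ht => rw [map_add]; exact add_mem hs ht
  | smul a t _ ht =>
    rw [map_smul, ← algebraMap_smul K a (f t)]
    exact Submodule.smul_mem _ _ ht
  | mem t ht =>
    obtain ⟨e, a, c, n, ha, hn, hd, rfl⟩ := ht
    refine Submodule.subset_span ⟨e, 1 ⊗ₜ a, c, fun i => 1 ⊗ₜ n i, tmul_mem_fiberRingPiece K ha,
      fun i => tmul_mem_fiberModulePiece K (hn i), hd, ?_⟩
    rw [Algebra.smul_def, Algebra.smul_def, map_mul, map_prod, hf.map_algebraMap]
    congr 1
    exact Finset.prod_congr rfl fun i _ => hf.map_ι (n i)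

variable [GradedAlgebra 𝒜]

theorem proj_map {Γ : Type*} [AddCommGroup Γ] (h : IsGradedSymmetricAlgebra 𝒜 ℳ ι)
    (hι' : IsSymmetricAlgebra ι') (χ : ℤ × ℤ →+ Γ) (γ : Γ) (t : T) :
    (h.fiber hι').proj χ γ (f t) = f (h.proj χ γ t) := by
  induction t using h.induction_homogeneous with
  | zero => simp only [map_zero]
  | add s t hs ht => simp only [map_add, hs, ht]
  | mem k d t ht =>
    by_cases hγ : χ (k, d) = γ
    · rw [h.proj_self χ ht hγ, (h.fiber hι').proj_self χ (hf.map_mem_symPiece ht) hγ]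
    · rw [h.proj_ne χ ht hγ, (h.fiber hι').proj_ne χ (hf.map_mem_symPiece ht) hγ, map_zero]

end IsFiberMap

end FiberSymmetricAlgebra

end

end GradedLocalCohomology

namespace GradedLocalCohomology

noncomputable section

set_option linter.unusedSectionVars false

/-! ### Symmetric powers inside the symmetric algebra, choice of generators, and base change of the
pieces. -/

section Power

variable {A R M T : Type*} [CommRing A] [CommRing R] [Algebra A R] [AddCommGroup M] [Module R M]
  [Module A M] [CommRing T] [Algebra A T] [Algebra R T] [IsScalarTower A R T]
  {𝒜 : ℕ → Submodule A R} {ℳ : ℤ → Submodule A M} {ι : M →ₗ[R] T}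

theorem prod_mem_range_pow (ι : M →ₗ[R] T) {k : ℕ} (n : Fin k → M) :
    ∏ i, ι (n i) ∈ (LinearMap.range ι ^ k : Submodule R T) := by
  induction k with
  | zero => rw [pow_zero, Fin.prod_univ_zero]; exact Submodule.one_le.mp le_rfl
  | succ k ih =>
    rw [Fin.prod_univ_succ, pow_succ']
    exact Submodule.mul_mem_mul ⟨n 0, rfl⟩ (ih _)

theorem mem_pow_of_mem_symPiece {k : ℕ} {d : ℤ} {t : T} (ht : t ∈ symPiece 𝒜 ℳ ι k d) :
    t ∈ (LinearMap.range ι ^ k : Submodule R T) := by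
  suffices h : symPiece 𝒜 ℳ ι k d ≤ (LinearMap.range ι ^ k : Submodule R T).restrictScalars A from
    h ht
  refine Submodule.span_le.mpr ?_
  rintro _ ⟨e, a, c, n, -, -, -, rfl⟩
  exact Submodule.smul_mem _ a (prod_mem_range_pow ι n)

namespace IsGradedSymmetricAlgebra

variable [GradedAlgebra 𝒜] (h : IsGradedSymmetricAlgebra 𝒜 ℳ ι)
include h

theorem coaction_ι_of_forall {Γ : Type*} [AddCommGroup Γ] (χ : ℤ × ℤ →+ Γ) {γ : Γ}
    (hχ : ∀ c, χ (1, c) = γ) (m : M) : h.coaction χ (ι m) = AddMonoidAlgebra.single γ (ι m) := by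
  induction m using induction_isInternal h.isInternal with
  | zero => simp
  | add m n hm hn => rw [map_add, map_add, hm, hn, AddMonoidAlgebra.single_add]
  | mem c m hm => rw [h.coaction_ι χ hm, hχ]

theorem coaction_fst_of_mem_pow {k : ℕ} {t : T} (ht : t ∈ (LinearMap.range ι ^ k : Submodule R T)) :
    h.coaction (AddMonoidHom.fst ℤ ℤ) t = AddMonoidAlgebra.single (k : ℤ) t := by
  induction ht using Submodule.pow_induction_on_left' with
  | algebraMap a => exact h.coaction_algebraMap_of_forall _ (fun _ => rfl) a
  | add s t i _ _ hs ht => rw [map_add, hs, ht, AddMonoidAlgebra.single_add]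
  | mem_mul s hs i t _ ht =>
    obtain ⟨m, rfl⟩ := hs
    rw [map_mul, ht, h.coaction_ι_of_forall (AddMonoidHom.fst ℤ ℤ) (fun _ => rfl),
      AddMonoidAlgebra.single_mul_single]
    congr 1
    push_cast
    exact add_comm _ _

/-- The symmetric powers are the components of the symmetric algebra. -/
theorem mem_pow_iff {k : ℕ} {t : T} : t ∈ (LinearMap.range ι ^ k : Submodule R T) ↔
    h.proj (AddMonoidHom.fst ℤ ℤ) k t = t := by
  constructor
  · intro ht
    rw [proj_apply, h.coaction_fst_of_mem_pow ht, AddMonoidAlgebra.coeff_single,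
      Finsupp.single_eq_same]
  · intro ht
    rw [← ht]
    clear ht
    induction t using h.induction_homogeneous with
    | zero => rw [map_zero]; exact zero_mem _
    | add s t hs ht => rw [map_add]; exact add_mem hs ht
    | mem k' d t ht =>
      by_cases hk : (k' : ℤ) = k
      · rw [h.proj_self (AddMonoidHom.fst ℤ ℤ) (γ := (k : ℤ)) ht hk]
        obtain rfl := Int.ofNat_inj.mp hk
        exact mem_pow_of_mem_symPiece ht
      · rw [h.proj_ne (AddMonoidHom.fst ℤ ℤ) (γ := (k : ℤ)) ht hk]
        exact zero_mem _

theorem raisesDegree {r : ℕ} {x : Fin r → R} {e : Fin r → ℕ} (hx : ∀ l, x l ∈ 𝒜 (e l)) (k : ℕ) :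
    RaisesDegree (fun l => algebraMap R T (x l)) e (symPiece 𝒜 ℳ ι k) := by
  intro l d t ht
  have := symPiece_mul_mem (algebraMap_mem_symPiece (ℳ := ℳ) (ι := ι) (hx l)) ht
  rwa [zero_add, add_comm] at this

theorem shiftsDegree {a : R} {c : ℕ} (ha : a ∈ 𝒜 c) (k : ℕ) :
    ShiftsDegree (symPiece 𝒜 ℳ ι k) c (algebraMap R T a) := by
  intro d t ht
  have := symPiece_mul_mem (algebraMap_mem_symPiece (ℳ := ℳ) (ι := ι) ha) ht
  rwa [zero_add, add_comm] at this

/-- The symmetric algebra as a graded module over the base ring. -/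
theorem isGradedModule {r : ℕ} {x : Fin r → R} {e : Fin r → ℕ} (hx : ∀ l, x l ∈ 𝒜 (e l)) :
    IsGradedModule x e (Fin.elim0 : Fin 0 → R) (Fin.elim0 : Fin 0 → ℕ)
      (h.proj (shiftedDegree 0)) where
  toIsGrading := h.isGrading_proj _
  x_smul l d t := by
    have := h.proj_mul (shiftedDegree 0) (h.coaction_algebraMap (shiftedDegree 0) (hx l)) d t
    rw [shiftedDegree_apply, zero_mul, sub_zero] at this
    rw [Algebra.smul_def, Algebra.smul_def, this]
  u_smul i := i.elim0

end IsGradedSymmetricAlgebra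

end Power

section FiniteCech

variable {K S N : Type*} [CommRing K] [CommRing S] [Algebra K S] [AddCommGroup N] [Module S N]
  [Module K N] [IsScalarTower K S N] {r : ℕ} {x : Fin r → S} {e : Fin r → ℕ}
  {𝒩 : ℤ → Submodule K N}

/-- The homology of the total complex collects all cohomological degrees. With the grading κ
concentrated in degree 0, `nonempty_range_equiv` exhibits a single cohomological degree as a direct
summand. -/
theorem finite_cechCohomology [IsNoetherianRing K] (hx : RaisesDegree x e 𝒩) (d : ℤ)
    [Module.Finite K (DiffHomology (cechDPiece x e hx d))] (p : ℕ) :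
    Module.Finite K (CechCohomology hx p d) := by
  let κ : ℤ → N →ₗ[K] N := fun k => if k = 0 then LinearMap.id else 0
  have h0 : κ 0 = LinearMap.id := if_pos rfl
  have h1 : ∀ k, k ≠ 0 → κ k = 0 := fun k hk => if_neg hk
  have hκ : IsCechGrading x 𝒩 κ := by
    refine ⟨⟨fun k n => ?_, fun k k' n hk => ?_, fun n => ⟨{0}, ?_⟩⟩, fun k l n => ?_,
      fun k d n hn => ?_⟩
    · by_cases hk : k = 0
      · rw [hk, h0]; rfl
      · rw [h1 k hk]; rfl
    · by_cases hk' : k = 0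
      · rw [h1 k' fun h => hk (hk'.trans h.symm), LinearMap.zero_apply, map_zero]
      · rw [h1 k hk']; rfl
    · rw [Finset.sum_singleton, h0]; rfl
    · by_cases hk : k = 0
      · rw [hk, h0]; rfl
      · rw [h1 k hk]; exact (smul_zero _).symm
    · by_cases hk : k = 0
      · rw [hk, h0]; exact hn
      · rw [h1 k hk]; exact zero_mem _
  obtain ⟨E⟩ := hκ.nonempty_range_equiv (ℛ := 𝒩) (k := 0) (s := 0) (fun d n => by
    rw [add_zero, h0]
    exact ⟨fun hn => ⟨hn, rfl⟩, fun hn => hn.1⟩) hx hx d p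
  rw [add_zero] at E
  exact Module.Finite.equiv E

end FiniteCech

section Generators

variable {A R : Type*} [CommRing A] [CommRing R] [Algebra A R] {𝒜 : ℕ → Submodule A R}
  [GradedAlgebra 𝒜]

theorem exists_homogeneous_coefficients {r : ℕ} {x : Fin r → R} {e : Fin r → ℕ}
    (hx : ∀ l, x l ∈ 𝒜 (e l)) {y : R} {c : ℕ} (hy : y ∈ 𝒜 c)
    (hyx : y ∈ Ideal.span (Set.range x)) :
    ∃ a : Fin r → R, (∀ i, a i = 0 ∨ ∃ c' : ℕ, (c' : ℤ) = c - e i ∧ a i ∈ 𝒜 c') ∧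
      y = ∑ i, a i * x i := by
  obtain ⟨w, hw⟩ := Ideal.mem_span_range_iff_exists_fun.mp hyx
  -- Only the component of degree c - e i of a coefficient contributes in degree c. For e i > c the
  -- coefficient must be zero, since truncated subtraction would give the wrong degree.
  refine ⟨fun i => if e i ≤ c then (DirectSum.decompose 𝒜 (w i) (c - e i) : R) else 0,
    fun i => ?_, ?_⟩
  · dsimp only
    by_cases hi : e i ≤ c
    · rw [if_pos hi]
      exact Or.inr ⟨c - e i, by lia, (DirectSum.decompose 𝒜 (w i) (c - e i)).2⟩
    · exact Or.inl (if_neg hi)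
  · have h1 : GradedRing.proj 𝒜 c y = y := by
      rw [GradedRing.proj_apply, DirectSum.decompose_of_mem_same 𝒜 hy]
    rw [← h1, ← hw, map_sum]
    refine Finset.sum_congr rfl fun i _ => ?_
    rw [GradedRing.proj_apply, DirectSum.coe_decompose_mul_of_right_mem 𝒜 c (hx i)]
    dsimp only
    split_ifs with hi
    · rfl
    · rw [zero_mul]

theorem exists_pos_degree {y : R} (hy : SetLike.IsHomogeneousElem 𝒜 y)
    (h : y ∈ (HomogeneousIdeal.irrelevant 𝒜).toIdeal) : ∃ e, 0 < e ∧ y ∈ 𝒜 e := by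
  obtain ⟨e, he⟩ := hy
  rcases Nat.eq_zero_or_pos e with rfl | hpos
  -- An element of degree zero in the irrelevant ideal is zero, so it may be assigned any positive
  -- degree; 1 is chosen.
  · exact ⟨1, one_pos, by rw [eq_zero_of_mem_irrelevant 𝒜 h he]; exact zero_mem _⟩
  · exact ⟨e, hpos, he⟩

theorem IsGradedSymmetricAlgebra.nonempty_equiv_of_generators {M T : Type*} [AddCommGroup M]
    [Module R M] [Module A M] [CommRing T] [Algebra A T] [Algebra R T] [IsScalarTower A R T]
    {ℳ : ℤ → Submodule A M} {ι : M →ₗ[R] T} (h : IsGradedSymmetricAlgebra 𝒜 ℳ ι) {r r' : ℕ}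
    {x : Fin r → R} {x' : Fin r' → R} {e : Fin r → ℕ} {e' : Fin r' → ℕ} (hx : ∀ l, x l ∈ 𝒜 (e l))
    (hx' : ∀ l, x' l ∈ 𝒜 (e' l)) (hspan : Ideal.span (Set.range x) = Ideal.span (Set.range x'))
    (k p : ℕ) (d : ℤ) : Nonempty (CechCohomology (h.raisesDegree hx k) p d ≃ₗ[A]
      CechCohomology (h.raisesDegree hx' k) p d) := by
  have key : ∀ {r r' : ℕ} {x : Fin r → R} {x' : Fin r' → R} {e : Fin r → ℕ} {e' : Fin r' → ℕ}
      (_ : ∀ l, x l ∈ 𝒜 (e l)) (_ : ∀ l, x' l ∈ 𝒜 (e' l))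
      (_ : Ideal.span (Set.range x) = Ideal.span (Set.range x')) (l : Fin r), ∃ a : Fin r' → T,
        (∀ i, ShiftsDegree (symPiece 𝒜 ℳ ι k) (e l - e' i) (a i)) ∧
        algebraMap R T (x l) = ∑ i, a i * algebraMap R T (x' i) := by
    intro r r' x x' e e' hx hx' hspan l
    obtain ⟨a, ha, hsum⟩ := exists_homogeneous_coefficients hx' (hx l)
      (hspan ▸ Ideal.subset_span ⟨l, rfl⟩)
    refine ⟨fun i => algebraMap R T (a i), fun i => ?_, ?_⟩
    · rcases ha i with h0 | ⟨c, hc, hmem⟩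
      · dsimp only
        rw [h0, map_zero]
        intro d t _
        rw [zero_smul]
        exact zero_mem _
      · rw [← hc]
        exact h.shiftsDegree hmem k
    · rw [hsum, map_sum]
      exact Finset.sum_congr rfl fun i _ => map_mul _ _ _
  exact CechCohomology.nonempty_equiv_of_generators (h.raisesDegree hx k) (h.raisesDegree hx' k)
    (key hx hx' hspan) (key hx' hx hspan.symm) p d

end Generators

section FiberCohomology

variable {A R M T : Type*} [CommRing A] [CommRing R] [Algebra A R] [AddCommGroup M] [Module R M]
  [Module A M] [IsScalarTower A R M] [CommRing T] [Algebra A T] [Algebra R T] [IsScalarTower A R T]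
  {𝒜 : ℕ → Submodule A R} [GradedAlgebra 𝒜] {ℳ : ℤ → Submodule A M} {ι : M →ₗ[R] T}
  {K : Type*} [CommRing K] [Algebra A K] {T' : Type*} [CommRing T'] [Algebra (K ⊗[A] R) T']
  [Algebra K T'] [IsScalarTower K (K ⊗[A] R) T'] [Algebra A T'] [IsScalarTower A K T']
  {ι' : FiberModule (A := A) (R := R) M K →ₗ[K ⊗[A] R] T'}

/-- Each bigraded piece is a direct summand of T, and the projections onto the pieces commute with
base change, so the isomorphism K ⊗ T ≅ T' restricts to the pieces. -/
theorem IsFiberMap.isCechBaseChange {f : T →ₐ[A] T'} (hf : IsFiberMap ι ι' f)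
    (h : IsGradedSymmetricAlgebra 𝒜 ℳ ι) (hι' : IsSymmetricAlgebra ι') {r : ℕ} (x : Fin r → R)
    (k : ℕ) : IsCechBaseChange K (fun l => algebraMap R T (x l))
      (fun l => algebraMap (K ⊗[A] R) T' (1 ⊗ₜ x l)) (f : T →+* T') (symPiece 𝒜 ℳ ι k)
      (symPiece (fiberRingPiece 𝒜 K) (fiberModulePiece (R := R) ℳ K) ι' k) f.toLinearMap where
  map_x l := hf.map_algebraMap (x l)
  map_smul l t := by
    change f (algebraMap R T (x l) * t) = _ * f t
    rw [map_mul, hf.map_algebraMap]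
  map_mem d t ht := hf.map_mem_symPiece ht
  isBaseChange d := by
    have hbij := hf.bijective_liftBaseChange h.isSymmetricAlgebra hι'
    have hmem : ∀ t ∈ symPiece 𝒜 ℳ ι k d, f.toLinearMap t ∈
        symPiece (fiberRingPiece 𝒜 K) (fiberModulePiece (R := R) ℳ K) ι' k d :=
      fun t ht => hf.map_mem_symPiece ht
    have hid : ∀ (k' : ℕ) (d' : ℤ), AddMonoidHom.id (ℤ × ℤ) (k', d') = ((k : ℤ), d) ↔
        k' = k ∧ d' = d := by
      intro k' d'
      change ((k' : ℤ), d') = ((k : ℤ), d) ↔ _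
      rw [Prod.mk.injEq, Nat.cast_inj]
    have hmemp : ∀ t, h.proj (AddMonoidHom.id (ℤ × ℤ)) ((k : ℤ), d) t ∈ symPiece 𝒜 ℳ ι k d :=
      fun t => h.range_proj_eq (AddMonoidHom.id (ℤ × ℤ)) hid ▸ ⟨t, rfl⟩
    let π : T →ₗ[A] symPiece 𝒜 ℳ ι k d :=
      (h.proj (AddMonoidHom.id (ℤ × ℤ)) ((k : ℤ), d)).codRestrict _ hmemp
    have hπ : π ∘ₗ (symPiece 𝒜 ℳ ι k d).subtype = LinearMap.id :=
      LinearMap.ext fun t => Subtype.ext (h.proj_self _ t.2 rfl)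
    set g := pieceMap f.toLinearMap (symPiece 𝒜 ℳ ι k d)
      (symPiece (fiberRingPiece 𝒜 K) (fiberModulePiece (R := R) ℳ K) ι' k d) hmem
    have h1 : ∀ z, (g.liftBaseChange K z : T') =
        f.toLinearMap.liftBaseChange K ((symPiece 𝒜 ℳ ι k d).subtype.baseChange K z) := by
      intro z
      induction z using TensorProduct.induction_on with
      | zero => simp
      | add z z' hz hz' => rw [map_add, map_add, map_add, Submodule.coe_add, hz, hz']
      | tmul c t =>
        rw [LinearMap.baseChange_tmul, LinearMap.liftBaseChange_tmul,
          LinearMap.liftBaseChange_tmul]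
        rfl
    refine IsBaseChange.of_bijective ⟨?_, ?_⟩
    · have h2 : Function.Injective ((symPiece 𝒜 ℳ ι k d).subtype.baseChange K) := by
        refine Function.LeftInverse.injective (g := π.baseChange K) fun z => ?_
        rw [← LinearMap.comp_apply, ← LinearMap.baseChange_comp, hπ, LinearMap.baseChange_id]
        rfl
      intro z z' hz
      exact h2 (hbij.1 (by rw [← h1, ← h1, hz]))
    · rintro ⟨t, ht⟩
      obtain ⟨z, rfl⟩ := hbij.2 t
      refine ⟨π.baseChange K z, Subtype.ext ?_⟩
      rw [h1]
      have h3 : ∀ z, f.toLinearMap.liftBaseChange K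
          ((symPiece 𝒜 ℳ ι k d).subtype.baseChange K (π.baseChange K z)) =
          (h.fiber hι').proj (AddMonoidHom.id (ℤ × ℤ)) ((k : ℤ), d)
            (f.toLinearMap.liftBaseChange K z) := by
        intro z
        induction z using TensorProduct.induction_on with
        | zero => simp only [map_zero]
        | add z z' hz hz' => simp only [map_add, hz, hz']
        | tmul c t =>
          rw [LinearMap.baseChange_tmul, LinearMap.baseChange_tmul, LinearMap.liftBaseChange_tmul,
            LinearMap.liftBaseChange_tmul, map_smul]
          congr 1
          exact (hf.proj_map h hι' _ _ t).symm
      rw [h3]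
      exact (h.fiber hι').proj_self _ ht rfl

end FiberCohomology

end

end GradedLocalCohomology

namespace GradedLocalCohomology

noncomputable section

set_option linter.unusedSectionVars false

/-! ### The symmetric powers of the statement, and finiteness over fibres. -/

section SymPowerComparison

variable {K S N T : Type*} [CommRing K] [CommRing S] [Algebra K S] [AddCommGroup N] [Module S N]
  [Module K N] [CommRing T] [Algebra K T] [Algebra S T] [IsScalarTower K S T]
  {𝒮 : ℕ → Submodule K S} {𝒩 : ℤ → Submodule K N} {ι : N →ₗ[S] T}

variable (K ι) in
/-- The map from the symmetric power to an algebra induced by a linear map. -/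
def symPowerMap (k : ℕ) : SymPower K S N k →ₗ[K] T :=
  ((SymmetricAlgebra.lift ι).toLinearMap ∘ₗ
    SymPower.toSymmetricAlgebra K S N k).restrictScalars K

theorem symPowerMap_smul (k : ℕ) (s : S) (z : SymPower K S N k) :
    symPowerMap K ι k (s • z) = algebraMap S T s • symPowerMap K ι k z := by
  rw [algebraMap_smul]
  exact ((SymmetricAlgebra.lift ι).toLinearMap ∘ₗ
    SymPower.toSymmetricAlgebra K S N k).map_smul s z

theorem symPowerMap_injective (hι : IsSymmetricAlgebra ι) (k : ℕ) :
    Function.Injective (symPowerMap K ι k) :=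
  hι.1.comp Subtype.coe_injective

theorem symPowerMap_eq {k : ℕ} {z : SymPower K S N k} {a : S} {n : Fin k → N}
    (hz : SymPower.toSymmetricAlgebra K S N k z = a • ∏ i, SymmetricAlgebra.ι S N (n i)) :
    symPowerMap K ι k z = a • ∏ i, ι (n i) := by
  change SymmetricAlgebra.lift ι (SymPower.toSymmetricAlgebra K S N k z) = _
  rw [hz, map_smul, map_prod]
  simp only [SymmetricAlgebra.lift_ι_apply]

theorem map_symPowerPiece (k : ℕ) (d : ℤ) :
    (symPowerPiece k 𝒮 𝒩 d).map (symPowerMap K ι k) = symPiece 𝒮 𝒩 ι k d := by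
  rw [symPowerPiece, Submodule.map_span, symPiece]
  congr 1
  ext t
  constructor
  · rintro ⟨z, ⟨e, a, c, n, ha, hn, hd, hz⟩, rfl⟩
    exact ⟨e, a, c, n, ha, hn, hd, symPowerMap_eq hz⟩
  · rintro ⟨e, a, c, n, ha, hn, hd, rfl⟩
    exact ⟨⟨_, Submodule.smul_mem _ a (prod_mem_range_pow (SymmetricAlgebra.ι S N) n)⟩,
      ⟨e, a, c, n, ha, hn, hd, rfl⟩, symPowerMap_eq rfl⟩

theorem mem_symPowerPiece (hι : IsSymmetricAlgebra ι) {k : ℕ} {d : ℤ} {z : SymPower K S N k} :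
    z ∈ symPowerPiece k 𝒮 𝒩 d ↔ symPowerMap K ι k z ∈ symPiece 𝒮 𝒩 ι k d := by
  rw [← map_symPowerPiece]
  constructor
  · exact fun hz => ⟨z, hz, rfl⟩
  · rintro ⟨w, hw, hwz⟩
    rwa [← symPowerMap_injective hι k hwz]

variable [GradedAlgebra 𝒮] {r : ℕ} {x : Fin r → S} {e : Fin r → ℕ}

theorem IsGradedSymmetricAlgebra.isGradedAction_symPowerPiece
    (h : IsGradedSymmetricAlgebra 𝒮 𝒩 ι) (hx : ∀ l, x l ∈ 𝒮 (e l)) (k : ℕ) :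
    IsGradedAction 𝒮 x (symPowerPiece k 𝒮 𝒩) e where
  one_mem := SetLike.GradedOne.one_mem
  mul_mem hs ht := SetLike.mul_mem_graded (A := 𝒮) hs ht
  eq_zero {a b s} ha hb hab := by
    rw [← DirectSum.decompose_of_mem_same 𝒮 ha, DirectSum.decompose_of_mem_ne 𝒮 hb hab.symm]
  mem := hx
  smul_mem {a d s n} hs hn := by
    rw [mem_symPowerPiece h.isSymmetricAlgebra] at hn ⊢
    rw [symPowerMap_smul]
    exact h.shiftsDegree hs k d _ hn

/-- The local cohomology of the symmetric powers, computed in the symmetric algebra. -/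
theorem IsGradedSymmetricAlgebra.nonempty_localCohomologyPiece_equiv
    (h : IsGradedSymmetricAlgebra 𝒮 𝒩 ι) (hx : ∀ l, x l ∈ 𝒮 (e l)) (k p : ℕ) (d : ℤ) :
    Nonempty (LocalCohomologyPiece 𝒮 x (symPowerPiece k 𝒮 𝒩) p d ≃ₗ[K]
      CechCohomology (h.raisesDegree hx k) p d) := by
  obtain ⟨E⟩ := (h.isGradedAction_symPowerPiece hx k).nonempty_equiv p d
  obtain ⟨E'⟩ := CechCohomology.nonempty_equiv_of_injective (algebraMap S T) (symPowerMap K ι k)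
    (symPowerMap_injective h.isSymmetricAlgebra k) (fun _ => rfl)
    (fun i n => symPowerMap_smul k (x i) n) (map_symPowerPiece k)
    (h.isGradedAction_symPowerPiece hx k).raisesDegree (h.raisesDegree hx k) p d
  exact ⟨E.trans E'⟩

end SymPowerComparison

section Finiteness

variable {K S N T : Type*} [CommRing K] [CommRing S] [Algebra K S] [AddCommGroup N] [Module S N]
  [Module K N] [CommRing T] [Algebra K T] [Algebra S T] [IsScalarTower K S T]
  {𝒮 : ℕ → Submodule K S} {𝒩 : ℤ → Submodule K N} {ι : N →ₗ[S] T} [GradedAlgebra 𝒮]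
  {r : ℕ} {x : Fin r → S} {e : Fin r → ℕ}

/-- Without elements of negative degree the only word is 1, so generators of the module 𝒮 0 can
serve as V. -/
theorem exists_generatedModulo [Module.Finite K (𝒮 0)]
    (hspan : 𝒮 0 ⊔ (Ideal.span (Set.range x)).restrictScalars K = ⊤) :
    ∃ V : Finset S, GeneratedModulo K x (Fin.elim0 : Fin 0 → S) V := by
  obtain ⟨V, hV⟩ := Module.Finite.iff_fg.mp (inferInstance : Module.Finite K (𝒮 0))
  refine ⟨V, ?_⟩
  rw [GeneratedModulo, ← hspan, ← hV]
  congr 2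
  ext a
  simp

/-- The local cohomology of a symmetric power is finite in every degree if the ring is finite in
degree zero. -/
theorem IsGradedSymmetricAlgebra.module_finite_cechCohomology [IsNoetherianRing K]
    [IsNoetherianRing S] [Module.Finite S N] [Module.Finite K (𝒮 0)]
    (h : IsGradedSymmetricAlgebra 𝒮 𝒩 ι) (he : ∀ l, 0 < e l) (hx : ∀ l, x l ∈ 𝒮 (e l))
    (hspan : 𝒮 0 ⊔ (Ideal.span (Set.range x)).restrictScalars K = ⊤) (k p : ℕ) (d : ℤ) :
    Module.Finite K (CechCohomology (h.raisesDegree hx k) p d) := by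
  obtain ⟨V, hV⟩ := exists_generatedModulo hspan
  -- T need not be finite over S, but its component of symmetric degree k is, being a power of a
  -- finite submodule. The finiteness theorem is applied to this homogeneous submodule with its
  -- internal grading.
  let B : Submodule S T := LinearMap.range ι ^ k
  have hB : ∀ d, ∀ t ∈ B, h.proj (shiftedDegree 0) d t ∈ B := by
    intro d t ht
    rw [h.mem_pow_iff] at ht ⊢
    rw [h.proj_comm, ht]
  have hfg : Module.Finite S B :=
    Module.Finite.iff_fg.mpr (Submodule.FG.pow (Module.Finite.iff_fg.mp inferInstance) k)
  have hgr := (h.isGradedModule hx).sub B hB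
  have hfin := (hgr.hasFiniteCohomology he (fun i => i.elim0) hV).1 d
  have hfin' := finite_cechCohomology hgr.raisesDegree d p
  obtain ⟨E⟩ := CechCohomology.nonempty_equiv_of_injective (algebraMap S T)
    (B.subtype.restrictScalars K) Subtype.coe_injective (fun _ => rfl) (fun i n => by
      rw [algebraMap_smul]
      exact B.subtype.map_smul _ n)
    (𝒩' := symPiece 𝒮 𝒩 ι k) (fun d => by
      ext t
      have hmem := h.mem_symPiece_iff 0 k d t
      rw [mul_zero, add_zero] at hmem
      rw [hmem, ← h.mem_pow_iff]
      constructor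
      · rintro ⟨_, ⟨t, rfl⟩, rfl⟩
        exact ⟨⟨_, rfl⟩, hB d _ t.2⟩
      · rintro ⟨ht, htB⟩
        rw [(h.isGrading_proj _).mem_range] at ht
        exact ⟨_, ⟨⟨t, htB⟩, rfl⟩, ht⟩)
    hgr.raisesDegree (h.raisesDegree hx k) p d
  exact Module.Finite.equiv E

end Finiteness

section FiberFiniteness

variable {A R : Type*} [CommRing A] [CommRing R] [Algebra A R] {𝒜 : ℕ → Submodule A R}
  [GradedAlgebra 𝒜] (K : Type*) [CommRing K] [Algebra A K] {r : ℕ} {x : Fin r → R}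

variable (𝒜) in
theorem sup_irrelevant_eq_top :
    𝒜 0 ⊔ (HomogeneousIdeal.irrelevant 𝒜).toIdeal.restrictScalars A = ⊤ := by
  rw [eq_top_iff]
  intro a _
  induction a using induction_graded 𝒜 with
  | zero => exact zero_mem _
  | add a b ha hb => exact add_mem (ha trivial) (hb trivial)
  | mem e a ha =>
    rcases Nat.eq_zero_or_pos e with rfl | he
    · exact Submodule.mem_sup_left ha
    · exact Submodule.mem_sup_right (HomogeneousIdeal.mem_irrelevant_of_mem 𝒜 he ha)

theorem fiberRingPiece_sup_span_eq_top
    (hspan : 𝒜 0 ⊔ (Ideal.span (Set.range x)).restrictScalars A = ⊤) :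
    fiberRingPiece 𝒜 K 0 ⊔ (Ideal.span (Set.range fun l => (1 : K) ⊗ₜ[A] x l)).restrictScalars K =
      ⊤ := by
  have hI : ∀ a ∈ Ideal.span (Set.range x),
      (1 : K) ⊗ₜ[A] a ∈ Ideal.span (Set.range fun l => (1 : K) ⊗ₜ[A] x l) := by
    intro a ha
    have := Ideal.mem_map_of_mem (algebraMap R (K ⊗[A] R)) ha
    rw [Ideal.map_span, ← Set.range_comp] at this
    exact this
  rw [eq_top_iff]
  intro s _
  induction s using TensorProduct.induction_on with
  | zero => exact zero_mem _
  | add s t hs ht => exact add_mem (hs trivial) (ht trivial)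
  | tmul c a =>
    have ha : a ∈ (⊤ : Submodule A R) := trivial
    rw [← hspan] at ha
    obtain ⟨a₀, h₀, a₁, h₁, rfl⟩ := Submodule.mem_sup.mp ha
    have : c ⊗ₜ[A] (a₀ + a₁) = c • ((1 : K) ⊗ₜ[A] a₀ + (1 : K) ⊗ₜ[A] a₁) := by
      rw [← TensorProduct.tmul_add, TensorProduct.smul_tmul', smul_eq_mul, mul_one]
    rw [this]
    exact Submodule.smul_mem _ c (add_mem
      (Submodule.mem_sup_left (tmul_mem_fiberRingPiece K h₀)) (Submodule.mem_sup_right (hI a₁ h₁)))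

theorem finite_fiberRingPiece (n : ℕ) [Module.Finite A (𝒜 n)] :
    Module.Finite K (fiberRingPiece 𝒜 K n) :=
  Module.Finite.of_surjective _ ((𝒜 n).toBaseChange_surjective K)

end FiberFiniteness

section FiberRank

variable {A R M T : Type*} [CommRing A] [CommRing R] [Algebra A R] [AddCommGroup M] [Module R M]
  [Module A M] [IsScalarTower A R M] [CommRing T] [Algebra A T] [Algebra R T] [IsScalarTower A R T]
  {𝒜 : ℕ → Submodule A R} [GradedAlgebra 𝒜] {ℳ : ℤ → Submodule A M} {ι : M →ₗ[R] T}
  {K : Type*} [CommRing K] [Algebra A K] {T' : Type*} [CommRing T'] [Algebra (K ⊗[A] R) T']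
  [Algebra K T'] [IsScalarTower K (K ⊗[A] R) T'] [Algebra A T'] [IsScalarTower A K T']
  {ι' : FiberModule (A := A) (R := R) M K →ₗ[K ⊗[A] R] T'}

/-- Base change for the local cohomology of the symmetric powers. -/
theorem IsGradedSymmetricAlgebra.nonempty_fiber_equiv (h : IsGradedSymmetricAlgebra 𝒜 ℳ ι)
    (hι' : IsSymmetricAlgebra ι') (Q : Type*) [CommRing Q] [Algebra A Q] [Module.Flat A Q]
    [Algebra Q K] [IsScalarTower A Q K] {r : ℕ} {x : Fin r → R} {e : Fin r → ℕ}
    (hx : ∀ l, x l ∈ 𝒜 (e l)) {k : ℕ} {d : ℤ} (h𝒩 : ∀ d, FlatOver A Q (symPiece 𝒜 ℳ ι k d))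
    (hH : ∀ i, FlatOver A Q (CechCohomology (h.raisesDegree hx k) i d)) (i : ℕ) :
    Nonempty (FiberSymCohomologyPiece 𝒜 ℳ K x i k d ≃ₗ[K]
      K ⊗[A] CechCohomology (h.raisesDegree hx k) i d) := by
  obtain ⟨f, hf⟩ := IsSymmetricAlgebra.exists_fiberMap h.isSymmetricAlgebra ι'
  obtain ⟨E⟩ := (hf.isCechBaseChange h hι' x k).nonempty_equiv Q (h.raisesDegree hx k)
    ((h.fiber hι').raisesDegree (fun l => tmul_mem_fiberRingPiece K (hx l)) k) h𝒩 d hH i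
  obtain ⟨E'⟩ := (h.fiber hι').nonempty_localCohomologyPiece_equiv
    (fun l => tmul_mem_fiberRingPiece K (hx l)) k i d
  exact ⟨E'.trans E.symm⟩

/-- Finiteness of the local cohomology of the symmetric powers of the fibre. -/
theorem IsGradedSymmetricAlgebra.finite_fiberSymCohomologyPiece [Algebra.FiniteType A R]
    [Module.Finite R M] [Module.Finite A (𝒜 0)] [IsNoetherianRing K]
    (h : IsGradedSymmetricAlgebra 𝒜 ℳ ι) (hι' : IsSymmetricAlgebra ι') {r : ℕ} {x : Fin r → R}
    {e : Fin r → ℕ} (he : ∀ l, 0 < e l) (hx : ∀ l, x l ∈ 𝒜 (e l))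
    (hspan : Ideal.span (Set.range x) = (HomogeneousIdeal.irrelevant 𝒜).toIdeal) (i k : ℕ)
    (d : ℤ) : Module.Finite K (FiberSymCohomologyPiece 𝒜 ℳ K x i k d) := by
  have : IsNoetherianRing (K ⊗[A] R) := Algebra.FiniteType.isNoetherianRing K _
  have := finite_fiberRingPiece (𝒜 := 𝒜) K 0
  obtain ⟨E⟩ := (h.fiber hι').nonempty_localCohomologyPiece_equiv
    (fun l => tmul_mem_fiberRingPiece K (hx l)) k i d
  have := (h.fiber hι').module_finite_cechCohomology he
    (fun l => tmul_mem_fiberRingPiece K (hx l))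
    (fiberRingPiece_sup_span_eq_top K (hspan ▸ sup_irrelevant_eq_top 𝒜)) k i d
  exact Module.Finite.equiv E.symm

end FiberRank

end

end GradedLocalCohomology

namespace GradedLocalCohomology

noncomputable section

set_option linter.unusedSectionVars false

/-! ### Ranks over residue fields and the main theorem. -/

section Rank

universe v

theorem FreeAt.rank_eq_of_equiv {A X : Type*} [CommRing A] [AddCommGroup X] [Module A X] {g : A}
    (h : FreeAt g X) {p q : PrimeSpectrum A} (hp : g ∉ p.asIdeal) (hq : g ∉ q.asIdeal)
    {Y Y' : Type v} [AddCommGroup Y] [Module p.asIdeal.ResidueField Y] [AddCommGroup Y']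
    [Module q.asIdeal.ResidueField Y']
    (E : Y ≃ₗ[p.asIdeal.ResidueField] p.asIdeal.ResidueField ⊗[A] X)
    (E' : Y' ≃ₗ[q.asIdeal.ResidueField] q.asIdeal.ResidueField ⊗[A] X) :
    Module.rank p.asIdeal.ResidueField Y = Module.rank q.asIdeal.ResidueField Y' := by
  obtain ⟨c, hc⟩ := h.exists_rank_residueField
  have h1 := E.lift_rank_eq
  have h2 := E'.lift_rank_eq
  rw [hc p hp] at h1
  rw [hc q hq] at h2
  exact Cardinal.lift_injective (h1.trans h2.symm)

end Rank

section ResidueField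

variable {A R M : Type*} [CommRing A] [CommRing R] [Algebra A R] [AddCommGroup M] [Module R M]
  [Module A M] [IsScalarTower A R M] {𝒜 : ℕ → Submodule A R} [GradedAlgebra 𝒜]
  {ℳ : ℤ → Submodule A M} {r : ℕ} {x : Fin r → R} {e : Fin r → ℕ}

/-- At the points where `g` does not vanish, the local cohomology of the fibre is a base change. -/
theorem IsGradedSymmetricAlgebra.nonempty_residueField_equiv
    (h : IsGradedSymmetricAlgebra 𝒜 ℳ (SymmetricAlgebra.ι R M)) (hx : ∀ l, x l ∈ 𝒜 (e l)) {g : A}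
    {k : ℕ} {d : ℤ} (hfree : ∀ d, FreeAt g (symPiece 𝒜 ℳ (SymmetricAlgebra.ι R M) k d))
    (hH : ∀ i, FreeAt g (CechCohomology (h.raisesDegree hx k) i d)) (p : PrimeSpectrum A)
    (hp : g ∉ p.asIdeal) (i : ℕ) :
    Nonempty (FiberSymCohomologyPiece 𝒜 ℳ p.asIdeal.ResidueField x i k d ≃ₗ[p.asIdeal.ResidueField]
      p.asIdeal.ResidueField ⊗[A] CechCohomology (h.raisesDegree hx k) i d) := by
  have hu : IsUnit (algebraMap A p.asIdeal.ResidueField g) := by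
    rw [isUnit_iff_ne_zero, Ne, Ideal.algebraMap_residueField_eq_zero]
    exact hp
  let := (IsLocalization.Away.lift (S := Localization.Away g) g hu).toAlgebra
  have : IsScalarTower A (Localization.Away g) p.asIdeal.ResidueField :=
    IsScalarTower.of_algebraMap_eq fun a => (IsLocalization.Away.lift_eq g hu a).symm
  have : Module.Flat A (Localization.Away g) :=
    IsLocalization.flat (Localization.Away g) (Submonoid.powers g)
  exact h.nonempty_fiber_equiv SymmetricAlgebra.isSymmetricAlgebra_ι (Localization.Away g) hx
    (fun d => (hfree d).flatOver) (fun i => (hH i).flatOver) i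

/-- The ranks of the local cohomology of the fibres are constant where `g` does not vanish. -/
theorem IsGradedSymmetricAlgebra.rank_fiberSymCohomologyPiece_eq
    (h : IsGradedSymmetricAlgebra 𝒜 ℳ (SymmetricAlgebra.ι R M)) (hx : ∀ l, x l ∈ 𝒜 (e l)) {g : A}
    {k : ℕ} {d : ℤ} (hfree : ∀ d, FreeAt g (symPiece 𝒜 ℳ (SymmetricAlgebra.ι R M) k d))
    (hH : ∀ i, FreeAt g (CechCohomology (h.raisesDegree hx k) i d)) (i : ℕ)
    {p q : PrimeSpectrum A} (hp : g ∉ p.asIdeal) (hq : g ∉ q.asIdeal) :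
    Module.rank p.asIdeal.ResidueField
        (FiberSymCohomologyPiece 𝒜 ℳ p.asIdeal.ResidueField x i k d) =
      Module.rank q.asIdeal.ResidueField
        (FiberSymCohomologyPiece 𝒜 ℳ q.asIdeal.ResidueField x i k d) := by
  obtain ⟨E⟩ := h.nonempty_residueField_equiv hx hfree hH p hp i
  obtain ⟨E'⟩ := h.nonempty_residueField_equiv hx hfree hH q hq i
  exact (hH i).rank_eq_of_equiv hp hq E E'

end ResidueField

end

end GradedLocalCohomology

theorem mainTheorem8 {A : Type*} [CommRing A] [IsNoetherianRing A] [IsReduced A]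
    {R : Type*} [CommRing R] [Algebra A R] [Algebra.FiniteType A R]
    (𝒜 : ℕ → Submodule A R) [GradedAlgebra 𝒜]
    {M : Type*} [AddCommGroup M] [Module R M] [Module A M] [IsScalarTower A R M]
    [Module.Finite R M]
    (ℳ : ℤ → Submodule A M) (hℳ : DirectSum.IsInternal ℳ)
    (hsmul : ∀ (n : ℕ) (d : ℤ) (a : R) (m : M), a ∈ 𝒜 n → m ∈ ℳ d → a • m ∈ ℳ (n + d))
    (j b : ℤ) (hb : b ∈ upperBounds (GradedLocalCohomology.generatorDegrees (R := R) 𝒜 ℳ)) :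
    ∃ U : Set (PrimeSpectrum A), IsOpen U ∧ Dense U ∧
      ∀ (r : ℕ) (x : Fin r → R), (∀ l, SetLike.IsHomogeneousElem 𝒜 (x l)) →
        Ideal.span (Set.range x) = (HomogeneousIdeal.irrelevant 𝒜).toIdeal →
        ∀ i k : ℕ,
          IsLocallyConstant (fun p : U => Module.rank p.1.asIdeal.ResidueField
            (GradedLocalCohomology.FiberSymCohomologyPiece 𝒜 ℳ p.1.asIdeal.ResidueField
              x i k (j + k * b))) ∧
          (Module.Finite A (𝒜 0) → ∀ p : PrimeSpectrum A,
            Module.Finite p.asIdeal.ResidueField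
              (GradedLocalCohomology.FiberSymCohomologyPiece 𝒜 ℳ p.asIdeal.ResidueField
                x i k (j + k * b))) := by
  have h : GradedLocalCohomology.IsGradedSymmetricAlgebra 𝒜 ℳ (SymmetricAlgebra.ι R M) :=
    ⟨hℳ, hsmul, SymmetricAlgebra.isSymmetricAlgebra_ι⟩
  obtain ⟨r₀, x₀, e₀, hx₀, hspan₀, hgen⟩ := h.exists_generators_freeAt j b hb
  choose g hg hfree hH using hgen
  -- The union of the basic open sets D(g q) over the minimal primes q. It contains every minimal
  -- prime, and the dimensions are constant on each D(g q).
  refine ⟨{p | ∃ q, ∃ hq : q ∈ minimalPrimes A, g q hq ∉ p.asIdeal}, ?_, ?_,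
    fun r x hx hspan i k => ?_⟩
  · simp only [Set.ofPred_exists]
    exact isOpen_iUnion fun q => isOpen_iUnion fun hq =>
      PrimeSpectrum.isOpen_basicOpen (a := g q hq)
  · exact GradedLocalCohomology.dense_of_minimalPrimes_subset fun p hp => ⟨_, hp, hg _ hp⟩
  · choose e he hxe using fun l => GradedLocalCohomology.exists_pos_degree (hx l)
      (hspan ▸ Ideal.subset_span ⟨l, rfl⟩)
    refine ⟨?_, fun _ p => h.finite_fiberSymCohomologyPiece
      SymmetricAlgebra.isSymmetricAlgebra_ι he hxe hspan i k _⟩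
    rw [IsLocallyConstant.iff_exists_open]
    rintro ⟨p, q, hq, hp⟩
    refine ⟨Subtype.val ⁻¹' (PrimeSpectrum.basicOpen (g q hq) : Set (PrimeSpectrum A)),
      (PrimeSpectrum.isOpen_basicOpen (a := g q hq)).preimage continuous_subtype_val, hp,
      fun p' hp' => ?_⟩
    refine h.rank_fiberSymCohomologyPiece_eq hxe (hfree q hq k) (fun i => ?_) i hp' hp
    -- The g were chosen for the generators x₀; independence of the generators over A, before
    -- passing to fibres, carries freeness over to x.
    obtain ⟨E⟩ := h.nonempty_equiv_of_generators hx₀ hxe (hspan₀.trans hspan.symm) k i (j + k * b)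
    exact (hH q hq k (h.raisesDegree hx₀ k) i).of_equiv E
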